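/- Let $p\ge 2$ be an integer, $z=4p-1$ and $c=\cos\frac{\pi}{2z}$. Let $$(b^{ij})=\begin{pmatrix}1&-c&0&0\\-c&1&-c&0\\0&-c&1&-c\\0&0&-c&1\end{pmatrix},\qquad (A_{ij})=(b^{ij})^{-1},\qquad \langle X,Y\rangle=X^iA_{ij}Y^j\ \text{ on }\mathbf R^4 .$$ This scalar product has signature $(+,+,+,-)$. Let $\mathbf H^3$ be the sheet of the hyperboloid $\langle X,X\rangle=-1$ on which $\langle X,A_2\rangle<0$, where $A_0,\dots,A_3$ is the standard basis, and put $\cosh d(X,Y)=-\langle X,Y\rangle/\sqrt{\langle X,X\rangle\langle Y,Y\rangle}$ for timelike $X,Y$ on the same side. Let $r_j$ be the reflection in the plane $X^j=0$, let $r_{a}$ be the reflection in the polar plane $\langle X,A_3\rangle=0$ of $A_3$, and let $h$ be the half-turn $A_i\leftrightarrow A_{3-i}$. Let $Q$ be the point in which the polar plane of $A_3$ meets the line $A_2A_3$. The complete orthoscheme $\mathcal O(2z)$ is the set of the $X\in\mathbf H^3$ with all $X^j\ge 0$, $\langle X,A_3\rangle\le0$ and $\langle X,A_0\rangle\le 0$;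 its half is $W(2z)=\{X\in\mathcal O(2z): d(X,Q)\le d(X,hQ)\}$. Put $\mathbf G_Q=\langle r_0,r_1,r_a\rangle$ and $Cw(2z)=\bigcup_{g\in \mathbf G_Q} g\,W(2z)$ (the cobweb polyhedron). Products of maps below are compositions (the right factor acts first), indices $i$ are taken mod $z$, and $$R=r_0r_1,\qquad \mathbf s=r_3r_aR^{z-1},\qquad \mathbf a_i=R^{-2i}\,(r_0\,h\,r_a\,R^{2p-1})\,R^{2i},\qquad \mathbf s_i=\mathbf a_i\mathbf s^{-1}\mathbf a_{i+1-p}.$$ Let $\Phi$ consist of $\mathbf s,\ \mathbf s_i,\ \mathbf a_i,\ \mathbf s^{-1}\mathbf a_i,\ \mathbf a_i\mathbf s^{-1},\ \mathbf s^{-1}\mathbf a_i\mathbf s^{-1}$ ($i$ mod $z$) and their inverses, and let $\mathbf{Cw}(2z)$ be the group generated by $\mathbf s$ and the $\mathbf a_i$. Then the following hold. 1. $\mathbf G_Q$ has $8z$ elements and fixes $Q$, which is a point of $W(2z)$; the $8z$ copies $g\,W(2z)$ have pairwise disjoint interiors. 2. $Cw(2z)$ is a compact convex polyhedron, namely $Cw(2z)=\{X: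 d(X,Q)\le d(X,\gamma Q)\ \forall \gamma\in\Phi\}$. The set $\Phi$ has $10z+2$ elements, and $\gamma\mapsto Cw(2z)\cap\gamma\,Cw(2z)$ is a bijection from $\Phi$ onto the set of the faces of $Cw(2z)$. 3. The part of $Cw(2z)$ in the plane $X^3=0$ (upper base) and its mirror image under $r_a$ (lower base) are faces. The map $\mathbf s$ is a screw motion of rotational angle $2\pi(z-1)/(2z)$ that maps the lower base onto the upper one, and $Cw(2z)\cap \mathbf s\,Cw(2z)$ is the upper base. Every $\mathbf a_i$ is a screw motion with rotational angle in $(0,\pi]$. 4. The construction is $z$-cyclic: $R^2$ has order $z$, maps $Cw(2z)$ onto itself, commutes with $\mathbf s$, and $R^2\mathbf a_{i+1}R^{-2}=\mathbf a_i$. 5. $\mathbf{Cw}(2z)$ consists of orientation-preserving isometries of $\mathbf H^3$ and acts on $\mathbf H^3$ without fixed points (only the identity has one). $Cw(2z)$ is a fundamental domain: its images cover $\mathbf H^3$, have pairwise disjoint interiors, and are locally finite. 6. Let $M$ be the quotient of $Cw(2z)$ by the equivalence relation generated by $x\sim\gamma x$ ($\gamma\in\Phi$; $x,\gamma x\in Cw(2z)$).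 Then $M$ is a compact connected Hausdorff space, the gluing map $Cw(2z)\to M$ extends to a covering $\pi:\mathbf H^3\to M$ whose fibres are the orbits of $\mathbf{Cw}(2z)$, and $M$ is an oriented hyperbolic manifold for which $\pi$ is a local orientation-preserving isometry. 7. $\mathbf{Cw}(2z)$, and hence the fundamental group $\pi_1(M)$, has the presentation with the generators $\mathbf s,\mathbf a_i$ ($i$ mod $z$) and the defining relations $$\mathbf a_{i+1-p}=\mathbf s\,\mathbf a_{i+p}\,\mathbf s^{-1}\,\mathbf a_{i+1}\,\mathbf s\,\mathbf a_{i+2p}^{-1}\,\mathbf s\quad(i=1,\dots,z),\qquad \mathbf 1=\prod_{i=1}^{z}(\mathbf a_i\mathbf s^{-1}\mathbf a_{i+1-p})^2 ,$$ where the factors of the product are taken in the order $i=1,\dots,z$. The first homology group, that is, the commutator factor group of $\pi_1(M)$, is the Abelianization of this presentation. -/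

import Mathlib

open scoped Topology

noncomputable section

namespace Cobweb

/-- The real vector space of coordinate vectors `X = (X⁰, X¹, X², X³)`, with respect to the basis
`A₀, A₁, A₂, A₃` of the vertices of the orthoscheme. -/
abbrev V4 : Type := Fin 4 → ℝ

/-- The Coxeter–Schläfli matrix `(bⁱʲ)` of the orthoscheme with essential angles
`π/u = π/v = π/w = π/(2z)`. -/
def coxeterSchlafli (z : ℕ) : Matrix (Fin 4) (Fin 4) ℝ :=
  let c : ℝ := Real.cos (Real.pi / (2 * z))
  !![1, -c, 0, 0;
     -c, 1, -c, 0;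
     0, -c, 1, -c;
     0, 0, -c, 1]

/-- The scalar product `⟨X, Y⟩ = Xⁱ A_{ij} Yʲ` with `(A_{ij}) = (bⁱʲ)⁻¹`. -/
def form (z : ℕ) (X Y : V4) : ℝ := dotProduct X ((coxeterSchlafli z)⁻¹.mulVec Y)

/-- The vertex `A_i` of the orthoscheme (a basis vector). -/
def vertexA (i : Fin 4) : V4 := Pi.single i 1

/-- The pole `b^{ij} A_j` of the face plane `b^i` (the plane `{X | Xⁱ = 0}`) of the orthoscheme. -/
def facePole (z : ℕ) (i : Fin 4) : V4 := fun j => coxeterSchlafli z i j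

/-- Hyperbolic 3-space: the sheet, containing the direction of the proper point `A₂`, of the
hyperboloid `⟨X, X⟩ = -1`. -/
abbrev H3 (z : ℕ) : Type := {X : V4 // form z X X = -1 ∧ form z X (vertexA 2) < 0}

/-- The hyperbolic distance of the points represented by the timelike vectors `X` and `Y`. -/
def hdist (z : ℕ) (X Y : V4) : ℝ :=
  Real.arcosh (-form z X Y / Real.sqrt (form z X X * form z Y Y))

/-- The scalar product has signature `(+, +, +, -)`. -/
def HasLorentzSignature (z : ℕ) : Prop :=
  ∃ T : V4 ≃ₗ[ℝ] V4, ∀ X Y : V4,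
    form z X Y = T X 0 * T Y 0 + T X 1 * T Y 1 + T X 2 * T Y 2 - T X 3 * T Y 3

/-- The group of orientation-preserving isometries of hyperbolic 3-space, as linear maps that
preserve the scalar product, the sheet of the hyperboloid, and the orientation. -/
def isomPlus (z : ℕ) : Subgroup (V4 ≃ₗ[ℝ] V4) where
  carrier := {g | (∀ X Y : V4, form z (g X) (g Y) = form z X Y) ∧
    (∀ X : V4, form z X X = -1 → (form z (g X) (vertexA 2) < 0 ↔ form z X (vertexA 2) < 0)) ∧
    LinearMap.det (g : V4 →ₗ[ℝ] V4) = 1}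
  mul_mem' := by
    rintro f g ⟨hf1, hf2, hf3⟩ ⟨hg1, hg2, hg3⟩
    refine ⟨fun X Y => ?_, fun X hX => ?_, ?_⟩
    · rw [LinearEquiv.mul_apply, LinearEquiv.mul_apply, hf1, hg1]
    · rw [LinearEquiv.mul_apply, hf2 _ (by rw [hg1, hX]), hg2 _ hX]
    · have : ((f * g : V4 ≃ₗ[ℝ] V4) : V4 →ₗ[ℝ] V4) = (f : V4 →ₗ[ℝ] V4) * (g : V4 →ₗ[ℝ] V4) := rfl
      rw [this, map_mul, hf3, hg3, one_mul]
  one_mem' := ⟨fun _ _ => rfl, fun _ _ => Iff.rfl, LinearMap.det_id⟩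
  inv_mem' := by
    rintro g ⟨h1, h2, h3⟩
    have hg : ∀ X : V4, g (g⁻¹ X) = X := fun X => g.apply_symm_apply X
    have k1 : ∀ X Y : V4, form z (g⁻¹ X) (g⁻¹ Y) = form z X Y := fun X Y => by
      rw [← h1, hg, hg]
    refine ⟨k1, fun X hX => ?_, ?_⟩
    · rw [← h2 (g⁻¹ X) (by rw [k1, hX]), hg]
    · have : LinearMap.det (g : V4 →ₗ[ℝ] V4) * LinearMap.det ((g⁻¹ : V4 ≃ₗ[ℝ] V4) : V4 →ₗ[ℝ] V4)
          = 1 := LinearEquiv.det_mul_det_symm g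
      rwa [h3, one_mul] at this

/-- The image of a set `F` of points under a linear map preserving hyperbolic space. -/
def move {z : ℕ} (g : V4 ≃ₗ[ℝ] V4) (F : Set (H3 z)) : Set (H3 z) :=
  {Y | ∃ X ∈ F, (Y : V4) = g (X : V4)}

/-- The reflection `X ↦ X - 2 ⟨X, U⟩ / ⟨U, U⟩ U` in the plane with the pole `U`. -/
def reflect (z : ℕ) (U : V4) : V4 ≃ₗ[ℝ] V4 :=
  if h : form z U U = 0 then LinearEquiv.refl ℝ V4
  else Module.reflection (x := U)
    (f := (2 / form z U U) • (Matrix.toBilin' (coxeterSchlafli z)⁻¹).flip U) (by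
      have : (Matrix.toBilin' (coxeterSchlafli z)⁻¹) U U = form z U U := by
        rw [Matrix.toBilin'_apply', form]
      simp only [LinearMap.smul_apply, smul_eq_mul]
      rw [show ((Matrix.toBilin' (coxeterSchlafli z)⁻¹).flip U) U = form z U U from this]
      field_simp)

/-- The reflection in the face plane `b^i`. -/
def planeRefl (z : ℕ) (i : Fin 4) : V4 ≃ₗ[ℝ] V4 := reflect z (facePole z i)

/-- The reflection in the polar plane `a₃` of the outer vertex `A₃`. -/
def reflA3 (z : ℕ) : V4 ≃ₗ[ℝ] V4 := reflect z (vertexA 3)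

/-- The half-turn `h` of the orthoscheme: `A₀ ↔ A₃`, `A₁ ↔ A₂`. -/
def halfTurn : V4 ≃ₗ[ℝ] V4 := LinearEquiv.funCongrLeft ℝ ℝ Fin.revPerm

/-- The complete orthoscheme `𝒪(2z)`: the coordinate simplex truncated by the polar planes `a₃`
and `a₀` of its outer vertices `A₃` and `A₀`. -/
def completeOrthoscheme (z : ℕ) : Set (H3 z) :=
  {X | (∀ i, 0 ≤ X.1 i) ∧ form z X (vertexA 3) ≤ 0 ∧ form z X (vertexA 0) ≤ 0}

/-- The point `Q`, where the plane `a₃` meets the edge line `A₃A₂`, as a (not normalized) vector. -/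
def pointQ (z : ℕ) : V4 :=
  vertexA 2 - (form z (vertexA 2) (vertexA 3) / form z (vertexA 3) (vertexA 3)) • vertexA 3

/-- The half orthoscheme `W(2z)`: the half of `𝒪(2z)` that contains `Q`, cut off by the halving
plane through the axis of the half-turn `h`, the perpendicular bisector of `Q` and `h Q`. -/
def halfOrthoscheme (z : ℕ) : Set (H3 z) :=
  {X ∈ completeOrthoscheme z | hdist z X (pointQ z) ≤ hdist z X (halfTurn (pointQ z))}

/-- The group generated by the reflections in the faces `b⁰`, `b¹`, `a₃` of `W(2z)` through `Q`. -/
def groupQ (z : ℕ) : Subgroup (V4 ≃ₗ[ℝ] V4) :=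
  Subgroup.closure {planeRefl z 0, planeRefl z 1, reflA3 z}

/-- The cobweb polyhedron `Cw(2z)`: the copies of `W(2z)` around `Q`. -/
def cobweb (z : ℕ) : Set (H3 z) := ⋃ g ∈ groupQ z, move g (halfOrthoscheme z)

/-- The upper base of the cobweb polyhedron, in the plane `b³`. -/
def upperBase (z : ℕ) : Set (H3 z) := {X ∈ cobweb z | X.1 3 = 0}

/-- The lower base of the cobweb polyhedron, the mirror image of the upper one in `a₃`. -/
def lowerBase (z : ℕ) : Set (H3 z) := move (reflA3 z) (upperBase z)

/-- `f` is a (two-dimensional) face of the convex polyhedron `F`: it is the intersection of `F`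
with a supporting plane, and it spans this plane. -/
def IsFacet {z : ℕ} (F f : Set (H3 z)) : Prop :=
  ∃ U : V4, 0 < form z U U ∧ (∀ X ∈ F, 0 ≤ form z X U) ∧ f = {X ∈ F | form z X U = 0} ∧
    Module.finrank ℝ (Submodule.span ℝ (Subtype.val '' f)) = 3

/-- The rotation about the cobweb axis `A₂A₃` through the angle `2π/(2z)`. -/
def rot (z : ℕ) : V4 ≃ₗ[ℝ] V4 := planeRefl z 0 * planeRefl z 1

/-- The base pairing `s`: the translation along the cobweb axis from the lower to the upper base,
combined with the `(z - 1)`-st power of the rotation through `2π/(2z)`. -/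
def baseScrew (z : ℕ) : V4 ≃ₗ[ℝ] V4 := planeRefl z 3 * reflA3 z * rot z ^ (z - 1)

/-- The side pairings `a_i` (`i` mod `z`), obtained from `a_0` by the `z`-fold rotations about the
axis. The halving face of the chamber `r⁻¹ W`, `r = a₃ R^(2p-1)`, in the lower half of the cobweb is
mapped by `a_0` onto the halving face of the chamber `b⁰ W` in the upper half. -/
def sideScrew (z p : ℕ) (i : ZMod z) : V4 ≃ₗ[ℝ] V4 :=
  (rot z ^ (2 * i.val))⁻¹ * (planeRefl z 0 * halfTurn * (reflA3 z * rot z ^ (2 * p - 1))) *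
    rot z ^ (2 * i.val)

/-- The middle pairings `s_i = a_i s⁻¹ a_{i+1-p}`. -/
def middleScrew (z p : ℕ) (i : ZMod z) : V4 ≃ₗ[ℝ] V4 :=
  sideScrew z p i * (baseScrew z)⁻¹ * sideScrew z p (i + 1 - p)

/-- One element of each pair of mutually inverse face pairings: `s`, then `s_i`, `a_i`, `s⁻¹ a_i`,
`a_i s⁻¹` and `s⁻¹ a_i s⁻¹`. -/
def pairingHalf (z p : ℕ) : Set (V4 ≃ₗ[ℝ] V4) :=
  {baseScrew z} ∪ Set.range (middleScrew z p) ∪ Set.range (sideScrew z p) ∪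
    Set.range (fun i => (baseScrew z)⁻¹ * sideScrew z p i) ∪
    Set.range (fun i => sideScrew z p i * (baseScrew z)⁻¹) ∪
    Set.range (fun i => (baseScrew z)⁻¹ * sideScrew z p i * (baseScrew z)⁻¹)

/-- All face pairings of the cobweb polyhedron. -/
def facePairings (z p : ℕ) : Set (V4 ≃ₗ[ℝ] V4) :=
  {γ | γ ∈ pairingHalf z p ∨ γ⁻¹ ∈ pairingHalf z p}

/-- The group generated by `s` and the `a_i`. -/
def cobwebGroup (z p : ℕ) : Subgroup (V4 ≃ₗ[ℝ] V4) :=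
  Subgroup.closure ({baseScrew z} ∪ Set.range (sideScrew z p))

/-- `g` is a screw motion with rotational angle `θ`: in a suitable orthonormal frame it is the
rotation through `θ` about a line combined with a translation by `d > 0` along this line. -/
def IsScrewMotion (z : ℕ) (g : V4 ≃ₗ[ℝ] V4) (θ : ℝ) : Prop :=
  g ∈ isomPlus z ∧ ∃ (e : Fin 4 → V4) (d : ℝ), 0 < d ∧
    (∀ i j, form z (e i) (e j) = if i = j then (if i = 3 then -1 else 1) else 0) ∧
    g (e 0) = Real.cos θ • e 0 + Real.sin θ • e 1 ∧
    g (e 1) = -Real.sin θ • e 0 + Real.cos θ • e 1 ∧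
    g (e 2) = Real.cosh d • e 2 + Real.sinh d • e 3 ∧
    g (e 3) = Real.sinh d • e 2 + Real.cosh d • e 3

/-- `F` is a fundamental domain of `Γ`: the images of `F` form a locally finite tiling of space. -/
def IsFundamentalDomain {z : ℕ} (Γ : Subgroup (V4 ≃ₗ[ℝ] V4)) (F : Set (H3 z)) : Prop :=
  (⋃ γ ∈ Γ, move γ F) = Set.univ ∧
  (∀ γ ∈ Γ, γ ≠ 1 → Disjoint (interior F) (interior (move γ F))) ∧
  (∀ X : H3 z, ∃ N ∈ 𝓝 X, {γ ∈ Γ | (move γ F ∩ N).Nonempty}.Finite)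

/-- Two points of the cobweb polyhedron are paired if some face pairing maps the first one to the
second one. -/
def facePaired (z p : ℕ) (x y : cobweb z) : Prop :=
  ∃ γ ∈ facePairings z p, (y : H3 z).1 = γ (x : H3 z).1

/-- The space obtained from the cobweb polyhedron by gluing its paired faces, with the quotient
topology (`Quot` passes to the generated equivalence relation). -/
abbrev CobwebManifold (z p : ℕ) : Type := Quot (facePaired z p)

/-- The pseudogroup on hyperbolic space whose elements are locally orientation-preserving
isometries. -/
def hyperbolicPregroupoid (z : ℕ) : Pregroupoid (H3 z) where
  property f s := ∀ x ∈ s, ∃ g ∈ isomPlus z, ∃ u : Set (H3 z), IsOpen u ∧ x ∈ u ∧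
    ∀ y ∈ s ∩ u, (f y).1 = g y.1
  comp := by
    intro f g u v hf hg _ _ _ x hx
    obtain ⟨a, ha, s, hs, hxs, hfs⟩ := hf x hx.1
    obtain ⟨b, hb, t, ht, hxt, hgt⟩ := hg (f x) hx.2
    obtain ⟨t', ht', rfl⟩ := isOpen_induced_iff.1 ht
    have ca : Continuous (a : V4 → V4) :=
      LinearMap.continuous_of_finiteDimensional (a : V4 →ₗ[ℝ] V4)
    refine ⟨b * a, mul_mem hb ha, s ∩ (fun y : H3 z => a y.1) ⁻¹' t',
      hs.inter (ht'.preimage (ca.comp continuous_subtype_val)), ⟨hxs, ?_⟩, ?_⟩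
    · have := hfs x ⟨hx.1, hxs⟩
      simpa [← this] using hxt
    · rintro y ⟨⟨hyu, hyv⟩, hys, hyt⟩
      have e := hfs y ⟨hyu, hys⟩
      have : f y ∈ Subtype.val ⁻¹' t' := by
        change (f y).1 ∈ t'
        rw [e]; exact hyt
      rw [Function.comp_apply, hgt (f y) ⟨hyv, this⟩, e, LinearEquiv.mul_apply]
  id_mem := fun x _ => ⟨1, one_mem _, Set.univ, isOpen_univ, trivial, fun _ _ => rfl⟩
  locality := by
    intro f u _ h x hx
    obtain ⟨v, hv, hxv, hP⟩ := h x hx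
    obtain ⟨g, hg, w, hw, hxw, hfw⟩ := hP x ⟨hx, hxv⟩
    exact ⟨g, hg, v ∩ w, hv.inter hw, ⟨hxv, hxw⟩, fun y hy => hfw y ⟨⟨hy.1, hy.2.1⟩, hy.2.2⟩⟩
  congr := by
    intro f g u _ h hf x hx
    obtain ⟨a, ha, v, hv, hxv, hfv⟩ := hf x hx
    exact ⟨a, ha, v, hv, hxv, fun y hy => by rw [h y hy.1, hfv y hy]⟩

/-- The structure groupoid of oriented hyperbolic manifolds. -/
def hyperbolicGroupoid (z : ℕ) : StructureGroupoid (H3 z) := (hyperbolicPregroupoid z).groupoid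

/-- The map `π` is a covering of `M` by hyperbolic space, and `M` carries an atlas with
orientation-preserving isometries as coordinate changes (an oriented hyperbolic structure) for
which `π` is a local isometry. -/
def IsHyperbolicCovering {z : ℕ} {M : Type} [TopologicalSpace M] (π : H3 z → M) : Prop :=
  IsCoveringMap π ∧ Function.Surjective π ∧
  ∃ _ : ChartedSpace (H3 z) M, HasGroupoid M (hyperbolicGroupoid z) ∧
    ∀ e ∈ atlas (H3 z) M, ∀ x : H3 z, π x ∈ e.source →
      ∃ g ∈ isomPlus z, ∀ᶠ y in 𝓝 x, (e (π y)).1 = g y.1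

/-- The generators of the presentation: `s` and `a_i`, `i` mod `z`. -/
inductive Gen (z : ℕ) : Type
  | s : Gen z
  | a (i : ZMod z) : Gen z

/-- The relator of `a_{i+1-p} = s a_{i+p} s⁻¹ a_{i+1} s a_{i+2p}⁻¹ s`. -/
def relator (z p : ℕ) (i : ZMod z) : FreeGroup (Gen z) :=
  let s : FreeGroup (Gen z) := FreeGroup.of Gen.s
  let a : ZMod z → FreeGroup (Gen z) := fun j => FreeGroup.of (Gen.a j)
  (a (i + 1 - p))⁻¹ * (s * a (i + p) * s⁻¹ * a (i + 1) * s * (a (i + 2 * p))⁻¹ * s)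

/-- The relator `∏_{i=1}^z (a_i s⁻¹ a_{i+1-p})²` (factors in this order). -/
def longRelator (z p : ℕ) : FreeGroup (Gen z) :=
  let s : FreeGroup (Gen z) := FreeGroup.of Gen.s
  let a : ZMod z → FreeGroup (Gen z) := fun j => FreeGroup.of (Gen.a j)
  ((List.range z).map fun k : ℕ =>
    (a ((k + 1 : ℕ) : ZMod z) * s⁻¹ * a (((k + 1 : ℕ) : ZMod z) + 1 - p)) ^ 2).prod

/-- The abstract group with the generators `s`, `a_i` and the above relators. -/
abbrev PresentedCobwebGroup (z p : ℕ) : Type :=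
  PresentedGroup (Set.range (relator z p) ∪ {longRelator z p})

end Cobweb

end

open Cobweb

/-!
The cobweb polyhedron is studied inside the group `Γ` that is generated by the reflections in the six
faces of the complete orthoscheme and by its half-turn `h`. Three facts carry the proof.

*The reflection group.* By Tits' argument on roots and chambers (`IsReflectionRep.root_nonneg`,
`IsReflectionRep.stabilizer`, `IsReflectionRep.form_orbit_le`), the orthoscheme is a strict fundamental
domain of the reflection group, the latter is the Coxeter group of the orthoscheme, point stabilizers
are generated by the reflections in the faces through the point, and a point of the orthoscheme is
at least as near to another one as to any image of the latter. Hence `Γ` is the Coxeter group extended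
by `h` (`isFaithful`), and the half `W` consists of the points of the orthoscheme that are at least as
near to `Q` as to any other point of the orbit `Γ Q`.

*The coset model.* Every element of `Γ` is a product `w k` with `w` in the group of the pairings and
`k` in the stabilizer of `Q`. On the set of all pairs of an element `w` of the *presented* group and a
normal form of `k`, explicit formulas describe right multiplication by `r₀`, `r₁`, `r_a` and `h`. These
permutations satisfy the relations of `Γ` (`permRelations`), so `Γ` acts. It follows that the
presentation is faithful (`pairingHom_injective`), that the group of the pairings is a complement of
the stabilizer of `Q`, which has `8z` elements (`eq_one_of_pairingHom_mem`, `card_stab`), and that the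
group of the pairings acts freely on space: the stabilizers in `Γ` of the points of the orthoscheme
act on the model without fixing a coset of the group of the pairings (`eq_one_of_fixesComponent`,
`not_fixesComponent`, `eq_one_of_fixes`).

*The Voronoi cell.* The copies of `W` around `Q` make up the Voronoi cell of `Q` in the orbit `Γ Q`, and
its neighbours are the `10z + 2` images of `Q` under the face pairings (`mem_cobweb_iff`,
`image_facePairings`, `ncard_facePairings`, `bijOn_face`). As `Γ Q` is also the orbit of `Q` under the
group of the pairings, which acts freely, the cobweb polyhedron is a fundamental domain
(`isFundamentalDomain`).

The rest are consequences. If two points of the polyhedron lie in one orbit, crossing faces towards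
the other centre joins them by a chain of face pairings (`mk_eq_mk_of_apply_eq`). So the glued space is
the orbit space of a free and properly discontinuous action (`exists_covering`,
`isHyperbolicCovering`), and its fundamental group is the acting group because hyperbolic space is
simply connected (`nonempty_fundamentalGroup_mulEquiv`). That the pairings are screw motions is read
off from explicit frames and from the operators `g + g⁻¹`, whose eigenvalues are `2 cosh d` and
`2 cos θ` (`isScrewMotion_baseScrew`, `exists_isScrewMotion`, `exists_isScrewMotion_sideScrew`).
-/

open scoped Topology

noncomputable section

namespace Cobweb

section

/-! ### Reflection groups with a fundamental chamber -/

/-- A linear representation of a Coxeter group in which the simple generators act as reflections in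
unit roots `u i` of a symmetric bilinear form; the roots may be linearly dependent, and two roots
whose product has infinite order only have to satisfy `φ (u i) (u j) ≤ -1`. -/
structure IsReflectionRep {B W V : Type*} [Group W] {M : CoxeterMatrix B} (cs : CoxeterSystem M W)
    [AddCommGroup V] [Module ℝ V] (φ : LinearMap.BilinForm ℝ V) (u : B → V)
    (ρ : W →* (V ≃ₗ[ℝ] V)) : Prop where
  symm : ∀ x y, φ x y = φ y x
  unit : ∀ i, φ (u i) (u i) = 1
  gram : ∀ i j, i ≠ j → M i j ≠ 0 → φ (u i) (u j) = -Real.cos (Real.pi / M i j)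
  gram_inf : ∀ i j, M i j = 0 → φ (u i) (u j) ≤ -1
  simple : ∀ i x, ρ (cs.simple i) x = x - (2 * φ x (u i)) • u i

/-- The closed chamber of the roots `u i`. -/
def chamber {B V : Type*} [AddCommGroup V] [Module ℝ V] (φ : LinearMap.BilinForm ℝ V)
    (u : B → V) : Set V := {x | ∀ i, 0 ≤ φ x (u i)}

/-- The Chebyshev-type recursion for the coefficients of the roots of a dihedral group. -/
def rootCoeff (c : ℝ) : ℕ → ℝ
  | 0 => 0
  | 1 => 1
  | n + 2 => 2 * c * rootCoeff c (n + 1) - rootCoeff c n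

lemma rootCoeff_cos (t : ℝ) : ∀ n : ℕ, rootCoeff (Real.cos t) n * Real.sin t = Real.sin (n * t)
  | 0 => by simp [rootCoeff]
  | 1 => by simp [rootCoeff]
  | n + 2 => by
    have h1 := rootCoeff_cos t n
    have h2 := rootCoeff_cos t (n + 1)
    rw [rootCoeff, sub_mul, h1, mul_assoc, h2]
    push_cast
    have e1 : ((n : ℝ) + 2) * t = (n + 1) * t + t := by ring
    have e2 : (n : ℝ) * t = (n + 1) * t - t := by ring
    rw [e1, e2, Real.sin_add, Real.sin_sub]; ring

lemma rootCoeff_nonneg_of_one_le {c : ℝ} (hc : 1 ≤ c) (n : ℕ) :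
    0 ≤ rootCoeff c n ∧ rootCoeff c n ≤ rootCoeff c (n + 1) := by
  induction n with
  | zero => simp [rootCoeff]
  | succ n ih =>
    refine ⟨ih.1.trans ih.2, ?_⟩
    rw [rootCoeff]
    nlinarith [ih.1, ih.2]

lemma rootCoeff_cos_nonneg {m n : ℕ} (hm : 2 ≤ m) (hn : n ≤ m) :
    0 ≤ rootCoeff (Real.cos (Real.pi / m)) n := by
  have hm' : (2 : ℝ) ≤ m := by exact_mod_cast hm
  have hp := Real.pi_pos
  have hs : 0 < Real.sin (Real.pi / m) := by
    apply Real.sin_pos_of_pos_of_lt_pi (by positivity)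
    rw [div_lt_iff₀ (by linarith)]; nlinarith
  have h := rootCoeff_cos (Real.pi / m) n
  have h2 : 0 ≤ Real.sin (n * (Real.pi / m)) := by
    apply Real.sin_nonneg_of_nonneg_of_le_pi (by positivity)
    have : (n : ℝ) ≤ m := by exact_mod_cast hn
    rw [← mul_div_assoc, div_le_iff₀ (by linarith)]; nlinarith
  by_contra hneg
  push Not at hneg
  nlinarith [mul_neg_of_neg_of_pos hneg hs]

namespace IsReflectionRep

variable {B W V : Type*} [Group W] {M : CoxeterMatrix B} {cs : CoxeterSystem M W}
  [AddCommGroup V] [Module ℝ V] {φ : LinearMap.BilinForm ℝ V} {u : B → V}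
  {ρ : W →* (V ≃ₗ[ℝ] V)}

lemma isometry (h : IsReflectionRep cs φ u ρ) (w : W) : ∀ x y, φ (ρ w x) (ρ w y) = φ x y := by
  induction w using cs.simple_induction_left with
  | one => simp
  | mul_simple_left w i ih =>
    intro x y
    rw [map_mul, LinearEquiv.mul_apply, LinearEquiv.mul_apply, h.simple, h.simple]
    simp only [map_sub, map_smul, LinearMap.sub_apply, LinearMap.smul_apply, smul_eq_mul, h.unit,
      h.symm (u i), ih]
    ring

lemma simple_root (h : IsReflectionRep cs φ u ρ) (i : B) : ρ (cs.simple i) (u i) = - u i := by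
  rw [h.simple, h.unit]; module

/-- The action of an alternating word on a simple root. -/
lemma alternating (h : IsReflectionRep cs φ u ρ) (i j : B) (n : ℕ) :
    ρ (cs.wordProd (CoxeterSystem.alternatingWord i j n)) (u i) =
      if Even n then rootCoeff (-φ (u i) (u j)) (n + 1) • u i +
          rootCoeff (-φ (u i) (u j)) n • u j
      else rootCoeff (-φ (u i) (u j)) n • u i +
          rootCoeff (-φ (u i) (u j)) (n + 1) • u j := by
  induction n with
  | zero => simp [CoxeterSystem.alternatingWord, rootCoeff]
  | succ n ih =>
    rw [CoxeterSystem.alternatingWord_succ', cs.wordProd_cons, map_mul, LinearEquiv.mul_apply, ih]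
    by_cases hn : Even n
    · have hn' : ¬ Even (n + 1) := by simpa [Nat.even_add_one] using hn
      simp only [if_pos hn, if_neg hn', h.simple]
      simp only [map_add, map_smul, LinearMap.add_apply, LinearMap.smul_apply, smul_eq_mul, h.unit,
        rootCoeff]
      module
    · have hn' : Even (n + 1) := by simpa [Nat.even_add_one] using hn
      simp only [if_pos hn', if_neg hn, h.simple]
      simp only [map_add, map_smul, LinearMap.add_apply, LinearMap.smul_apply, smul_eq_mul, h.unit,
        rootCoeff, h.symm (u j) (u i)]
      module

open CoxeterSystem in
/-- Tits's lemma: an element that is lengthened by the simple reflection `i` maps the root `u i` to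
a root that is nonnegative on the chamber. -/
theorem root_nonneg (h : IsReflectionRep cs φ u ρ) : ∀ (n : ℕ) (w : W), cs.length w = n →
    ∀ i, ¬ cs.IsRightDescent w i → ∀ x ∈ chamber φ u, 0 ≤ φ x (ρ w (u i)) := by
  intro n
  induction n using Nat.strong_induction_on with
  | _ n ih =>
  intro w hw i hi x hx
  by_cases hw1 : w = 1
  · subst hw1; simpa using hx i
  obtain ⟨j, hj⟩ := cs.exists_rightDescent_of_ne_one hw1
  have hij : i ≠ j := fun e => hi (e ▸ hj)
  -- split off the longest alternating word in `i` and `j` at the right end of `w`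
  let S : ℕ → Prop := fun k => ∃ v, w = v * cs.wordProd (alternatingWord i j k) ∧
    cs.length v + k = cs.length w
  have hS1 : S 1 := by
    refine ⟨w * cs.simple j, ?_, ?_⟩
    · simp [alternatingWord]
    · exact (cs.isRightDescent_iff).1 hj
  classical
  have hbound : ∀ k, S k → k ≤ cs.length w := fun k ⟨v, _, hv⟩ => by omega
  let k := Nat.findGreatest S (cs.length w)
  have hSk : S k := Nat.findGreatest_spec (hbound 1 hS1) hS1
  have hmax : ∀ k', S k' → k' ≤ k := fun k' hk' => Nat.le_findGreatest (hbound k' hk') hk'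
  have hk1 : 1 ≤ k := hmax 1 hS1
  obtain ⟨v, hwv, hlen⟩ := hSk
  have key : ∀ l, l = i ∨ l = j → ¬ cs.IsRightDescent v l := by
    intro l hl hd
    have hd' := (cs.isRightDescent_iff).1 hd
    obtain ⟨k', hk'⟩ : ∃ k', k = k' + 1 := ⟨k - 1, by omega⟩
    have cases : l = (if Even k then j else i) ∨ l = (if Even k' then j else i) := by
      by_cases he : Even k'
      · have : ¬ Even k := by rw [hk']; simpa [Nat.even_add_one] using he
        simp only [he, this, if_true, if_false]; tauto
      · have : Even k := by rw [hk']; simpa [Nat.even_add_one] using he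
        simp only [he, this, if_true, if_false]; tauto
    rcases cases with e | e
    · have : S (k + 1) := by
        refine ⟨v * cs.simple l, ?_, by omega⟩
        rw [alternatingWord_succ', ← e, cs.wordProd_cons, hwv, ← mul_assoc]
        simp
      have := hmax _ this
      omega
    · have hw' : w = (v * cs.simple l) * cs.wordProd (alternatingWord i j k') := by
        rw [hwv, hk', alternatingWord_succ', ← e, cs.wordProd_cons, ← mul_assoc]
      have h1 := cs.length_mul_le (v * cs.simple l) (cs.wordProd (alternatingWord i j k'))
      have h2 := cs.length_wordProd_le (alternatingWord i j k')
      rw [length_alternatingWord] at h2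
      rw [← hw'] at h1
      omega
  have hv_lt : cs.length v < n := by omega
  have pi := ih _ hv_lt v rfl i (key i (Or.inl rfl)) x hx
  have pj := ih _ hv_lt v rfl j (key j (Or.inr rfl)) x hx
  have hcoef : 0 ≤ rootCoeff (-φ (u i) (u j)) k ∧ 0 ≤ rootCoeff (-φ (u i) (u j)) (k + 1) := by
    by_cases hm : M i j = 0
    · have := rootCoeff_nonneg_of_one_le (c := -φ (u i) (u j)) (by linarith [h.gram_inf i j hm])
      exact ⟨(this k).1, (this (k + 1)).1⟩
    · have hm2 : 2 ≤ M i j := by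
        have := M.off_diagonal i j hij
        omega
      have hlenk : cs.length (cs.wordProd (alternatingWord i j k)) = k := by
        have h1 := cs.length_mul_le v (cs.wordProd (alternatingWord i j k))
        have h2 := cs.length_wordProd_le (alternatingWord i j k)
        rw [length_alternatingWord] at h2
        rw [← hwv] at h1
        omega
      have hk_le : k ≤ M i j := by
        by_contra hlt
        push Not at hlt
        refine cs.not_isReduced_alternatingWord i j hm hlt ?_
        rw [CoxeterSystem.IsReduced, hlenk, length_alternatingWord]
      have hk_ne : k ≠ M i j := by
        intro he
        apply hi
        obtain ⟨k', hk'⟩ : ∃ k', k = k' + 1 := ⟨k - 1, by omega⟩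
        have hb : cs.wordProd (alternatingWord i j k) = cs.wordProd (alternatingWord j i k) := by
          have := cs.wordProd_braidWord_eq i j
          rw [braidWord, braidWord, ← M.symmetric i j, ← he] at this
          exact this
        have hw' : w * cs.simple i = v * cs.wordProd (alternatingWord i j k') := by
          rw [hwv, hb, hk', alternatingWord_succ, cs.wordProd_concat]
          simp [mul_assoc]
        have h1 := cs.length_mul_le v (cs.wordProd (alternatingWord i j k'))
        have h2 := cs.length_wordProd_le (alternatingWord i j k')
        rw [length_alternatingWord] at h2
        rw [IsRightDescent, hw']
        omega
      rw [h.gram i j hij hm, neg_neg]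
      exact ⟨rootCoeff_cos_nonneg hm2 hk_le, rootCoeff_cos_nonneg hm2 (by omega)⟩
  rw [hwv, map_mul, LinearEquiv.mul_apply, h.alternating]
  split_ifs
  · rw [map_add, map_smul, map_smul, map_add, map_smul, map_smul, smul_eq_mul, smul_eq_mul]
    exact add_nonneg (mul_nonneg hcoef.2 pi) (mul_nonneg hcoef.1 pj)
  · rw [map_add, map_smul, map_smul, map_add, map_smul, map_smul, smul_eq_mul, smul_eq_mul]
    exact add_nonneg (mul_nonneg hcoef.1 pi) (mul_nonneg hcoef.2 pj)

/-- If `w` has the right descent `i`, the root `w (u i)` is non-positive on the chamber. -/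
lemma root_nonpos (h : IsReflectionRep cs φ u ρ) {w : W} {i : B} (hi : cs.IsRightDescent w i)
    {x : V} (hx : x ∈ chamber φ u) : φ x (ρ w (u i)) ≤ 0 := by
  have := h.root_nonneg _ _ rfl i ((cs.isRightDescent_iff_not_isRightDescent_mul).1 hi) x hx
  rw [map_mul, LinearEquiv.mul_apply, h.simple_root, map_neg, map_neg] at this
  linarith

/-- The group acts freely on the orbit of an inner point of the chamber: the mirror of a right
descent of `w` would separate this point from itself. -/
lemma eq_one_of_interior (h : IsReflectionRep cs φ u ρ) {w : W} {x y : V}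
    (hx : x ∈ chamber φ u) (hy : ∀ i, 0 < φ y (u i)) (hxy : x = ρ w y) : w = 1 := by
  by_contra hw
  obtain ⟨i, hi⟩ := cs.exists_rightDescent_of_ne_one hw
  have := h.root_nonpos hi hx
  rw [hxy, h.isometry] at this
  linarith [hy i]

/-- The closed chamber is a strict fundamental domain, and the stabilizers of its points are
generated by simple reflections. -/
theorem stabilizer (h : IsReflectionRep cs φ u ρ) : ∀ (n : ℕ) (w : W), cs.length w = n → ∀ x y : V,
    x ∈ chamber φ u → y ∈ chamber φ u → x = ρ w y →
    x = y ∧ w ∈ Subgroup.closure {s | ∃ i, φ y (u i) = 0 ∧ s = cs.simple i} := by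
  intro n
  induction n with
  | zero =>
    intro w hw x y hx hy hxy
    rw [cs.length_eq_zero_iff] at hw
    subst hw
    exact ⟨by simpa using hxy, one_mem _⟩
  | succ n ih =>
    intro w hw x y hx hy hxy
    have hw1 : w ≠ 1 := by rintro rfl; simp at hw
    obtain ⟨i, hi⟩ := cs.exists_rightDescent_of_ne_one hw1
    have h0 : φ y (u i) = 0 := by
      have := h.root_nonpos hi hx
      rw [hxy, h.isometry] at this
      exact le_antisymm this (hy i)
    have hfix : ρ (cs.simple i) y = y := by rw [h.simple, h0]; simp
    have hlen : cs.length (w * cs.simple i) = n := by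
      have := (cs.isRightDescent_iff).1 hi; omega
    obtain ⟨e, hm⟩ := ih (w * cs.simple i) hlen x y hx hy (by
      rw [map_mul, LinearEquiv.mul_apply, hfix, hxy])
    refine ⟨e, ?_⟩
    have := mul_mem hm (Subgroup.subset_closure
      (show cs.simple i ∈ {s | ∃ i, φ y (u i) = 0 ∧ s = cs.simple i} from ⟨i, h0, rfl⟩))
    simpa using this

/-- Two points of the chamber are at least as close to each other as to the images of one another
under the reflection group. -/
theorem form_orbit_le (h : IsReflectionRep cs φ u ρ) : ∀ (n : ℕ) (w : W), cs.length w = n →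
    ∀ x y : V, x ∈ chamber φ u → y ∈ chamber φ u → φ x (ρ w y) ≤ φ x y := by
  intro n
  induction n with
  | zero =>
    intro w hw x y _ _
    rw [cs.length_eq_zero_iff] at hw
    subst hw
    simp
  | succ n ih =>
    intro w hw x y hx hy
    have hw1 : w ≠ 1 := by rintro rfl; simp at hw
    obtain ⟨i, hi⟩ := cs.exists_rightDescent_of_ne_one hw1
    have hlen : cs.length (w * cs.simple i) = n := by
      have := (cs.isRightDescent_iff).1 hi; omega
    have h1 := ih _ hlen x y hx hy
    have h2 := h.root_nonpos hi hx
    rw [map_mul, LinearEquiv.mul_apply, h.simple, map_sub, map_smul, map_sub, map_smul,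
      smul_eq_mul] at h1
    nlinarith [hy i, mul_nonneg (hy i) (neg_nonneg.2 h2)]

end IsReflectionRep

end

section

/-! ### The scalar product -/

/-- The cosine `c` of the essential angle `π/(2z)`. -/
def cz (z : ℕ) : ℝ := Real.cos (Real.pi / (2 * z))

/-- The sine of the essential angle `π/(2z)`. -/
def sz (z : ℕ) : ℝ := Real.sin (Real.pi / (2 * z))

/-- Minus the determinant of the Coxeter–Schläfli matrix. -/
def ez (z : ℕ) : ℝ := 3 * cz z ^ 2 - 1 - cz z ^ 4

lemma coxeterSchlafli_eq (z : ℕ) : coxeterSchlafli z =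
    !![1, -cz z, 0, 0; -cz z, 1, -cz z, 0; 0, -cz z, 1, -cz z; 0, 0, -cz z, 1] := rfl

lemma angle_pos {z : ℕ} (hz : 7 ≤ z) : 0 < Real.pi / (2 * z) := by
  have : (7 : ℝ) ≤ z := by exact_mod_cast hz
  have := Real.pi_pos
  positivity

lemma angle_lt {z : ℕ} (hz : 7 ≤ z) : Real.pi / (2 * z) < 9 / 40 := by
  have : (7 : ℝ) ≤ z := by exact_mod_cast hz
  rw [div_lt_iff₀ (by linarith)]
  have := Real.pi_lt_d2
  nlinarith

lemma cz_lt_one {z : ℕ} (hz : 7 ≤ z) : cz z < 1 := by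
  rw [cz, ← Real.cos_zero]
  apply Real.cos_lt_cos_of_nonneg_of_le_pi le_rfl _ (angle_pos hz)
  linarith [angle_lt hz, Real.pi_gt_three]

lemma cz_gt {z : ℕ} (hz : 7 ≤ z) : 97 / 100 < cz z := by
  have h := Real.one_sub_sq_div_two_le_cos (x := Real.pi / (2 * z))
  rw [cz]
  nlinarith [angle_lt hz, angle_pos hz]

lemma sz_pos {z : ℕ} (hz : 7 ≤ z) : 0 < sz z := by
  apply Real.sin_pos_of_pos_of_lt_pi (angle_pos hz)
  linarith [angle_lt hz, Real.pi_gt_three]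

lemma sz_sq (z : ℕ) : sz z ^ 2 = 1 - cz z ^ 2 := by
  rw [sz, cz, Real.sin_sq]

lemma cz_sq_lt {z : ℕ} (hz : 7 ≤ z) : cz z ^ 2 < 1 := by
  nlinarith [sz_sq z, sz_pos hz]

lemma cz_sq_gt {z : ℕ} (hz : 7 ≤ z) : 94 / 100 < cz z ^ 2 := by
  nlinarith [cz_gt hz]

lemma ez_pos {z : ℕ} (hz : 7 ≤ z) : 0 < ez z := by
  rw [ez]
  nlinarith [cz_sq_lt hz, cz_sq_gt hz]

lemma inv_coxeterSchlafli {z : ℕ} (hz : 7 ≤ z) : (coxeterSchlafli z)⁻¹ =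
    (-(ez z)⁻¹) • !![1 - 2 * cz z ^ 2, cz z * (1 - cz z ^ 2), cz z ^ 2, cz z ^ 3;
      cz z * (1 - cz z ^ 2), 1 - cz z ^ 2, cz z, cz z ^ 2;
      cz z ^ 2, cz z, 1 - cz z ^ 2, cz z * (1 - cz z ^ 2);
      cz z ^ 3, cz z ^ 2, cz z * (1 - cz z ^ 2), 1 - 2 * cz z ^ 2] := by
  apply Matrix.inv_eq_right_inv
  have he : ez z ≠ 0 := (ez_pos hz).ne'
  rw [Matrix.mul_smul, ← smul_right_injective _ (neg_ne_zero.2 he) |>.eq_iff, smul_smul,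
    neg_mul_neg, mul_inv_cancel₀ he, one_smul]
  rw [coxeterSchlafli_eq, ez]
  ext i j
  fin_cases i <;> fin_cases j <;> simp [Matrix.mul_apply, Fin.sum_univ_four] <;> ring

/-- The scalar product in coordinates. -/
lemma form_eq {z : ℕ} (hz : 7 ≤ z) (X Y : V4) : form z X Y =
    -((1 - 2 * cz z ^ 2) * (X 0 * Y 0 + X 3 * Y 3) + (1 - cz z ^ 2) * (X 1 * Y 1 + X 2 * Y 2)
      + cz z * (1 - cz z ^ 2) * (X 0 * Y 1 + X 1 * Y 0 + X 2 * Y 3 + X 3 * Y 2)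
      + cz z ^ 2 * (X 0 * Y 2 + X 2 * Y 0 + X 1 * Y 3 + X 3 * Y 1)
      + cz z ^ 3 * (X 0 * Y 3 + X 3 * Y 0) + cz z * (X 1 * Y 2 + X 2 * Y 1)) / ez z := by
  rw [form, inv_coxeterSchlafli hz]
  simp [dotProduct, Matrix.mulVec, Fin.sum_univ_four, Matrix.smul_apply]
  ring

/-- The scalar product as a bilinear form. -/
def bil (z : ℕ) : LinearMap.BilinForm ℝ V4 := Matrix.toBilin' (coxeterSchlafli z)⁻¹

lemma bil_apply (z : ℕ) (X Y : V4) : bil z X Y = form z X Y := by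
  rw [bil, Matrix.toBilin'_apply', form]

lemma form_add_left (z : ℕ) (X Y Z : V4) : form z (X + Y) Z = form z X Z + form z Y Z := by
  simp [← bil_apply]
lemma form_add_right (z : ℕ) (X Y Z : V4) : form z X (Y + Z) = form z X Y + form z X Z := by
  simp [← bil_apply]
lemma form_sub_left (z : ℕ) (X Y Z : V4) : form z (X - Y) Z = form z X Z - form z Y Z := by
  simp [← bil_apply]
lemma form_sub_right (z : ℕ) (X Y Z : V4) : form z X (Y - Z) = form z X Y - form z X Z := by
  simp [← bil_apply]
lemma form_smul_left (z : ℕ) (a : ℝ) (X Z : V4) : form z (a • X) Z = a * form z X Z := by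
  simp [← bil_apply]
lemma form_smul_right (z : ℕ) (a : ℝ) (X Z : V4) : form z X (a • Z) = a * form z X Z := by
  simp [← bil_apply]
lemma form_neg_left (z : ℕ) (X Z : V4) : form z (-X) Z = - form z X Z := by
  simp [← bil_apply]
lemma form_neg_right (z : ℕ) (X Z : V4) : form z X (-Z) = - form z X Z := by
  simp [← bil_apply]
lemma form_zero_left (z : ℕ) (Z : V4) : form z 0 Z = 0 := by simp [← bil_apply]

lemma form_comm {z : ℕ} (hz : 7 ≤ z) (X Y : V4) : form z X Y = form z Y X := by
  rw [form_eq hz, form_eq hz]; ring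

lemma continuous_form (z : ℕ) : Continuous fun p : V4 × V4 => form z p.1 p.2 := by
  unfold form
  fun_prop

lemma form_facePole {z : ℕ} (hz : 7 ≤ z) (X : V4) (i : Fin 4) :
    form z X (facePole z i) = X i := by
  have he : ez z ≠ 0 := (ez_pos hz).ne'
  rw [form_eq hz, div_eq_iff he, ez]
  fin_cases i <;> simp [facePole, coxeterSchlafli_eq] <;> ring

lemma form_vertexA {z : ℕ} (hz : 7 ≤ z) (X : V4) : form z X (vertexA 0) =
      -((1 - 2 * cz z ^ 2) * X 0 + cz z * (1 - cz z ^ 2) * X 1 + cz z ^ 2 * X 2 + cz z ^ 3 * X 3)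
        / ez z ∧
    form z X (vertexA 2) =
      -(cz z ^ 2 * X 0 + cz z * X 1 + (1 - cz z ^ 2) * X 2 + cz z * (1 - cz z ^ 2) * X 3)
        / ez z ∧
    form z X (vertexA 3) =
      -((1 - 2 * cz z ^ 2) * X 3 + cz z * (1 - cz z ^ 2) * X 2 + cz z ^ 2 * X 1 + cz z ^ 3 * X 0)
        / ez z := by
  refine ⟨?_, ?_, ?_⟩
  all_goals
    rw [form_eq hz]
    simp [vertexA]
  all_goals ring

/-! ### Reflections -/

lemma reflect_apply (z : ℕ) {U : V4} (hU : form z U U ≠ 0) (X : V4) :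
    reflect z U X = X - (2 * form z X U / form z U U) • U := by
  rw [reflect, dif_neg hU, Module.reflection_apply]
  congr 2
  simp only [LinearMap.smul_apply, smul_eq_mul]
  change _ * bil z X U = _
  rw [bil_apply]; ring

lemma reflect_smul (z : ℕ) {U : V4} (hU : form z U U ≠ 0) {a : ℝ} (ha : a ≠ 0) :
    reflect z (a • U) = reflect z U := by
  have h2 : form z (a • U) (a • U) ≠ 0 := by
    rw [form_smul_left, form_smul_right]; exact mul_ne_zero ha (mul_ne_zero ha hU)
  ext1 X
  rw [reflect_apply z h2, reflect_apply z hU, smul_smul]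
  simp only [form_smul_left, form_smul_right]
  congr 2
  field_simp

lemma reflect_mul_self (z : ℕ) (U : V4) : reflect z U * reflect z U = 1 := by
  by_cases hU : form z U U = 0
  · rw [reflect, dif_pos hU]; rfl
  · ext1 X
    rw [LinearEquiv.mul_apply, reflect_apply z hU, reflect_apply z hU, form_sub_left,
      form_smul_left, LinearEquiv.coe_one, id]
    have : 2 * (form z X U - 2 * form z X U / form z U U * form z U U) / form z U U =
      - (2 * form z X U / form z U U) := by field_simp; ring
    rw [this]; module

lemma form_reflect {z : ℕ} (hz : 7 ≤ z) {U : V4} (hU : form z U U ≠ 0) (X Y : V4) :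
    form z (reflect z U X) (reflect z U Y) = form z X Y := by
  rw [reflect_apply z hU, reflect_apply z hU]
  simp only [form_sub_left, form_sub_right, form_smul_left, form_smul_right, form_comm hz U]
  field_simp; ring

/-- The part of the space spanned by two unit vectors `u`, `v` with `⟨u, v⟩ = -cos t` is rotated by
the product of the reflections in their planes through the angle `2t`. -/
lemma rotation_pow {z : ℕ} (hz : 7 ≤ z) {u v : V4} {t : ℝ} (hu : form z u u = 1)
    (hv : form z v v = 1) (huv : form z u v = -Real.cos t) (ht : Real.sin t ≠ 0) (n : ℕ) :
    ((reflect z u * reflect z v) ^ n) u = Real.cos (2 * n * t) • u +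
        Real.sin (2 * n * t) • (Real.sin t)⁻¹ • (v + Real.cos t • u) ∧
    ((reflect z u * reflect z v) ^ n) ((Real.sin t)⁻¹ • (v + Real.cos t • u)) =
        - Real.sin (2 * n * t) • u + Real.cos (2 * n * t) • (Real.sin t)⁻¹ • (v + Real.cos t • u) ∧
    ∀ X, form z X u = 0 → form z X v = 0 → ((reflect z u * reflect z v) ^ n) X = X := by
  have hu0 : form z u u ≠ 0 := by rw [hu]; exact one_ne_zero
  have hv0 : form z v v ≠ 0 := by rw [hv]; exact one_ne_zero
  have hvu : form z v u = -Real.cos t := by rw [form_comm hz, huv]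
  have hs := Real.sin_sq_add_cos_sq t
  set C := Real.cos t with hC
  set S := Real.sin t with hS
  set e := S⁻¹ • (v + C • u) with he
  have hve : v = S • e - C • u := by rw [he, smul_smul, mul_inv_cancel₀ ht]; module
  have r2 : ∀ X, (reflect z u * reflect z v) X =
      X - (2 * form z X u) • u - (2 * form z X v) • (v + (2 * C) • u) := by
    intro X
    rw [LinearEquiv.mul_apply, reflect_apply z hu0, reflect_apply z hv0, hu, hv, form_sub_left,
      form_smul_left, hvu]
    module
  have hee : form z e u = 0 := by
    rw [he, form_smul_left, form_add_left, form_smul_left, hu, hvu]; ring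
  have hev : form z e v = S := by
    rw [he, form_smul_left, form_add_left, form_smul_left, hv, huv]
    field_simp; linarith
  have c2 : Real.cos (2 * t) = 1 - 2 * S ^ 2 := by rw [Real.cos_two_mul]; linarith
  have s2 : Real.sin (2 * t) = 2 * S * C := Real.sin_two_mul t
  have a1 : (reflect z u * reflect z v) u = Real.cos (2 * t) • u + Real.sin (2 * t) • e := by
    rw [r2, hu, huv, hve, c2, s2]
    match_scalars
    · linear_combination 2 * hs
    · ring
  have a2 : (reflect z u * reflect z v) e = - Real.sin (2 * t) • u + Real.cos (2 * t) • e := by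
    rw [r2, hee, hev, hve, c2, s2]
    module
  induction n with
  | zero => simp
  | succ n ih =>
    obtain ⟨h1, h2, h3⟩ := ih
    have e1 : (2 * ((n + 1 : ℕ) : ℝ) * t) = 2 * n * t + 2 * t := by push_cast; ring
    rw [e1, Real.cos_add, Real.sin_add]
    refine ⟨?_, ?_, ?_⟩
    · rw [pow_succ', LinearEquiv.mul_apply, h1, map_add, map_smul, map_smul, a1, a2]
      module
    · rw [pow_succ', LinearEquiv.mul_apply, h2, map_add, map_smul, map_smul, a1, a2]
      module
    · intro X hX hX'
      rw [pow_succ', LinearEquiv.mul_apply, h3 X hX hX', r2, hX, hX']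
      simp

lemma rotation_pow_eq_one {z : ℕ} (hz : 7 ≤ z) {u v : V4} {m : ℕ} (hm : 2 ≤ m)
    (hu : form z u u = 1)
    (hv : form z v v = 1) (huv : form z u v = -Real.cos (Real.pi / m)) :
    (reflect z u * reflect z v) ^ m = 1 := by
  have hm' : (2 : ℝ) ≤ m := by exact_mod_cast hm
  have hs : Real.sin (Real.pi / m) ≠ 0 := by
    apply ne_of_gt
    have := Real.pi_pos
    apply Real.sin_pos_of_pos_of_lt_pi (by positivity)
    rw [div_lt_iff₀ (by linarith)]; nlinarith
  obtain ⟨h1, h2, h3⟩ := rotation_pow hz hu hv huv hs m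
  have e : 2 * (m : ℝ) * (Real.pi / m) = 2 * Real.pi := by field_simp
  rw [e, Real.cos_two_pi, Real.sin_two_pi] at h1 h2
  set t := Real.pi / (m : ℝ)
  set e1 := (Real.sin t)⁻¹ • (v + Real.cos t • u) with he1
  have hvu : form z v u = -Real.cos t := by rw [form_comm hz, huv]
  have hsc := Real.sin_sq_add_cos_sq t
  have o1 : form z e1 u = 0 := by
    rw [he1, form_smul_left, form_add_left, form_smul_left, hu, hvu]; ring
  have o2 : form z e1 v = Real.sin t := by
    rw [he1, form_smul_left, form_add_left, form_smul_left, hv, huv]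
    field_simp; linarith
  ext1 X
  have hX := h3 (X - form z X u • u - ((form z X v + Real.cos t * form z X u) / Real.sin t) • e1)
    (by rw [form_sub_left, form_sub_left, form_smul_left, form_smul_left, hu, o1]; ring)
    (by rw [form_sub_left, form_sub_left, form_smul_left, form_smul_left, huv, o2]
        field_simp; ring)
  rw [map_sub, map_sub, map_smul, map_smul, h1, h2] at hX
  simp only [neg_zero, zero_smul, one_smul, add_zero, zero_add] at hX
  rw [LinearEquiv.coe_one, id]
  linear_combination hX

/-! ### The hyperboloid -/

/-- Lorentz coordinates adapted to the orthonormal frame of `b⁰`, `b¹`, `b³` and `A₂`; the last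
one is the time coordinate. -/
def lorentz (z : ℕ) (hz : 7 ≤ z) : V4 ≃ₗ[ℝ] V4 where
  toFun X := ![X 0, (X 1 + cz z * X 0) / sz z, X 3,
    (cz z ^ 2 * X 0 + cz z * X 1 + (1 - cz z ^ 2) * X 2 + cz z * (1 - cz z ^ 2) * X 3) /
      (sz z * Real.sqrt (ez z))]
  invFun Y := ![Y 0, sz z * Y 1 - cz z * Y 0,
    (sz z * Real.sqrt (ez z) * Y 3 - cz z ^ 2 * Y 0 - cz z * (sz z * Y 1 - cz z * Y 0)
      - cz z * (1 - cz z ^ 2) * Y 2) / (1 - cz z ^ 2), Y 2]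
  map_add' X Y := by
    ext i; fin_cases i <;> simp <;> ring
  map_smul' a X := by
    ext i; fin_cases i <;> simp <;> ring
  left_inv X := by
    have h1 := (sz_pos hz).ne'
    have h2 : Real.sqrt (ez z) ≠ 0 := (Real.sqrt_pos.2 (ez_pos hz)).ne'
    have h3 : 1 - cz z ^ 2 ≠ 0 := by linarith [cz_sq_lt hz]
    ext i; fin_cases i <;> simp <;> field_simp <;> ring
  right_inv X := by
    have h1 := (sz_pos hz).ne'
    have h2 : Real.sqrt (ez z) ≠ 0 := (Real.sqrt_pos.2 (ez_pos hz)).ne'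
    have h3 : 1 - cz z ^ 2 ≠ 0 := by linarith [cz_sq_lt hz]
    ext i; fin_cases i <;> simp <;> field_simp; ring

lemma form_lorentz {z : ℕ} (hz : 7 ≤ z) (X Y : V4) : form z X Y =
    lorentz z hz X 0 * lorentz z hz Y 0 + lorentz z hz X 1 * lorentz z hz Y 1 +
      lorentz z hz X 2 * lorentz z hz Y 2 - lorentz z hz X 3 * lorentz z hz Y 3 := by
  have h1 := (sz_pos hz).ne'
  have h2 : Real.sqrt (ez z) ≠ 0 := (Real.sqrt_pos.2 (ez_pos hz)).ne'
  have h3 : Real.sqrt (ez z) ^ 2 = ez z := Real.sq_sqrt (ez_pos hz).le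
  have h4 := sz_sq z
  have he : ez z ≠ 0 := (ez_pos hz).ne'
  have h5 : 1 - cz z ^ 2 ≠ 0 := by linarith [cz_sq_lt hz]
  rw [form_eq hz]
  simp only [lorentz, LinearEquiv.coe_mk, LinearMap.coe_mk, AddHom.coe_mk]
  simp only [Matrix.cons_val]
  rw [div_mul_div_comm, div_mul_div_comm, ← pow_two, ← pow_two, mul_pow, h3, h4]
  field_simp
  rw [ez]
  ring

lemma lorentzSignature {z : ℕ} (hz : 7 ≤ z) : HasLorentzSignature z :=
  ⟨lorentz z hz, form_lorentz hz⟩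

lemma form_A2_lorentz {z : ℕ} (hz : 7 ≤ z) (X : V4) :
    form z X (vertexA 2) = -(sz z / Real.sqrt (ez z)) * lorentz z hz X 3 := by
  have h1 := (sz_pos hz).ne'
  have h2 : Real.sqrt (ez z) ≠ 0 := (Real.sqrt_pos.2 (ez_pos hz)).ne'
  have h3 : Real.sqrt (ez z) ^ 2 = ez z := Real.sq_sqrt (ez_pos hz).le
  have he : ez z ≠ 0 := (ez_pos hz).ne'
  rw [(form_vertexA hz X).2.1]
  simp only [lorentz, LinearEquiv.coe_mk, LinearMap.coe_mk, AddHom.coe_mk]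
  simp only [Matrix.cons_val]
  field_simp
  rw [h3]

lemma sheet_iff {z : ℕ} (hz : 7 ≤ z) (X : V4) :
    form z X (vertexA 2) < 0 ↔ 0 < lorentz z hz X 3 := by
  rw [form_A2_lorentz hz]
  have : 0 < sz z / Real.sqrt (ez z) := div_pos (sz_pos hz) (Real.sqrt_pos.2 (ez_pos hz))
  constructor <;> intro h
  · by_contra h'
    push Not at h'
    nlinarith
  · nlinarith

end

section

/-! ### The geometry of the hyperboloid -/

/-- The reversed Cauchy–Schwarz inequality for two points of the upper sheet of the hyperboloid. -/
lemma hyperboloid_ineq {x0 x1 x2 t y0 y1 y2 s : ℝ} (ht : 0 < t) (hs : 0 < s)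
    (hx : x0 * x0 + x1 * x1 + x2 * x2 - t * t = -1)
    (hy : y0 * y0 + y1 * y1 + y2 * y2 - s * s = -1) :
    1 ≤ -(x0 * y0 + x1 * y1 + x2 * y2 - t * s) := by
  have h : (1 + (x0 * y0 + x1 * y1 + x2 * y2)) ^ 2 ≤ (t * s) ^ 2 := by
    have e1 : t * t = 1 + (x0 * x0 + x1 * x1 + x2 * x2) := by linarith
    have e2 : s * s = 1 + (y0 * y0 + y1 * y1 + y2 * y2) := by linarith
    have e3 : (t * s) ^ 2 = (t * t) * (s * s) := by ring
    rw [e3, e1, e2]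
    nlinarith [sq_nonneg (x0 * y1 - x1 * y0), sq_nonneg (x0 * y2 - x2 * y0),
      sq_nonneg (x1 * y2 - x2 * y1), sq_nonneg (x0 - y0), sq_nonneg (x1 - y1), sq_nonneg (x2 - y2)]
  have := abs_le_of_sq_le_sq' h (by positivity)
  linarith [this.2]

lemma hyperboloid_eq {x0 x1 x2 t y0 y1 y2 s : ℝ} (ht : 0 < t) (hs : 0 < s)
    (hx : x0 * x0 + x1 * x1 + x2 * x2 - t * t = -1)
    (hy : y0 * y0 + y1 * y1 + y2 * y2 - s * s = -1)
    (h : x0 * y0 + x1 * y1 + x2 * y2 - t * s = -1) : x0 = y0 ∧ x1 = y1 ∧ x2 = y2 ∧ t = s := by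
  have e1 : t * t = 1 + (x0 * x0 + x1 * x1 + x2 * x2) := by linarith
  have e2 : s * s = 1 + (y0 * y0 + y1 * y1 + y2 * y2) := by linarith
  have e3 : (t * s) ^ 2 = (t * t) * (s * s) := by ring
  have e4 : t * s = 1 + (x0 * y0 + x1 * y1 + x2 * y2) := by linarith
  rw [e1, e2, e4] at e3
  have h0 : (x0 - y0) ^ 2 ≤ 0 := by
    nlinarith [sq_nonneg (x0 * y1 - x1 * y0), sq_nonneg (x0 * y2 - x2 * y0),
      sq_nonneg (x1 * y2 - x2 * y1), sq_nonneg (x1 - y1), sq_nonneg (x2 - y2)]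
  have h1 : (x1 - y1) ^ 2 ≤ 0 := by
    nlinarith [sq_nonneg (x0 * y1 - x1 * y0), sq_nonneg (x0 * y2 - x2 * y0),
      sq_nonneg (x1 * y2 - x2 * y1), sq_nonneg (x0 - y0), sq_nonneg (x2 - y2)]
  have h2 : (x2 - y2) ^ 2 ≤ 0 := by
    nlinarith [sq_nonneg (x0 * y1 - x1 * y0), sq_nonneg (x0 * y2 - x2 * y0),
      sq_nonneg (x1 * y2 - x2 * y1), sq_nonneg (x0 - y0), sq_nonneg (x1 - y1)]
  have g0 : x0 = y0 := sub_eq_zero.1 (pow_eq_zero_iff two_ne_zero |>.1 (le_antisymm h0 (sq_nonneg _)))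
  have g1 : x1 = y1 := sub_eq_zero.1 (pow_eq_zero_iff two_ne_zero |>.1 (le_antisymm h1 (sq_nonneg _)))
  have g2 : x2 = y2 := sub_eq_zero.1 (pow_eq_zero_iff two_ne_zero |>.1 (le_antisymm h2 (sq_nonneg _)))
  refine ⟨g0, g1, g2, ?_⟩
  subst g0 g1 g2
  have : (t - s) * (t + s) = 0 := by nlinarith
  rcases mul_eq_zero.1 this with h | h <;> linarith

variable {z : ℕ}

lemma one_le_neg_form (hz : 7 ≤ z) (X Y : H3 z) : 1 ≤ -form z X.1 Y.1 := by
  have hX := X.2.1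
  have hY := Y.2.1
  rw [form_lorentz hz] at hX hY ⊢
  exact hyperboloid_ineq ((sheet_iff hz _).1 X.2.2) ((sheet_iff hz _).1 Y.2.2) hX hY

lemma form_neg (hz : 7 ≤ z) (X Y : H3 z) : form z X.1 Y.1 < 0 := by
  linarith [one_le_neg_form hz X Y]

lemma eq_of_form_eq (hz : 7 ≤ z) {X Y : H3 z} (h : form z X.1 Y.1 = -1) : X = Y := by
  have hX := X.2.1
  have hY := Y.2.1
  rw [form_lorentz hz] at hX hY h
  obtain ⟨h0, h1, h2, h3⟩ :=
    hyperboloid_eq ((sheet_iff hz _).1 X.2.2) ((sheet_iff hz _).1 Y.2.2) hX hY h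
  apply Subtype.ext
  apply (lorentz z hz).injective
  ext i
  fin_cases i
  exacts [h0, h1, h2, h3]

/-- A vector of square `-1` lies on the sheet of the points with which its product is negative. -/
lemma sheet_iff_form (hz : 7 ≤ z) {X : V4} (hX : form z X X = -1) (Y : H3 z) :
    form z X (vertexA 2) < 0 ↔ form z X Y.1 < 0 := by
  constructor
  · intro h; exact form_neg hz ⟨X, hX, h⟩ Y
  · intro h
    rw [sheet_iff hz]
    by_contra h'
    have h0 : lorentz z hz X 3 ≠ 0 := by
      intro h0
      rw [form_lorentz hz, h0] at hX
      nlinarith [mul_self_nonneg (lorentz z hz X 0), mul_self_nonneg (lorentz z hz X 1),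
        mul_self_nonneg (lorentz z hz X 2)]
    have h1 : 0 < lorentz z hz (-X) 3 := by
      rw [map_neg, Pi.neg_apply]
      rcases lt_or_gt_of_ne h0 with h | h
      · linarith
      · exact absurd h h'
    have := form_neg hz ⟨-X, by rw [form_neg_left, form_neg_right, hX]; norm_num,
      (sheet_iff hz _).2 h1⟩ Y
    rw [form_neg_left] at this
    linarith

/-- The isometries of hyperbolic space, of both orientations. -/
def isomH (z : ℕ) : Subgroup (V4 ≃ₗ[ℝ] V4) where
  carrier := {g | (∀ X Y : V4, form z (g X) (g Y) = form z X Y) ∧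
    (∀ X : V4, form z X X = -1 → (form z (g X) (vertexA 2) < 0 ↔ form z X (vertexA 2) < 0))}
  mul_mem' := by
    rintro f g ⟨hf1, hf2⟩ ⟨hg1, hg2⟩
    refine ⟨fun X Y => ?_, fun X hX => ?_⟩
    · rw [LinearEquiv.mul_apply, LinearEquiv.mul_apply, hf1, hg1]
    · rw [LinearEquiv.mul_apply, hf2 _ (by rw [hg1, hX]), hg2 _ hX]
  one_mem' := ⟨fun _ _ => rfl, fun _ _ => Iff.rfl⟩
  inv_mem' := by
    rintro g ⟨h1, h2⟩
    have hg : ∀ X : V4, g (g⁻¹ X) = X := fun X => g.apply_symm_apply X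
    have k1 : ∀ X Y : V4, form z (g⁻¹ X) (g⁻¹ Y) = form z X Y := fun X Y => by
      rw [← h1, hg, hg]
    exact ⟨k1, fun X hX => by rw [← h2 (g⁻¹ X) (by rw [k1, hX]), hg]⟩

lemma isomPlus_le : isomPlus z ≤ isomH z := fun _ h => ⟨h.1, h.2.1⟩

lemma mem_isomH_of_form (hz : 7 ≤ z) {g : V4 ≃ₗ[ℝ] V4}
    (h : ∀ X Y : V4, form z (g X) (g Y) = form z X Y) (Y : H3 z) (hY : form z (g Y.1) Y.1 < 0) :
    g ∈ isomH z := by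
  refine ⟨h, fun X hX => ?_⟩
  have h1 : form z (g Y.1) (g Y.1) = -1 := by rw [h, Y.2.1]
  have h2 := (sheet_iff_form hz h1 Y).2 hY
  rw [sheet_iff_form hz (by rw [h, hX]) ⟨g Y.1, h1, h2⟩, sheet_iff_form hz hX Y, h]

lemma inv_apply_self (g : V4 ≃ₗ[ℝ] V4) (X : V4) : g⁻¹ (g X) = X := g.symm_apply_apply X
lemma apply_inv_self (g : V4 ≃ₗ[ℝ] V4) (X : V4) : g (g⁻¹ X) = X := g.apply_symm_apply X

/-- A timelike vector on the side of the upper sheet, scaled to a point of hyperbolic space. -/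
def normalize (z : ℕ) (X : V4) (h : form z X X < 0) (h2 : form z X (vertexA 2) < 0) : H3 z :=
  ⟨(Real.sqrt (-form z X X))⁻¹ • X, by
    have h0 : 0 < -form z X X := by linarith
    have hs := Real.sqrt_pos.2 h0
    have hq := Real.mul_self_sqrt h0.le
    rw [form_smul_left, form_smul_right, form_smul_left]
    refine ⟨?_, mul_neg_of_pos_of_neg (by positivity) h2⟩
    field_simp
    linarith⟩

lemma normalize_val (z : ℕ) (X : V4) (h : form z X X < 0) (h2 : form z X (vertexA 2) < 0) :
    (normalize z X h h2).1 = (Real.sqrt (-form z X X))⁻¹ • X := rfl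

lemma sqrt_inv_pos {X : V4} (h : form z X X < 0) : 0 < (Real.sqrt (-form z X X))⁻¹ :=
  inv_pos.2 (Real.sqrt_pos.2 (by linarith))

/-- The point `A₂` of hyperbolic space. -/
def basePoint (z : ℕ) (hz : 7 ≤ z) : H3 z :=
  have h : form z (vertexA 2) (vertexA 2) < 0 := by
    rw [(form_vertexA hz _).2.1]
    simp only [vertexA]
    simp
    exact div_neg_of_neg_of_pos (by linarith [cz_sq_lt hz]) (ez_pos hz)
  normalize z (vertexA 2) h h

lemma reflect_mem_isomH (hz : 7 ≤ z) {U : V4} (hU : 0 < form z U U) : reflect z U ∈ isomH z := by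
  apply mem_isomH_of_form hz (form_reflect hz hU.ne') (basePoint z hz)
  rw [reflect_apply z hU.ne', form_sub_left, form_smul_left, (basePoint z hz).2.1,
    form_comm hz U (basePoint z hz).1]
  have : 0 ≤ 2 * form z (basePoint z hz).1 U / form z U U * form z (basePoint z hz).1 U := by
    have : 2 * form z (basePoint z hz).1 U / form z U U * form z (basePoint z hz).1 U =
      2 * (form z (basePoint z hz).1 U) ^ 2 / form z U U := by ring
    rw [this]; positivity
  linarith

lemma halfTurn_apply (X : V4) (i : Fin 4) : halfTurn X i = X (Fin.rev i) := rfl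

lemma form_halfTurn (hz : 7 ≤ z) (X Y : V4) :
    form z (halfTurn X) (halfTurn Y) = form z X Y := by
  rw [form_eq hz, form_eq hz]
  simp only [halfTurn_apply]
  have r0 : Fin.rev (0 : Fin 4) = 3 := rfl
  have r1 : Fin.rev (1 : Fin 4) = 2 := rfl
  have r2 : Fin.rev (2 : Fin 4) = 1 := rfl
  have r3 : Fin.rev (3 : Fin 4) = 0 := rfl
  rw [r0, r1, r2, r3]; ring

lemma halfTurn_mem_isomH (hz : 7 ≤ z) : halfTurn ∈ isomH z := by
  apply mem_isomH_of_form hz (form_halfTurn hz) (basePoint z hz)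
  change form z (halfTurn (_ • vertexA 2)) (_ • vertexA 2) < 0
  rw [map_smul, form_smul_left, form_smul_right]
  have h : form z (vertexA 2) (vertexA 2) < 0 := by
    rw [(form_vertexA hz _).2.1]
    simp only [vertexA]
    simp
    exact div_neg_of_neg_of_pos (by linarith [cz_sq_lt hz]) (ez_pos hz)
  refine mul_neg_of_pos_of_neg (sqrt_inv_pos h) (mul_neg_of_pos_of_neg (sqrt_inv_pos h) ?_)
  rw [(form_vertexA hz _).2.1]
  apply div_neg_of_neg_of_pos _ (ez_pos hz)
  simp [halfTurn_apply, vertexA, Fin.rev]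
  linarith [cz_gt hz]

/-- The action of an isometry on hyperbolic space. -/
def act (g : isomH z) (X : H3 z) : H3 z :=
  ⟨g.1 X.1, by rw [g.2.1, X.2.1], (g.2.2 X.1 X.2.1).2 X.2.2⟩

instance : MulAction (isomH z) (H3 z) where
  smul := act
  one_smul _ := rfl
  mul_smul _ _ _ := rfl

lemma smul_val (g : isomH z) (X : H3 z) : (g • X).1 = g.1 X.1 := rfl

lemma continuous_gl (g : V4 ≃ₗ[ℝ] V4) : Continuous g :=
  LinearMap.continuous_of_finiteDimensional (g : V4 →ₗ[ℝ] V4)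

instance : ContinuousConstSMul (isomH z) (H3 z) where
  continuous_const_smul g :=
    Continuous.subtype_mk ((continuous_gl g.1).comp continuous_subtype_val) _

lemma move_eq_smul (g : isomH z) (F : Set (H3 z)) :
    move g.1 F = (fun X => g • X) '' F := by
  ext Y
  constructor
  · rintro ⟨X, hX, h⟩
    exact ⟨X, hX, Subtype.ext h.symm⟩
  · rintro ⟨X, hX, rfl⟩
    exact ⟨X, hX, rfl⟩

lemma mem_move {g : V4 ≃ₗ[ℝ] V4} (hg : g ∈ isomH z) {F : Set (H3 z)} {Y : H3 z} :
    Y ∈ move g F ↔ (⟨g, hg⟩ : isomH z)⁻¹ • Y ∈ F := by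
  have e : move g F = (fun X => (⟨g, hg⟩ : isomH z) • X) '' F := move_eq_smul ⟨g, hg⟩ F
  rw [e]
  constructor
  · rintro ⟨X, hX, rfl⟩
    simpa using hX
  · intro h
    exact ⟨_, h, by simp⟩

lemma move_mul (g g' : V4 ≃ₗ[ℝ] V4) (hg' : g' ∈ isomH z) (F : Set (H3 z)) :
    move (g * g') F = move g (move g' F) := by
  ext Y
  constructor
  · rintro ⟨X, hX, h⟩
    exact ⟨(⟨g', hg'⟩ : isomH z) • X, ⟨X, hX, rfl⟩, h⟩
  · rintro ⟨X, ⟨X', hX', h'⟩, h⟩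
    exact ⟨X', hX', by rw [h, h', LinearEquiv.mul_apply]⟩

lemma move_one (F : Set (H3 z)) : move 1 F = F := by
  ext Y
  constructor
  · rintro ⟨X, hX, h⟩
    rwa [Subtype.ext (show Y.1 = X.1 from h)]
  · intro h
    exact ⟨Y, h, rfl⟩

lemma move_mono (g : V4 ≃ₗ[ℝ] V4) {F F' : Set (H3 z)} (h : F ⊆ F') : move g F ⊆ move g F' :=
  fun _ ⟨X, hX, e⟩ => ⟨X, h hX, e⟩

/-! ### Topology of hyperbolic space -/

/-- Hyperbolic space is homeomorphic to `ℝ³` through the spatial Lorentz coordinates. -/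
def spatial (z : ℕ) (hz : 7 ≤ z) : H3 z ≃ₜ (Fin 3 → ℝ) where
  toFun X := ![lorentz z hz X.1 0, lorentz z hz X.1 1, lorentz z hz X.1 2]
  invFun y := ⟨(lorentz z hz).symm
      ![y 0, y 1, y 2, Real.sqrt (1 + (y 0 ^ 2 + y 1 ^ 2 + y 2 ^ 2))], by
    have h0 : 0 < 1 + (y 0 ^ 2 + y 1 ^ 2 + y 2 ^ 2) := by positivity
    constructor
    · rw [form_lorentz hz]
      simp only [LinearEquiv.apply_symm_apply, Matrix.cons_val]
      rw [Real.mul_self_sqrt h0.le]; ring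
    · rw [sheet_iff hz]
      simp only [LinearEquiv.apply_symm_apply, Matrix.cons_val]
      exact Real.sqrt_pos.2 h0⟩
  left_inv X := by
    apply Subtype.ext
    apply (lorentz z hz).injective
    have hX := X.2.1
    rw [form_lorentz hz] at hX
    have ht := (sheet_iff hz _).1 X.2.2
    simp only [LinearEquiv.apply_symm_apply]
    ext i
    fin_cases i
    · rfl
    · rfl
    · rfl
    · change Real.sqrt _ = lorentz z hz X.1 3
      rw [Real.sqrt_eq_iff_mul_self_eq_of_pos ht]
      simp only [Matrix.cons_val]
      linarith
  right_inv y := by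
    simp only [LinearEquiv.apply_symm_apply]
    ext i
    fin_cases i <;> rfl
  continuous_toFun := by
    have h : Continuous fun X : H3 z => lorentz z hz X.1 :=
      (continuous_gl _).comp continuous_subtype_val
    refine continuous_pi fun i => ?_
    fin_cases i
    · have h0 : Continuous fun X : H3 z => lorentz z hz X.1 0 := (continuous_apply (0 : Fin 4)).comp h
      exact h0
    · have h1 : Continuous fun X : H3 z => lorentz z hz X.1 1 := (continuous_apply (1 : Fin 4)).comp h
      exact h1
    · have h2 : Continuous fun X : H3 z => lorentz z hz X.1 2 := (continuous_apply (2 : Fin 4)).comp h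
      exact h2
  continuous_invFun := by
    refine Continuous.subtype_mk ((continuous_gl _).comp ?_) _
    refine continuous_pi fun i => ?_
    fin_cases i <;> simp <;> fun_prop

lemma contractibleSpace_H3 (hz : 7 ≤ z) : ContractibleSpace (H3 z) :=
  (spatial z hz).contractibleSpace

lemma locallyCompactSpace_H3 (hz : 7 ≤ z) : LocallyCompactSpace (H3 z) :=
  (spatial z hz).isClosedEmbedding.locallyCompactSpace

/-- A closed set of points at bounded distance from a fixed point is compact. -/
lemma isCompact_of_form_le (hz : 7 ≤ z) {F : Set (H3 z)} (hF : IsClosed F) (Y : H3 z) (r : ℝ)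
    (h : ∀ X ∈ F, -form z X.1 Y.1 ≤ r) : IsCompact F := by
  rw [← (spatial z hz).isCompact_image]
  obtain ⟨K, hK⟩ : ∃ K : ℝ, ∀ X ∈ F, lorentz z hz X.1 3 ≤ K := by
    have hY := Y.2.1
    rw [form_lorentz hz] at hY
    have ht := (sheet_iff hz _).1 Y.2.2
    set y0 := lorentz z hz Y.1 0
    set y1 := lorentz z hz Y.1 1
    set y2 := lorentz z hz Y.1 2
    set s := lorentz z hz Y.1 3
    refine ⟨r * (2 * s), fun X hX => ?_⟩
    have h1 := h X hX
    have h2 := X.2.1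
    rw [form_lorentz hz] at h1 h2
    have hs := (sheet_iff hz _).1 X.2.2
    set x0 := lorentz z hz X.1 0
    set x1 := lorentz z hz X.1 1
    set x2 := lorentz z hz X.1 2
    set t := lorentz z hz X.1 3
    -- with `n` the length of the spatial part of `Y`, `t (s - n) ≤ r` and `(s - n) (s + n) = 1`
    set n := Real.sqrt (y0 * y0 + y1 * y1 + y2 * y2) with hn
    have hnn : n * n = y0 * y0 + y1 * y1 + y2 * y2 :=
      Real.mul_self_sqrt (by nlinarith [mul_self_nonneg y0, mul_self_nonneg y1, mul_self_nonneg y2])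
    have hn0 : 0 ≤ n := Real.sqrt_nonneg _
    have hns : n < s := by nlinarith
    have cs : x0 * y0 + x1 * y1 + x2 * y2 ≤ t * n := by
      apply le_of_sq_le_sq _ (by positivity)
      rw [mul_pow, pow_two n, hnn]
      nlinarith [sq_nonneg (x0 * y1 - x1 * y0), sq_nonneg (x0 * y2 - x2 * y0),
        sq_nonneg (x1 * y2 - x2 * y1), mul_self_nonneg y0, mul_self_nonneg y1, mul_self_nonneg y2]
    have k1 : t * (s - n) ≤ r := by nlinarith
    have k2 : (s - n) * (s + n) = 1 := by nlinarith
    have k3 : t = t * (s - n) * (s + n) := by rw [mul_assoc, k2, mul_one]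
    have hr : 0 ≤ r := le_trans (mul_nonneg hs.le (by linarith)) k1
    rw [k3]
    calc t * (s - n) * (s + n) ≤ r * (s + n) := by gcongr
      _ ≤ r * (2 * s) := by gcongr; linarith
  refine IsCompact.of_isClosed_subset (isCompact_closedBall (0 : Fin 3 → ℝ) |K|)
    ((spatial z hz).isClosedMap _ hF) ?_
  rintro _ ⟨X, hX, rfl⟩
  rw [mem_closedBall_zero_iff, pi_norm_le_iff_of_nonneg (abs_nonneg _)]
  have h2 := X.2.1
  rw [form_lorentz hz] at h2
  have hs := (sheet_iff hz _).1 X.2.2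
  have hk := hK X hX
  intro i
  rw [Real.norm_eq_abs, ← sq_le_sq]
  have hKK : lorentz z hz X.1 3 ^ 2 ≤ K ^ 2 := by gcongr
  fin_cases i
  · change lorentz z hz X.1 0 ^ 2 ≤ _
    nlinarith [mul_self_nonneg (lorentz z hz X.1 1), mul_self_nonneg (lorentz z hz X.1 2)]
  · change lorentz z hz X.1 1 ^ 2 ≤ _
    nlinarith [mul_self_nonneg (lorentz z hz X.1 0), mul_self_nonneg (lorentz z hz X.1 2)]
  · change lorentz z hz X.1 2 ^ 2 ≤ _
    nlinarith [mul_self_nonneg (lorentz z hz X.1 1), mul_self_nonneg (lorentz z hz X.1 0)]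

lemma continuous_form_left (U : V4) : Continuous fun X : H3 z => form z X.1 U :=
  (continuous_form z).comp (continuous_subtype_val.prodMk continuous_const)

/-- The geodesic through a point of the plane with the unit pole `U`, perpendicular to the plane. -/
lemma perpendicular_mem (hz : 7 ≤ z) (X : H3 z) {U : V4} (hU : form z U U = 1)
    (hX : form z X.1 U = 0) (t : ℝ) :
    form z (Real.cosh t • X.1 + Real.sinh t • U) (Real.cosh t • X.1 + Real.sinh t • U) = -1 ∧
      form z (Real.cosh t • X.1 + Real.sinh t • U) (vertexA 2) < 0 := by
  have h1 : form z (Real.cosh t • X.1 + Real.sinh t • U) (Real.cosh t • X.1 + Real.sinh t • U)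
      = -1 := by
    simp only [form_add_left, form_add_right, form_smul_left, form_smul_right, hU, hX, X.2.1,
      form_comm hz U]
    linear_combination - Real.cosh_sq_sub_sinh_sq t
  refine ⟨h1, (sheet_iff_form hz h1 X).2 ?_⟩
  rw [form_add_left, form_smul_left, form_smul_left, X.2.1, form_comm hz U, hX]
  linarith [Real.cosh_pos t]

/-- Every neighbourhood of a point of a plane contains points on the negative side. -/
lemma exists_neg_of_nhds (hz : 7 ≤ z) (X : H3 z) {U : V4} (hU : 0 < form z U U)
    (hX : form z X.1 U = 0) {N : Set (H3 z)} (hN : N ∈ 𝓝 X) : ∃ Y ∈ N, form z Y.1 U < 0 := by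
  have hs : 0 < Real.sqrt (form z U U) := Real.sqrt_pos.2 hU
  have hq := Real.mul_self_sqrt hU.le
  set a := (Real.sqrt (form z U U))⁻¹ with ha
  have ha0 : 0 < a := inv_pos.2 hs
  have hU1 : form z (a • U) (a • U) = 1 := by
    rw [form_smul_left, form_smul_right, ha]
    field_simp
    linarith
  have hX1 : form z X.1 (a • U) = 0 := by rw [form_smul_right, hX, mul_zero]
  let γ : ℝ → H3 z := fun t => ⟨_, perpendicular_mem hz X hU1 hX1 t⟩
  have hγ : Continuous γ := by
    refine Continuous.subtype_mk ?_ _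
    exact (Real.continuous_cosh.smul continuous_const).add
      (Real.continuous_sinh.smul continuous_const)
  have hγ0 : γ 0 = X := Subtype.ext (by simp [γ])
  have h1 : γ ⁻¹' N ∈ 𝓝 (0 : ℝ) := hγ.continuousAt (by rwa [hγ0])
  have h2 : γ ⁻¹' N ∈ 𝓝[<] (0 : ℝ) := nhdsWithin_le_nhds h1
  obtain ⟨t, ht, ht0⟩ := ((Filter.eventually_mem_set.2 h2).and self_mem_nhdsWithin).exists
  refine ⟨γ t, ht, ?_⟩
  change form z (Real.cosh t • X.1 + Real.sinh t • a • U) U < 0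
  rw [form_add_left, form_smul_left, hX, form_smul_left, form_smul_left]
  have : Real.sinh t < 0 := Real.sinh_neg_iff.2 ht0
  nlinarith [mul_pos ha0 hU]

lemma form_pos_of_mem_interior (hz : 7 ≤ z) {F : Set (H3 z)} {U : V4} (hU : 0 < form z U U)
    (hF : ∀ X ∈ F, 0 ≤ form z X.1 U) {X : H3 z} (hX : X ∈ interior F) : 0 < form z X.1 U := by
  refine lt_of_le_of_ne (hF X (interior_subset hX)) fun h => ?_
  obtain ⟨Y, hY, hn⟩ := exists_neg_of_nhds hz X hU h.symm (mem_interior_iff_mem_nhds.1 hX)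
  exact absurd (hF Y hY) (not_le.2 hn)

/-- The difference of two distinct points of the hyperboloid is spacelike. -/
lemma form_sub_pos (hz : 7 ≤ z) {X Y : H3 z} (h : X ≠ Y) : 0 < form z (X.1 - Y.1) (X.1 - Y.1) := by
  rw [form_sub_left, form_sub_right, form_sub_right, X.2.1, Y.2.1, form_comm hz Y.1]
  have h1 := one_le_neg_form hz X Y
  have h2 : form z X.1 Y.1 ≠ -1 := fun e => h (eq_of_form_eq hz e)
  rcases lt_or_eq_of_le h1 with h3 | h3
  · linarith
  · exact absurd (by linarith) h2

end

section

/-! ### Relations of the extended reflection group -/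

/-- The defining relations, up to conjugation by the half-turn, of the group generated by the
reflections `r₀`, `r₁`, `r_a` and the half-turn `h`; the other reflections are
`r₂ = h r₁ h`, `r₃ = h r₀ h`. -/
structure OrthoschemeRelations {H : Type*} [Group H] (z : ℕ) (r0 r1 ra h : H) : Prop where
  r0_sq : r0 * r0 = 1
  r1_sq : r1 * r1 = 1
  ra_sq : ra * ra = 1
  h_sq : h * h = 1
  rot : (r0 * r1) ^ (2 * z) = 1
  ra_r0 : ra * r0 = r0 * ra
  ra_r1 : ra * r1 = r1 * ra
  ra_r2 : ra * (h * r1 * h) = h * r1 * h * ra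
  r3_r0 : h * r0 * h * r0 = r0 * (h * r0 * h)
  r3_r1 : h * r0 * h * r1 = r1 * (h * r0 * h)
  r1_r2 : (r1 * (h * r1 * h)) ^ (2 * z) = 1

/-- The Coxeter matrix of the complete orthoscheme; the mirrors are numbered in the order
`a₃, b⁰, b¹, b², b³, a₀`, so that the half-turn reverses the numbering. -/
def orthoMatrix (z : ℕ) : CoxeterMatrix (Fin 6) where
  M := if z = 0 then Matrix.of fun i j => if i = j then 1 else 0 else
    !![1, 2, 2, 2, 0, 0;
     2, 1, 2 * z, 2, 2, 0;
     2, 2 * z, 1, 2 * z, 2, 2;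
     2, 2, 2 * z, 1, 2 * z, 2;
     0, 2, 2, 2 * z, 1, 2;
     0, 0, 2, 2, 2, 1]
  isSymm := by
    split_ifs
    · ext i j; simp [eq_comm]
    · ext i j; fin_cases i <;> fin_cases j <;> rfl
  diagonal := by
    intro i
    split_ifs
    · simp
    · fin_cases i <;> rfl
  off_diagonal := by
    intro i i' h
    split_ifs with hz
    · simp [h]
    · fin_cases i <;> fin_cases i' <;> first | exact absurd rfl h | (simp; try omega)

lemma orthoMatrix_apply {z : ℕ} (hz : z ≠ 0) (i j : Fin 6) : orthoMatrix z i j =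
    (!![1, 2, 2, 2, 0, 0;
     2, 1, 2 * z, 2, 2, 0;
     2, 2 * z, 1, 2 * z, 2, 2;
     2, 2, 2 * z, 1, 2 * z, 2;
     0, 2, 2, 2 * z, 1, 2;
     0, 0, 2, 2, 2, 1] : Matrix (Fin 6) (Fin 6) ℕ) i j := by
  change (if z = 0 then _ else _ : Matrix (Fin 6) (Fin 6) ℕ) i j = _
  rw [if_neg hz]

/-- The Coxeter group of the complete orthoscheme. -/
abbrev orthoSystem (z : ℕ) : CoxeterSystem (orthoMatrix z) (orthoMatrix z).Group :=
  (orthoMatrix z).toCoxeterSystem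

namespace OrthoschemeRelations

variable {H : Type*} [Group H] {z : ℕ} {r0 r1 ra h : H}

/-- The six reflections, in the order of `orthoMatrix`. -/
def mirrors (r0 r1 ra h : H) : Fin 6 → H :=
  ![ra, r0, r1, h * r1 * h, h * r0 * h, h * ra * h]

lemma conj_mul (hr : OrthoschemeRelations z r0 r1 ra h) (x y : H) :
    h * x * h * (h * y * h) = h * (x * y) * h := by
  have : h * x * h * (h * y * h) = h * x * (h * h) * y * h := by group
  rw [this, hr.h_sq]; group

lemma conj_conj (hr : OrthoschemeRelations z r0 r1 ra h) (x : H) : h * (h * x * h) * h = x := by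
  have : h * (h * x * h) * h = (h * h) * x * (h * h) := by group
  rw [this, hr.h_sq]; group

lemma h_inv (hr : OrthoschemeRelations z r0 r1 ra h) : h⁻¹ = h := inv_eq_of_mul_eq_one_left hr.h_sq

lemma conj_pow (hr : OrthoschemeRelations z r0 r1 ra h) (x : H) (n : ℕ) :
    (h * x * h) ^ n = h * x ^ n * h := by
  have : h * x * h = h * x * h⁻¹ := by rw [hr.h_inv]
  rw [this, _root_.conj_pow, hr.h_inv]

lemma pow_two_of_comm {x y : H} (hx : x * x = 1) (hy : y * y = 1) (hxy : x * y = y * x) :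
    (x * y) ^ 2 = 1 := by
  rw [pow_two, mul_assoc, ← mul_assoc y x y, ← hxy, mul_assoc x y y, hy, mul_one, hx]

lemma pow_swap {x y : H} {n : ℕ} (hx : x * x = 1) (hy : y * y = 1) (hxy : (x * y) ^ n = 1) :
    (y * x) ^ n = 1 := by
  have : y * x = (x * y)⁻¹ := by
    rw [mul_inv_rev, inv_eq_of_mul_eq_one_left hx, inv_eq_of_mul_eq_one_left hy]
  rw [this, inv_pow, hxy, inv_one]

lemma isLiftable (hr : OrthoschemeRelations z r0 r1 ra h) (hz : z ≠ 0) :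
    (orthoMatrix z).IsLiftable (mirrors r0 r1 ra h) := by
  have s2 : h * r1 * h * (h * r1 * h) = 1 := by
    rw [hr.conj_mul, hr.r1_sq, mul_one, hr.h_sq]
  have s3 : h * r0 * h * (h * r0 * h) = 1 := by
    rw [hr.conj_mul, hr.r0_sq, mul_one, hr.h_sq]
  have s5 : h * ra * h * (h * ra * h) = 1 := by
    rw [hr.conj_mul, hr.ra_sq, mul_one, hr.h_sq]
  have c20 : h * r1 * h * r0 = r0 * (h * r1 * h) := by
    have e := congrArg (fun x => h * x * h) hr.r3_r1
    rw [← hr.conj_mul (h * r0 * h) r1, ← hr.conj_mul r1 (h * r0 * h), hr.conj_conj] at e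
    exact e.symm
  have c5a : h * ra * h * (h * r0 * h) = h * r0 * h * (h * ra * h) := by
    rw [hr.conj_mul, hr.conj_mul, hr.ra_r0]
  have c5b : h * ra * h * (h * r1 * h) = h * r1 * h * (h * ra * h) := by
    rw [hr.conj_mul, hr.conj_mul, hr.ra_r1]
  have c5c : h * ra * h * r1 = r1 * (h * ra * h) := by
    have e := congrArg (fun x => h * x * h) hr.ra_r2
    rw [← hr.conj_mul ra (h * r1 * h), ← hr.conj_mul (h * r1 * h) ra, hr.conj_conj] at e
    exact e
  have m23 : (h * r1 * h * (h * r0 * h)) ^ (2 * z) = 1 := by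
    rw [hr.conj_mul, hr.conj_pow, pow_swap hr.r0_sq hr.r1_sq hr.rot, mul_one, hr.h_sq]
  intro i j
  rw [orthoMatrix_apply hz]
  fin_cases i <;> fin_cases j <;> simp only [mirrors] <;>
    simp only [Fin.zero_eta, Fin.mk_one, Fin.reduceFinMk, Matrix.cons_val, Matrix.of_apply,
      pow_one, pow_zero, Fin.isValue]
  all_goals first
    | exact hr.ra_sq
    | exact hr.r0_sq
    | exact hr.r1_sq
    | exact s2
    | exact s3
    | exact s5
    | exact hr.rot
    | exact pow_swap hr.r0_sq hr.r1_sq hr.rot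
    | exact hr.r1_r2
    | exact pow_swap hr.r1_sq s2 hr.r1_r2
    | exact m23
    | exact pow_swap s2 s3 m23
    | exact pow_two_of_comm hr.ra_sq hr.r0_sq hr.ra_r0
    | exact pow_two_of_comm hr.r0_sq hr.ra_sq hr.ra_r0.symm
    | exact pow_two_of_comm hr.ra_sq hr.r1_sq hr.ra_r1
    | exact pow_two_of_comm hr.r1_sq hr.ra_sq hr.ra_r1.symm
    | exact pow_two_of_comm hr.ra_sq s2 hr.ra_r2
    | exact pow_two_of_comm s2 hr.ra_sq hr.ra_r2.symm
    | exact pow_two_of_comm s2 hr.r0_sq c20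
    | exact pow_two_of_comm hr.r0_sq s2 c20.symm
    | exact pow_two_of_comm s3 hr.r0_sq hr.r3_r0
    | exact pow_two_of_comm hr.r0_sq s3 hr.r3_r0.symm
    | exact pow_two_of_comm s3 hr.r1_sq hr.r3_r1
    | exact pow_two_of_comm hr.r1_sq s3 hr.r3_r1.symm
    | exact pow_two_of_comm s5 s3 c5a
    | exact pow_two_of_comm s3 s5 c5a.symm
    | exact pow_two_of_comm s5 s2 c5b
    | exact pow_two_of_comm s2 s5 c5b.symm
    | exact pow_two_of_comm s5 hr.r1_sq c5c
    | exact pow_two_of_comm hr.r1_sq s5 c5c.symm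

/-- The homomorphism from the Coxeter group of the orthoscheme. -/
def hom (hr : OrthoschemeRelations z r0 r1 ra h) (hz : z ≠ 0) : (orthoMatrix z).Group →* H :=
  (orthoSystem z).lift ⟨mirrors r0 r1 ra h, hr.isLiftable hz⟩

lemma hom_simple (hr : OrthoschemeRelations z r0 r1 ra h) (hz : z ≠ 0) (i : Fin 6) :
    hr.hom hz ((orthoSystem z).simple i) = mirrors r0 r1 ra h i :=
  (orthoSystem z).lift_apply_simple _ i

lemma mirrors_rev (hr : OrthoschemeRelations z r0 r1 ra h) (i : Fin 6) :
    h * mirrors r0 r1 ra h i * h = mirrors r0 r1 ra h (Fin.rev i) := by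
  fin_cases i
  · rfl
  · rfl
  · rfl
  · exact hr.conj_conj r1
  · exact hr.conj_conj r0
  · exact hr.conj_conj ra

/-- Conjugation by the half-turn permutes the images of the Coxeter group, simultaneously for two
groups that satisfy the relations. -/
lemma exists_conj {K : Type*} [Group K] {k0 k1 ka kh : K} (hr : OrthoschemeRelations z r0 r1 ra h)
    (hk : OrthoschemeRelations z k0 k1 ka kh) (hz : z ≠ 0) (w : (orthoMatrix z).Group) :
    ∃ w', hr.hom hz w' = h * hr.hom hz w * h ∧ hk.hom hz w' = kh * hk.hom hz w * kh := by
  induction w using (orthoSystem z).simple_induction_left with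
  | one => exact ⟨1, by simp [hr.h_sq], by simp [hk.h_sq]⟩
  | mul_simple_left w i ih =>
    obtain ⟨w', h1, h2⟩ := ih
    refine ⟨(orthoSystem z).simple (Fin.rev i) * w', ?_, ?_⟩
    · rw [map_mul, map_mul, h1, hom_simple, hom_simple, ← hr.mirrors_rev, hr.conj_mul]
    · rw [map_mul, map_mul, h2, hom_simple, hom_simple, ← hk.mirrors_rev, hk.conj_mul]

/-- The elements of the subgroup generated by the pairs of corresponding generators come from the
Coxeter group, up to the half-turn. -/
lemma mem_closure_pairs {K : Type*} [Group K] {k0 k1 ka kh : K}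
    (hr : OrthoschemeRelations z r0 r1 ra h)
    (hk : OrthoschemeRelations z k0 k1 ka kh) (hz : z ≠ 0) {x : H × K}
    (hx : x ∈ Subgroup.closure {(r0, k0), (r1, k1), (ra, ka), (h, kh)}) :
    ∃ w, x = (hr.hom hz w, hk.hom hz w) ∨ x = (hr.hom hz w * h, hk.hom hz w * kh) := by
  have inv : ∀ y : H × K, y ∈ ({(r0, k0), (r1, k1), (ra, ka), (h, kh)} : Set (H × K)) →
      y⁻¹ = y := by
    rintro y (rfl | rfl | rfl | rfl)
    · exact Prod.ext (inv_eq_of_mul_eq_one_left hr.r0_sq) (inv_eq_of_mul_eq_one_left hk.r0_sq)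
    · exact Prod.ext (inv_eq_of_mul_eq_one_left hr.r1_sq) (inv_eq_of_mul_eq_one_left hk.r1_sq)
    · exact Prod.ext (inv_eq_of_mul_eq_one_left hr.ra_sq) (inv_eq_of_mul_eq_one_left hk.ra_sq)
    · exact Prod.ext (inv_eq_of_mul_eq_one_left hr.h_sq) (inv_eq_of_mul_eq_one_left hk.h_sq)
  have step : ∀ y : H × K, y ∈ ({(r0, k0), (r1, k1), (ra, ka), (h, kh)} : Set (H × K)) →
      ∀ x : H × K,
      (∃ w, x = (hr.hom hz w, hk.hom hz w) ∨ x = (hr.hom hz w * h, hk.hom hz w * kh)) →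
      ∃ w, y * x = (hr.hom hz w, hk.hom hz w) ∨ y * x = (hr.hom hz w * h, hk.hom hz w * kh) := by
    have simple : ∀ (i : Fin 6) (x : H × K),
        (∃ w, x = (hr.hom hz w, hk.hom hz w) ∨ x = (hr.hom hz w * h, hk.hom hz w * kh)) →
        ∃ w, (mirrors r0 r1 ra h i, mirrors k0 k1 ka kh i) * x = (hr.hom hz w, hk.hom hz w) ∨
        (mirrors r0 r1 ra h i, mirrors k0 k1 ka kh i) * x = (hr.hom hz w * h, hk.hom hz w * kh) := by
      rintro i x ⟨w, hw⟩
      refine ⟨(orthoSystem z).simple i * w, ?_⟩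
      rw [map_mul, map_mul, hom_simple, hom_simple]
      rcases hw with rfl | rfl
      · exact Or.inl rfl
      · right; simp [mul_assoc]
    rintro y (rfl | rfl | rfl | rfl) x hx
    · exact simple 1 x hx
    · exact simple 2 x hx
    · exact simple 0 x hx
    · obtain ⟨w, hw⟩ := hx
      obtain ⟨w', h1, h2⟩ := exists_conj hr hk hz w
      refine ⟨w', ?_⟩
      rw [h1, h2]
      rcases hw with rfl | rfl
      · right
        simp [mul_assoc, hr.h_sq, hk.h_sq]
      · left; simp [mul_assoc]
  induction hx using Subgroup.closure_induction_left with
  | one => exact ⟨1, Or.inl (by rw [map_one, map_one]; rfl)⟩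
  | mul_left y hy x _ ih => exact step y hy x ih
  | inv_mul_cancel y hy x _ ih => rw [inv y hy]; exact step y hy x ih

end OrthoschemeRelations

end

section

/-! ### The side pairings in the extended reflection group -/

namespace OrthoschemeRelations

variable {H : Type*} [Group H] {z : ℕ} {r0 r1 ra h : H}

lemma inv_r0 (hr : OrthoschemeRelations z r0 r1 ra h) : r0⁻¹ = r0 :=
  inv_eq_of_mul_eq_one_left hr.r0_sq
lemma inv_r1 (hr : OrthoschemeRelations z r0 r1 ra h) : r1⁻¹ = r1 :=
  inv_eq_of_mul_eq_one_left hr.r1_sq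
lemma inv_ra (hr : OrthoschemeRelations z r0 r1 ra h) : ra⁻¹ = ra :=
  inv_eq_of_mul_eq_one_left hr.ra_sq
lemma inv_r3 (hr : OrthoschemeRelations z r0 r1 ra h) : (h * r0 * h)⁻¹ = h * r0 * h := by
  rw [mul_inv_rev, mul_inv_rev, hr.h_inv, hr.inv_r0, mul_assoc]

lemma r0_mul_zpow (hr : OrthoschemeRelations z r0 r1 ra h) (n : ℤ) :
    r0 * (r0 * r1) ^ n = (r0 * r1) ^ (-n) * r0 := by
  have e : (r0 * r1)⁻¹ = r0 * (r0 * r1) * r0⁻¹ := by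
    rw [mul_inv_rev, hr.inv_r0, hr.inv_r1, ← mul_assoc, hr.r0_sq, one_mul]
  rw [zpow_neg, ← inv_zpow, e, conj_zpow]
  group

lemma commute_ra (hr : OrthoschemeRelations z r0 r1 ra h) : Commute ra (r0 * r1) :=
  Commute.mul_right hr.ra_r0 hr.ra_r1
lemma commute_r3 (hr : OrthoschemeRelations z r0 r1 ra h) : Commute (h * r0 * h) (r0 * r1) :=
  Commute.mul_right hr.r3_r0 hr.r3_r1

lemma zpow_two_mul (hr : OrthoschemeRelations z r0 r1 ra h) (n : ℤ) :
    (r0 * r1) ^ (2 * (z : ℤ) + n) = (r0 * r1) ^ n := by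
  rw [zpow_add, show (2 * (z : ℤ)) = ((2 * z : ℕ) : ℤ) by push_cast; rfl, zpow_natCast, hr.rot,
    one_mul]

/-- The base pairing, in an arbitrary group with the relations of the orthoscheme. -/
def base (r0 r1 ra h : H) (p : ℕ) : H := h * r0 * h * ra * (r0 * r1) ^ (4 * (p : ℤ) - 2)

/-- The first side pairing `a₀`, in an arbitrary group with the relations of the orthoscheme. -/
def side (r0 r1 ra h : H) (p : ℕ) : H := r0 * h * (ra * (r0 * r1) ^ (2 * (p : ℤ) - 1))

lemma commute_base (hr : OrthoschemeRelations z r0 r1 ra h) (p : ℕ) :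
    Commute (base r0 r1 ra h p) (r0 * r1) :=
  (hr.commute_r3.mul_left hr.commute_ra).mul_left ((Commute.refl _).zpow_left _)

variable {p : ℕ}

lemma cancel_left {a : H} (ha : a * a = 1) (x : H) : a * (a * x) = x := by
  rw [← mul_assoc, ha, one_mul]

lemma ra_mul_zpow (hr : OrthoschemeRelations z r0 r1 ra h) (n : ℤ) (x : H) :
    ra * ((r0 * r1) ^ n * x) = (r0 * r1) ^ n * (ra * x) := by
  rw [← mul_assoc, (hr.commute_ra.zpow_right n).eq, mul_assoc]

lemma r3_mul_zpow (hr : OrthoschemeRelations z r0 r1 ra h) (n : ℤ) (x : H) :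
    h * r0 * h * ((r0 * r1) ^ n * x) = (r0 * r1) ^ n * (h * r0 * h * x) := by
  rw [← mul_assoc, (hr.commute_r3.zpow_right n).eq, mul_assoc]

lemma base_mul_zpow (hr : OrthoschemeRelations z r0 r1 ra h) (n : ℤ) (x : H) :
    base r0 r1 ra h p * ((r0 * r1) ^ n * x) = (r0 * r1) ^ n * (base r0 r1 ra h p * x) := by
  rw [← mul_assoc, ((hr.commute_base p).zpow_right n).eq, mul_assoc]

lemma base_inv_mul_zpow (hr : OrthoschemeRelations z r0 r1 ra h) (n : ℤ) (x : H) :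
    (base r0 r1 ra h p)⁻¹ * ((r0 * r1) ^ n * x) = (r0 * r1) ^ n * ((base r0 r1 ra h p)⁻¹ * x) := by
  rw [← mul_assoc, ((hr.commute_base p).inv_left.zpow_right n).eq, mul_assoc]

lemma zpow_mul_zpow (m n : ℤ) (x : H) :
    (r0 * r1) ^ m * ((r0 * r1) ^ n * x) = (r0 * r1) ^ (m + n) * x := by
  rw [← mul_assoc, ← zpow_add]

lemma base_mul (hr : OrthoschemeRelations z r0 r1 ra h) (x : H) : base r0 r1 ra h p * x =
    (r0 * r1) ^ (4 * (p : ℤ) - 2) * (h * r0 * h * (ra * x)) := by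
  rw [base, mul_assoc, mul_assoc, hr.ra_mul_zpow, hr.r3_mul_zpow]

lemma base_inv_mul (hr : OrthoschemeRelations z r0 r1 ra h) (x : H) :
    (base r0 r1 ra h p)⁻¹ * x = (r0 * r1) ^ (2 - 4 * (p : ℤ)) * (ra * (h * r0 * h * x)) := by
  rw [base, mul_inv_rev, mul_inv_rev, hr.inv_ra, ← zpow_neg, neg_sub, hr.inv_r3, mul_assoc,
    mul_assoc]

lemma side_mul (x : H) : side r0 r1 ra h p * x =
    r0 * (h * (ra * ((r0 * r1) ^ (2 * (p : ℤ) - 1) * x))) := by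
  simp only [side, mul_assoc]

lemma side_inv_mul (hr : OrthoschemeRelations z r0 r1 ra h) (x : H) :
    (side r0 r1 ra h p)⁻¹ * x = (r0 * r1) ^ (1 - 2 * (p : ℤ)) * (ra * (h * (r0 * x))) := by
  rw [side, mul_inv_rev, mul_inv_rev, mul_inv_rev, hr.inv_r0, hr.h_inv, hr.inv_ra, ← zpow_neg,
    neg_sub]
  simp only [mul_assoc]

lemma zpow_mul_of_eq_zero {n : ℤ} (hn : n = 0) (x : H) : (r0 * r1) ^ n * x = x := by
  rw [hn, zpow_zero, one_mul]

lemma zpow_mul_congr {m n : ℤ} (hn : m = n) (x : H) : (r0 * r1) ^ m * x = (r0 * r1) ^ n * x := by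
  rw [hn]

lemma h_mul_r3 (hr : OrthoschemeRelations z r0 r1 ra h) (x : H) :
    h * (h * r0 * h * x) = r0 * (h * x) := by
  rw [mul_assoc, mul_assoc, cancel_left hr.h_sq]

lemma r3_mul_h (hr : OrthoschemeRelations z r0 r1 ra h) (x : H) :
    h * r0 * h * (h * x) = h * (r0 * x) := by
  simp only [mul_assoc]
  rw [cancel_left hr.h_sq]

lemma r3_mul_r0 (hr : OrthoschemeRelations z r0 r1 ra h) (x : H) :
    h * r0 * h * (r0 * x) = r0 * (h * r0 * h * x) := by
  rw [← mul_assoc, hr.r3_r0, mul_assoc]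

lemma zpow_neg_one_mul_r0 (hr : OrthoschemeRelations z r0 r1 ra h) (x : H) :
    (r0 * r1) ^ (-1 : ℤ) * (r0 * x) = r1 * x := by
  rw [zpow_neg_one, mul_inv_rev, hr.inv_r0, hr.inv_r1, mul_assoc, cancel_left hr.r0_sq]

lemma r0_r2 (hr : OrthoschemeRelations z r0 r1 ra h) :
    h * r1 * h * r0 = r0 * (h * r1 * h) := by
  have e := congrArg (fun x => h * x * h) hr.r3_r1
  rw [← hr.conj_mul (h * r0 * h) r1, ← hr.conj_mul r1 (h * r0 * h), hr.conj_conj] at e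
  exact e.symm

lemma side_base_side_inv (hr : OrthoschemeRelations z r0 r1 ra h) (x : H) :
    side r0 r1 ra h p * ((r0 * r1) ^ (2 : ℤ) * (base r0 r1 ra h p *
      ((r0 * r1) ^ (-4 * (p : ℤ)) * ((side r0 r1 ra h p)⁻¹ * x)))) = r0 * (h * (ra * (h * x))) := by
  simp only [hr.side_inv_mul, hr.base_mul_zpow, zpow_mul_zpow]
  rw [side_mul, hr.base_mul, cancel_left hr.ra_sq]
  simp only [zpow_mul_zpow]
  rw [zpow_mul_of_eq_zero (by ring), hr.r3_mul_h, cancel_left hr.r0_sq]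

lemma side_base_inv (hr : OrthoschemeRelations z r0 r1 ra h) (x : H) :
    side r0 r1 ra h p * ((r0 * r1) ^ (2 * (p : ℤ) - 2) * ((base r0 r1 ra h p)⁻¹ * x)) =
      r0 * (h * ((r0 * r1) ^ (-1 : ℤ) * (h * r0 * h * x))) := by
  rw [side_mul, hr.base_inv_mul]
  simp only [zpow_mul_zpow]
  rw [hr.ra_mul_zpow, cancel_left hr.ra_sq, zpow_mul_congr (n := -1) (by ring)]

/-- The short relation between the pairings, for the index `0`. -/
lemma short_relation (hr : OrthoschemeRelations z r0 r1 ra h) (hz : (z : ℤ) = 4 * p - 1) :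
    (r0 * r1) ^ (2 * (p : ℤ) - 2) * side r0 r1 ra h p * (r0 * r1) ^ (2 - 2 * (p : ℤ)) =
    base r0 r1 ra h p * ((r0 * r1) ^ (-2 * (p : ℤ)) * side r0 r1 ra h p * (r0 * r1) ^ (2 * (p : ℤ)))
      * (base r0 r1 ra h p)⁻¹ * ((r0 * r1) ^ (-2 : ℤ) * side r0 r1 ra h p * (r0 * r1) ^ (2 : ℤ)) *
      base r0 r1 ra h p *
      ((r0 * r1) ^ (-4 * (p : ℤ)) * (side r0 r1 ra h p)⁻¹ * (r0 * r1) ^ (4 * (p : ℤ))) *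
      base r0 r1 ra h p := by
  simp only [mul_assoc]
  have e := fun x => hr.base_inv_mul_zpow (p := p) (-2) x
  rw [e, hr.side_base_side_inv, zpow_mul_zpow,
    zpow_mul_congr (show 2 * (p : ℤ) + -2 = 2 * p - 2 by ring), hr.side_base_inv, hr.r3_mul_r0,
    hr.zpow_neg_one_mul_r0, hr.base_mul_zpow, hr.base_mul, zpow_mul_zpow]
  have e2 : (r0 * r1) ^ (4 * (p : ℤ)) * base r0 r1 ra h p = h * r0 * h * ra := by
    rw [base, ← mul_assoc, ← ((hr.commute_r3.mul_left hr.commute_ra).zpow_right _).eq, mul_assoc,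
      ← zpow_add, show 4 * (p : ℤ) + (4 * p - 2) = 2 * z + 0 by rw [hz]; ring, hr.zpow_two_mul,
      zpow_zero, mul_one]
  have e3 : side r0 r1 ra h p * (r0 * r1) ^ (2 - 2 * (p : ℤ)) = r0 * (h * (ra * (r0 * r1))) := by
    rw [side, mul_assoc, mul_assoc, mul_assoc, ← zpow_add,
      show 2 * (p : ℤ) - 1 + (2 - 2 * p) = 1 by ring, zpow_one]
  have c02 : ∀ x, r0 * (h * r1 * h * (r0 * x)) = h * r1 * h * x := fun x => by
    rw [← mul_assoc r0, ← hr.r0_r2, mul_assoc _ r0, cancel_left hr.r0_sq]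
  have ca2 : ∀ x, ra * (h * r1 * h * (ra * x)) = h * r1 * h * x := fun x => by
    rw [← mul_assoc ra, hr.ra_r2, mul_assoc _ ra, cancel_left hr.ra_sq]
  have k1 : ∀ x, h * (r1 * (h * r0 * h * (h * x))) = h * r1 * h * (r0 * x) := fun x => by
    rw [hr.r3_mul_h]
    simp only [mul_assoc]
  have k2 : ∀ x, h * r1 * h * (h * x) = h * (r1 * x) := fun x => by
    rw [mul_assoc, cancel_left hr.h_sq, mul_assoc]
  have k3 : r1 * (h * r0 * h * ra) = h * r0 * h * (r1 * ra) := by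
    rw [← mul_assoc, ← hr.r3_r1, mul_assoc]
  rw [e2, e3, zpow_mul_congr (show -2 * (p : ℤ) + (4 * p - 2) = 2 * p - 2 by ring)]
  congr 1
  rw [k1, c02, ca2, k2, hr.r3_mul_h, k3, ← hr.r3_mul_r0, hr.h_mul_r3, hr.commute_ra.eq, mul_assoc]

end OrthoschemeRelations

end

section

/-! ### The relations between the pairings -/

namespace OrthoschemeRelations

variable {H : Type*} [Group H] {z p : ℕ} {r0 r1 ra h : H}

/-- The side pairing `a_j`, for an integer `j`. -/
def sideAt (r0 r1 ra h : H) (p : ℕ) (j : ℤ) : H :=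
  (r0 * r1) ^ (-(2 * j)) * side r0 r1 ra h p * (r0 * r1) ^ (2 * j)

lemma sideAt_add (j k : ℤ) : sideAt r0 r1 ra h p (j + k) =
    MulAut.conj ((r0 * r1) ^ (-(2 * k))) (sideAt r0 r1 ra h p j) := by
  rw [MulAut.conj_apply, sideAt, sideAt, ← zpow_neg, neg_neg]
  simp only [mul_assoc, ← zpow_add]
  rw [zpow_mul_zpow]
  ring_nf

lemma sideAt_zero : sideAt r0 r1 ra h p 0 = side r0 r1 ra h p := by
  simp [sideAt]

lemma conj_base (hr : OrthoschemeRelations z r0 r1 ra h) (n : ℤ) :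
    MulAut.conj ((r0 * r1) ^ n) (base r0 r1 ra h p) = base r0 r1 ra h p := by
  rw [MulAut.conj_apply, mul_inv_eq_iff_eq_mul, ((hr.commute_base p).zpow_right n).eq]

lemma sideAt_congr (hr : OrthoschemeRelations z r0 r1 ra h) {j k : ℤ}
    (hjk : (j : ZMod z) = k) : sideAt r0 r1 ra h p j = sideAt r0 r1 ra h p k := by
  obtain ⟨n, hn⟩ := (ZMod.intCast_eq_intCast_iff_dvd_sub j k z).1 hjk
  have e : ∀ n : ℤ, (r0 * r1) ^ (2 * ((z : ℤ) * n)) = 1 := fun n => by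
    rw [← mul_assoc, zpow_mul, show (2 * (z : ℤ)) = ((2 * z : ℕ) : ℤ) by push_cast; rfl,
      zpow_natCast, hr.rot, one_zpow]
  have hk : k = j + z * n := by linarith
  rw [hk, sideAt, sideAt, mul_add, neg_add, zpow_add, zpow_add, e,
    show -(2 * ((z : ℤ) * n)) = 2 * ((z : ℤ) * (-n)) by ring, e]
  simp

/-- The first family of relations of the presentation, with an arbitrary integer index. -/
lemma short_relation_at (hr : OrthoschemeRelations z r0 r1 ra h) (hz : (z : ℤ) = 4 * p - 1)
    (j : ℤ) : sideAt r0 r1 ra h p (1 - p + j) =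
    base r0 r1 ra h p * sideAt r0 r1 ra h p (p + j) * (base r0 r1 ra h p)⁻¹ *
      sideAt r0 r1 ra h p (1 + j) * base r0 r1 ra h p * (sideAt r0 r1 ra h p (2 * p + j))⁻¹ *
      base r0 r1 ra h p := by
  have e := hr.short_relation hz
  have k1 : sideAt r0 r1 ra h p (1 - p) =
    (r0 * r1) ^ (2 * (p : ℤ) - 2) * side r0 r1 ra h p * (r0 * r1) ^ (2 - 2 * (p : ℤ)) := by
    rw [sideAt]; ring_nf
  have k2 : sideAt r0 r1 ra h p p =
    (r0 * r1) ^ (-2 * (p : ℤ)) * side r0 r1 ra h p * (r0 * r1) ^ (2 * (p : ℤ)) := by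
    rw [sideAt]; ring_nf
  have k3 : sideAt r0 r1 ra h p 1 =
    (r0 * r1) ^ (-2 : ℤ) * side r0 r1 ra h p * (r0 * r1) ^ (2 : ℤ) := by
    rw [sideAt]; rfl
  have k4 : (sideAt r0 r1 ra h p (2 * p))⁻¹ = (r0 * r1) ^ (-4 * (p : ℤ)) *
      (side r0 r1 ra h p)⁻¹ * (r0 * r1) ^ (4 * (p : ℤ)) := by
    rw [sideAt, mul_inv_rev, mul_inv_rev, ← zpow_neg, ← zpow_neg, mul_assoc]; ring_nf
  rw [← k1, ← k2, ← k3, ← k4] at e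
  have e2 := congrArg (MulAut.conj ((r0 * r1) ^ (-(2 * j)))) e
  simp only [map_mul, map_inv, hr.conj_base, ← sideAt_add] at e2
  exact e2

lemma middle_zero (hr : OrthoschemeRelations z r0 r1 ra h) :
    sideAt r0 r1 ra h p 0 * (base r0 r1 ra h p)⁻¹ * sideAt r0 r1 ra h p (1 - p) =
      h * r1 * h * ra * (r0 * r1) := by
  have k1 : sideAt r0 r1 ra h p (1 - p) =
    (r0 * r1) ^ (2 * (p : ℤ) - 2) * (side r0 r1 ra h p * (r0 * r1) ^ (2 - 2 * (p : ℤ))) := by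
    rw [sideAt, mul_assoc]; ring_nf
  have e3 : side r0 r1 ra h p * (r0 * r1) ^ (2 - 2 * (p : ℤ)) = r0 * (h * (ra * (r0 * r1))) := by
    rw [side, mul_assoc, mul_assoc, mul_assoc, ← zpow_add,
      show 2 * (p : ℤ) - 1 + (2 - 2 * p) = 1 by ring, zpow_one]
  rw [sideAt_zero, k1, e3, mul_assoc, hr.base_inv_mul_zpow, hr.side_base_inv, hr.r3_mul_r0,
    hr.zpow_neg_one_mul_r0, hr.r3_mul_h]
  have : r0 * (h * (r1 * (h * (r0 * (ra * (r0 * r1)))))) =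
      r0 * (h * r1 * h) * (r0 * (ra * (r0 * r1))) := by simp only [mul_assoc]
  rw [this, ← hr.r0_r2, mul_assoc _ r0, cancel_left hr.r0_sq, mul_assoc _ ra]

/-- The pairings `a_j s⁻¹ a_{j+1-p}` are conjugate by powers of `R²`. -/
lemma middle_at (hr : OrthoschemeRelations z r0 r1 ra h) (j : ℤ) :
    sideAt r0 r1 ra h p j * (base r0 r1 ra h p)⁻¹ * sideAt r0 r1 ra h p (1 - p + j) =
      MulAut.conj ((r0 * r1) ^ (-(2 * j))) (h * r1 * h * ra * (r0 * r1)) := by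
  rw [← hr.middle_zero (p := p)]
  simp only [map_mul, map_inv, hr.conj_base, ← sideAt_add, zero_add]

/-- The product of the squares `(a_j s⁻¹ a_{j+1-p})²` telescopes, since the factors are conjugates
of one element by successive powers of `R²`. -/
lemma long_relation (hr : OrthoschemeRelations z r0 r1 ra h) :
    ((List.range z).map fun k : ℕ => (sideAt r0 r1 ra h p ((k : ℤ) + 1) * (base r0 r1 ra h p)⁻¹ *
      sideAt r0 r1 ra h p (1 - p + ((k : ℤ) + 1))) ^ 2).prod = 1 := by
  set y := h * r1 * h * ra * (r0 * r1) with hy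
  have key : ∀ n : ℕ, ((List.range n).map fun k : ℕ =>
      (sideAt r0 r1 ra h p ((k : ℤ) + 1) * (base r0 r1 ra h p)⁻¹ *
      sideAt r0 r1 ra h p (1 - p + ((k : ℤ) + 1))) ^ 2).prod =
      (r0 * r1) ^ (-2 : ℤ) * (y ^ 2 * (r0 * r1) ^ (-2 : ℤ)) ^ n *
        (r0 * r1) ^ (2 * (n : ℤ) + 2) := by
    intro n
    induction n with
    | zero => simp
    | succ n ih =>
      rw [List.range_succ, List.map_append, List.prod_append, ih]
      simp only [List.map_cons, List.map_nil, List.prod_cons, List.prod_nil, mul_one]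
      rw [hr.middle_at, ← hy, ← map_pow, MulAut.conj_apply, pow_succ _ n]
      simp only [mul_assoc]
      congr 2
      rw [← mul_assoc ((r0 * r1) ^ (2 * (n : ℤ) + 2)), ← zpow_add, ← zpow_neg, ← zpow_add]
      rw [show 2 * (n : ℤ) + 2 + -(2 * (n + 1)) = 0 by ring, zpow_zero, one_mul]
      congr 2
      push_cast; ring
  rw [key]
  have hsq : y ^ 2 * (r0 * r1) ^ (-2 : ℤ) = r0 * (h * r1 * h * r1) ^ 2 * r0 := by
    have e1 : y ^ 2 = (h * r1 * h) * (r0 * r1) * ((h * r1 * h) * (r0 * r1)) := by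
      rw [pow_two, hy, mul_assoc (h * r1 * h) ra, hr.commute_ra.eq]
      have : h * r1 * h * (r0 * r1 * ra) * (h * r1 * h * (r0 * r1 * ra)) =
        h * r1 * h * (r0 * r1) * (ra * (h * r1 * h) * (r0 * r1 * ra)) := by
          simp only [mul_assoc]
      rw [this, hr.ra_r2, ← hr.commute_ra.eq, mul_assoc _ ra, cancel_left hr.ra_sq]
    have e2 : (r0 * r1) * (r0 * r1) ^ (-2 : ℤ) = r1 * r0 := by
      nth_rewrite 1 [← zpow_one (r0 * r1)]
      rw [← zpow_add, show (1 : ℤ) + -2 = -1 by ring, zpow_neg_one, mul_inv_rev, hr.inv_r0,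
        hr.inv_r1]
    rw [e1]
    rw [mul_assoc (h * r1 * h * (r0 * r1)) (h * r1 * h * (r0 * r1)) _,
      mul_assoc (h * r1 * h) (r0 * r1) ((r0 * r1) ^ (-2 : ℤ)), e2, ← mul_assoc (h * r1 * h) r0 r1,
      hr.r0_r2, pow_two]
    simp only [mul_assoc]
  have hcon : r0 * (h * r1 * h * r1) ^ 2 * r0 = r0 * (h * r1 * h * r1) ^ 2 * r0⁻¹ := by
    rw [hr.inv_r0]
  have s2 : h * r1 * h * (h * r1 * h) = 1 := by
    rw [hr.conj_mul, hr.r1_sq, mul_one, hr.h_sq]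
  rw [hsq, hcon, _root_.conj_pow, ← pow_mul, pow_swap hr.r1_sq s2 hr.r1_r2, mul_one, mul_inv_cancel,
    mul_one, ← zpow_add, show (-2 : ℤ) + (2 * z + 2) = 2 * z + 0 by ring, hr.zpow_two_mul, zpow_zero]

/-- The homomorphism from the abstract group of the pairings. -/
def pairingHom (hr : OrthoschemeRelations z r0 r1 ra h) (hz : (z : ℤ) = 4 * p - 1)
    (hz0 : z ≠ 0) : PresentedCobwebGroup z p →* H :=
  PresentedGroup.toGroup (f := fun g : Gen z => match g with
    | Gen.s => base r0 r1 ra h p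
    | Gen.a i => sideAt r0 r1 ra h p i.val) (by
    have : NeZero z := ⟨hz0⟩
    have cast : ∀ i : ZMod z, ((i.val : ℤ) : ZMod z) = i := fun i => by simp
    rintro _ (⟨i, rfl⟩ | rfl)
    · have e := hr.short_relation_at hz i.val
      simp only [relator, map_mul, map_inv, FreeGroup.lift_apply_of]
      rw [inv_mul_eq_one]
      rw [hr.sideAt_congr (j := (i + 1 - p : ZMod z).val) (k := 1 - p + i.val)
          (by rw [cast]; push_cast; simp; ring), e,
        hr.sideAt_congr (j := (i + p : ZMod z).val) (k := p + i.val)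
          (by rw [cast]; push_cast; simp; ring),
        hr.sideAt_congr (j := (i + 1 : ZMod z).val) (k := 1 + i.val)
          (by rw [cast]; push_cast; simp; ring),
        hr.sideAt_congr (j := (i + 2 * p : ZMod z).val) (k := 2 * p + i.val)
          (by rw [cast]; push_cast; simp; ring)]
    · rw [longRelator, map_list_prod, List.map_map]
      rw [← hr.long_relation (p := p)]
      congr 2
      funext k
      simp only [Function.comp, map_pow, map_mul, map_inv, FreeGroup.lift_apply_of]
      rw [hr.sideAt_congr (j := (((k + 1 : ℕ) : ZMod z)).val) (k := (k : ℤ) + 1)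
          (by rw [cast]; push_cast; rfl),
        hr.sideAt_congr (j := (((k + 1 : ℕ) : ZMod z) + 1 - p).val) (k := 1 - p + ((k : ℤ) + 1))
          (by rw [cast]; push_cast; ring)])

lemma pairingHom_s (hr : OrthoschemeRelations z r0 r1 ra h) (hz : (z : ℤ) = 4 * p - 1)
    (hz0 : z ≠ 0) : hr.pairingHom hz hz0 (PresentedGroup.of Gen.s) = base r0 r1 ra h p :=
  PresentedGroup.toGroup.of _

lemma pairingHom_a (hr : OrthoschemeRelations z r0 r1 ra h) (hz : (z : ℤ) = 4 * p - 1)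
    (hz0 : z ≠ 0) (i : ZMod z) :
    hr.pairingHom hz hz0 (PresentedGroup.of (Gen.a i)) = sideAt r0 r1 ra h p i.val :=
  PresentedGroup.toGroup.of _

end OrthoschemeRelations

end

section

/-! ### The coset action of the extended reflection group -/

section CosetAction

variable (z p : ℕ)

/-- The points `(w, i, e, f, d)` stand for the elements `w R^(2i) r₀^e (R^z)^f r_a^d` of the extended
reflection group: `w` lies in the group of the pairings, the rest in the stabilizer of `Q`. -/
abbrev CosetModel : Type := PresentedCobwebGroup z p × ZMod z × Bool × Bool × Bool

/-- The generator `s` of the presented group. -/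
def genS : PresentedCobwebGroup z p := PresentedGroup.of Gen.s

/-- The generators `a_i` of the presented group. -/
def genA (i : ZMod z) : PresentedCobwebGroup z p := PresentedGroup.of (Gen.a i)

/-- Right multiplication by `r₀`. -/
def mulR0 : CosetModel z p → CosetModel z p := fun (w, i, e, f, d) => (w, i, !e, f, d)

/-- Right multiplication by `r_a`. -/
def mulRa : CosetModel z p → CosetModel z p := fun (w, i, e, f, d) => (w, i, e, f, !d)

/-- Right multiplication by `r₁ = r₀ R`. -/
def mulR1 : CosetModel z p → CosetModel z p :=
  fun (w, i, e, f, d) => (w, bif e then i + 2 * p else i - 2 * p, !e, !f, d)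

/-- Right multiplication by the half-turn `h`. -/
def mulH : CosetModel z p → CosetModel z p
  | (w, i, false, false, false) =>
    (w * genA z p (-i) * (genS z p)⁻¹, i - p, false, true, false)
  | (w, i, false, true, false) =>
    (w * genS z p * (genA z p (-(i + p)))⁻¹, i + p, false, false, false)
  | (w, i, true, false, false) => (w * genA z p (-i), i + p, false, true, true)
  | (w, i, false, true, true) => (w * (genA z p (-(i - p)))⁻¹, i - p, true, false, false)
  | (w, i, true, false, true) =>
    (w * (genS z p)⁻¹ * genA z p (-(i - 2 * p)), i - p, true, true, true)
  | (w, i, true, true, true) =>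
    (w * (genA z p (-(i - p)))⁻¹ * genS z p, i + p, true, false, true)
  | (w, i, false, false, true) =>
    (w * (genS z p)⁻¹ * genA z p (-(i - 2 * p)) * (genS z p)⁻¹, i - 3 * p, true, true, false)
  | (w, i, true, true, false) =>
    (w * genS z p * (genA z p (-(i + p)))⁻¹ * genS z p, i + 3 * p, false, false, true)

variable {z p}

lemma genA_congr {i j : ZMod z} (h : i = j) : genA z p i = genA z p j := by rw [h]

lemma mulR0_invol : Function.Involutive (mulR0 z p) := by
  rintro ⟨w, i, e, f, d⟩; simp [mulR0]

lemma mulRa_invol : Function.Involutive (mulRa z p) := by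
  rintro ⟨w, i, e, f, d⟩; simp [mulRa]

lemma mulR1_invol : Function.Involutive (mulR1 z p) := by
  rintro ⟨w, i, e, f, d⟩; cases e <;> simp [mulR1]

lemma mulH_invol : Function.Involutive (mulH z p) := by
  rintro ⟨w, i, e, f, d⟩
  cases e <;> cases f <;> cases d <;> simp only [mulH, Prod.mk.injEq, and_true]
  all_goals refine ⟨?_, by ring⟩
  · rw [genA_congr (show -(i - p + p) = -i by ring)]; group
  · rw [genA_congr (show -(i - 3 * p + p) = -(i - 2 * p) by ring)]; group
  · group
  · group
  · rw [genA_congr (show -(i + p - p) = -i by ring)]; group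
  · rw [genA_congr (show -(i - p - p) = -(i - 2 * p) by ring)]; group
  · rw [genA_congr (show -(i + 3 * p - 2 * p) = -(i + p) by ring)]; group
  · rw [genA_congr (show -(i + p - 2 * p) = -(i - p) by ring)]; group

/-- The short relations, in terms of `p` alone: `4 p = 1` modulo `z`. -/
lemma genA_relation (h4 : (4 * p : ZMod z) = 1) (i : ZMod z) : genA z p (i + 3 * p) =
    genS z p * genA z p (i + p) * (genS z p)⁻¹ * genA z p (i + 4 * p) * genS z p *
      (genA z p (i + 2 * p))⁻¹ * genS z p := by
  have h : (QuotientGroup.mk (relator z p i) : PresentedCobwebGroup z p) = 1 :=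
    (QuotientGroup.eq_one_iff _).2 (Subgroup.subset_normalClosure (Or.inl ⟨i, rfl⟩))
  have h2 : (genA z p (i + 1 - p))⁻¹ * (genS z p * genA z p (i + p) * (genS z p)⁻¹ *
      genA z p (i + 1) * genS z p * (genA z p (i + 2 * p))⁻¹ * genS z p) = 1 := h
  rw [inv_mul_eq_one] at h2
  rw [h4, ← h2]
  apply genA_congr
  linear_combination h4

/-- The element `s_{-i}` of the presented group. -/
def genM (z p : ℕ) (i : ZMod z) : PresentedCobwebGroup z p :=
  genA z p (-i) * (genS z p)⁻¹ * genA z p (3 * p - i)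

/-- Right multiplication by `r₃ = h r₀ h`. -/
lemma mulR3_apply (w : PresentedCobwebGroup z p) (i : ZMod z) (e f d : Bool) :
    mulH z p (mulR0 z p (mulH z p (w, i, e, f, d))) =
      (w * bif d then (genS z p)⁻¹ else genS z p, bif d then i - 2 * p else i + 2 * p, e, f, !d) := by
  cases e <;> cases f <;> cases d <;>
    simp only [mulH, mulR0, Prod.mk.injEq, and_true, Bool.not_true, Bool.not_false, cond_true,
      cond_false]
  all_goals
    refine ⟨?_, by ring⟩
    ring_nf
    try group

/-- Right multiplication by `r₂ = h r₁ h`. -/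
def mulR2 (z p : ℕ) (x : CosetModel z p) : CosetModel z p := mulH z p (mulR1 z p (mulH z p x))

lemma mulR2_invol : Function.Involutive (mulR2 z p) := by
  intro x
  simp only [mulR2]
  rw [mulH_invol, mulR1_invol, mulH_invol]

lemma genM_eq (h4 : (4 * p : ZMod z) = 1) (i : ZMod z) : genM z p i =
    (genS z p)⁻¹ * genA z p (2 * p - i) * (genS z p)⁻¹ * genA z p (p - i) * (genS z p)⁻¹ := by
  have h := genA_relation h4 (-p - i)
  rw [genA_congr (show -p - i + 3 * p = 2 * p - i by ring),
    genA_congr (show -p - i + p = -i by ring), genA_congr (show -p - i + 4 * p = 3 * p - i by ring),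
    genA_congr (show -p - i + 2 * p = p - i by ring)] at h
  rw [h, genM]
  group

lemma mulR2_false (h4 : (4 * p : ZMod z) = 1) (w : PresentedCobwebGroup z p) (i : ZMod z)
    (e d : Bool) :
    mulR2 z p (w, i, e, false, d) = (w * genM z p i, i - 2 * p, e, true, !d) := by
  have h := genM_eq h4 i
  cases e <;> cases d <;>
    simp only [mulR2, mulH, mulR1, Prod.mk.injEq, and_true, Bool.not_true, Bool.not_false,
      cond_true, cond_false]
  · refine ⟨?_, by ring⟩
    rw [genM, genA_congr (show -(i - p - 2 * p) = 3 * p - i by ring)]; group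
  · refine ⟨?_, by ring⟩
    rw [h, genA_congr (show -(i - 2 * p) = 2 * p - i by ring),
      genA_congr (show -(i - 3 * p + 2 * p) = p - i by ring)]; group
  · refine ⟨?_, by ring⟩
    rw [genM, genA_congr (show -(i + p - 2 * p - 2 * p) = 3 * p - i by ring)]; group
  · refine ⟨?_, by ring⟩
    rw [h, genA_congr (show -(i - 2 * p) = 2 * p - i by ring),
      genA_congr (show -(i - p + 2 * p - 2 * p) = p - i by ring)]; group

lemma mulR2_true (h4 : (4 * p : ZMod z) = 1) (w : PresentedCobwebGroup z p) (i : ZMod z)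
    (e d : Bool) : mulR2 z p (w, i, e, true, d) =
      (w * (genM z p (i + 2 * p))⁻¹, i + 2 * p, e, false, !d) := by
  have h := mulR2_false h4 (w * (genM z p (i + 2 * p))⁻¹) (i + 2 * p) e (!d)
  rw [inv_mul_cancel_right, add_sub_cancel_right, Bool.not_not] at h
  rw [← h, mulR2_invol]

/-- The products of squares in the long relation, starting at any index. -/
lemma prod_genM_sq (h4 : (4 * p : ZMod z) = 1) (hz0 : z ≠ 0) (i : ZMod z) :
    ((List.range z).map fun k : ℕ => genM z p (i - k) ^ 2).prod = 1 := by
  have : NeZero z := ⟨hz0⟩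
  have step : ∀ i : ZMod z, ((List.range z).map fun k : ℕ => genM z p (i - k) ^ 2).prod = 1 →
      ((List.range z).map fun k : ℕ => genM z p (i - 1 - k) ^ 2).prod = 1 := by
    intro i hi
    have h1 := List.prod_range_succ (fun k : ℕ => genM z p (i - k) ^ 2) z
    have h2 := List.prod_range_succ' (fun k : ℕ => genM z p (i - k) ^ 2) z
    rw [hi, one_mul] at h1
    rw [h1] at h2
    simp only [CharP.cast_eq_zero, sub_zero, Nat.cast_zero] at h2
    have h3 := mul_eq_left.1 h2.symm
    rw [← h3]
    congr 2
    funext k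
    push_cast
    rw [sub_sub, add_comm (1 : ZMod z)]
  have base : ((List.range z).map fun k : ℕ => genM z p (-1 - k) ^ 2).prod = 1 := by
    have h : (QuotientGroup.mk (longRelator z p) : PresentedCobwebGroup z p) = 1 :=
      (QuotientGroup.eq_one_iff _).2 (Subgroup.subset_normalClosure (Or.inr rfl))
    obtain ⟨q, hq, hqs, hqa⟩ : ∃ q : FreeGroup (Gen z) →* PresentedCobwebGroup z p,
        q (longRelator z p) = 1 ∧ q (FreeGroup.of Gen.s) = genS z p ∧
        ∀ i, q (FreeGroup.of (Gen.a i)) = genA z p i :=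
      ⟨PresentedGroup.mk _, h, rfl, fun _ => rfl⟩
    have hq2 : q (((List.range z).map fun k : ℕ =>
        (FreeGroup.of (Gen.a ((k + 1 : ℕ) : ZMod z)) * (FreeGroup.of Gen.s)⁻¹ *
          FreeGroup.of (Gen.a (((k + 1 : ℕ) : ZMod z) + 1 - (p : ZMod z)))) ^ 2).prod) = 1 := hq
    rw [map_list_prod, List.map_map] at hq2
    rw [← hq2]
    congr 2
    funext k
    simp only [Function.comp, map_pow, map_mul, map_inv, hqs, hqa]
    rw [genM]
    have e1 : genA z p (-(-1 - (k : ZMod z))) = genA z p ((k + 1 : ℕ) : ZMod z) :=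
      genA_congr (by push_cast; ring)
    have e2 : genA z p (3 * p - (-1 - (k : ZMod z))) = genA z p (((k + 1 : ℕ) : ZMod z) + 1 - p) :=
      genA_congr (by push_cast; linear_combination h4)
    rw [e1, e2]
  have all : ∀ m : ℕ, ((List.range z).map fun k : ℕ => genM z p (-1 - m - k) ^ 2).prod = 1 := by
    intro m
    induction m with
    | zero => simpa using base
    | succ m ih =>
      have := step _ ih
      push_cast
      rwa [sub_sub (-1 : ZMod z) m 1] at this
  have := all (-1 - i).val
  rw [ZMod.natCast_zmod_val, sub_sub_cancel] at this
  exact this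

/-- The rotation `r₁ r₂`, applied twice. -/
lemma mulR1_mulR2_sq (h4 : (4 * p : ZMod z) = 1) (w : PresentedCobwebGroup z p) (i : ZMod z)
    (e d : Bool) :
    mulR1 z p (mulR2 z p (mulR1 z p (mulR2 z p (w, i, e, false, d)))) =
      (w * (genM z p i * genM z p (bif e then i else i - 1)), i - 1, e, false, d) := by
  cases e
  · simp only [mulR2_false h4, mulR1, cond_false, cond_true, Bool.not_true, Bool.not_false,
      Bool.not_not, Prod.mk.injEq, and_true]
    rw [show i - 2 * p - 2 * p = i - 1 by linear_combination -h4, mul_assoc]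
    exact ⟨rfl, by ring⟩
  · simp only [mulR2_false h4, mulR1, cond_false, cond_true, Bool.not_true, Bool.not_false,
      Bool.not_not, Prod.mk.injEq, and_true]
    rw [show i - 2 * p + 2 * p = i by ring, mul_assoc]
    exact ⟨rfl, by linear_combination -h4⟩

/-- Right multiplication by `r₀`, as a permutation. -/
def permR0 (z p : ℕ) : Equiv.Perm (CosetModel z p) := mulR0_invol.toPerm
/-- Right multiplication by `r₁`, as a permutation. -/
def permR1 (z p : ℕ) : Equiv.Perm (CosetModel z p) := mulR1_invol.toPerm
/-- Right multiplication by `r_a`, as a permutation. -/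
def permRa (z p : ℕ) : Equiv.Perm (CosetModel z p) := mulRa_invol.toPerm
/-- Right multiplication by the half-turn, as a permutation. -/
def permH (z p : ℕ) : Equiv.Perm (CosetModel z p) := mulH_invol.toPerm

lemma permR0_apply (x : CosetModel z p) : permR0 z p x = mulR0 z p x := rfl
lemma permR1_apply (x : CosetModel z p) : permR1 z p x = mulR1 z p x := rfl
lemma permRa_apply (x : CosetModel z p) : permRa z p x = mulRa z p x := rfl
lemma permH_apply (x : CosetModel z p) : permH z p x = mulH z p x := rfl

lemma permR2_apply (x : CosetModel z p) :
    (permH z p * permR1 z p * permH z p) x = mulR2 z p x := rfl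

lemma permR3_apply (x : CosetModel z p) :
    (permH z p * permR0 z p * permH z p) x = mulH z p (mulR0 z p (mulH z p x)) := rfl

lemma permR1_permR2_pow (h4 : (4 * p : ZMod z) = 1) (w : PresentedCobwebGroup z p) (i : ZMod z)
    (e d : Bool) (n : ℕ) :
    ((permR1 z p * (permH z p * permR1 z p * permH z p)) ^ (2 * n)) (w, i, e, false, d) =
      (w * ((List.range n).map fun k : ℕ => genM z p (i - k) *
        genM z p (bif e then i - k else i - k - 1)).prod, i - n, e, false, d) := by
  induction n with
  | zero => simp
  | succ n ih =>
    rw [mul_add, mul_one, add_comm, pow_add, Equiv.Perm.mul_apply, ih, pow_two]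
    simp only [Equiv.Perm.mul_apply]
    have := mulR1_mulR2_sq h4 (w * ((List.range n).map fun k : ℕ => genM z p (i - k) *
        genM z p (bif e then i - k else i - k - 1)).prod) (i - n) e d
    refine Eq.trans this ?_
    rw [List.prod_range_succ, mul_assoc]
    push_cast
    rw [sub_sub]

lemma prod_genM_mul (h4 : (4 * p : ZMod z) = 1) (hz0 : z ≠ 0) (i : ZMod z) (e : Bool) :
    ((List.range z).map fun k : ℕ => genM z p (i - k) *
        genM z p (bif e then i - k else i - k - 1)).prod = 1 := by
  cases e
  · have key : ∀ n : ℕ, ((List.range n).map fun k : ℕ => genM z p (i - k) *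
        genM z p (i - k - 1)).prod = genM z p i *
          ((List.range n).map fun k : ℕ => genM z p (i - 1 - k) ^ 2).prod *
          (genM z p (i - n))⁻¹ := by
      intro n
      induction n with
      | zero => simp
      | succ n ih =>
        rw [List.prod_range_succ, List.prod_range_succ, ih, pow_two]
        have e1 : (i - 1 - n : ZMod z) = i - n - 1 := by ring
        have e2 : (i - ((n + 1 : ℕ) : ZMod z)) = i - n - 1 := by push_cast; ring
        rw [e1, e2]
        group
    simp only [cond_false]
    rw [key, prod_genM_sq h4 hz0]
    simp
  · simpa only [cond_true, pow_two] using prod_genM_sq h4 hz0 i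

lemma permR0_permR1_pow (h4 : (4 * p : ZMod z) = 1) (w : PresentedCobwebGroup z p) (i : ZMod z)
    (e f d : Bool) (n : ℕ) :
    ((permR0 z p * permR1 z p) ^ (2 * n)) (w, i, e, f, d) =
      (w, bif e then i + n else i - n, e, f, d) := by
  induction n with
  | zero => cases e <;> simp
  | succ n ih =>
    rw [mul_add, mul_one, add_comm, pow_add, Equiv.Perm.mul_apply, ih, pow_two]
    simp only [Equiv.Perm.mul_apply, permR0_apply, permR1_apply, mulR0, mulR1]
    cases e
    · simp only [cond_false, Bool.not_false, Bool.not_true, Bool.not_not, Prod.mk.injEq, and_true,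
        true_and]
      push_cast
      linear_combination -h4
    · simp only [cond_true, Bool.not_false, Bool.not_true, Bool.not_not, Prod.mk.injEq, and_true,
        true_and]
      push_cast
      linear_combination h4

/-- The right multiplications on the coset model satisfy the relations of the orthoscheme. -/
theorem permRelations (h4 : (4 * p : ZMod z) = 1) (hz0 : z ≠ 0) :
    OrthoschemeRelations z (permR0 z p) (permR1 z p) (permRa z p) (permH z p) where
  r0_sq := Equiv.ext mulR0_invol
  r1_sq := Equiv.ext mulR1_invol
  ra_sq := Equiv.ext mulRa_invol
  h_sq := Equiv.ext mulH_invol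
  rot := by
    ext1 ⟨w, i, e, f, d⟩
    rw [permR0_permR1_pow h4]
    cases e <;> simp
  ra_r0 := by
    ext1 ⟨w, i, e, f, d⟩
    simp only [Equiv.Perm.mul_apply, permR0_apply, permRa_apply, mulR0, mulRa]
  ra_r1 := by
    ext1 ⟨w, i, e, f, d⟩
    simp only [Equiv.Perm.mul_apply, permR1_apply, permRa_apply, mulR1, mulRa]
  ra_r2 := by
    ext1 ⟨w, i, e, f, d⟩
    rw [Equiv.Perm.mul_apply, permR2_apply, Equiv.Perm.mul_apply, permR2_apply]
    simp only [permRa_apply]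
    cases f
    · simp only [mulR2_false h4, mulRa]
    · simp only [mulR2_true h4, mulRa]
  r3_r0 := by
    ext1 ⟨w, i, e, f, d⟩
    rw [Equiv.Perm.mul_apply, permR3_apply, Equiv.Perm.mul_apply, permR3_apply]
    change mulH z p (mulR0 z p (mulH z p (w, i, !e, f, d))) =
      mulR0 z p (mulH z p (mulR0 z p (mulH z p (w, i, e, f, d))))
    rw [mulR3_apply, mulR3_apply, mulR0]
  r3_r1 := by
    ext1 ⟨w, i, e, f, d⟩
    rw [Equiv.Perm.mul_apply, permR3_apply, Equiv.Perm.mul_apply, permR3_apply]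
    simp only [permR1_apply]
    rw [mulR1, mulR3_apply, mulR3_apply, mulR1]
    cases d <;> cases e <;> simp
  r1_r2 := by
    have hfalse : ∀ w i e d, ((permR1 z p * (permH z p * permR1 z p * permH z p)) ^ (2 * z))
        (w, i, e, false, d) = (w, i, e, false, d) := by
      intro w i e d
      rw [permR1_permR2_pow h4, prod_genM_mul h4 hz0]
      simp
    have h2 : (permH z p * permR1 z p * permH z p) * (permH z p * permR1 z p * permH z p) = 1 :=
      Equiv.ext mulR2_invol
    have h1 : permR1 z p * permR1 z p = 1 := Equiv.ext mulR1_invol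
    set r2 := permH z p * permR1 z p * permH z p with hr2
    have i2 : r2⁻¹ = r2 := inv_eq_of_mul_eq_one_left h2
    have i1 : (permR1 z p)⁻¹ = permR1 z p := inv_eq_of_mul_eq_one_left h1
    have hconj : (permR1 z p * r2) ^ (2 * z) = r2 * ((permR1 z p * r2) ^ (2 * z))⁻¹ * r2⁻¹ := by
      rw [← inv_pow, ← _root_.conj_pow, mul_inv_rev, i1, i2, ← mul_assoc r2 r2, h2, one_mul]
    ext1 ⟨w, i, e, f, d⟩
    cases f
    · exact hfalse w i e d
    · rw [hconj, i2, Equiv.Perm.mul_apply, Equiv.Perm.mul_apply, hr2, permR2_apply, permR2_apply,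
        mulR2_true h4, ← hr2, Equiv.Perm.inv_eq_iff_eq.2 (hfalse _ _ _ _).symm, ← mulR2_true h4,
        mulR2_invol]
      rfl

end CosetAction

end

section

/-! ### Decomposition of the extended reflection group -/

section PermRotation

variable {z p : ℕ}

lemma permR_sq_zpow (h4 : (4 * p : ZMod z) = 1) (w : PresentedCobwebGroup z p) (i : ZMod z)
    (e f d : Bool) (n : ℤ) :
    ((permR0 z p * permR1 z p) ^ (2 * n)) (w, i, e, f, d) =
      (w, bif e then i + n else i - n, e, f, d) := by
  rcases Int.le_total 0 n with hn | hn
  · lift n to ℕ using hn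
    have := permR0_permR1_pow h4 w i e f d n
    rw [show (2 * (n : ℤ)) = ((2 * n : ℕ) : ℤ) by push_cast; rfl, zpow_natCast, this]
    simp
  · obtain ⟨m, rfl⟩ : ∃ m : ℕ, n = -m := ⟨(-n).toNat, by omega⟩
    have := permR0_permR1_pow h4 w (bif e then i - m else i + m) e f d m
    rw [show (2 * (-(m : ℤ))) = -((2 * m : ℕ) : ℤ) by push_cast; ring, zpow_neg, zpow_natCast,
      Equiv.Perm.inv_eq_iff_eq]
    symm
    cases e <;> simpa only [cond_false, cond_true, sub_neg_eq_add, Int.cast_neg, Int.cast_natCast,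
      add_sub_cancel_right, sub_add_cancel, ← sub_eq_add_neg] using this

lemma permR_apply (w : PresentedCobwebGroup z p) (i : ZMod z) (e f d : Bool) :
    (permR0 z p * permR1 z p) (w, i, e, f, d) =
      (w, bif e then i + 2 * p else i - 2 * p, e, !f, d) := by
  rw [Equiv.Perm.mul_apply, permR1_apply, permR0_apply, mulR1, mulR0]
  simp

lemma permR_zpow_odd (h4 : (4 * p : ZMod z) = 1) (w : PresentedCobwebGroup z p) (i : ZMod z)
    (e f d : Bool) (n : ℤ) :
    ((permR0 z p * permR1 z p) ^ (2 * n + 1)) (w, i, e, f, d) =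
      (w, bif e then i + 2 * p + n else i - 2 * p - n, e, !f, d) := by
  rw [zpow_add, zpow_one, Equiv.Perm.mul_apply, permR_apply, permR_sq_zpow h4]
  cases e <;> simp

/-- The base pairing acts on the coset of the identity through `s⁻¹`. -/
lemma permBase_apply (h4 : (4 * p : ZMod z) = 1) (w : PresentedCobwebGroup z p) :
    OrthoschemeRelations.base (permR0 z p) (permR1 z p) (permRa z p) (permH z p) p
      (w, 0, false, false, false) = (w * (genS z p)⁻¹, 0, false, false, false) := by
  rw [OrthoschemeRelations.base, show 4 * (p : ℤ) - 2 = 2 * (2 * p - 1) by ring,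
    Equiv.Perm.mul_apply, permR_sq_zpow h4, Equiv.Perm.mul_apply, permRa_apply, mulRa,
    permR3_apply, mulR3_apply]
  simp only [cond_false, cond_true, Bool.not_false, Bool.not_true, Prod.mk.injEq, and_true,
    true_and]
  push_cast
  linear_combination -h4

/-- On the cosets `(w, i, 0, 0, 0)` the permutation that belongs to the side pairing acts by right
multiplication with a generator of the presented group. This makes the action detect every element
of the presented group. -/
lemma permSide_apply (h4 : (4 * p : ZMod z) = 1) (w : PresentedCobwebGroup z p) (i : ZMod z) :
    OrthoschemeRelations.side (permR0 z p) (permR1 z p) (permRa z p) (permH z p) p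
      (w, i, false, false, false) = (w * (genA z p (-i))⁻¹, i, false, false, false) := by
  rw [OrthoschemeRelations.side, show 2 * (p : ℤ) - 1 = 2 * (p - 1) + 1 by ring,
    Equiv.Perm.mul_apply, Equiv.Perm.mul_apply, Equiv.Perm.mul_apply, permR_zpow_odd h4,
    permRa_apply, mulRa, permH_apply]
  have e : i - 2 * p - ((p - 1 : ℤ) : ZMod z) = i + p := by
    push_cast; linear_combination -h4
  simp only [cond_false, Bool.not_false, e, mulH, permR0_apply, mulR0, Bool.not_true]
  rw [genA_congr (show -(i + p - p) = -i by ring), add_sub_cancel_right]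

/-- The side pairings act on the coset of the identity through `a_j⁻¹`. -/
lemma permSideAt_apply (h4 : (4 * p : ZMod z) = 1) (w : PresentedCobwebGroup z p) (j : ℤ) :
    OrthoschemeRelations.sideAt (permR0 z p) (permR1 z p) (permRa z p) (permH z p) p j
      (w, 0, false, false, false) = (w * (genA z p j)⁻¹, 0, false, false, false) := by
  rw [OrthoschemeRelations.sideAt, Equiv.Perm.mul_apply, Equiv.Perm.mul_apply, permR_sq_zpow h4,
    show -(2 * j) = 2 * (-j) by ring]
  simp only [cond_false]
  rw [permSide_apply h4, permR_sq_zpow h4, genA_congr (show -(0 - (j : ZMod z)) = j by ring)]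
  simp

end PermRotation

/-- Left multiplication by the group of the pairings on the coset model. -/
def leftMul {z p : ℕ} (u : PresentedCobwebGroup z p) : Equiv.Perm (CosetModel z p) :=
  (Equiv.mulLeft u).prodCongr (Equiv.refl _)

lemma leftMul_apply {z p : ℕ} (u w : PresentedCobwebGroup z p) (t : ZMod z × Bool × Bool × Bool) :
    leftMul u (w, t) = (u * w, t) := rfl

namespace OrthoschemeRelations

variable {H : Type*} [Group H] {z p : ℕ} {r0 r1 ra h : H}

/-- The pairs of an element of the extended reflection group and the inverse right multiplication
on the coset model. -/
def cosetPairs (z p : ℕ) (r0 r1 ra h : H) : Subgroup (H × Equiv.Perm (CosetModel z p)) :=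
  Subgroup.closure {(r0, permR0 z p), (r1, permR1 z p), (ra, permRa z p), (h, permH z p)}

lemma exists_cosetPairs {g : H} (hg : g ∈ Subgroup.closure {r0, r1, ra, h}) :
    ∃ π, (g, π) ∈ cosetPairs z p r0 r1 ra h := by
  have : Subgroup.closure {r0, r1, ra, h} ≤
      Subgroup.map (MonoidHom.fst _ _) (cosetPairs z p r0 r1 ra h) := by
    rw [cosetPairs, MonoidHom.map_closure]
    apply Subgroup.closure_mono
    rintro y (rfl | rfl | rfl | rfl)
    · exact ⟨(_, permR0 z p), by simp, rfl⟩
    · exact ⟨(_, permR1 z p), by simp, rfl⟩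
    · exact ⟨(_, permRa z p), by simp, rfl⟩
    · exact ⟨(_, permH z p), by simp, rfl⟩
  obtain ⟨⟨_, π⟩, h1, rfl⟩ := this hg
  exact ⟨π, h1⟩

lemma pair_r0 : (r0, permR0 z p) ∈ cosetPairs z p r0 r1 ra h := Subgroup.subset_closure (by simp)
lemma pair_r1 : (r1, permR1 z p) ∈ cosetPairs z p r0 r1 ra h := Subgroup.subset_closure (by simp)
lemma pair_ra : (ra, permRa z p) ∈ cosetPairs z p r0 r1 ra h := Subgroup.subset_closure (by simp)
lemma pair_h : (h, permH z p) ∈ cosetPairs z p r0 r1 ra h := Subgroup.subset_closure (by simp)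

lemma pair_rot_zpow (n : ℤ) :
    ((r0 * r1) ^ n, (permR0 z p * permR1 z p) ^ n) ∈ cosetPairs z p r0 r1 ra h :=
  zpow_mem (mul_mem pair_r0 pair_r1) n

lemma pair_base : (base r0 r1 ra h p, base (permR0 z p) (permR1 z p) (permRa z p) (permH z p) p) ∈
    cosetPairs z p r0 r1 ra h :=
  mul_mem (mul_mem (mul_mem (mul_mem pair_h pair_r0) pair_h) pair_ra) (pair_rot_zpow _)

lemma pair_sideAt (j : ℤ) : (sideAt r0 r1 ra h p j,
    sideAt (permR0 z p) (permR1 z p) (permRa z p) (permH z p) p j) ∈ cosetPairs z p r0 r1 ra h :=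
  mul_mem (mul_mem (pair_rot_zpow _) (mul_mem (mul_mem pair_r0 pair_h)
    (mul_mem pair_ra (pair_rot_zpow _)))) (pair_rot_zpow _)

/-- The inverse right multiplications commute with the left multiplications. -/
lemma commute_leftMul {x : H × Equiv.Perm (CosetModel z p)}
    (hx : x ∈ cosetPairs z p r0 r1 ra h) (u : PresentedCobwebGroup z p) :
    Commute x.2 (leftMul u) := by
  have : cosetPairs z p r0 r1 ra h ≤
      (Subgroup.centralizer {leftMul u}).comap (MonoidHom.snd _ _) := by
    rw [cosetPairs, Subgroup.closure_le]
    rintro y (rfl | rfl | rfl | rfl) <;>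
      simp only [Subgroup.coe_comap, Set.mem_preimage, SetLike.mem_coe,
        Subgroup.mem_centralizer_singleton_iff, MonoidHom.coe_snd] <;> ext1 ⟨w, i, e, f, d⟩
    · rfl
    · rfl
    · rfl
    · simp only [Equiv.Perm.mul_apply, leftMul_apply, permH_apply]
      cases e <;> cases f <;> cases d <;> simp only [mulH, leftMul_apply, mul_assoc]
  exact (Subgroup.mem_centralizer_singleton_iff.1 (this hx))

variable (hr : OrthoschemeRelations z r0 r1 ra h) (hz : (z : ℤ) = 4 * p - 1) (hz0 : z ≠ 0)

lemma four_mul_cast (hz : (z : ℤ) = 4 * p - 1) : (4 * p : ZMod z) = 1 := by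
  have := congrArg (Int.cast : ℤ → ZMod z) hz
  push_cast at this
  rw [ZMod.natCast_self] at this
  linear_combination -this

/-- The action of the pairings on the coset of the identity. -/
lemma exists_pair_pairingHom (w : PresentedCobwebGroup z p) :
    ∃ π, (hr.pairingHom hz hz0 w, π) ∈ cosetPairs z p r0 r1 ra h ∧
      ∀ u, π (u, 0, false, false, false) = (u * w⁻¹, 0, false, false, false) := by
  have h4 : (4 * p : ZMod z) = 1 := four_mul_cast hz
  have : NeZero z := ⟨hz0⟩
  have hw : w ∈ Subgroup.closure (Set.range (PresentedGroup.of
      (rels := Set.range (relator z p) ∪ {longRelator z p}))) := by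
    rw [PresentedGroup.closure_range_of]; trivial
  induction hw using Subgroup.closure_induction with
  | mem x hx =>
    obtain ⟨g, rfl⟩ := hx
    cases g with
    | s =>
      refine ⟨_, ?_, fun u => permBase_apply h4 u⟩
      rw [pairingHom_s]
      exact pair_base
    | a i =>
      refine ⟨_, ?_, fun u => (permSideAt_apply h4 u i.val).trans ?_⟩
      · rw [pairingHom_a]
        exact pair_sideAt _
      · simp [genA]
  | one => exact ⟨1, by rw [map_one]; exact one_mem _, fun u => by simp⟩
  | mul x y _ _ hx hy =>
    obtain ⟨π, h1, h2⟩ := hx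
    obtain ⟨σ, h3, h5⟩ := hy
    refine ⟨π * σ, by rw [map_mul]; exact mul_mem h1 h3, fun u => ?_⟩
    rw [Equiv.Perm.mul_apply, h5, h2, mul_inv_rev, mul_assoc]
  | inv x _ hx =>
    obtain ⟨π, h1, h2⟩ := hx
    refine ⟨π⁻¹, by rw [map_inv]; exact inv_mem h1, fun u => ?_⟩
    rw [Equiv.Perm.inv_eq_iff_eq, h2, inv_inv, mul_inv_cancel_right]

end OrthoschemeRelations

end

section

/-! ### The elements of the coset model -/

namespace OrthoschemeRelations

variable {H : Type*} [Group H] {z p : ℕ} {r0 r1 ra h : H}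

/-- The rotation `R^(2i)` for a residue `i`. -/
def rotAt (r0 r1 : H) (i : ZMod z) : H := (r0 * r1) ^ (2 * (i.val : ℤ))

lemma rotAt_eq (hr : OrthoschemeRelations z r0 r1 ra h) (hz0 : z ≠ 0) {i : ZMod z} {j : ℤ}
    (hj : (j : ZMod z) = i) : rotAt r0 r1 i = (r0 * r1) ^ (2 * j) := by
  have : NeZero z := ⟨hz0⟩
  have h2 : (j : ZMod z) = ((i.val : ℤ) : ZMod z) := by rw [hj]; simp
  obtain ⟨n, hn⟩ := (ZMod.intCast_eq_intCast_iff_dvd_sub _ _ z).1 h2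
  have hk : 2 * (i.val : ℤ) = 2 * z * n + 2 * j := by linarith
  rw [rotAt, hk, zpow_add, zpow_mul, show (2 * (z : ℤ)) = ((2 * z : ℕ) : ℤ) by push_cast; rfl,
    zpow_natCast, hr.rot, one_zpow, one_mul]

lemma pairingHom_genA (hr : OrthoschemeRelations z r0 r1 ra h) (hz : (z : ℤ) = 4 * p - 1)
    (hz0 : z ≠ 0) {i : ZMod z} {j : ℤ} (hj : (j : ZMod z) = i) :
    hr.pairingHom hz hz0 (genA z p i) = sideAt r0 r1 ra h p j := by
  have : NeZero z := ⟨hz0⟩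
  rw [genA, pairingHom_a]
  exact hr.sideAt_congr (by rw [hj]; simp)

/-- The elements `R^(2i) r₀^e (R^z)^f r_a^d` of the stabilizer of `Q`. -/
def stabElt (r0 r1 ra : H) (p : ℕ) (t : ZMod z × Bool × Bool × Bool) : H :=
  rotAt r0 r1 t.1 * ((bif t.2.1 then r0 else 1) *
    ((bif t.2.2.1 then (r0 * r1) ^ (4 * (p : ℤ) - 1) else 1) * (bif t.2.2.2 then ra else 1)))

lemma stabElt_eq (hr : OrthoschemeRelations z r0 r1 ra h) (hz0 : z ≠ 0) {i : ZMod z} {j : ℤ}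
    (hj : (j : ZMod z) = i) (e f d : Bool) :
    stabElt r0 r1 ra p (i, e, f, d) = (r0 * r1) ^ (2 * j) * ((bif e then r0 else 1) *
    ((bif f then (r0 * r1) ^ (4 * (p : ℤ) - 1) else 1) * (bif d then ra else 1))) := by
  rw [stabElt, hr.rotAt_eq hz0 hj]

/-- The element of the extended reflection group that a point of the coset model stands for. -/
def eval (hr : OrthoschemeRelations z r0 r1 ra h) (hz : (z : ℤ) = 4 * p - 1) (hz0 : z ≠ 0)
    (x : CosetModel z p) : H := hr.pairingHom hz hz0 x.1 * stabElt r0 r1 ra p x.2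

lemma zpow_mul_r0 (hr : OrthoschemeRelations z r0 r1 ra h) (n : ℤ) (x : H) :
    (r0 * r1) ^ n * (r0 * x) = r0 * ((r0 * r1) ^ (-n) * x) := by
  rw [← mul_assoc r0, hr.r0_mul_zpow, neg_neg, mul_assoc]

lemma eval_mulR0 (hr : OrthoschemeRelations z r0 r1 ra h) (hz : (z : ℤ) = 4 * p - 1) (hz0 : z ≠ 0)
    (x : CosetModel z p) : hr.eval hz hz0 (mulR0 z p x) = hr.eval hz hz0 x * r0 := by
  obtain ⟨w, i, e, f, d⟩ := x
  have k1 : (r0 * r1) ^ (4 * (p : ℤ) - 1) * r0 = r0 * (r0 * r1) ^ (4 * (p : ℤ) - 1) := by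
    rw [hr.r0_mul_zpow, ← hr.zpow_two_mul (-(4 * (p : ℤ) - 1)), hz]
    congr 2
    ring
  have k2 : ∀ x, (r0 * r1) ^ (4 * (p : ℤ) - 1) * (r0 * x) =
      r0 * ((r0 * r1) ^ (4 * (p : ℤ) - 1) * x) := fun x => by
    rw [← mul_assoc, k1, mul_assoc]
  simp only [mulR0, eval, mul_assoc, stabElt]
  congr 2
  cases e <;> cases f <;> cases d <;>
    simp [hr.ra_r0, cancel_left hr.r0_sq, hr.r0_sq, k1, k2]

lemma eval_mulRa (hr : OrthoschemeRelations z r0 r1 ra h) (hz : (z : ℤ) = 4 * p - 1) (hz0 : z ≠ 0)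
    (x : CosetModel z p) : hr.eval hz hz0 (mulRa z p x) = hr.eval hz hz0 x * ra := by
  obtain ⟨w, i, e, f, d⟩ := x
  simp only [mulRa, eval, mul_assoc, stabElt]
  congr 4
  cases d <;> simp [hr.ra_sq]

lemma zpow_congr_add (hr : OrthoschemeRelations z r0 r1 ra h) {m n : ℤ} (k : ℤ)
    (hmn : m = n + 2 * z * k) : (r0 * r1) ^ m = (r0 * r1) ^ n := by
  rw [hmn, zpow_add, zpow_mul, show (2 * (z : ℤ)) = ((2 * z : ℕ) : ℤ) by push_cast; rfl,
    zpow_natCast, hr.rot, one_zpow, mul_one]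

lemma eval_mulR1 (hr : OrthoschemeRelations z r0 r1 ra h) (hz : (z : ℤ) = 4 * p - 1) (hz0 : z ≠ 0)
    (x : CosetModel z p) : hr.eval hz hz0 (mulR1 z p x) = hr.eval hz hz0 x * r1 := by
  have : NeZero z := ⟨hz0⟩
  obtain ⟨w, i, e, f, d⟩ := x
  obtain ⟨j, rfl⟩ : ∃ j : ℤ, (j : ZMod z) = i := ⟨i.val, by simp⟩
  have kr : r1 = r0 * (r0 * r1) ^ (1 : ℤ) := by
    rw [zpow_one, ← mul_assoc, hr.r0_sq, one_mul]
  have ka : ra * r1 = r0 * ((r0 * r1) ^ (1 : ℤ) * ra) := by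
    rw [hr.ra_r1, ← mul_assoc, ← kr]
  have k1 : ∀ n : ℤ, (r0 * r1) ^ n * r1 = r0 * (r0 * r1) ^ (-n + 1) := fun n => by
    have : (r0 * r1) ^ n * r1 = (r0 * r1) ^ n * (r0 * (r0 * r1) ^ (1 : ℤ)) := congrArg _ kr
    rw [this, hr.zpow_mul_r0, ← zpow_add]
  have k0 : ∀ n : ℤ, (r0 * r1) ^ n * r0 = r0 * (r0 * r1) ^ (-n) := fun n => by
    rw [hr.r0_mul_zpow, neg_neg]
  simp only [mulR1, eval, mul_assoc]
  congr 1
  cases e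
  · simp only [cond_false, Bool.not_false]
    rw [hr.stabElt_eq hz0 (j := j - 2 * p) (by push_cast; ring), hr.stabElt_eq hz0 rfl]
    cases f <;> cases d <;> simp only [cond_false, cond_true, one_mul, Bool.not_false,
      Bool.not_true, mul_one, mul_assoc, ka, k0, k1, hr.zpow_mul_r0, zpow_mul_zpow, ← zpow_add]
    all_goals
      refine congrArg (r0 * ·) ?_
      first
        | exact hr.zpow_congr_add 0 (by ring1)
        | exact congrArg (· * ra) (hr.zpow_congr_add 0 (by ring1))
        | exact hr.zpow_congr_add 1 (by linear_combination (-2 : ℤ) * hz)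
        | exact congrArg (· * ra) (hr.zpow_congr_add 1 (by linear_combination (-2 : ℤ) * hz))
  · simp only [cond_true, Bool.not_true]
    rw [hr.stabElt_eq hz0 (j := j + 2 * p) (by push_cast; ring), hr.stabElt_eq hz0 rfl]
    cases f <;> cases d <;> simp only [cond_false, cond_true, one_mul, Bool.not_false,
      Bool.not_true, mul_one, mul_assoc, ka, k1, hr.zpow_mul_r0, zpow_mul_zpow, ← zpow_add,
      cancel_left hr.r0_sq]
    all_goals
      first
        | exact hr.zpow_congr_add 1 (by linear_combination (-2 : ℤ) * hz)
        | exact congrArg (· * ra) (hr.zpow_congr_add 1 (by linear_combination (-2 : ℤ) * hz))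

lemma side_zpow_base_inv (hr : OrthoschemeRelations z r0 r1 ra h) (m : ℤ) (x : H) :
    side r0 r1 ra h p * ((r0 * r1) ^ m * ((base r0 r1 ra h p)⁻¹ * x)) =
      r0 * (h * ((r0 * r1) ^ (m + 1 - 2 * p) * (h * r0 * h * x))) := by
  rw [side_mul, hr.base_inv_mul]
  simp only [zpow_mul_zpow]
  rw [hr.ra_mul_zpow, cancel_left hr.ra_sq, zpow_mul_congr (n := m + 1 - 2 * p) (by ring1)]

lemma base_inv_side_zpow (hr : OrthoschemeRelations z r0 r1 ra h) {m n : ℤ}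
    (hmn : n = 2 * p - 1 + m) : (base r0 r1 ra h p)⁻¹ *
      (side r0 r1 ra h p * ((r0 * r1) ^ m * (r0 * ((r0 * r1) ^ n * ra)))) =
      (r0 * r1) ^ (2 - 4 * (p : ℤ)) * (r0 * (ra * h)) := by
  rw [side_mul, zpow_mul_zpow, hr.zpow_mul_r0, zpow_mul_zpow, zpow_mul_of_eq_zero (by rw [hmn]; ring),
    hr.ra_r0.symm, cancel_left hr.ra_sq, hr.base_inv_mul, hr.r3_mul_r0, hr.r3_mul_h, hr.r0_sq,
    mul_one, ← mul_assoc ra, hr.ra_r0, mul_assoc]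

lemma base_inv_side_base_inv (hr : OrthoschemeRelations z r0 r1 ra h) {m n : ℤ} (k : ℤ)
    (hmn : -(m + 1 - 2 * p) + n = 2 * z * k) : (base r0 r1 ra h p)⁻¹ *
      (side r0 r1 ra h p * ((r0 * r1) ^ m * ((base r0 r1 ra h p)⁻¹ * (r0 * (r0 * r1) ^ n)))) =
      (r0 * r1) ^ (2 - 4 * (p : ℤ)) * (ra * h) := by
  rw [hr.side_zpow_base_inv, ← hr.r3_mul_zpow, hr.zpow_mul_r0, ← zpow_add,
    hr.zpow_congr_add (n := 0) k (by rw [hmn, zero_add]), zpow_zero, mul_one, hr.h_mul_r3,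
    cancel_left hr.r0_sq, hr.base_inv_mul, hr.r3_mul_h, hr.r0_sq, mul_one]

/-- The formulas that define `mulH` are correct in every group with the relations of the extended
reflection group. -/
lemma eval_mulH (hr : OrthoschemeRelations z r0 r1 ra h) (hz : (z : ℤ) = 4 * p - 1) (hz0 : z ≠ 0)
    (x : CosetModel z p) : hr.eval hz hz0 (mulH z p x) = hr.eval hz hz0 x * h := by
  have : NeZero z := ⟨hz0⟩
  have invol : ∀ x, hr.eval hz hz0 (mulH z p x) = hr.eval hz hz0 x * h →
      hr.eval hz hz0 (mulH z p (mulH z p x)) = hr.eval hz hz0 (mulH z p x) * h := by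
    intro x hx
    rw [mulH_invol, hx, mul_assoc, hr.h_sq, mul_one]
  have cast : ∀ i : ZMod z, ∃ j : ℤ, (j : ZMod z) = i := fun i => ⟨i.val, by simp⟩
  have h1 : ∀ w (i : ZMod z), hr.eval hz hz0 (mulH z p (w, i, false, false, false)) =
      hr.eval hz hz0 (w, i, false, false, false) * h := by
    intro w i
    obtain ⟨j, rfl⟩ := cast i
    simp only [mulH, eval, map_mul, map_inv]
    rw [hr.pairingHom_genA hz hz0 (j := -j) (by push_cast; ring),
      hr.stabElt_eq hz0 (j := j - p) (by push_cast; ring), hr.stabElt_eq hz0 rfl, genS, pairingHom_s]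
    simp only [cond_false, cond_true, one_mul, mul_one, sideAt, mul_assoc, hr.base_inv_mul_zpow,
      zpow_mul_zpow]
    congr 1
    rw [hr.side_zpow_base_inv, (hr.commute_r3.zpow_right _).eq, zpow_mul_zpow,
      zpow_mul_of_eq_zero (n := 2 * -j + 2 * (j - p) + 1 - 2 * p + (4 * p - 1)) (by ring), mul_assoc h r0 h, cancel_left hr.h_sq, cancel_left hr.r0_sq]
    ring_nf
  have h2 : ∀ w (i : ZMod z), hr.eval hz hz0 (mulH z p (w, i, true, false, false)) =
      hr.eval hz hz0 (w, i, true, false, false) * h := by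
    intro w i
    obtain ⟨j, rfl⟩ := cast i
    simp only [mulH, eval, map_mul]
    rw [hr.pairingHom_genA hz hz0 (j := -j) (by push_cast; ring),
      hr.stabElt_eq hz0 (j := j + p) (by push_cast; ring), hr.stabElt_eq hz0 rfl]
    simp only [cond_false, cond_true, one_mul, mul_one, sideAt, mul_assoc, 
      zpow_mul_zpow, side_mul]
    congr 1
    rw [hr.zpow_congr_add (m := 2 * (p : ℤ) - 1 + (2 * -j + (2 * (j + p) + (4 * p - 1)))) (n := 0) 1
      (by rw [hz]; ring), zpow_zero, one_mul, hr.ra_sq, mul_one]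
    ring_nf
  have h3 : ∀ w (i : ZMod z), hr.eval hz hz0 (mulH z p (w, i, true, false, true)) =
      hr.eval hz hz0 (w, i, true, false, true) * h := by
    intro w i
    obtain ⟨j, rfl⟩ := cast i
    simp only [mulH, eval, map_mul, map_inv]
    rw [hr.pairingHom_genA hz hz0 (j := -(j - 2 * p)) (by push_cast; ring),
      hr.stabElt_eq hz0 (j := j - p) (by push_cast; ring), hr.stabElt_eq hz0 rfl, genS, pairingHom_s]
    simp only [cond_false, cond_true, one_mul, sideAt, mul_assoc, hr.base_inv_mul_zpow,
      zpow_mul_zpow]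
    congr 1
    rw [hr.base_inv_side_zpow (by ring), zpow_mul_zpow]
    exact congrArg (· * (r0 * (ra * h))) (hr.zpow_congr_add (-1) (by rw [hz]; ring))
  have h4 : ∀ w (i : ZMod z), hr.eval hz hz0 (mulH z p (w, i, false, false, true)) =
      hr.eval hz hz0 (w, i, false, false, true) * h := by
    intro w i
    obtain ⟨j, rfl⟩ := cast i
    simp only [mulH, eval, map_mul, map_inv]
    rw [hr.pairingHom_genA hz hz0 (j := -(j - 2 * p)) (by push_cast; ring),
      hr.stabElt_eq hz0 (j := j - 3 * p) (by push_cast; ring), hr.stabElt_eq hz0 rfl, genS,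
      pairingHom_s]
    simp only [cond_false, cond_true, one_mul, mul_one, sideAt, mul_assoc, hr.base_inv_mul_zpow,
      hr.zpow_mul_r0]
    congr 1
    rw [← zpow_add, hr.base_inv_side_base_inv 1 (by rw [hz]; ring), zpow_mul_zpow]
    exact congrArg (· * (ra * h)) (hr.zpow_congr_add (-1) (by rw [hz]; ring))
  obtain ⟨w, i, e, f, d⟩ := x
  cases e <;> cases f <;> cases d
  · exact h1 w i
  · exact h4 w i
  · have := invol _ (h1 (w * genS z p * (genA z p (-(i + p)))⁻¹) (i + p))
    rwa [show mulH z p (w * genS z p * (genA z p (-(i + p)))⁻¹, i + p, false, false, false) =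
      mulH z p (mulH z p (w, i, false, true, false)) from rfl, mulH_invol, mulH_invol] at this
  · have := invol _ (h2 (w * (genA z p (-(i - p)))⁻¹) (i - p))
    rwa [show mulH z p (w * (genA z p (-(i - p)))⁻¹, i - p, true, false, false) =
      mulH z p (mulH z p (w, i, false, true, true)) from rfl, mulH_invol, mulH_invol] at this
  · exact h2 w i
  · exact h3 w i
  · have := invol _ (h4 (w * genS z p * (genA z p (-(i + p)))⁻¹ * genS z p) (i + 3 * p))
    rwa [show mulH z p (w * genS z p * (genA z p (-(i + p)))⁻¹ * genS z p, i + 3 * p, false, false,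
      true) = mulH z p (mulH z p (w, i, true, true, false)) from rfl, mulH_invol, mulH_invol] at this
  · have := invol _ (h3 (w * (genA z p (-(i - p)))⁻¹ * genS z p) (i + p))
    rwa [show mulH z p (w * (genA z p (-(i - p)))⁻¹ * genS z p, i + p, true, false, true) =
      mulH z p (mulH z p (w, i, true, true, true)) from rfl, mulH_invol, mulH_invol] at this

end OrthoschemeRelations

end

section

/-! ### Consequences of the coset action -/

namespace OrthoschemeRelations

variable {H : Type*} [Group H] {z p : ℕ} {r0 r1 ra h : H}

/-- The pairs act on the coset model as the inverse right multiplications do. -/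
lemma eval_pair (hr : OrthoschemeRelations z r0 r1 ra h) (hz : (z : ℤ) = 4 * p - 1) (hz0 : z ≠ 0)
    {y : H × Equiv.Perm (CosetModel z p)} (hy : y ∈ cosetPairs z p r0 r1 ra h)
    (x : CosetModel z p) : hr.eval hz hz0 (y.2 x) = hr.eval hz hz0 x * y.1⁻¹ := by
  revert x
  induction hy using Subgroup.closure_induction with
  | mem y hy =>
    intro x
    rcases hy with rfl | rfl | rfl | rfl
    · rw [hr.inv_r0]; exact hr.eval_mulR0 hz hz0 x
    · rw [hr.inv_r1]; exact hr.eval_mulR1 hz hz0 x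
    · rw [hr.inv_ra]; exact hr.eval_mulRa hz hz0 x
    · rw [hr.h_inv]; exact hr.eval_mulH hz hz0 x
  | one => intro x; simp
  | mul y y' _ _ h1 h2 => intro x; rw [Prod.snd_mul, Equiv.Perm.mul_apply, h1, h2]; simp [mul_assoc]
  | inv y _ h1 =>
    intro x
    have := h1 (y.2⁻¹ x)
    rw [show y.2 (y.2⁻¹ x) = x from y.2.apply_symm_apply x] at this
    rw [Prod.snd_inv, this]; simp

lemma stabElt_zero : stabElt r0 r1 ra p ((0 : ZMod z), false, false, false) = 1 := by
  simp [stabElt, rotAt]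

lemma stabElt_mem (t : ZMod z × Bool × Bool × Bool) :
    stabElt r0 r1 ra p t ∈ Subgroup.closure {r0, r1, ra} := by
  have m0 : r0 ∈ Subgroup.closure {r0, r1, ra} := Subgroup.subset_closure (by simp)
  have m1 : r1 ∈ Subgroup.closure {r0, r1, ra} := Subgroup.subset_closure (by simp)
  have ma : ra ∈ Subgroup.closure {r0, r1, ra} := Subgroup.subset_closure (by simp)
  obtain ⟨i, e, f, d⟩ := t
  refine mul_mem (zpow_mem (mul_mem m0 m1) _) (mul_mem ?_ (mul_mem ?_ ?_))
  · cases e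
    exacts [one_mem _, m0]
  · cases f
    exacts [one_mem _, zpow_mem (mul_mem m0 m1) _]
  · cases d
    exacts [one_mem _, ma]

/-- Every element of the extended reflection group is the product of a pairing and an element of
the stabilizer of `Q`. -/
lemma exists_eq_mul_stabElt (hr : OrthoschemeRelations z r0 r1 ra h) (hz : (z : ℤ) = 4 * p - 1)
    (hz0 : z ≠ 0) {g : H} (hg : g ∈ Subgroup.closure {r0, r1, ra, h}) :
    ∃ (w : PresentedCobwebGroup z p) (t : ZMod z × Bool × Bool × Bool),
      g = hr.pairingHom hz hz0 w * stabElt r0 r1 ra p t := by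
  obtain ⟨π, hπ⟩ := exists_cosetPairs (z := z) (p := p) (inv_mem hg)
  have := hr.eval_pair hz hz0 hπ (1, 0, false, false, false)
  rw [eval, eval, stabElt_zero, map_one, one_mul, inv_inv, one_mul] at this
  exact ⟨_, _, this.symm⟩

/-- The group acts faithfully, in the sense that it has no more relations than the Coxeter group
extended by the half-turn. -/
structure IsFaithful (hr : OrthoschemeRelations z r0 r1 ra h) (hz0 : z ≠ 0) : Prop where
  hom_eq_one : ∀ w, hr.hom hz0 w = 1 → w = 1
  hom_mul_ne_one : ∀ w, hr.hom hz0 w * h ≠ 1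

/-- The permutations satisfy all relations of the extended reflection group, so the pairs in
`cosetPairs` form the graph of a homomorphism. -/
lemma snd_eq_one {hr : OrthoschemeRelations z r0 r1 ra h} {hz0 : z ≠ 0} (hf : hr.IsFaithful hz0)
    (hz : (z : ℤ) = 4 * p - 1) {y : H × Equiv.Perm (CosetModel z p)}
    (hy : y ∈ cosetPairs z p r0 r1 ra h) (h1 : y.1 = 1) : y.2 = 1 := by
  obtain ⟨w, rfl | rfl⟩ := mem_closure_pairs hr (permRelations (four_mul_cast hz) hz0) hz0 hy
  · rw [hf.hom_eq_one w h1]; simp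
  · exact absurd h1 (hf.hom_mul_ne_one w)

lemma snd_unique {hr : OrthoschemeRelations z r0 r1 ra h} {hz0 : z ≠ 0} (hf : hr.IsFaithful hz0)
    (hz : (z : ℤ) = 4 * p - 1) {g : H} {π π' : Equiv.Perm (CosetModel z p)}
    (hy : (g, π) ∈ cosetPairs z p r0 r1 ra h) (hy' : (g, π') ∈ cosetPairs z p r0 r1 ra h) :
    π = π' := by
  have := snd_eq_one hf hz (mul_mem hy (inv_mem hy')) (by simp)
  simpa [mul_inv_eq_one] using this

/-- The presented group acts faithfully on the coset model by right multiplication of the first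
coordinate, and this action factors through its image in the extended reflection group. -/
lemma pairingHom_injective {hr : OrthoschemeRelations z r0 r1 ra h} {hz0 : z ≠ 0}
    (hf : hr.IsFaithful hz0) (hz : (z : ℤ) = 4 * p - 1) :
    Function.Injective (hr.pairingHom hz hz0) := by
  rw [injective_iff_map_eq_one]
  intro w hw
  obtain ⟨π, h1, h2⟩ := hr.exists_pair_pairingHom hz hz0 w
  have h3 : π = 1 := snd_eq_one hf hz h1 hw
  have := h2 1
  rw [h3] at this
  simpa using (congrArg Prod.fst this).symm

/-- The stabilizer of `Q` does not move the first coordinate of the coset model. -/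
lemma exists_pair_of_mem_stab {g : H} (hg : g ∈ Subgroup.closure {r0, r1, ra}) :
    ∃ π, (g, π) ∈ cosetPairs z p r0 r1 ra h ∧ ∀ x, (π x).1 = x.1 := by
  induction hg using Subgroup.closure_induction with
  | mem y hy =>
    rcases hy with rfl | rfl | rfl
    · exact ⟨_, pair_r0, fun _ => rfl⟩
    · exact ⟨_, pair_r1, fun _ => rfl⟩
    · exact ⟨_, pair_ra, fun _ => rfl⟩
  | one => exact ⟨1, one_mem _, fun _ => rfl⟩
  | mul y y' _ _ h1 h2 =>
    obtain ⟨π, h1, h3⟩ := h1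
    obtain ⟨σ, h2, h4⟩ := h2
    exact ⟨π * σ, mul_mem h1 h2, fun x => by rw [Equiv.Perm.mul_apply, h3, h4]⟩
  | inv y _ h1 =>
    obtain ⟨π, h1, h3⟩ := h1
    exact ⟨π⁻¹, inv_mem h1, fun x => by
      have := h3 (π⁻¹ x)
      rw [show π (π⁻¹ x) = x from π.apply_symm_apply x] at this
      exact this.symm⟩

/-- The group of the pairings meets the stabilizer of `Q` only in the identity. -/
lemma eq_one_of_pairingHom_mem {hr : OrthoschemeRelations z r0 r1 ra h} {hz0 : z ≠ 0}
    (hf : hr.IsFaithful hz0) (hz : (z : ℤ) = 4 * p - 1) {w : PresentedCobwebGroup z p}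
    (hw : hr.pairingHom hz hz0 w ∈ Subgroup.closure {r0, r1, ra}) : w = 1 := by
  obtain ⟨π, h1, h2⟩ := hr.exists_pair_pairingHom hz hz0 w
  obtain ⟨σ, h3, h4⟩ := exists_pair_of_mem_stab (z := z) (p := p) (h := h) hw
  obtain rfl := snd_unique hf hz h1 h3
  have h5 := congrArg Prod.fst (h2 1)
  rw [h4] at h5
  simpa using h5.symm

lemma exists_stabElt_eq (hr : OrthoschemeRelations z r0 r1 ra h) (hz : (z : ℤ) = 4 * p - 1)
    (hz0 : z ≠ 0) {g : H} (hg : g ∈ Subgroup.closure {r0, r1, ra}) :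
    ∃ t : ZMod z × Bool × Bool × Bool, stabElt r0 r1 ra p t = g := by
  obtain ⟨π, h1, h2⟩ := exists_pair_of_mem_stab (z := z) (p := p) (h := h) (inv_mem hg)
  have := hr.eval_pair hz hz0 h1 (1, 0, false, false, false)
  rw [eval, eval, stabElt_zero, h2, map_one, one_mul, inv_inv, one_mul, one_mul] at this
  exact ⟨_, this⟩

/-- The elements `R^(2i) r₀^e (R^z)^f r_a^d` of the stabilizer of `Q` are different, as they move
the base point of the coset model to different points. -/
lemma stabElt_injective {hr : OrthoschemeRelations z r0 r1 ra h} {hz0 : z ≠ 0}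
    (hf : hr.IsFaithful hz0) (hz : (z : ℤ) = 4 * p - 1) :
    Function.Injective (stabElt (z := z) r0 r1 ra p) := by
  have : NeZero z := ⟨hz0⟩
  have h4 : (4 * p : ZMod z) = 1 := four_mul_cast hz
  have key : ∀ t : ZMod z × Bool × Bool × Bool, ∃ π,
      (stabElt r0 r1 ra p t, π) ∈ cosetPairs z p r0 r1 ra h ∧
      π (1, t) = (1, 0, false, false, false) := by
    rintro ⟨i, e, f, d⟩
    refine ⟨(permR0 z p * permR1 z p) ^ (2 * (i.val : ℤ)) * ((bif e then permR0 z p else 1) *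
      ((bif f then (permR0 z p * permR1 z p) ^ (4 * (p : ℤ) - 1) else 1) *
      (bif d then permRa z p else 1))), mul_mem (pair_rot_zpow _)
      (show (_, _) * (_, _) ∈ _ from mul_mem ?_ (show (_, _) * (_, _) ∈ _ from mul_mem ?_ ?_)), ?_⟩
    · cases e
      exacts [one_mem _, pair_r0]
    · cases f
      exacts [one_mem _, pair_rot_zpow _]
    · cases d
      exacts [one_mem _, pair_ra]
    · have e1 : (bif d then permRa z p else 1) (1, i, e, f, d) = (1, i, e, f, false) := by
        cases d <;> rfl
      have e2 : (bif f then (permR0 z p * permR1 z p) ^ (4 * (p : ℤ) - 1) else 1)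
          (1, i, e, f, false) = (1, i, e, false, false) := by
        cases f
        · rfl
        · rw [cond_true, show 4 * (p : ℤ) - 1 = 2 * (2 * p - 1) + 1 by ring, permR_zpow_odd h4]
          cases e
          · simp only [cond_false, Bool.not_true, Prod.mk.injEq, and_true, true_and]
            push_cast; linear_combination -h4
          · simp only [cond_true, Bool.not_true, Prod.mk.injEq, and_true, true_and]
            push_cast; linear_combination h4
      have e3 : (bif e then permR0 z p else 1) (1, i, e, false, false) =
          (1, i, false, false, false) := by
        cases e <;> rfl
      rw [Equiv.Perm.mul_apply, Equiv.Perm.mul_apply, Equiv.Perm.mul_apply, e1, e2, e3,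
        permR_sq_zpow h4]
      simp
  intro t t' htt
  obtain ⟨π, h1, h2⟩ := key t
  obtain ⟨σ, h3, h5⟩ := key t'
  rw [← htt] at h3
  obtain rfl := snd_unique hf hz h1 h3
  exact congrArg Prod.snd (π.injective (h2.trans h5.symm))

/-- The stabilizer of `Q` has `8 z` elements. -/
lemma card_stab {hr : OrthoschemeRelations z r0 r1 ra h} {hz0 : z ≠ 0}
    (hf : hr.IsFaithful hz0) (hz : (z : ℤ) = 4 * p - 1) :
    Nat.card (Subgroup.closure {r0, r1, ra}) = 8 * z := by
  have : NeZero z := ⟨hz0⟩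
  have e : (ZMod z × Bool × Bool × Bool) ≃ Subgroup.closure {r0, r1, ra} :=
    Equiv.ofBijective (fun t => ⟨stabElt r0 r1 ra p t, stabElt_mem t⟩)
      ⟨fun t t' htt => stabElt_injective hf hz (Subtype.ext_iff.1 htt),
        fun g => by
          obtain ⟨t, ht⟩ := hr.exists_stabElt_eq hz hz0 g.2
          exact ⟨t, Subtype.ext ht⟩⟩
  rw [← Nat.card_congr e, Nat.card_eq_fintype_card]
  simp [ZMod.card]
  ring

lemma orderOf_rot_sq {hr : OrthoschemeRelations z r0 r1 ra h} {hz0 : z ≠ 0}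
    (hf : hr.IsFaithful hz0) (hz : (z : ℤ) = 4 * p - 1) : orderOf ((r0 * r1) ^ 2) = z := by
  have : NeZero z := ⟨hz0⟩
  refine Nat.dvd_antisymm (orderOf_dvd_of_pow_eq_one (by rw [← pow_mul, hr.rot])) ?_
  set n := orderOf ((r0 * r1) ^ 2) with hn
  have h1 : (r0 * r1) ^ (2 * (n : ℤ)) = 1 := by
    rw [show 2 * (n : ℤ) = ((2 * n : ℕ) : ℤ) by push_cast; rfl, zpow_natCast, pow_mul]
    exact pow_orderOf_eq_one _
  have h2 := snd_eq_one hf hz (pair_rot_zpow (p := p) (2 * (n : ℤ))) h1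
  have h3 := permR_sq_zpow (four_mul_cast hz) 1 0 true true true n
  simp only at h2
  rw [h2] at h3
  have h5 := congrArg (fun x => x.2.1) h3
  simp only [cond_true, Equiv.Perm.one_apply] at h5
  rw [← ZMod.natCast_eq_zero_iff]
  simpa using h5.symm

end OrthoschemeRelations

end

section

/-! ### Stabilizers of points do not meet the group of the pairings -/

/-- Normal form in a group generated by two involutions and a third one that commutes with both. -/
lemma exists_normal_form {G : Type*} [Group G] {x y c : G} (hx : x * x = 1) (hy : y * y = 1)
    (hc : c * c = 1) (hcx : c * x = x * c) (hcy : c * y = y * c) {g : G}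
    (hg : g ∈ Subgroup.closure {x, y, c}) :
    ∃ (n : ℤ) (e d : Bool), g = (x * y) ^ n * (bif e then x else 1) * (bif d then c else 1) := by
  have ix : x⁻¹ = x := inv_eq_of_mul_eq_one_left hx
  have iy : y⁻¹ = y := inv_eq_of_mul_eq_one_left hy
  have ic : c⁻¹ = c := inv_eq_of_mul_eq_one_left hc
  have kx : ∀ n : ℤ, x * (x * y) ^ n = (x * y) ^ (-n) * x := fun n => by
    have e : (x * y)⁻¹ = x * (x * y) * x⁻¹ := by
      rw [mul_inv_rev, ix, iy, ← mul_assoc, hx, one_mul]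
    rw [zpow_neg, ← inv_zpow, e, conj_zpow]
    group
  have kc : ∀ n : ℤ, c * (x * y) ^ n = (x * y) ^ n * c := fun n =>
    ((show Commute c (x * y) from Commute.mul_right hcx hcy).zpow_right n).eq
  have sx : ∀ g : G, (∃ (n : ℤ) (e d : Bool),
      g = (x * y) ^ n * (bif e then x else 1) * (bif d then c else 1)) → ∃ (n : ℤ) (e d : Bool),
      x * g = (x * y) ^ n * (bif e then x else 1) * (bif d then c else 1) := by
    rintro _ ⟨n, e, d, rfl⟩
    refine ⟨-n, !e, d, ?_⟩
    rw [← mul_assoc, ← mul_assoc, kx]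
    cases e <;> simp [mul_assoc, hx]
  have sc : ∀ g : G, (∃ (n : ℤ) (e d : Bool),
      g = (x * y) ^ n * (bif e then x else 1) * (bif d then c else 1)) → ∃ (n : ℤ) (e d : Bool),
      c * g = (x * y) ^ n * (bif e then x else 1) * (bif d then c else 1) := by
    rintro _ ⟨n, e, d, rfl⟩
    refine ⟨n, e, !d, ?_⟩
    rw [← mul_assoc, ← mul_assoc, kc]
    cases e <;> cases d <;> simp [mul_assoc, hc, hcx]
  have sr : ∀ g : G, (∃ (n : ℤ) (e d : Bool),
      g = (x * y) ^ n * (bif e then x else 1) * (bif d then c else 1)) → ∃ (n : ℤ) (e d : Bool),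
      x * y * g = (x * y) ^ n * (bif e then x else 1) * (bif d then c else 1) := by
    rintro _ ⟨n, e, d, rfl⟩
    refine ⟨1 + n, e, d, ?_⟩
    rw [zpow_add, zpow_one]
    simp only [mul_assoc]
  have sy : ∀ g : G, (∃ (n : ℤ) (e d : Bool),
      g = (x * y) ^ n * (bif e then x else 1) * (bif d then c else 1)) → ∃ (n : ℤ) (e d : Bool),
      y * g = (x * y) ^ n * (bif e then x else 1) * (bif d then c else 1) := by
    intro g hg
    have := sx _ (sr g hg)
    rwa [mul_assoc x y g, ← mul_assoc x x, hx, one_mul] at this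
  induction hg using Subgroup.closure_induction_left with
  | one => exact ⟨0, false, false, by simp⟩
  | mul_left w hw g _ ih =>
    rcases hw with rfl | rfl | rfl
    exacts [sx g ih, sy g ih, sc g ih]
  | inv_mul_cancel w hw g _ ih =>
    rcases hw with rfl | rfl | rfl
    · rw [ix]; exact sx g ih
    · rw [iy]; exact sy g ih
    · rw [ic]; exact sc g ih

/-- The effect of a power of a permutation on a coordinate that is flipped (if `b`) or preserved. -/
lemma xor_zpow {X : Type*} {σ : Equiv.Perm X} {φ : X → Bool} {b : Bool}
    (h : ∀ x, φ (σ x) = (φ x ^^ b)) (n : ℤ) (x : X) :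
    φ ((σ ^ n) x) = (φ x ^^ (b && decide (Odd n))) := by
  have hinv : ∀ x, φ (σ⁻¹ x) = (φ x ^^ b) := fun x => by
    have := h (σ⁻¹ x)
    rw [show σ (σ⁻¹ x) = x from σ.apply_symm_apply x] at this
    rw [this, Bool.xor_assoc, Bool.xor_self, Bool.xor_false]
  induction n with
  | zero => simp
  | succ n ih =>
    rw [add_comm, zpow_add, zpow_one, Equiv.Perm.mul_apply, h, ih]
    have : decide (Odd (1 + (n : ℤ))) = !decide (Odd (n : ℤ)) := by
      rw [← decide_not, decide_eq_decide]
      grind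
    rw [this]
    cases b <;> cases decide (Odd (n : ℤ)) <;> simp
  | pred n ih =>
    rw [sub_eq_add_neg, add_comm, zpow_add, zpow_neg_one, Equiv.Perm.mul_apply, hinv, ih]
    have : decide (Odd (-1 + -(n : ℤ))) = !decide (Odd (-(n : ℤ))) := by
      rw [← decide_not, decide_eq_decide]
      grind
    rw [this]
    cases b <;> cases decide (Odd (-(n : ℤ))) <;> simp

variable {z p : ℕ}

/-- A permutation of the coset model fixes a coset of the stabilizer part, up to the group of the
pairings. -/
def FixesComponent (σ : Equiv.Perm (CosetModel z p)) : Prop :=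
  ∃ u v t, σ (u, t) = (v, t)

lemma FixesComponent.conj {σ τ : Equiv.Perm (CosetModel z p)} (hσ : FixesComponent σ)
    (hτ : ∀ u, Commute τ (leftMul u)) : FixesComponent (τ * σ * τ⁻¹) := by
  obtain ⟨u, v, t, h⟩ := hσ
  obtain ⟨⟨u', t'⟩, hx⟩ : ∃ x, τ (u, t) = x := ⟨_, rfl⟩
  refine ⟨u', v * u⁻¹ * u', t', ?_⟩
  have h1 : τ (v, t) = leftMul (v * u⁻¹) (τ (u, t)) := by
    have := congrArg (fun s : Equiv.Perm _ => s (u, t)) (hτ (v * u⁻¹)).eq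
    simp only [Equiv.Perm.mul_apply, leftMul_apply] at this
    rw [← this, inv_mul_cancel_right]
  rw [Equiv.Perm.mul_apply, Equiv.Perm.mul_apply, ← hx,
    show τ⁻¹ (τ (u, t)) = (u, t) from τ.symm_apply_apply _, h, h1, hx, leftMul_apply]

variable {G : Type*} [Group G] (T : G →* Equiv.Perm (CosetModel z p)) {x y c : G}

/-- Stabilizers generated by `b⁰`, `b¹` and a commuting reflection which preserves `e` and `f` but
flips `d`. -/
lemma eq_one_of_rot (h4 : (4 * p : ZMod z) = 1) (hx : x * x = 1) (hy : y * y = 1)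
    (hc : c * c = 1) (hcx : c * x = x * c) (hcy : c * y = y * c) (hxy : (x * y) ^ (2 * z) = 1)
    (Tx : T x = permR0 z p) (Ty : T y = permR1 z p)
    (Tc : ∀ w i e f d, ∃ w' i', T c (w, i, e, f, d) = (w', i', e, f, !d)) {g : G}
    (hg : g ∈ Subgroup.closure {x, y, c}) (hfix : FixesComponent (T g)) : g = 1 := by
  obtain ⟨n, e, d, rfl⟩ := exists_normal_form hx hy hc hcx hcy hg
  obtain ⟨u, v, ⟨i, e1, f1, d1⟩, hfix⟩ := hfix
  rw [map_mul, map_mul, map_zpow, map_mul, Tx, Ty, Equiv.Perm.mul_apply,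
    Equiv.Perm.mul_apply] at hfix
  obtain ⟨w', i', hw'⟩ : ∃ w' i', T (bif d then c else 1) (u, i, e1, f1, d1) =
      (w', i', e1, f1, d1 ^^ d) := by
    cases d
    · exact ⟨u, i, by simp⟩
    · obtain ⟨w', i', h⟩ := Tc u i e1 f1 d1
      exact ⟨w', i', by simpa using h⟩
  have hw2 : T (bif e then x else 1) (w', i', e1, f1, d1 ^^ d) =
      (w', i', e1 ^^ e, f1, d1 ^^ d) := by
    cases e
    · simp
    · simp [Tx, permR0_apply, mulR0]
  rw [hw', hw2] at hfix
  have kd := xor_zpow (σ := permR0 z p * permR1 z p) (φ := fun x => x.2.2.2.2) (b := false)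
    (fun ⟨w, i, e, f, d⟩ => by rw [permR_apply]; simp) n (w', i', e1 ^^ e, f1, d1 ^^ d)
  have ke := xor_zpow (σ := permR0 z p * permR1 z p) (φ := fun x => x.2.2.1) (b := false)
    (fun ⟨w, i, e, f, d⟩ => by rw [permR_apply]; simp) n (w', i', e1 ^^ e, f1, d1 ^^ d)
  have kf := xor_zpow (σ := permR0 z p * permR1 z p) (φ := fun x => x.2.2.2.1) (b := true)
    (fun ⟨w, i, e, f, d⟩ => by rw [permR_apply]; simp) n (w', i', e1 ^^ e, f1, d1 ^^ d)
  rw [hfix] at kd ke kf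
  have hd : d = false := by revert kd; cases d <;> cases d1 <;> simp
  have he : e = false := by revert ke; cases e <;> cases e1 <;> simp
  have hn : Even n := by
    rw [← Int.not_odd_iff_even]
    intro hn
    revert kf
    cases f1 <;> simp [hn]
  subst hd he
  obtain ⟨m, rfl⟩ := hn
  rw [← two_mul, permR_sq_zpow h4] at hfix
  simp only [cond_false, map_one, Equiv.Perm.one_apply, Prod.mk.injEq] at hw'
  obtain ⟨-, rfl, -⟩ := hw'
  have hm : (m : ZMod z) = 0 := by
    have := congrArg (fun x => x.2.1) hfix
    simp only at this
    revert this
    cases (e1 ^^ false) <;> simp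
  obtain ⟨k, rfl⟩ := (ZMod.intCast_zmod_eq_zero_iff_dvd m z).1 hm
  rw [cond_false, cond_false, mul_one, mul_one, show (z : ℤ) * k + z * k = ((2 * z : ℕ) : ℤ) * k by
    push_cast; ring, zpow_mul, zpow_natCast, hxy, one_zpow]

/-- Stabilizers generated by `b¹`, `b²` and `a₃`. -/
lemma eq_one_of_rot' (h4 : (4 * p : ZMod z) = 1) (hx : x * x = 1) (hy : y * y = 1)
    (hc : c * c = 1) (hcx : c * x = x * c) (hcy : c * y = y * c) (hxy : (x * y) ^ (2 * z) = 1)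
    (Tx : T x = permR1 z p) (Ty : T y = permH z p * permR1 z p * permH z p) (Tc : T c = permRa z p)
    {g : G} (hg : g ∈ Subgroup.closure {x, y, c}) (hfix : FixesComponent (T g)) : g = 1 := by
  have Ty2 : ∀ x, T y x = mulR2 z p x := fun x => by rw [Ty, permR2_apply]
  obtain ⟨n, e, d, rfl⟩ := exists_normal_form hx hy hc hcx hcy hg
  have key : ∀ (n : ℤ) (u v : PresentedCobwebGroup z p) (i : ZMod z) (e1 d1 : Bool),
      T ((x * y) ^ n) (u, i, e1, false, d1) = (v, i, e1, false, d1) → (x * y) ^ n = 1 := by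
    intro n u v i e1 d1 hfix
    rw [map_zpow] at hfix
    have ke := xor_zpow (σ := T (x * y)) (φ := fun x => x.2.2.1) (b := true)
      (fun ⟨w, i, e, f, d⟩ => by
        rw [map_mul, Equiv.Perm.mul_apply, Ty2, Tx, permR1_apply]
        cases f
        · rw [mulR2_false h4, mulR1]; simp
        · rw [mulR2_true h4, mulR1]; simp) n (u, i, e1, false, d1)
    rw [hfix] at ke
    have hn : Even n := by
      rw [← Int.not_odd_iff_even]
      intro hn
      revert ke
      cases e1 <;> simp [hn]
    obtain ⟨m, rfl⟩ := hn
    have main : ∀ (m : ℕ) u v, ((T (x * y)) ^ ((m : ℤ) + m)) (u, i, e1, false, d1) =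
        (v, i, e1, false, d1) → (m : ZMod z) = 0 := by
      intro m u v hfix
      rw [show (m : ℤ) + m = ((2 * m : ℕ) : ℤ) by push_cast; ring, zpow_natCast, map_mul, Tx, Ty,
        permR1_permR2_pow h4] at hfix
      have := congrArg (fun x => x.2.1) hfix
      simpa using this
    have hm : (m : ZMod z) = 0 := by
      rcases Int.le_total 0 m with h0 | h0
      · lift m to ℕ using h0
        exact_mod_cast main m u v hfix
      · obtain ⟨k, rfl⟩ : ∃ k : ℕ, m = -k := ⟨(-m).toNat, by omega⟩
        have := main k v u (by
          rw [← hfix, ← Equiv.Perm.mul_apply, ← zpow_add]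
          simp)
        simp [this]
    obtain ⟨k, rfl⟩ := (ZMod.intCast_zmod_eq_zero_iff_dvd m z).1 hm
    rw [show (z : ℤ) * k + z * k = ((2 * z : ℕ) : ℤ) * k by
      push_cast; ring, zpow_mul, zpow_natCast, hxy, one_zpow]
  obtain ⟨u, v, ⟨i, e1, f1, d1⟩, hfix⟩ := hfix
  have kf := xor_zpow (σ := T (x * y)) (φ := fun x => x.2.2.2.1) (b := false)
    (fun ⟨w, i, e, f, d⟩ => by
      rw [map_mul, Equiv.Perm.mul_apply, Ty2, Tx, permR1_apply]
      cases f
      · rw [mulR2_false h4, mulR1]; simp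
      · rw [mulR2_true h4, mulR1]; simp) n
    (T (bif e then x else 1) (T (bif d then c else 1) (u, i, e1, f1, d1)))
  have kd := xor_zpow (σ := T (x * y)) (φ := fun x => x.2.2.1 ^^ x.2.2.2.2) (b := false)
    (fun ⟨w, i, e, f, d⟩ => by
      rw [map_mul, Equiv.Perm.mul_apply, Ty2, Tx, permR1_apply]
      cases f
      · rw [mulR2_false h4, mulR1]; simp
      · rw [mulR2_true h4, mulR1]; simp) n
    (T (bif e then x else 1) (T (bif d then c else 1) (u, i, e1, f1, d1)))
  rw [map_mul, map_mul, Equiv.Perm.mul_apply, Equiv.Perm.mul_apply] at hfix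
  rw [← map_zpow, hfix] at kf kd
  have he : e = false := by
    revert kf
    cases e <;> cases d <;> cases f1 <;>
      simp [Tx, Tc, permR1_apply, permRa_apply, mulR1, mulRa]
  subst he
  have hd : d = false := by
    revert kd
    cases d <;> cases d1 <;> cases e1 <;>
      simp [Tc, permRa_apply, mulRa]
  subst hd
  simp only [cond_false, map_one, Equiv.Perm.one_apply] at hfix
  simp only [cond_false, mul_one]
  cases f1
  · exact key n u v i e1 d1 hfix
  · have hconj : (x * y) ^ (-n) = y * (x * y) ^ n * y⁻¹ := by
      rw [← conj_zpow, inv_eq_of_mul_eq_one_left hy, ← mul_assoc, mul_assoc, hy, mul_one, zpow_neg,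
        ← inv_zpow, mul_inv_rev, inv_eq_of_mul_eq_one_left hy, inv_eq_of_mul_eq_one_left hx]
    have h1 := mulR2_true h4 u i e1 d1
    have h2 : T ((x * y) ^ (-n)) (mulR2 z p (u, i, e1, true, d1)) =
        mulR2 z p (v, i, e1, true, d1) := by
      rw [hconj, map_mul, map_mul, inv_eq_of_mul_eq_one_left hy, Equiv.Perm.mul_apply,
        Equiv.Perm.mul_apply, Ty2 (mulR2 _ _ _), mulR2_invol, hfix, Ty2]
    rw [h1, mulR2_true h4] at h2
    have := key _ _ _ _ _ _ h2
    rwa [zpow_neg, inv_eq_one] at this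

/-- Stabilizers generated by `b⁰`, `b²` and `a₃`. -/
lemma eq_one_of_comm (h4 : (4 * p : ZMod z) = 1) (hx : x * x = 1) (hy : y * y = 1)
    (hc : c * c = 1) (hcx : c * x = x * c) (hcy : c * y = y * c) (hxy : (x * y) ^ 2 = 1)
    (Tx : T x = permR0 z p) (Ty : T y = permH z p * permR1 z p * permH z p) (Tc : T c = permRa z p)
    {g : G} (hg : g ∈ Subgroup.closure {x, y, c}) (hfix : FixesComponent (T g)) : g = 1 := by
  have Ty2 : ∀ x, T y x = mulR2 z p x := fun x => by rw [Ty, permR2_apply]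
  obtain ⟨n, e, d, rfl⟩ := exists_normal_form hx hy hc hcx hcy hg
  obtain ⟨u, v, ⟨i, e1, f1, d1⟩, hfix⟩ := hfix
  have kf := xor_zpow (σ := T (x * y)) (φ := fun x => x.2.2.2.1) (b := true)
    (fun ⟨w, i, e, f, d⟩ => by
      rw [map_mul, Equiv.Perm.mul_apply, Ty2, Tx, permR0_apply]
      cases f
      · rw [mulR2_false h4, mulR0]; simp
      · rw [mulR2_true h4, mulR0]; simp) n
    (T (bif e then x else 1) (T (bif d then c else 1) (u, i, e1, f1, d1)))
  rw [map_mul, map_mul, Equiv.Perm.mul_apply, Equiv.Perm.mul_apply] at hfix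
  rw [← map_zpow, hfix] at kf
  have hn : Even n := by
    rw [← Int.not_odd_iff_even]
    intro hn
    revert kf
    cases e <;> cases d <;> cases f1 <;>
      simp [Tx, Tc, permR0_apply, permRa_apply, mulR0, mulRa, hn]
  obtain ⟨m, rfl⟩ := hn
  have h1 : (x * y) ^ (m + m) = 1 := by
    rw [← two_mul, zpow_mul, show (x * y) ^ (2 : ℤ) = 1 by exact_mod_cast hxy, one_zpow]
  rw [h1, map_one, Equiv.Perm.one_apply] at hfix
  rw [h1, one_mul]
  revert hfix
  cases e <;> cases d <;> simp [Tx, Tc, permR0_apply, permRa_apply, mulR0, mulRa]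

end

section

/-! ### Points of the orthoscheme and the coset model -/

section Exclusion

variable {z p : ℕ}

/-- The sets of mirrors of the complete orthoscheme that have a point in common do not contain
any of these. -/
structure HasCommonPoint (S : Set (Fin 6)) : Prop where
  b012 : ¬(1 ∈ S ∧ 2 ∈ S ∧ 3 ∈ S)
  b123 : ¬(2 ∈ S ∧ 3 ∈ S ∧ 4 ∈ S)
  b0a0 : ¬(1 ∈ S ∧ 5 ∈ S)
  b3a3 : ¬(0 ∈ S ∧ 4 ∈ S)
  a0a3 : ¬(0 ∈ S ∧ 5 ∈ S)

/-- The maximal sets of mirrors with a common point belong to the vertices of the complete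
orthoscheme; those in the second row are the images of the first row under the half-turn. -/
lemma HasCommonPoint.cases {S : Set (Fin 6)} (hS : HasCommonPoint S) :
    (S ⊆ {1, 2, 4} ∨ S ⊆ {1, 2, 0} ∨ S ⊆ {2, 3, 0} ∨ S ⊆ {1, 3, 0}) ∨
    (S ⊆ {4, 3, 1} ∨ S ⊆ {4, 3, 5} ∨ S ⊆ {3, 2, 5} ∨ S ⊆ {4, 2, 5}) := by
  have sub : ∀ {a b c : Fin 6} (T : Set (Fin 6)), a ∉ S → b ∉ S → c ∉ S →
      (∀ i, i = a ∨ i = b ∨ i = c ∨ i ∈ T) → S ⊆ T := by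
    intro a b c T ha hb hc hT i hi
    rcases hT i with rfl | rfl | rfl | h
    exacts [absurd hi ha, absurd hi hb, absurd hi hc, h]
  have all : ∀ {q : Fin 6 → Prop}, q 0 → q 1 → q 2 → q 3 → q 4 → q 5 → ∀ i, q i := by
    intro q h0 h1 h2 h3 h4 h5 i
    fin_cases i <;> assumption
  obtain ⟨h1, h2, h3, h4, h5⟩ := hS
  by_cases m0 : (0 : Fin 6) ∈ S
  · have n4 : (4 : Fin 6) ∉ S := fun h => h4 ⟨m0, h⟩
    have n5 : (5 : Fin 6) ∉ S := fun h => h5 ⟨m0, h⟩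
    by_cases m1 : (1 : Fin 6) ∈ S
    · by_cases m2 : (2 : Fin 6) ∈ S
      · exact Or.inl (Or.inr (Or.inl (sub _ n4 n5 (fun h => h1 ⟨m1, m2, h⟩)
          (by apply all <;> simp))))
      · exact Or.inl (Or.inr (Or.inr (Or.inr (sub _ n4 n5 m2 (by apply all <;> simp)))))
    · exact Or.inl (Or.inr (Or.inr (Or.inl (sub _ n4 n5 m1 (by apply all <;> simp)))))
  · by_cases m5 : (5 : Fin 6) ∈ S
    · have n1 : (1 : Fin 6) ∉ S := fun h => h3 ⟨h, m5⟩
      by_cases m3 : (3 : Fin 6) ∈ S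
      · by_cases m4 : (4 : Fin 6) ∈ S
        · exact Or.inr (Or.inr (Or.inl (sub _ m0 n1 (fun h => h2 ⟨h, m3, m4⟩)
            (by apply all <;> simp))))
        · exact Or.inr (Or.inr (Or.inr (Or.inl (sub _ m0 n1 m4 (by apply all <;> simp)))))
      · exact Or.inr (Or.inr (Or.inr (Or.inr (sub _ m0 n1 m3 (by apply all <;> simp)))))
    · by_cases m2 : (2 : Fin 6) ∈ S
      · by_cases m3 : (3 : Fin 6) ∈ S
        · refine Or.inl (Or.inr (Or.inr (Or.inl fun i hi => ?_)))
          have n1 : i ≠ 1 := by rintro rfl; exact h1 ⟨hi, m2, m3⟩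
          have n4 : i ≠ 4 := by rintro rfl; exact h2 ⟨m2, m3, hi⟩
          have n5 : i ≠ 5 := by rintro rfl; exact m5 hi
          revert n1 n4 n5
          clear hi
          revert i
          apply all <;> simp
        · exact Or.inl (Or.inl (sub _ m0 m5 m3 (by apply all <;> simp)))
      · exact Or.inr (Or.inl (sub _ m0 m5 m2 (by apply all <;> simp)))

lemma simple_sq (z : ℕ) (i : Fin 6) :
    (orthoSystem z).simple i * (orthoSystem z).simple i = 1 := (orthoSystem z).simple_mul_simple_self i

lemma simple_comm {i j : Fin 6} (hij : orthoMatrix z i j = 2) :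
    (orthoSystem z).simple i * (orthoSystem z).simple j =
      (orthoSystem z).simple j * (orthoSystem z).simple i := by
  have h := (orthoSystem z).simple_mul_simple_pow i j
  rw [hij, pow_two, mul_eq_one_iff_eq_inv, mul_inv_rev, (orthoSystem z).inv_simple,
    (orthoSystem z).inv_simple] at h
  exact h

lemma simple_pow {i j : Fin 6} {m : ℕ} (hij : orthoMatrix z i j = m) :
    ((orthoSystem z).simple i * (orthoSystem z).simple j) ^ m = 1 := by
  rw [← hij]; exact (orthoSystem z).simple_mul_simple_pow i j

/-- The stabilizers of the vertices act on the coset model without fixing cosets. The map `σ` is the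
identity or the action of the half-turn on the mirrors, which covers the two halves of the
orthoscheme at the same time. -/
lemma eq_one_of_cases (h4 : (4 * p : ZMod z) = 1) (hz0 : z ≠ 0)
    (σ : Fin 6 → Fin 6) (hσ : σ = id ∨ σ = Fin.rev)
    (T : (orthoMatrix z).Group →* Equiv.Perm (CosetModel z p))
    (hT : ∀ i, T ((orthoSystem z).simple (σ i)) =
      OrthoschemeRelations.mirrors (permR0 z p) (permR1 z p) (permRa z p) (permH z p) i)
    (S : Set (Fin 6)) (hS : S ⊆ σ '' {1, 2, 4} ∨ S ⊆ σ '' {1, 2, 0} ∨ S ⊆ σ '' {2, 3, 0} ∨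
      S ⊆ σ '' {1, 3, 0}) {w : (orthoMatrix z).Group}
    (hw : w ∈ Subgroup.closure ((orthoSystem z).simple '' S)) (hfix : FixesComponent (T w)) :
    w = 1 := by
  have hM : ∀ i j, orthoMatrix z (σ i) (σ j) = orthoMatrix z i j := by
    intro i j
    rcases hσ with rfl | rfl
    · rfl
    · rw [orthoMatrix_apply hz0, orthoMatrix_apply hz0]
      fin_cases i <;> fin_cases j <;> rfl
  have cl : ∀ a b c : Fin 6, S ⊆ σ '' {a, b, c} → w ∈ Subgroup.closure
      {(orthoSystem z).simple (σ a), (orthoSystem z).simple (σ b), (orthoSystem z).simple (σ c)} := by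
    intro a b c h
    refine Subgroup.closure_mono ?_ hw
    rintro _ ⟨i, hi, rfl⟩
    obtain ⟨j, hj, rfl⟩ := h hi
    rcases hj with rfl | rfl | rfl <;> simp
  have hm : ∀ {i j : Fin 6} {n : ℕ}, (!![1, 2, 2, 2, 0, 0;
     2, 1, 2 * z, 2, 2, 0;
     2, 2 * z, 1, 2 * z, 2, 2;
     2, 2, 2 * z, 1, 2 * z, 2;
     0, 2, 2, 2 * z, 1, 2;
     0, 0, 2, 2, 2, 1] : Matrix (Fin 6) (Fin 6) ℕ) i j = n → orthoMatrix z (σ i) (σ j) = n := by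
    intro i j n h
    rw [hM, orthoMatrix_apply hz0, h]
  rcases hS with h | h | h | h
  · refine eq_one_of_rot T h4 (simple_sq _ _) (simple_sq _ _) (simple_sq _ _)
      (simple_comm (hm rfl)) (simple_comm (hm rfl)) (simple_pow (hm rfl)) (hT 1) (hT 2) ?_
      (cl _ _ _ h) hfix
    intro w i e f d
    exact ⟨_, _, (congrArg (fun s : Equiv.Perm _ => s (w, i, e, f, d)) (hT 4)).trans
      ((permR3_apply _).trans (mulR3_apply w i e f d))⟩
  · refine eq_one_of_rot T h4 (simple_sq _ _) (simple_sq _ _) (simple_sq _ _)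
      (simple_comm (hm rfl)) (simple_comm (hm rfl)) (simple_pow (hm rfl)) (hT 1) (hT 2) ?_
      (cl _ _ _ h) hfix
    intro w i e f d
    exact ⟨_, _, (congrArg (fun s : Equiv.Perm _ => s (w, i, e, f, d)) (hT 0))⟩
  · exact eq_one_of_rot' T h4 (simple_sq _ _) (simple_sq _ _) (simple_sq _ _)
      (simple_comm (hm rfl)) (simple_comm (hm rfl)) (simple_pow (hm rfl)) (hT 2) (hT 3) (hT 0)
      (cl _ _ _ h) hfix
  · exact eq_one_of_comm T h4 (simple_sq _ _) (simple_sq _ _) (simple_sq _ _)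
      (simple_comm (hm rfl)) (simple_comm (hm rfl)) (simple_pow (hm rfl)) (hT 1) (hT 3) (hT 0)
      (cl _ _ _ h) hfix

lemma commute_permH (u : PresentedCobwebGroup z p) : Commute (permH z p) (leftMul u) :=
  OrthoschemeRelations.commute_leftMul (x := (permH z p, permH z p)) (r0 := permR0 z p)
    (r1 := permR1 z p) (ra := permRa z p) OrthoschemeRelations.pair_h u

/-- An element of the stabilizer of a point of the orthoscheme that fixes a coset of the coset model
is trivial. -/
theorem eq_one_of_fixesComponent (h4 : (4 * p : ZMod z) = 1) (hz0 : z ≠ 0) {S : Set (Fin 6)}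
    (hS : HasCommonPoint S) {w : (orthoMatrix z).Group}
    (hw : w ∈ Subgroup.closure ((orthoSystem z).simple '' S))
    (hfix : FixesComponent ((permRelations h4 hz0).hom hz0 w)) : w = 1 := by
  rcases hS.cases with h | h
  · exact eq_one_of_cases h4 hz0 id (Or.inl rfl) _ (fun i => (permRelations h4 hz0).hom_simple hz0 i)
      S (by simpa only [Set.image_id] using h) hw hfix
  · have himg : ∀ a b c : Fin 6, Fin.rev '' {a, b, c} = {Fin.rev a, Fin.rev b, Fin.rev c} :=
      fun a b c => by rw [Set.image_insert_eq, Set.image_pair]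
    refine eq_one_of_cases h4 hz0 Fin.rev (Or.inr rfl)
      ((MulAut.conj (permH z p)).toMonoidHom.comp ((permRelations h4 hz0).hom hz0)) (fun i => ?_)
      S (by simp only [himg]; exact h) hw (hfix.conj commute_permH)
    rw [MonoidHom.comp_apply, (permRelations h4 hz0).hom_simple, ← (permRelations h4 hz0).mirrors_rev]
    change permH z p * _ * (permH z p)⁻¹ = _
    rw [(permRelations h4 hz0).h_inv, (permRelations h4 hz0).conj_conj]

/-- The elements of the stabilizer of a point on the axis of the half-turn that interchange the two
sides do not fix any coset of the coset model. -/
theorem not_fixesComponent (h4 : (4 * p : ZMod z) = 1) (hz0 : z ≠ 0) {S : Set (Fin 6)}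
    (hS : HasCommonPoint S) (hrev : ∀ i ∈ S, Fin.rev i ∈ S) {w : (orthoMatrix z).Group}
    (hw : w ∈ Subgroup.closure ((orthoSystem z).simple '' S)) :
    ¬FixesComponent ((permRelations h4 hz0).hom hz0 w * permH z p) := by
  set T := (permRelations h4 hz0).hom hz0 with hTdef
  have pres : ∀ φ : CosetModel z p → Bool, (∀ i ∈ S, ∀ x,
      φ (OrthoschemeRelations.mirrors (permR0 z p) (permR1 z p) (permRa z p) (permH z p) i x) = φ x) →
      ∀ x, φ (T w x) = φ x := by
    intro φ hφ
    induction hw using Subgroup.closure_induction_left with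
    | one => simp
    | mul_left y hy g _ ih =>
      obtain ⟨i, hi, rfl⟩ := hy
      intro x
      rw [map_mul, Equiv.Perm.mul_apply, hTdef, OrthoschemeRelations.hom_simple, hφ i hi, ih]
    | inv_mul_cancel y hy g _ ih =>
      obtain ⟨i, hi, rfl⟩ := hy
      intro x
      rw [(orthoSystem z).inv_simple, map_mul, Equiv.Perm.mul_apply, hTdef,
        OrthoschemeRelations.hom_simple, hφ i hi, ih]
  have m0 : (0 : Fin 6) ∉ S := fun h => hS.a0a3 ⟨h, hrev _ h⟩
  have m5 : (5 : Fin 6) ∉ S := fun h => hS.a0a3 ⟨hrev _ h, h⟩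
  -- the half-turn changes the coordinate `f` and preserves the sum of the coordinates `e` and `d`
  have hf : ∀ x : CosetModel z p, (permH z p x).2.2.2.1 = !x.2.2.2.1 := by
    rintro ⟨w, i, e, f, d⟩
    cases e <;> cases f <;> cases d <;> rfl
  have hed : ∀ x : CosetModel z p, ((permH z p x).2.2.1 ^^ (permH z p x).2.2.2.2) =
      (x.2.2.1 ^^ x.2.2.2.2) := by
    rintro ⟨w, i, e, f, d⟩
    cases e <;> cases f <;> cases d <;> rfl
  rintro ⟨u, v, t, hfix⟩
  rw [Equiv.Perm.mul_apply] at hfix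
  by_cases m2 : (2 : Fin 6) ∈ S
  · have m3 : (3 : Fin 6) ∈ S := hrev _ m2
    -- the reflections `r₁` and `r₂` preserve the sum of `e`, `f` and `d`, but `h` does not
    have := pres (fun x => x.2.2.2.1 ^^ (x.2.2.1 ^^ x.2.2.2.2)) (by
      rintro i hi ⟨w, j, e, f, d⟩
      fin_cases i
      · exact absurd hi m0
      · exact absurd ⟨hi, m2, m3⟩ hS.b012
      · cases e <;> cases f <;> cases d <;> rfl
      · have key : ∀ y : CosetModel z p, mulR2 z p (w, j, e, f, d) = y →
            (y.2.2.2.1 ^^ (y.2.2.1 ^^ y.2.2.2.2)) = (f ^^ (e ^^ d)) := by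
          rintro y rfl
          cases f
          · rw [mulR2_false h4]; cases e <;> cases d <;> rfl
          · rw [mulR2_true h4]; cases e <;> cases d <;> rfl
        exact key _ rfl
      · exact absurd ⟨m2, m3, hi⟩ hS.b123
      · exact absurd hi m5) (permH z p (u, t))
    rw [hfix] at this
    simp only [hf, hed] at this
    revert this
    cases t.2.2.1 <;> simp
  · have m3 : (3 : Fin 6) ∉ S := fun h => m2 (hrev _ h)
    -- the reflections `r₀` and `r₃` preserve `f`, but `h` does not
    have := pres (fun x => x.2.2.2.1) (by
      rintro i hi ⟨w, j, e, f, d⟩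
      fin_cases i
      · exact absurd hi m0
      · rfl
      · exact absurd hi m2
      · exact absurd hi m3
      · have key : ∀ y, mulH z p (mulR0 z p (mulH z p (w, j, e, f, d))) = y → y.2.2.2.1 = f := by
          rintro y rfl
          rw [mulR3_apply]
        exact key _ rfl
      · exact absurd hi m5) (permH z p (u, t))
    rw [hfix] at this
    simp only [hf] at this
    revert this
    cases t.2.2.1 <;> simp

end Exclusion

end

section

/-! ### The reflection representation of the orthoscheme -/

variable {z : ℕ}

lemma two_cz_sq_pos (hz : 7 ≤ z) : 0 < 2 * cz z ^ 2 - 1 := by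
  have := cz_sq_gt hz; linarith

/-- The square `⟨A₃, A₃⟩ = ⟨A₀, A₀⟩` of an outer vertex. -/
def outerSq (z : ℕ) : ℝ := (2 * cz z ^ 2 - 1) / ez z

lemma outerSq_pos (hz : 7 ≤ z) : 0 < outerSq z := div_pos (two_cz_sq_pos hz) (ez_pos hz)

lemma outerSq_le_one (hz : 7 ≤ z) : outerSq z ≤ 1 := by
  rw [outerSq, div_le_one (ez_pos hz), ez]
  nlinarith [cz_sq_lt hz, sq_nonneg (cz z)]

lemma form_A3_A3 (hz : 7 ≤ z) : form z (vertexA 3) (vertexA 3) = outerSq z := by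
  rw [(form_vertexA hz _).2.2, outerSq]; simp [vertexA]

lemma form_A0_A0 (hz : 7 ≤ z) : form z (vertexA 0) (vertexA 0) = outerSq z := by
  rw [(form_vertexA hz _).1, outerSq]; simp [vertexA]

lemma form_A3_A0 (hz : 7 ≤ z) : form z (vertexA 3) (vertexA 0) = -(cz z ^ 3) / ez z := by
  rw [(form_vertexA hz _).1]; simp [vertexA]

lemma form_A2_A3 (hz : 7 ≤ z) :
    form z (vertexA 2) (vertexA 3) = -(cz z * (1 - cz z ^ 2)) / ez z := by
  rw [(form_vertexA hz _).2.2]; simp [vertexA]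

lemma form_facePole_facePole (hz : 7 ≤ z) (i j : Fin 4) :
    form z (facePole z i) (facePole z j) = coxeterSchlafli z i j := by
  rw [form_facePole hz]; rfl

/-- The inward unit normals of the faces of the complete orthoscheme. -/
def root (z : ℕ) : Fin 6 → V4 :=
  ![-(Real.sqrt (outerSq z))⁻¹ • vertexA 3, facePole z 0, facePole z 1, facePole z 2, facePole z 3,
    -(Real.sqrt (outerSq z))⁻¹ • vertexA 0]

lemma sqrt_outerSq_pos (hz : 7 ≤ z) : 0 < Real.sqrt (outerSq z) := Real.sqrt_pos.2 (outerSq_pos hz)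

lemma form_root_zero (hz : 7 ≤ z) : form z (root z 0) (root z 0) = 1 := by
  change form z (-(Real.sqrt (outerSq z))⁻¹ • vertexA 3) (-(Real.sqrt (outerSq z))⁻¹ • vertexA 3) = 1
  have := (sqrt_outerSq_pos hz).ne'
  rw [form_smul_left, form_smul_right, form_A3_A3 hz]
  field_simp
  exact (Real.sq_sqrt (outerSq_pos hz).le).symm

lemma form_root_five (hz : 7 ≤ z) : form z (root z 5) (root z 5) = 1 := by
  change form z (-(Real.sqrt (outerSq z))⁻¹ • vertexA 0) (-(Real.sqrt (outerSq z))⁻¹ • vertexA 0) = 1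
  have := (sqrt_outerSq_pos hz).ne'
  rw [form_smul_left, form_smul_right, form_A0_A0 hz]
  field_simp
  exact (Real.sq_sqrt (outerSq_pos hz).le).symm

lemma form_root_zero_five (hz : 7 ≤ z) : form z (root z 0) (root z 5) ≤ -1 := by
  change form z (-(Real.sqrt (outerSq z))⁻¹ • vertexA 3) (-(Real.sqrt (outerSq z))⁻¹ • vertexA 0) ≤ -1
  have h1 : (Real.sqrt (outerSq z))⁻¹ * (Real.sqrt (outerSq z))⁻¹ = (outerSq z)⁻¹ := by
    rw [← mul_inv, Real.mul_self_sqrt (outerSq_pos hz).le]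
  have h2 := ez_pos hz
  have h3 := two_cz_sq_pos hz
  rw [form_smul_left, form_smul_right, form_A3_A0 hz, ← mul_assoc, neg_mul_neg, h1, outerSq, inv_div,
    div_mul_div_comm, div_le_iff₀ (by positivity)]
  have : 0 < (1 - cz z) * (1 + cz z - cz z ^ 2) :=
    mul_pos (by linarith [cz_lt_one hz]) (by nlinarith [cz_gt hz, cz_sq_lt hz])
  nlinarith

lemma vertexA_apply (i j : Fin 4) : (vertexA i : V4) j = if j = i then 1 else 0 := by
  simp [vertexA, Pi.single_apply]

lemma form_root_pole (hz : 7 ≤ z) (X : V4) (i : Fin 4) : form z X (root z i.succ.castSucc) = X i := by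
  fin_cases i <;> exact form_facePole hz X _

lemma root_gram_apply (hz : 7 ≤ z) (i : Fin 6) (j : Fin 4)
    (h : orthoMatrix z i j.succ.castSucc ≠ 0) :
    root z i j = -Real.cos (Real.pi / orthoMatrix z i j.succ.castSucc) := by
  have hz0 : z ≠ 0 := by omega
  have e : -Real.cos (Real.pi / (2 * z)) = -cz z := rfl
  rw [orthoMatrix_apply hz0] at h ⊢
  fin_cases i <;> fin_cases j <;> first
    | exact absurd rfl h
    | simp [root, vertexA, facePole, coxeterSchlafli_eq, cz]

lemma root_gram_apply_inf (hz : 7 ≤ z) (i : Fin 6) (j : Fin 4)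
    (h : orthoMatrix z i j.succ.castSucc = 0) : root z i j ≤ -1 := by
  have hz0 : z ≠ 0 := by omega
  have h1 : Real.sqrt (outerSq z) ≤ 1 := Real.sqrt_le_one.2 (outerSq_le_one hz)
  have := (one_le_inv₀ (sqrt_outerSq_pos hz)).2 h1
  rw [orthoMatrix_apply hz0] at h
  fin_cases i <;> fin_cases j <;> simp [hz0] at h
  · simpa [root, vertexA] using this
  · simpa [root, vertexA] using this

lemma forall_fin_six {q : Fin 6 → Prop} (h0 : q 0) (h5 : q 5)
    (h : ∀ j : Fin 4, q j.succ.castSucc) (i : Fin 6) : q i := by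
  fin_cases i
  exacts [h0, h 0, h 1, h 2, h 3, h5]

lemma form_root_gram (hz : 7 ≤ z) : ∀ j i : Fin 6, orthoMatrix z i j ≠ 0 →
    form z (root z i) (root z j) = -Real.cos (Real.pi / orthoMatrix z i j) := by
  have hz0 : z ≠ 0 := by omega
  have pole : ∀ (j : Fin 4) (i : Fin 6), orthoMatrix z i j.succ.castSucc ≠ 0 →
      form z (root z i) (root z j.succ.castSucc) =
        -Real.cos (Real.pi / orthoMatrix z i j.succ.castSucc) := fun j i h => by
    rw [form_root_pole hz]; exact root_gram_apply hz i j h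
  have symm : ∀ (k : Fin 6) (j : Fin 4), orthoMatrix z j.succ.castSucc k ≠ 0 →
      form z (root z j.succ.castSucc) (root z k) =
        -Real.cos (Real.pi / orthoMatrix z j.succ.castSucc k) := fun k j h => by
    rw [(orthoMatrix z).symmetric] at h ⊢
    rw [form_comm hz]
    exact pole j k h
  refine forall_fin_six (forall_fin_six (fun _ => ?_) (fun h => ?_) (symm 0))
    (forall_fin_six (fun h => ?_) (fun _ => ?_) (symm 5)) pole
  · rw [form_root_zero hz, (orthoMatrix z).diagonal]; simp
  · exact absurd (orthoMatrix_apply hz0 _ _) h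
  · exact absurd (orthoMatrix_apply hz0 _ _) h
  · rw [form_root_five hz, (orthoMatrix z).diagonal]; simp

lemma form_root_gram_inf (hz : 7 ≤ z) : ∀ j i : Fin 6, orthoMatrix z i j = 0 →
    form z (root z i) (root z j) ≤ -1 := by
  have pole : ∀ (j : Fin 4) (i : Fin 6), orthoMatrix z i j.succ.castSucc = 0 →
      form z (root z i) (root z j.succ.castSucc) ≤ -1 := fun j i h => by
    rw [form_root_pole hz]; exact root_gram_apply_inf hz i j h
  have symm : ∀ (k : Fin 6) (j : Fin 4), orthoMatrix z j.succ.castSucc k = 0 →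
      form z (root z j.succ.castSucc) (root z k) ≤ -1 := fun k j h => by
    rw [(orthoMatrix z).symmetric] at h
    rw [form_comm hz]
    exact pole j k h
  refine forall_fin_six (forall_fin_six (fun h => ?_) (fun _ => ?_) (symm 0))
    (forall_fin_six (fun _ => form_root_zero_five hz) (fun h => ?_) (symm 5)) pole
  · rw [(orthoMatrix z).diagonal] at h; exact absurd h one_ne_zero
  · rw [form_comm hz]; exact form_root_zero_five hz
  · rw [(orthoMatrix z).diagonal] at h; exact absurd h one_ne_zero

lemma halfTurn_facePole (i : Fin 4) : halfTurn (facePole z i) = facePole z (Fin.rev i) := by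
  ext j
  rw [halfTurn_apply, facePole, facePole, coxeterSchlafli_eq]
  fin_cases i <;> fin_cases j <;> rfl

lemma halfTurn_vertexA (i : Fin 4) : halfTurn (vertexA i) = vertexA (Fin.rev i) := by
  ext j
  rw [halfTurn_apply, vertexA_apply, vertexA_apply]
  congr 1
  rw [Fin.rev_eq_iff]

lemma halfTurn_mul_self : halfTurn * halfTurn = 1 := by
  ext X j
  simp [halfTurn_apply]

/-- Reflections are conjugated by isometries. -/
lemma conj_reflect {g : V4 ≃ₗ[ℝ] V4} (hg : ∀ X Y : V4, form z (g X) (g Y) = form z X Y) {U : V4}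
    (hU : form z U U ≠ 0) : g * reflect z U * g⁻¹ = reflect z (g U) := by
  ext1 X
  have h1 : form z (g⁻¹ X) U = form z X (g U) := by rw [← hg, apply_inv_self]
  rw [LinearEquiv.mul_apply, LinearEquiv.mul_apply, reflect_apply z hU,
    reflect_apply z (by rwa [hg]), hg, map_sub, map_smul, apply_inv_self, h1]

lemma reflect_comm (hz : 7 ≤ z) {U V : V4} (hU : form z U U ≠ 0) (hV : form z V V ≠ 0)
    (hUV : form z U V = 0) : reflect z U * reflect z V = reflect z V * reflect z U := by
  have h := conj_reflect (fun X Y => form_reflect hz hU X Y) hV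
  have e : reflect z U V = V := by
    rw [reflect_apply z hU, form_comm hz, hUV]; simp
  rw [e, mul_inv_eq_iff_eq_mul] at h
  exact h

end

section

/-! ### The extended reflection group -/

variable {z : ℕ}

lemma halfTurn_conj_reflect (hz : 7 ≤ z) {U : V4} (hU : form z U U ≠ 0) :
    halfTurn * reflect z U * halfTurn = reflect z (halfTurn U) := by
  have h : (halfTurn : V4 ≃ₗ[ℝ] V4)⁻¹ = halfTurn := inv_eq_of_mul_eq_one_left halfTurn_mul_self
  have := conj_reflect (form_halfTurn hz) hU
  rwa [h] at this

lemma form_facePole_self (hz : 7 ≤ z) (i : Fin 4) : form z (facePole z i) (facePole z i) = 1 := by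
  rw [form_facePole_facePole hz, coxeterSchlafli_eq]; fin_cases i <;> rfl

lemma facePole_ne (hz : 7 ≤ z) (i : Fin 4) : form z (facePole z i) (facePole z i) ≠ 0 := by
  rw [form_facePole_self hz]; exact one_ne_zero

lemma halfTurn_conj_planeRefl (hz : 7 ≤ z) (i : Fin 4) :
    halfTurn * planeRefl z i * halfTurn = planeRefl z (Fin.rev i) := by
  rw [planeRefl, halfTurn_conj_reflect hz (facePole_ne hz i), halfTurn_facePole]; rfl

lemma form_A3_ne (hz : 7 ≤ z) : form z (vertexA 3) (vertexA 3) ≠ 0 := by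
  rw [form_A3_A3 hz]; exact (outerSq_pos hz).ne'

lemma form_A0_ne (hz : 7 ≤ z) : form z (vertexA 0) (vertexA 0) ≠ 0 := by
  rw [form_A0_A0 hz]; exact (outerSq_pos hz).ne'

/-- The reflections of the orthoscheme and its half-turn satisfy the relations. -/
lemma orthoRelations (hz : 7 ≤ z) :
    OrthoschemeRelations z (planeRefl z 0) (planeRefl z 1) (reflA3 z) halfTurn := by
  have e2 : halfTurn * planeRefl z 1 * halfTurn = planeRefl z 2 := halfTurn_conj_planeRefl hz 1
  have e3 : halfTurn * planeRefl z 0 * halfTurn = planeRefl z 3 := halfTurn_conj_planeRefl hz 0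
  have a : ∀ i : Fin 4, i ≠ 3 → reflA3 z * planeRefl z i = planeRefl z i * reflA3 z := fun i hi =>
    reflect_comm hz (form_A3_ne hz) (facePole_ne hz i) (by
      rw [form_facePole hz, vertexA_apply, if_neg hi])
  refine ⟨reflect_mul_self z _, reflect_mul_self z _, reflect_mul_self z _, halfTurn_mul_self,
    rotation_pow_eq_one hz (by omega) (form_facePole_self hz 0) (form_facePole_self hz 1) ?_,
    a 0 (by decide), a 1 (by decide), ?_, ?_, ?_, ?_⟩
  · rw [form_facePole_facePole hz, coxeterSchlafli_eq, cz]; simp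
  · rw [e2]; exact a 2 (by decide)
  · rw [e3]; exact reflect_comm hz (facePole_ne hz 3) (facePole_ne hz 0) (by
      rw [form_facePole_facePole hz, coxeterSchlafli_eq]; rfl)
  · rw [e3]; exact reflect_comm hz (facePole_ne hz 3) (facePole_ne hz 1) (by
      rw [form_facePole_facePole hz, coxeterSchlafli_eq]; rfl)
  · rw [e2]
    refine rotation_pow_eq_one hz (by omega) (form_facePole_self hz 1) (form_facePole_self hz 2) ?_
    rw [form_facePole_facePole hz, coxeterSchlafli_eq, cz]; simp

lemma root_self (hz : 7 ≤ z) (i : Fin 6) : form z (root z i) (root z i) = 1 := by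
  have := form_root_gram hz i i (by rw [(orthoMatrix z).diagonal]; exact one_ne_zero)
  rw [this, (orthoMatrix z).diagonal]; simp

lemma reflect_root (hz : 7 ≤ z) (i : Fin 6) :
    OrthoschemeRelations.mirrors (planeRefl z 0) (planeRefl z 1) (reflA3 z) halfTurn i =
      reflect z (root z i) := by
  have hs : -(Real.sqrt (outerSq z))⁻¹ ≠ 0 := neg_ne_zero.2 (inv_ne_zero (sqrt_outerSq_pos hz).ne')
  fin_cases i
  · exact (reflect_smul z (form_A3_ne hz) hs).symm
  · rfl
  · rfl
  · exact halfTurn_conj_planeRefl hz 1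
  · exact halfTurn_conj_planeRefl hz 0
  · change halfTurn * reflA3 z * halfTurn = reflect z (-(Real.sqrt (outerSq z))⁻¹ • vertexA 0)
    rw [reflect_smul z (form_A0_ne hz) hs, reflA3, halfTurn_conj_reflect hz (form_A3_ne hz),
      halfTurn_vertexA]
    rfl

/-- The action of the Coxeter group of the orthoscheme on space. -/
def orthoHom (hz : 7 ≤ z) : (orthoMatrix z).Group →* (V4 ≃ₗ[ℝ] V4) :=
  (orthoRelations hz).hom (by omega)

/-- The reflections in the six faces of the complete orthoscheme represent its Coxeter group; the
chamber is the cone over the orthoscheme. -/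
lemma isReflectionRep (hz : 7 ≤ z) : IsReflectionRep (orthoSystem z) (bil z) (root z)
    (orthoHom hz) where
  symm x y := by rw [bil_apply, bil_apply, form_comm hz]
  unit i := by rw [bil_apply, root_self hz]
  gram i j _ h := by rw [bil_apply, form_root_gram hz j i h]
  gram_inf i j h := by rw [bil_apply]; exact form_root_gram_inf hz j i h
  simple i x := by
    rw [orthoHom, OrthoschemeRelations.hom_simple, reflect_root hz,
      reflect_apply z (by rw [root_self hz]; exact one_ne_zero), root_self hz, div_one,
      bil_apply]

lemma form_root_zero_nonneg_iff (hz : 7 ≤ z) (X : V4) :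
    0 ≤ form z X (root z 0) ↔ form z X (vertexA 3) ≤ 0 := by
  change 0 ≤ form z X (-(Real.sqrt (outerSq z))⁻¹ • vertexA 3) ↔ _
  have := inv_pos.2 (sqrt_outerSq_pos hz)
  rw [form_smul_right, neg_mul, neg_nonneg, ← not_lt, mul_pos_iff_of_pos_left this, not_lt]

lemma form_root_five_nonneg_iff (hz : 7 ≤ z) (X : V4) :
    0 ≤ form z X (root z 5) ↔ form z X (vertexA 0) ≤ 0 := by
  change 0 ≤ form z X (-(Real.sqrt (outerSq z))⁻¹ • vertexA 0) ↔ _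
  have := inv_pos.2 (sqrt_outerSq_pos hz)
  rw [form_smul_right, neg_mul, neg_nonneg, ← not_lt, mul_pos_iff_of_pos_left this, not_lt]

lemma form_root_zero_eq_iff (hz : 7 ≤ z) (X : V4) :
    form z X (root z 0) = 0 ↔ form z X (vertexA 3) = 0 := by
  change form z X (-(Real.sqrt (outerSq z))⁻¹ • vertexA 3) = 0 ↔ _
  rw [form_smul_right]
  simp [(sqrt_outerSq_pos hz).ne']

lemma form_root_five_eq_iff (hz : 7 ≤ z) (X : V4) :
    form z X (root z 5) = 0 ↔ form z X (vertexA 0) = 0 := by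
  change form z X (-(Real.sqrt (outerSq z))⁻¹ • vertexA 0) = 0 ↔ _
  rw [form_smul_right]
  simp [(sqrt_outerSq_pos hz).ne']

lemma mem_chamber {X : V4} :
    X ∈ chamber (bil z) (root z) ↔ ∀ i, 0 ≤ form z X (root z i) := by
  simp only [chamber, Set.mem_ofPred_eq, bil_apply]

lemma mem_completeOrthoscheme_iff (hz : 7 ≤ z) (X : H3 z) :
    X ∈ completeOrthoscheme z ↔ X.1 ∈ chamber (bil z) (root z) := by
  rw [mem_chamber]
  constructor
  · rintro ⟨h1, h2, h3⟩ i
    revert i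
    exact forall_fin_six ((form_root_zero_nonneg_iff hz _).2 h2)
      ((form_root_five_nonneg_iff hz _).2 h3) (fun j => by rw [form_root_pole hz]; exact h1 j)
  · intro h
    refine ⟨fun j => ?_, (form_root_zero_nonneg_iff hz _).1 (h 0),
      (form_root_five_nonneg_iff hz _).1 (h 5)⟩
    have := h j.succ.castSucc
    rwa [form_root_pole hz] at this

lemma halfTurn_root (i : Fin 6) : halfTurn (root z i) = root z (Fin.rev i) := by
  fin_cases i
  · change halfTurn (-(Real.sqrt (outerSq z))⁻¹ • vertexA 3) =
      -(Real.sqrt (outerSq z))⁻¹ • vertexA 0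
    rw [map_smul, halfTurn_vertexA]; rfl
  · exact halfTurn_facePole 0
  · exact halfTurn_facePole 1
  · exact halfTurn_facePole 2
  · exact halfTurn_facePole 3
  · change halfTurn (-(Real.sqrt (outerSq z))⁻¹ • vertexA 0) =
      -(Real.sqrt (outerSq z))⁻¹ • vertexA 3
    rw [map_smul, halfTurn_vertexA]; rfl

lemma form_halfTurn_root (hz : 7 ≤ z) (X : V4) (i : Fin 6) :
    form z (halfTurn X) (root z i) = form z X (root z (Fin.rev i)) := by
  rw [← form_halfTurn hz, halfTurn_root]
  congr 1
  exact congrArg (fun g : V4 ≃ₗ[ℝ] V4 => g X) halfTurn_mul_self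

lemma halfTurn_mem_chamber (hz : 7 ≤ z) {X : V4} (hX : X ∈ chamber (bil z) (root z)) :
    halfTurn X ∈ chamber (bil z) (root z) := mem_chamber.2 fun i => by
  rw [form_halfTurn_root hz]; exact mem_chamber.1 hX _

lemma form_root_one_pos (hz : 7 ≤ z) (i : Fin 6) : 0 < form z (fun _ => 1) (root z i) := by
  have h1 := cz_gt hz
  have h2 := cz_sq_lt hz
  have key : form z (fun _ => 1) (vertexA 3) < 0 := by
    rw [(form_vertexA hz _).2.2]
    refine div_neg_of_neg_of_pos ?_ (ez_pos hz)
    nlinarith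
  have h0 : 0 < form z (fun _ => 1) (root z 0) := by
    refine lt_of_le_of_ne ((form_root_zero_nonneg_iff hz _).2 key.le) fun h => ?_
    rw [eq_comm, form_root_zero_eq_iff hz] at h
    exact key.ne h
  have h5 : 0 < form z (fun _ => 1) (root z 5) := by
    have := form_halfTurn_root hz (fun _ => 1) 5
    rw [show halfTurn (fun _ => 1) = fun _ => 1 from rfl] at this
    rw [this]; exact h0
  revert i
  exact forall_fin_six h0 h5 fun j => by rw [form_root_pole hz]; exact one_pos

lemma halfTurn_ne_one : (halfTurn : V4 ≃ₗ[ℝ] V4) ≠ 1 := by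
  intro h
  have := congrArg (fun g : V4 ≃ₗ[ℝ] V4 => g (vertexA 0) 0) h
  simp [halfTurn_apply, vertexA] at this

/-- The point `(1, 1, 1, 1)` is an inner point of the chamber and fixed by `h`. So an element `w` or
`w h` of the extended reflection group that acts trivially has `w = 1`, and `h ≠ 1`. -/
lemma isFaithful (hz : 7 ≤ z) : (orthoRelations hz).IsFaithful (by omega) := by
  have hc : (fun _ => 1 : V4) ∈ chamber (bil z) (root z) := 
    mem_chamber.2 fun i => (form_root_one_pos hz i).le
  have hp : ∀ i, 0 < bil z (fun _ => 1) (root z i) := fun i => by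
    rw [bil_apply]; exact form_root_one_pos hz i
  constructor
  · intro w hw
    refine (isReflectionRep hz).eq_one_of_interior hc hp ?_
    rw [orthoHom, hw]; rfl
  · intro w hw
    have : w = 1 := by
      refine (isReflectionRep hz).eq_one_of_interior hc hp ?_
      exact (congrArg (fun g : V4 ≃ₗ[ℝ] V4 => g (fun _ => 1)) hw).symm
    rw [this, map_one, one_mul] at hw
    exact halfTurn_ne_one hw

/-- The group generated by the reflections in the faces of the complete orthoscheme and its
half-turn. -/
def orthoGroup (z : ℕ) : Subgroup (V4 ≃ₗ[ℝ] V4) :=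
  Subgroup.closure {planeRefl z 0, planeRefl z 1, reflA3 z, halfTurn}

lemma orthoGroup_le (hz : 7 ≤ z) : orthoGroup z ≤ isomH z := by
  rw [orthoGroup, Subgroup.closure_le]
  rintro g (rfl | rfl | rfl | rfl)
  · exact reflect_mem_isomH hz (by rw [form_facePole_self hz]; exact one_pos)
  · exact reflect_mem_isomH hz (by rw [form_facePole_self hz]; exact one_pos)
  · exact reflect_mem_isomH hz (by rw [form_A3_A3 hz]; exact outerSq_pos hz)
  · exact halfTurn_mem_isomH hz

lemma exists_orthoHom (hz : 7 ≤ z) {g : V4 ≃ₗ[ℝ] V4} (hg : g ∈ orthoGroup z) :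
    ∃ w, g = orthoHom hz w ∨ g = orthoHom hz w * halfTurn := by
  obtain ⟨π, hπ⟩ : ∃ π, (g, π) ∈ Subgroup.closure {(planeRefl z 0, planeRefl z 0),
      (planeRefl z 1, planeRefl z 1), (reflA3 z, reflA3 z), (halfTurn, halfTurn)} := by
    refine ⟨g, ?_⟩
    have : orthoGroup z ≤ (Subgroup.closure {(planeRefl z 0, planeRefl z 0),
      (planeRefl z 1, planeRefl z 1), (reflA3 z, reflA3 z), (halfTurn, halfTurn)}).comap
        ((MonoidHom.id _).prod (MonoidHom.id _)) := by
      rw [orthoGroup, Subgroup.closure_le]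
      rintro g (rfl | rfl | rfl | rfl) <;> exact Subgroup.subset_closure (by simp)
    exact this hg
  obtain ⟨w, h | h⟩ := OrthoschemeRelations.mem_closure_pairs (orthoRelations hz) (orthoRelations hz)
    (by omega) hπ
  · exact ⟨w, Or.inl (congrArg Prod.fst h)⟩
  · exact ⟨w, Or.inr (congrArg Prod.fst h)⟩

lemma groupQ_le : groupQ z ≤ orthoGroup z :=
  Subgroup.closure_mono (by
    rintro g (rfl | rfl | rfl) <;> simp)

lemma orthoHom_mem (hz : 7 ≤ z) (w : (orthoMatrix z).Group) : orthoHom hz w ∈ orthoGroup z := by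
  have m0 : planeRefl z 0 ∈ orthoGroup z := Subgroup.subset_closure (by simp)
  have m1 : planeRefl z 1 ∈ orthoGroup z := Subgroup.subset_closure (by simp)
  have ma : reflA3 z ∈ orthoGroup z := Subgroup.subset_closure (by simp)
  have mh : halfTurn ∈ orthoGroup z := Subgroup.subset_closure (by simp)
  induction w using (orthoSystem z).simple_induction_left with
  | one => rw [map_one]; exact one_mem _
  | mul_simple_left w i ih =>
    rw [map_mul]
    refine mul_mem ?_ ih
    rw [orthoHom, OrthoschemeRelations.hom_simple]
    fin_cases i
    exacts [ma, m0, m1, mul_mem (mul_mem mh m1) mh, mul_mem (mul_mem mh m0) mh,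
      mul_mem (mul_mem mh ma) mh]

/-- The mirrors through a point of the complete orthoscheme. -/
lemma hasCommonPoint (hz : 7 ≤ z) {Y : H3 z} (hY : Y ∈ completeOrthoscheme z) :
    HasCommonPoint {i | form z Y.1 (root z i) = 0} := by
  have e1 : form z Y.1 (root z 1) = Y.1 0 := form_root_pole hz Y.1 0
  have e2 : form z Y.1 (root z 2) = Y.1 1 := form_root_pole hz Y.1 1
  have e3 : form z Y.1 (root z 3) = Y.1 2 := form_root_pole hz Y.1 2
  have e4 : form z Y.1 (root z 4) = Y.1 3 := form_root_pole hz Y.1 3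
  have hE := ez_pos hz
  have c1 := cz_gt hz
  have c2 := cz_sq_lt hz
  have c3 := two_cz_sq_pos hz
  have c0 : 0 < cz z := by linarith
  have hc3 : 0 < cz z ^ 3 := by positivity
  have hYY := Y.2.1
  rw [form_eq hz, div_eq_iff hE.ne'] at hYY
  have h0 := hY.1 0
  have h1 := hY.1 1
  have h2 := hY.1 2
  have h3 := hY.1 3
  have zero : Y.1 0 + Y.1 1 + Y.1 2 + Y.1 3 ≤ 0 → False := by
    intro h
    have z0 : Y.1 0 = 0 := by linarith
    have z1 : Y.1 1 = 0 := by linarith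
    have z2 : Y.1 2 = 0 := by linarith
    have z3 : Y.1 3 = 0 := by linarith
    rw [z0, z1, z2, z3] at hYY
    linarith
  have hm : ∀ i, i ∈ {i | form z Y.1 (root z i) = 0} ↔ form z Y.1 (root z i) = 0 := fun _ => Iff.rfl
  have p1 : 0 < cz z * (1 - cz z ^ 2) := mul_pos c0 (by linarith)
  have p2 : 0 < cz z ^ 2 := by positivity
  constructor <;> simp only [hm]
  · rintro ⟨i1, i2, i3⟩
    rw [e1] at i1; rw [e2] at i2; rw [e3] at i3
    rw [i1, i2, i3] at hYY
    nlinarith [mul_nonneg c3.le (mul_self_nonneg (Y.1 3))]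
  · rintro ⟨i1, i2, i3⟩
    rw [e2] at i1; rw [e3] at i2; rw [e4] at i3
    rw [i1, i2, i3] at hYY
    nlinarith [mul_nonneg c3.le (mul_self_nonneg (Y.1 0))]
  · rintro ⟨i1, i2⟩
    rw [e1] at i1
    rw [form_root_five_eq_iff hz, (form_vertexA hz _).1, div_eq_iff hE.ne', zero_mul, i1] at i2
    have q1 := mul_nonneg p1.le h1
    have q2 := mul_nonneg p2.le h2
    have q3 := mul_nonneg hc3.le h3
    have t1 : Y.1 1 = 0 := by
      have : cz z * (1 - cz z ^ 2) * Y.1 1 = 0 := by linarith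
      exact (mul_eq_zero.1 this).resolve_left p1.ne'
    have t2 : Y.1 2 = 0 := by
      have : cz z ^ 2 * Y.1 2 = 0 := by linarith
      exact (mul_eq_zero.1 this).resolve_left p2.ne'
    have t3 : Y.1 3 = 0 := by
      have : cz z ^ 3 * Y.1 3 = 0 := by linarith
      exact (mul_eq_zero.1 this).resolve_left hc3.ne'
    exact zero (by linarith)
  · rintro ⟨i2, i1⟩
    rw [e4] at i1
    rw [form_root_zero_eq_iff hz, (form_vertexA hz _).2.2, div_eq_iff hE.ne', zero_mul, i1] at i2
    have q1 := mul_nonneg p1.le h2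
    have q2 := mul_nonneg p2.le h1
    have q3 := mul_nonneg hc3.le h0
    have t1 : Y.1 2 = 0 := by
      have : cz z * (1 - cz z ^ 2) * Y.1 2 = 0 := by linarith
      exact (mul_eq_zero.1 this).resolve_left p1.ne'
    have t2 : Y.1 1 = 0 := by
      have : cz z ^ 2 * Y.1 1 = 0 := by linarith
      exact (mul_eq_zero.1 this).resolve_left p2.ne'
    have t3 : Y.1 0 = 0 := by
      have : cz z ^ 3 * Y.1 0 = 0 := by linarith
      exact (mul_eq_zero.1 this).resolve_left hc3.ne'
    exact zero (by linarith)
  · rintro ⟨i1, i2⟩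
    rw [form_root_zero_eq_iff hz, (form_vertexA hz _).2.2, div_eq_iff hE.ne', zero_mul] at i1
    rw [form_root_five_eq_iff hz, (form_vertexA hz _).1, div_eq_iff hE.ne', zero_mul] at i2
    have p3 : 0 < 1 - 2 * cz z ^ 2 + cz z ^ 3 := by
      have : 0 < (1 - cz z) * (1 + cz z - cz z ^ 2) :=
        mul_pos (by linarith [cz_lt_one hz]) (by linarith)
      nlinarith
    have p4 : 0 < cz z * (1 - cz z ^ 2) + cz z ^ 2 := by linarith
    have q1 := mul_nonneg p3.le (add_nonneg h0 h3)
    have q2 := mul_nonneg p4.le (add_nonneg h1 h2)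
    have t1 : Y.1 0 + Y.1 3 = 0 := by
      have : (1 - 2 * cz z ^ 2 + cz z ^ 3) * (Y.1 0 + Y.1 3) = 0 := by linarith
      exact (mul_eq_zero.1 this).resolve_left p3.ne'
    have t2 : Y.1 1 + Y.1 2 = 0 := by
      have : (cz z * (1 - cz z ^ 2) + cz z ^ 2) * (Y.1 1 + Y.1 2) = 0 := by linarith
      exact (mul_eq_zero.1 this).resolve_left p4.ne'
    exact zero (by linarith)

/-- The orthoscheme is a strict fundamental domain of the reflection group, and the stabilizer of a
point is generated by the reflections in the faces through it. -/
lemma stabilizer_orthoHom (hz : 7 ≤ z) {w : (orthoMatrix z).Group} {X Y : V4}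
    (hX : X ∈ chamber (bil z) (root z)) (hY : Y ∈ chamber (bil z) (root z))
    (h : X = orthoHom hz w Y) : X = Y ∧
      w ∈ Subgroup.closure ((orthoSystem z).simple '' {i | form z Y (root z i) = 0}) := by
  obtain ⟨h1, h2⟩ := (isReflectionRep hz).stabilizer _ w rfl X Y hX hY h
  refine ⟨h1, Subgroup.closure_mono ?_ h2⟩
  rintro s ⟨i, hi, rfl⟩
  exact ⟨i, by rwa [bil_apply] at hi, rfl⟩

end

section

/-! ### The group of the pairings in the group of the orthoscheme -/

variable {z p : ℕ}

lemma det_reflect {U : V4} (hU : form z U U ≠ 0) :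
    LinearMap.det (reflect z U : V4 →ₗ[ℝ] V4) = -1 := by
  have h : (reflect z U : V4 →ₗ[ℝ] V4) =
      LinearMap.transvection ((-(2 / form z U U)) • (bil z).flip U) U := by
    refine LinearMap.ext fun X => ?_
    change reflect z U X = X + ((-(2 / form z U U)) * bil z X U) • U
    rw [reflect_apply z hU, bil_apply]
    module
  rw [h, LinearMap.transvection.det]
  change 1 + (-(2 / form z U U)) * bil z U U = -1
  rw [bil_apply]
  field_simp
  ring

lemma det_halfTurn : LinearMap.det (halfTurn : V4 →ₗ[ℝ] V4) = 1 := by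
  rw [← LinearMap.det_toMatrix']
  have : LinearMap.toMatrix' (halfTurn : V4 →ₗ[ℝ] V4) =
      !![0, 0, 0, 1; 0, 0, 1, 0; 0, 1, 0, 0; 1, 0, 0, 0] := by
    ext i j
    rw [LinearMap.toMatrix'_apply, LinearEquiv.coe_coe, halfTurn_apply]
    fin_cases i <;> fin_cases j <;> simp
  rw [this]
  simp [Matrix.det_succ_row_zero, Fin.sum_univ_succ, Fin.succAbove]
  norm_num

/-- The determinant as a homomorphism on the linear automorphisms. -/
def detHom : (V4 ≃ₗ[ℝ] V4) →* ℝ where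
  toFun g := LinearMap.det (g : V4 →ₗ[ℝ] V4)
  map_one' := LinearMap.det_id
  map_mul' f g := by
    have : ((f * g : V4 ≃ₗ[ℝ] V4) : V4 →ₗ[ℝ] V4) = (f : V4 →ₗ[ℝ] V4) * (g : V4 →ₗ[ℝ] V4) := rfl
    rw [this, map_mul]

lemma mem_isomPlus_iff {g : V4 ≃ₗ[ℝ] V4} : g ∈ isomPlus z ↔ g ∈ isomH z ∧ detHom g = 1 :=
  ⟨fun h => ⟨⟨h.1, h.2.1⟩, h.2.2⟩, fun h => ⟨h.1.1, h.1.2, h.2⟩⟩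

lemma detHom_planeRefl (hz : 7 ≤ z) (i : Fin 4) : detHom (planeRefl z i) = -1 :=
  det_reflect (facePole_ne hz i)

lemma detHom_reflA3 (hz : 7 ≤ z) : detHom (reflA3 z) = -1 := det_reflect (form_A3_ne hz)

lemma detHom_rot (hz : 7 ≤ z) : detHom (rot z) = 1 := by
  rw [rot, map_mul, detHom_planeRefl hz, detHom_planeRefl hz]; norm_num

lemma rot_mem : rot z ∈ orthoGroup z :=
  mul_mem (Subgroup.subset_closure (by simp)) (Subgroup.subset_closure (by simp))

lemma planeRefl_mem (hz : 7 ≤ z) (i : Fin 4) : planeRefl z i ∈ orthoGroup z := by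
  have mh : halfTurn ∈ orthoGroup z := Subgroup.subset_closure (by simp)
  have m0 : planeRefl z 0 ∈ orthoGroup z := Subgroup.subset_closure (by simp)
  have m1 : planeRefl z 1 ∈ orthoGroup z := Subgroup.subset_closure (by simp)
  fin_cases i
  · exact m0
  · exact m1
  · change planeRefl z (Fin.rev 1) ∈ _
    rw [← halfTurn_conj_planeRefl hz]; exact mul_mem (mul_mem mh m1) mh
  · change planeRefl z (Fin.rev 0) ∈ _
    rw [← halfTurn_conj_planeRefl hz]; exact mul_mem (mul_mem mh m0) mh

lemma halfTurn_mem_orthoGroup : halfTurn ∈ orthoGroup z := Subgroup.subset_closure (by simp)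
lemma reflA3_mem_orthoGroup : reflA3 z ∈ orthoGroup z := Subgroup.subset_closure (by simp)

lemma seven_le (hp : 2 ≤ p) (hz : z = 4 * p - 1) : 7 ≤ z := by omega

lemma cast_eq (hp : 2 ≤ p) (hz : z = 4 * p - 1) : (z : ℤ) = 4 * p - 1 := by omega

lemma baseScrew_eq (hz : 7 ≤ z) (hzp : (z : ℤ) = 4 * p - 1) : baseScrew z =
    OrthoschemeRelations.base (planeRefl z 0) (planeRefl z 1) (reflA3 z) halfTurn p := by
  rw [baseScrew, OrthoschemeRelations.base, halfTurn_conj_planeRefl hz,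
    show 4 * (p : ℤ) - 2 = ((z - 1 : ℕ) : ℤ) by omega, zpow_natCast]
  rfl

lemma sideScrew_eq (hz : 7 ≤ z) (hzp : (z : ℤ) = 4 * p - 1) (i : ZMod z) : sideScrew z p i =
    OrthoschemeRelations.sideAt (planeRefl z 0) (planeRefl z 1) (reflA3 z) halfTurn p i.val := by
  rw [sideScrew, OrthoschemeRelations.sideAt, OrthoschemeRelations.side,
    show 2 * (p : ℤ) - 1 = ((2 * p - 1 : ℕ) : ℤ) by omega, zpow_natCast, zpow_neg,
    show 2 * (i.val : ℤ) = ((2 * i.val : ℕ) : ℤ) by push_cast; rfl, zpow_natCast]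
  rfl

/-- The homomorphism of the presented group onto the group of the pairings. -/
def pairing (hz : 7 ≤ z) (hzp : (z : ℤ) = 4 * p - 1) :
    PresentedCobwebGroup z p →* (V4 ≃ₗ[ℝ] V4) :=
  (orthoRelations hz).pairingHom hzp (by omega)

lemma pairing_s (hz : 7 ≤ z) (hzp : (z : ℤ) = 4 * p - 1) :
    pairing hz hzp (PresentedGroup.of Gen.s) = baseScrew z := by
  rw [baseScrew_eq hz hzp]; exact (orthoRelations hz).pairingHom_s hzp _

lemma pairing_a (hz : 7 ≤ z) (hzp : (z : ℤ) = 4 * p - 1) (i : ZMod z) :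
    pairing hz hzp (PresentedGroup.of (Gen.a i)) = sideScrew z p i := by
  rw [sideScrew_eq hz hzp]; exact (orthoRelations hz).pairingHom_a hzp _ i

lemma pairing_range (hz : 7 ≤ z) (hzp : (z : ℤ) = 4 * p - 1) :
    (pairing hz hzp).range = cobwebGroup z p := by
  rw [MonoidHom.range_eq_map, ← PresentedGroup.closure_range_of, MonoidHom.map_closure, cobwebGroup]
  congr 1
  ext g
  constructor
  · rintro ⟨_, ⟨x, rfl⟩, rfl⟩
    cases x with
    | s => left; exact pairing_s hz hzp
    | a i => right; exact ⟨i, (pairing_a hz hzp i).symm⟩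
  · rintro (rfl | ⟨i, rfl⟩)
    · exact ⟨_, ⟨Gen.s, rfl⟩, pairing_s hz hzp⟩
    · exact ⟨_, ⟨Gen.a i, rfl⟩, pairing_a hz hzp i⟩

lemma pairing_injective (hz : 7 ≤ z) (hzp : (z : ℤ) = 4 * p - 1) :
    Function.Injective (pairing hz hzp) :=
  OrthoschemeRelations.pairingHom_injective (isFaithful hz) hzp

/-- The group of the pairings has the presentation. -/
def presentation (hz : 7 ≤ z) (hzp : (z : ℤ) = 4 * p - 1) :
    PresentedCobwebGroup z p ≃* cobwebGroup z p :=
  (MonoidHom.ofInjective (pairing_injective hz hzp)).trans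
    (MulEquiv.subgroupCongr (pairing_range hz hzp))

lemma presentation_val (hz : 7 ≤ z) (hzp : (z : ℤ) = 4 * p - 1) (x : PresentedCobwebGroup z p) :
    (presentation hz hzp x : V4 ≃ₗ[ℝ] V4) = pairing hz hzp x := rfl

lemma baseScrew_mem_orthoGroup (hz : 7 ≤ z) : baseScrew z ∈ orthoGroup z :=
  mul_mem (mul_mem (planeRefl_mem hz 3) reflA3_mem_orthoGroup) (pow_mem (rot_mem) _)

lemma sideScrew_mem_orthoGroup (hz : 7 ≤ z) (i : ZMod z) : sideScrew z p i ∈ orthoGroup z :=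
  mul_mem (mul_mem (inv_mem (pow_mem (rot_mem) _)) (mul_mem (mul_mem (planeRefl_mem hz 0)
    halfTurn_mem_orthoGroup) (mul_mem reflA3_mem_orthoGroup (pow_mem (rot_mem) _))))
    (pow_mem (rot_mem) _)

lemma cobwebGroup_le_orthoGroup (hz : 7 ≤ z) : cobwebGroup z p ≤ orthoGroup z := by
  rw [cobwebGroup, Subgroup.closure_le]
  rintro g (rfl | ⟨i, rfl⟩)
  exacts [baseScrew_mem_orthoGroup hz, sideScrew_mem_orthoGroup hz i]

lemma baseScrew_mem_isomPlus (hz : 7 ≤ z) : baseScrew z ∈ isomPlus z := by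
  rw [mem_isomPlus_iff]
  refine ⟨orthoGroup_le hz (baseScrew_mem_orthoGroup hz), ?_⟩
  rw [baseScrew, map_mul, map_mul, map_pow, detHom_rot hz, detHom_planeRefl hz, detHom_reflA3 hz]
  norm_num

lemma sideScrew_mem_isomPlus (hz : 7 ≤ z) (i : ZMod z) : sideScrew z p i ∈ isomPlus z := by
  rw [mem_isomPlus_iff]
  refine ⟨orthoGroup_le hz (sideScrew_mem_orthoGroup hz i), ?_⟩
  have hr : detHom (rot z ^ (2 * i.val))⁻¹ = 1 := by
    have h := map_mul detHom (rot z ^ (2 * i.val))⁻¹ (rot z ^ (2 * i.val))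
    rw [inv_mul_cancel, map_one, map_pow, detHom_rot hz, one_pow, mul_one] at h
    exact h.symm
  rw [sideScrew, map_mul, map_mul, hr, map_mul, map_mul, map_mul, map_pow, map_pow, detHom_rot hz,
    detHom_planeRefl hz, detHom_reflA3 hz, show detHom halfTurn = 1 from det_halfTurn]
  norm_num

lemma cobwebGroup_le_isomPlus (hz : 7 ≤ z) : cobwebGroup z p ≤ isomPlus z := by
  rw [cobwebGroup, Subgroup.closure_le]
  rintro g (rfl | ⟨i, rfl⟩)
  exacts [baseScrew_mem_isomPlus hz, sideScrew_mem_isomPlus hz i]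

/-- Every element of the extended reflection group is the product of a pairing group element and an
element of the stabilizer of `Q`. -/
lemma exists_mul_groupQ (hz : 7 ≤ z) (hzp : (z : ℤ) = 4 * p - 1) {g : V4 ≃ₗ[ℝ] V4}
    (hg : g ∈ orthoGroup z) : ∃ γ ∈ cobwebGroup z p, ∃ k ∈ groupQ z, g = γ * k := by
  obtain ⟨w, t, rfl⟩ := (orthoRelations hz).exists_eq_mul_stabElt hzp (by omega) hg
  exact ⟨_, by rw [← pairing_range hz hzp]; exact ⟨w, rfl⟩, _,
    OrthoschemeRelations.stabElt_mem t, rfl⟩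

lemma eq_one_of_mem_groupQ (hz : 7 ≤ z) (hzp : (z : ℤ) = 4 * p - 1) {g : V4 ≃ₗ[ℝ] V4}
    (hg : g ∈ cobwebGroup z p) (hQ : g ∈ groupQ z) : g = 1 := by
  rw [← pairing_range hz hzp] at hg
  obtain ⟨w, rfl⟩ := hg
  rw [OrthoschemeRelations.eq_one_of_pairingHom_mem (isFaithful hz) hzp hQ, map_one]

lemma card_groupQ (hz : 7 ≤ z) (hzp : (z : ℤ) = 4 * p - 1) : Nat.card (groupQ z) = 8 * z :=
  OrthoschemeRelations.card_stab (isFaithful hz) hzp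

lemma orderOf_rot_sq (hz : 7 ≤ z) (hzp : (z : ℤ) = 4 * p - 1) : orderOf (rot z ^ 2) = z :=
  OrthoschemeRelations.orderOf_rot_sq (isFaithful hz) hzp

/-- A pairing that fixes a point in the orbit of the orthoscheme is trivial. -/
theorem eq_one_of_fixes (hz : 7 ≤ z) (hzp : (z : ℤ) = 4 * p - 1) {γ δ : V4 ≃ₗ[ℝ] V4}
    (hγ : γ ∈ cobwebGroup z p) (hδ : δ ∈ orthoGroup z) {Y : H3 z} (hY : Y ∈ completeOrthoscheme z)
    (h : γ (δ Y.1) = δ Y.1) : γ = 1 := by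
  have hz0 : z ≠ 0 := by omega
  have h4 : (4 * p : ZMod z) = 1 := OrthoschemeRelations.four_mul_cast hzp
  rw [← pairing_range hz hzp] at hγ
  obtain ⟨w, rfl⟩ := hγ
  obtain ⟨π, h1, h2⟩ := (orthoRelations hz).exists_pair_pairingHom hzp hz0 w
  obtain ⟨τ, hτ⟩ := OrthoschemeRelations.exists_cosetPairs (z := z) (p := p) (inv_mem hδ)
  have hfix : FixesComponent (τ * π * τ⁻¹) := FixesComponent.conj ⟨1, _, _, h2 1⟩
    (OrthoschemeRelations.commute_leftMul hτ)
  have hpair := mul_mem (mul_mem hτ h1) (inv_mem hτ)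
  have hYfix : (δ⁻¹ * pairing hz hzp w * δ⁻¹⁻¹) Y.1 = Y.1 := by
    rw [inv_inv, LinearEquiv.mul_apply, LinearEquiv.mul_apply, h, inv_apply_self]
  have hYc := (mem_completeOrthoscheme_iff hz Y).1 hY
  have hS := hasCommonPoint hz hY
  have main : δ⁻¹ * pairing hz hzp w * δ⁻¹⁻¹ = 1 := by
    obtain ⟨v, hv | hv⟩ := OrthoschemeRelations.mem_closure_pairs (orthoRelations hz)
      (permRelations h4 hz0) hz0 hpair
    · have e1 : δ⁻¹ * pairing hz hzp w * δ⁻¹⁻¹ = orthoHom hz v := congrArg Prod.fst hv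
      have e2 : τ * π * τ⁻¹ = (permRelations h4 hz0).hom hz0 v := congrArg Prod.snd hv
      rw [e1] at hYfix
      rw [e2] at hfix
      obtain ⟨-, hcl⟩ := stabilizer_orthoHom hz hYc hYc hYfix.symm
      rw [e1, eq_one_of_fixesComponent h4 hz0 hS hcl hfix, map_one]
    · have e1 : δ⁻¹ * pairing hz hzp w * δ⁻¹⁻¹ = orthoHom hz v * halfTurn := congrArg Prod.fst hv
      have e2 : τ * π * τ⁻¹ = (permRelations h4 hz0).hom hz0 v * permH z p := congrArg Prod.snd hv
      rw [e1] at hYfix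
      rw [e2] at hfix
      obtain ⟨hh, hcl⟩ := stabilizer_orthoHom hz hYc (halfTurn_mem_chamber hz hYc) hYfix.symm
      rw [← hh] at hcl
      refine absurd hfix (not_fixesComponent h4 hz0 hS (fun i hi => ?_) hcl)
      change form z Y.1 (root z (Fin.rev i)) = 0
      rw [← form_halfTurn_root hz, ← hh]
      exact hi
  rw [inv_inv] at main
  have : pairing hz hzp w = δ * (δ⁻¹ * pairing hz hzp w * δ) * δ⁻¹ := by group
  rw [this, main, mul_one, mul_inv_cancel]

end

section

/-! ### Discreteness and the orbit of the orthoscheme -/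

variable {z : ℕ}

/-- A weak triangle inequality: `cosh (a + b) ≤ 2 cosh a cosh b`. -/
lemma neg_form_le (hz : 7 ≤ z) (P Q Y : H3 z) :
    -form z P.1 Y.1 ≤ 2 * (-form z P.1 Q.1) * (-form z Q.1 Y.1) := by
  -- the image of `Y` under the point reflection in `Q`
  have h1 : form z ((-2 * form z Q.1 Y.1) • Q.1 - Y.1) ((-2 * form z Q.1 Y.1) • Q.1 - Y.1) = -1 := by
    rw [form_sub_left, form_sub_right, form_sub_right, form_smul_left, form_smul_left,
      form_smul_right, form_smul_right, Q.2.1, Y.2.1, form_comm hz Y.1]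
    ring
  have h2 : form z ((-2 * form z Q.1 Y.1) • Q.1 - Y.1) Q.1 < 0 := by
    rw [form_sub_left, form_smul_left, Q.2.1, form_comm hz Y.1]
    linarith [form_neg hz Q Y]
  have := one_le_neg_form hz P ⟨_, h1, (sheet_iff_form hz h1 Q).2 h2⟩
  rw [form_sub_right, form_smul_right] at this
  linarith

lemma isCompact_neg_form_le (hz : 7 ≤ z) (Y : H3 z) (r : ℝ) :
    IsCompact {X : H3 z | -form z X.1 Y.1 ≤ r} :=
  isCompact_of_form_le hz (isClosed_le (continuous_form_left Y.1).neg continuous_const) Y r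
    fun _ h => h

/-- The sets `{Y | -⟨Y, X⟩ < 1 + δ}` form a basis of neighbourhoods of `X`. -/
lemma exists_form_lt_subset (hz : 7 ≤ z) (X : H3 z) {N : Set (H3 z)} (hN : N ∈ 𝓝 X) :
    ∃ δ > 0, ∀ Y : H3 z, -form z Y.1 X.1 < 1 + δ → Y ∈ N := by
  have hc : IsCompact ({Y : H3 z | -form z Y.1 X.1 ≤ 2} \ interior N) :=
    (isCompact_neg_form_le hz X 2).diff isOpen_interior
  rcases ({Y : H3 z | -form z Y.1 X.1 ≤ 2} \ interior N).eq_empty_or_nonempty with he | hne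
  · refine ⟨1, one_pos, fun Y hY => interior_subset ?_⟩
    by_contra h
    have : Y ∈ {Y : H3 z | -form z Y.1 X.1 ≤ 2} \ interior N :=
      ⟨show -form z Y.1 X.1 ≤ 2 by linarith, h⟩
    rw [he] at this
    exact this
  · obtain ⟨P, hP, hmin⟩ := hc.exists_isMinOn hne (continuous_form_left X.1).neg.continuousOn
    have h1 : 1 < -form z P.1 X.1 := by
      refine lt_of_le_of_ne (one_le_neg_form hz P X) fun e => hP.2 ?_
      rw [eq_of_form_eq hz (show form z P.1 X.1 = -1 by linarith)]
      exact mem_interior_iff_mem_nhds.2 hN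
    have h2 : -form z P.1 X.1 ≤ 2 := hP.1
    refine ⟨-form z P.1 X.1 - 1, by linarith, fun Y hY => interior_subset ?_⟩
    by_contra h
    have := hmin (show Y ∈ {Y : H3 z | -form z Y.1 X.1 ≤ 2} \ interior N from
      ⟨show -form z Y.1 X.1 ≤ 2 by linarith, h⟩)
    change -form z P.1 X.1 ≤ -form z Y.1 X.1 at this
    linarith

lemma form_one_neg (hz : 7 ≤ z) : form z (fun _ => 1) (fun _ => 1) < 0 := by
  have h1 := cz_gt hz
  have h2 := cz_lt_one hz
  rw [form_eq hz]
  refine div_neg_of_neg_of_pos ?_ (ez_pos hz)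
  nlinarith [mul_pos (show 0 < cz z by linarith) (show 0 < 1 - cz z by linarith),
    mul_pos (show 0 < cz z ^ 2 by positivity) (show 0 < 1 - cz z by linarith)]

/-- A point in the interior of the orthoscheme. -/
def innerPoint (z : ℕ) (hz : 7 ≤ z) : H3 z :=
  normalize z (fun _ => 1) (form_one_neg hz) (by
    have h1 := cz_gt hz
    have h2 := cz_lt_one hz
    rw [(form_vertexA hz _).2.1]
    refine div_neg_of_neg_of_pos ?_ (ez_pos hz)
    nlinarith [mul_pos (show 0 < cz z ^ 2 by positivity) (show 0 < 1 - cz z by linarith)])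

lemma innerPoint_pos (hz : 7 ≤ z) (i : Fin 6) : 0 < form z (innerPoint z hz).1 (root z i) := by
  change 0 < form z (_ • fun _ => 1) (root z i)
  rw [form_smul_left]
  refine mul_pos ?_ (form_root_one_pos hz i)
  exact sqrt_inv_pos (form_one_neg hz)

lemma innerPoint_mem (hz : 7 ≤ z) : (innerPoint z hz).1 ∈ chamber (bil z) (root z) :=
  mem_chamber.2 fun i => (innerPoint_pos hz i).le

/-- An element of the orthoscheme group that moves an interior point of the orthoscheme into the
interior is trivial up to the half-turn. -/
lemma eq_of_interior (hz : 7 ≤ z) {g : V4 ≃ₗ[ℝ] V4} (hg : g ∈ orthoGroup z) {X Y : V4}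
    (hX : X ∈ chamber (bil z) (root z)) (hY : ∀ i, 0 < form z Y (root z i)) (h : X = g Y) :
    g = 1 ∨ g = halfTurn := by
  obtain ⟨w, rfl | rfl⟩ := exists_orthoHom hz hg
  · left
    rw [(isReflectionRep hz).eq_one_of_interior hX (fun i => by rw [bil_apply]; exact hY i) h, map_one]
  · right
    have := (isReflectionRep hz).eq_one_of_interior hX (y := halfTurn Y) (fun i => by
      rw [bil_apply, form_halfTurn_root hz]; exact hY _) h
    rw [this, map_one, one_mul]

/-- The orthoscheme group acts properly discontinuously. -/
theorem finite_form_le (hz : 7 ≤ z) (X Y : H3 z) (r : ℝ) :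
    {g | g ∈ orthoGroup z ∧ -form z (g X.1) Y.1 ≤ r}.Finite := by
  set P := innerPoint z hz with hP
  have iso : ∀ {g}, g ∈ orthoGroup z → g ∈ isomH z := fun h => orthoGroup_le hz h
  -- the images of the inner point are uniformly separated
  have hN : {Z : H3 z | ∀ i, 0 < form z Z.1 (root z i)} ∈ 𝓝 P := by
    have : {Z : H3 z | ∀ i, 0 < form z Z.1 (root z i)} =
        ⋂ i, {Z : H3 z | 0 < form z Z.1 (root z i)} := by ext; simp
    rw [this]
    exact (isOpen_iInter_of_finite fun i =>
      isOpen_lt continuous_const (continuous_form_left _)).mem_nhds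
        (Set.mem_iInter.2 fun i => innerPoint_pos hz i)
  obtain ⟨δ, hδ, hsub⟩ := exists_form_lt_subset hz P hN
  have key : ∀ K : Set (H3 z), IsCompact K →
      {g | ∃ h : g ∈ orthoGroup z, (⟨g, iso h⟩ : isomH z) • P ∈ K}.Finite := by
    intro K hK
    have loc : ∀ Z ∈ K, ∃ U ∈ 𝓝 Z,
        {g | ∃ h : g ∈ orthoGroup z, (⟨g, iso h⟩ : isomH z) • P ∈ U}.Finite := by
      intro Z _
      have hc : Continuous fun q : H3 z × H3 z => -form z q.1.1 q.2.1 :=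
        ((continuous_form z).comp ((continuous_subtype_val.comp continuous_fst).prodMk
          (continuous_subtype_val.comp continuous_snd))).neg
      have ho : {q : H3 z × H3 z | -form z q.1.1 q.2.1 < 1 + δ} ∈ 𝓝 (Z, Z) :=
        (isOpen_lt hc continuous_const).mem_nhds (by
          change -form z Z.1 Z.1 < 1 + δ
          rw [Z.2.1]; linarith)
      rw [nhds_prod_eq, Filter.mem_prod_same_iff] at ho
      obtain ⟨U, hU, hUU⟩ := ho
      refine ⟨U, hU, ?_⟩
      by_cases hne : ∃ g₀, ∃ h : g₀ ∈ orthoGroup z, (⟨g₀, iso h⟩ : isomH z) • P ∈ U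
      · obtain ⟨g₀, h₀, hg₀⟩ := hne
        refine Set.Finite.subset (Set.toFinite {g₀, g₀ * halfTurn}) ?_
        rintro g ⟨h, hg⟩
        have h3 : -form z (g P.1) (g₀ P.1) < 1 + δ := hUU (Set.mk_mem_prod hg hg₀)
        have hm : g₀⁻¹ * g ∈ orthoGroup z := mul_mem (inv_mem h₀) h
        have h4 := hsub ((⟨g₀⁻¹ * g, iso hm⟩ : isomH z) • P) (by
          rw [smul_val]
          change -form z (g₀⁻¹ (g P.1)) P.1 < 1 + δ
          rwa [← (iso h₀).1, apply_inv_self])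
        rcases eq_of_interior hz hm (mem_chamber.2 fun i => (h4 i).le) (innerPoint_pos hz) rfl with e | e
        · left; rw [inv_mul_eq_one] at e; exact e.symm
        · right; rw [inv_mul_eq_iff_eq_mul] at e; exact e
      · convert Set.finite_empty
        ext g
        exact ⟨fun h => hne ⟨g, h⟩, fun h => h.elim⟩
    choose! U hU hfin using loc
    obtain ⟨t, ht, hcov⟩ := hK.elim_nhds_subcover U hU
    refine (t.finite_toSet.biUnion fun Z hZ => hfin Z (ht Z hZ)).subset ?_
    rintro g ⟨h, hg⟩
    obtain ⟨Z, hZ, hgZ⟩ := Set.mem_iUnion₂.1 (hcov hg)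
    exact Set.mem_biUnion hZ ⟨h, hgZ⟩
  refine (key _ (isCompact_neg_form_le hz Y (2 * (-form z P.1 X.1) * r))).subset ?_
  rintro g ⟨hg, hr⟩
  refine ⟨hg, ?_⟩
  have h5 := neg_form_le hz ((⟨g, iso hg⟩ : isomH z) • P) ((⟨g, iso hg⟩ : isomH z) • X) Y
  have h6 : form z ((⟨g, iso hg⟩ : isomH z) • P).1 ((⟨g, iso hg⟩ : isomH z) • X).1 =
    form z P.1 X.1 := (iso hg).1 _ _
  rw [h6] at h5
  refine h5.trans (mul_le_mul_of_nonneg_left hr ?_)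
  linarith [form_neg hz P X]

lemma reflect_root_mem (hz : 7 ≤ z) (i : Fin 6) : reflect z (root z i) ∈ orthoGroup z := by
  have := orthoHom_mem hz ((orthoSystem z).simple i)
  rwa [show orthoHom hz ((orthoSystem z).simple i) = reflect z (root z i) by
    rw [orthoHom, OrthoschemeRelations.hom_simple, reflect_root hz]] at this

/-- The reflections of a finite set decrease the distance from a point, until the point lies in
the chamber: if the distance of `g X` from `P` is minimal, then `g X` lies on the same side as `P` of
each mirror. -/
lemma form_nonneg_of_min (hz : 7 ≤ z) {X : V4} {P : V4} {U : V4} (hU : form z U U = 1)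
    (hP : 0 < form z P U) (h : -form z X P ≤ -form z (reflect z U X) P) : 0 ≤ form z X U := by
  rw [reflect_apply z (by rw [hU]; exact one_ne_zero), hU, form_sub_left, form_smul_left,
    form_comm hz U P] at h
  nlinarith

/-- The images of the orthoscheme cover space. -/
theorem exists_mem_orthoscheme (hz : 7 ≤ z) (X : H3 z) :
    ∃ g ∈ orthoGroup z, g X.1 ∈ chamber (bil z) (root z) := by
  set P := innerPoint z hz
  obtain ⟨g, ⟨hg, hr⟩, hmin⟩ := Set.exists_min_image _ (fun g : V4 ≃ₗ[ℝ] V4 => -form z (g X.1) P.1)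
    (finite_form_le hz X P (-form z X.1 P.1)) ⟨1, one_mem _, le_rfl⟩
  refine ⟨g, hg, mem_chamber.2 fun i =>
    form_nonneg_of_min hz (root_self hz i) (innerPoint_pos hz i) ?_⟩
  by_contra hlt
  push Not at hlt
  have := hmin (reflect z (root z i) * g) ⟨mul_mem (reflect_root_mem hz i) hg, by
    rw [LinearEquiv.mul_apply]; linarith⟩
  rw [LinearEquiv.mul_apply] at this
  linarith

end

section

/-! ### The centre of the cobweb polyhedron and the half orthoscheme -/

variable {z : ℕ}

/-- The last coordinate of the point `Q`. -/
def heightQ (z : ℕ) : ℝ := cz z * (1 - cz z ^ 2) / (2 * cz z ^ 2 - 1)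

lemma heightQ_pos (hz : 7 ≤ z) : 0 < heightQ z :=
  div_pos (mul_pos (by linarith [cz_gt hz]) (by linarith [cz_sq_lt hz])) (two_cz_sq_pos hz)

lemma heightQ_lt_one (hz : 7 ≤ z) : heightQ z < 1 := by
  rw [heightQ, div_lt_one (two_cz_sq_pos hz)]
  nlinarith [cz_sq_gt hz, cz_lt_one hz, cz_sq_lt hz]

lemma pointQ_eq (hz : 7 ≤ z) : pointQ z = ![0, 0, 1, heightQ z] := by
  have h1 := ez_pos hz
  have h2 := two_cz_sq_pos hz
  have : -(form z (vertexA 2) (vertexA 3) / form z (vertexA 3) (vertexA 3)) = heightQ z := by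
    rw [form_A2_A3 hz, form_A3_A3 hz, outerSq, heightQ]; field_simp
  rw [pointQ, sub_eq_add_neg, ← neg_smul, this]
  ext i; fin_cases i <;> simp [vertexA]

lemma form_pointQ (hz : 7 ≤ z) (X : V4) : form z X (pointQ z) =
    -(cz z ^ 2 * X 0 + cz z * X 1 + (1 - cz z ^ 2) * X 2) / (2 * cz z ^ 2 - 1) := by
  have h1 := (ez_pos hz).ne'
  have h2 := (two_cz_sq_pos hz).ne'
  rw [form_eq hz, pointQ_eq hz]
  simp only [Matrix.cons_val_zero, Matrix.cons_val_one, Matrix.cons_val, heightQ]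
  rw [div_eq_div_iff h1 h2]
  field_simp
  rw [ez]
  ring

lemma form_halfTurn_right (hz : 7 ≤ z) (X Y : V4) :
    form z X (halfTurn Y) = form z (halfTurn X) Y := by
  rw [← form_halfTurn hz X, show halfTurn (halfTurn Y) = Y from
    congrArg (fun g : V4 ≃ₗ[ℝ] V4 => g Y) halfTurn_mul_self]

lemma form_halfTurn_pointQ (hz : 7 ≤ z) (X : V4) : form z X (halfTurn (pointQ z)) =
    -(cz z ^ 2 * X 3 + cz z * X 2 + (1 - cz z ^ 2) * X 1) / (2 * cz z ^ 2 - 1) := by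
  rw [form_halfTurn_right hz, form_pointQ hz]; rfl

lemma form_pointQ_pointQ (hz : 7 ≤ z) : form z (pointQ z) (pointQ z) < 0 := by
  rw [form_pointQ hz, pointQ_eq hz]
  refine div_neg_of_neg_of_pos ?_ (two_cz_sq_pos hz)
  simpa [abs_lt] using ⟨by linarith [cz_gt hz], cz_lt_one hz⟩

lemma form_pointQ_A2 (hz : 7 ≤ z) : form z (pointQ z) (vertexA 2) < 0 := by
  rw [form_comm hz, form_pointQ hz]
  refine div_neg_of_neg_of_pos ?_ (two_cz_sq_pos hz)
  simpa [vertexA, abs_lt] using ⟨by linarith [cz_gt hz], cz_lt_one hz⟩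

/-- The point `Q` of hyperbolic space. -/
def centre (z : ℕ) (hz : 7 ≤ z) : H3 z :=
  normalize z (pointQ z) (form_pointQ_pointQ hz) (form_pointQ_A2 hz)

lemma centre_val (hz : 7 ≤ z) : ∃ t : ℝ, 0 < t ∧ (centre z hz).1 = t • pointQ z :=
  ⟨_, sqrt_inv_pos (form_pointQ_pointQ hz), rfl⟩

lemma form_pointQ_neg (hz : 7 ≤ z) {g : V4 ≃ₗ[ℝ] V4} (hg : g ∈ isomH z) (X : H3 z) :
    form z X.1 (g (pointQ z)) < 0 := by
  obtain ⟨t, ht, e⟩ := centre_val hz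
  have := form_neg hz X ((⟨g, hg⟩ : isomH z) • centre z hz)
  rw [smul_val, e, map_smul, form_smul_right] at this
  exact (pos_iff_neg_of_mul_neg this).1 ht

lemma hdist_le_iff (hz : 7 ≤ z) {g : V4 ≃ₗ[ℝ] V4} (hg : g ∈ isomH z) (X : H3 z) :
    hdist z X.1 (pointQ z) ≤ hdist z X.1 (g (pointQ z)) ↔
      form z X.1 (g (pointQ z)) ≤ form z X.1 (pointQ z) := by
  have hs : 0 < Real.sqrt (form z X.1 X.1 * form z (pointQ z) (pointQ z)) :=
    Real.sqrt_pos.2 (mul_pos_of_neg_of_neg (by rw [X.2.1]; norm_num) (form_pointQ_pointQ hz))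
  have h1 := form_pointQ_neg hz hg X
  have h2 : form z X.1 (pointQ z) < 0 := form_pointQ_neg hz (one_mem _) X
  rw [hdist, hdist, hg.1, Real.arcosh_le_arcosh (div_pos (by linarith) hs)
    (div_pos (by linarith) hs), div_le_div_iff_of_pos_right hs, neg_le_neg_iff]

lemma form_pointQ_root_zero (hz : 7 ≤ z) : form z (pointQ z) (root z 0) = 0 := by
  rw [form_root_zero_eq_iff hz, form_comm hz, form_pointQ hz]; simp [vertexA]

lemma form_pointQ_root_five (hz : 7 ≤ z) : 0 < form z (pointQ z) (root z 5) := by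
  have h1 : form z (pointQ z) (vertexA 0) < 0 := by
    rw [form_comm hz, form_pointQ hz]
    refine div_neg_of_neg_of_pos ?_ (two_cz_sq_pos hz)
    simp [vertexA]
    nlinarith [cz_sq_gt hz]
  refine lt_of_le_of_ne ((form_root_five_nonneg_iff hz _).2 h1.le) fun h => ?_
  rw [eq_comm, form_root_five_eq_iff hz] at h
  exact h1.ne h

lemma pointQ_mem_chamber (hz : 7 ≤ z) : pointQ z ∈ chamber (bil z) (root z) := by
  refine mem_chamber.2 (forall_fin_six (form_pointQ_root_zero hz).ge (form_pointQ_root_five hz).le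
    fun j => ?_)
  rw [form_root_pole hz, pointQ_eq hz]
  have := heightQ_pos hz
  fin_cases j <;> simp [this.le]

lemma form_pointQ_root_eq_zero (hz : 7 ≤ z) {i : Fin 6} (h : form z (pointQ z) (root z i) = 0) :
    i = 0 ∨ i = 1 ∨ i = 2 := by
  revert i
  have := heightQ_pos hz
  refine forall_fin_six (by simp) (fun h => absurd h (form_pointQ_root_five hz).ne') fun j h => ?_
  rw [form_root_pole hz, pointQ_eq hz] at h
  fin_cases j <;> simp_all

/-! #### The half orthoscheme is the part of the orthoscheme that is closest to `Q` -/

/-- The half orthoscheme consists of the points of the chamber that are at least as near to `Q` as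
to `h Q`. -/
lemma mem_half_iff' (hz : 7 ≤ z) (X : H3 z) : X ∈ halfOrthoscheme z ↔
    X.1 ∈ chamber (bil z) (root z) ∧
      form z X.1 (halfTurn (pointQ z)) ≤ form z X.1 (pointQ z) := by
  rw [← mem_completeOrthoscheme_iff hz, ← hdist_le_iff hz (halfTurn_mem_isomH hz)]; rfl

/-- The constraint by the plane `a₀` is redundant in the half orthoscheme. -/
lemma form_A0_nonpos (hz : 7 ≤ z) {X : V4} (h1 : ∀ i, 0 ≤ X i)
    (h3 : form z X (halfTurn (pointQ z)) ≤ form z X (pointQ z)) : form z X (vertexA 0) ≤ 0 := by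
  have ha := two_cz_sq_pos hz
  have hc := cz_gt hz
  have hc1 := cz_lt_one hz
  rw [form_pointQ hz, form_halfTurn_pointQ hz, div_le_div_iff_of_pos_right ha] at h3
  rw [(form_vertexA hz _).1]
  refine div_nonpos_of_nonpos_of_nonneg ?_ (ez_pos hz).le
  have hq := cz_sq_lt hz
  generalize cz z = c at *
  have e1 : 2 * c ^ 2 - 1 ≤ c ^ 3 := by
    nlinarith [mul_nonneg (sub_nonneg.2 hc1.le) (show 0 ≤ c by linarith)]
  have e2 : (2 * c ^ 2 - 1) * (c - (1 - c ^ 2)) ≤ c ^ 4 := by nlinarith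
  have e3 : 0 ≤ (2 * c ^ 2 - 1) * (c - (1 - c ^ 2)) := mul_nonneg ha.le (by nlinarith)
  have e4 : 0 ≤ c * (1 - c ^ 2) := mul_nonneg (by linarith) (by linarith)
  have f0 := mul_le_mul_of_nonneg_left h3 ha.le
  have f1 := mul_nonneg (sub_nonneg.2 e1) (mul_nonneg (sq_nonneg c) (h1 3))
  have f2 := mul_nonneg (sub_nonneg.2 e2) (h1 2)
  have f3 := mul_nonneg e3 (h1 1)
  have f4 := mul_nonneg e4 (mul_nonneg (sq_nonneg c) (h1 1))
  have : 0 ≤ c ^ 2 * ((1 - 2 * c ^ 2) * X 0 + c * (1 - c ^ 2) * X 1 + c ^ 2 * X 2 +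
    c ^ 3 * X 3) := by nlinarith
  linarith [nonneg_of_mul_nonneg_right this (by positivity)]

lemma mem_half_iff (hz : 7 ≤ z) (X : H3 z) : X ∈ halfOrthoscheme z ↔
    (∀ i, 0 ≤ X.1 i) ∧ form z X.1 (vertexA 3) ≤ 0 ∧
      form z X.1 (halfTurn (pointQ z)) ≤ form z X.1 (pointQ z) := by
  rw [mem_half_iff' hz, ← mem_completeOrthoscheme_iff hz]
  constructor
  · rintro ⟨⟨h1, h2, -⟩, h3⟩; exact ⟨h1, h2, h3⟩
  · rintro ⟨h1, h2, h3⟩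
    exact ⟨⟨h1, h2, form_A0_nonpos hz h1 h3⟩, h3⟩

/-- Among the images of `Q` under the orthoscheme group, `Q` itself is closest to the points of the
half orthoscheme. -/
theorem form_orbit_le_of_mem_half (hz : 7 ≤ z) {X : H3 z} (hX : X ∈ halfOrthoscheme z)
    {g : V4 ≃ₗ[ℝ] V4} (hg : g ∈ orthoGroup z) :
    form z X.1 (g (pointQ z)) ≤ form z X.1 (pointQ z) := by
  rw [mem_half_iff' hz] at hX
  obtain ⟨w, rfl | rfl⟩ := exists_orthoHom hz hg
  · have := (isReflectionRep hz).form_orbit_le _ w rfl X.1 (pointQ z) hX.1 (pointQ_mem_chamber hz)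
    rwa [bil_apply, bil_apply] at this
  · have := (isReflectionRep hz).form_orbit_le _ w rfl X.1 (halfTurn (pointQ z)) hX.1
      (halfTurn_mem_chamber hz (pointQ_mem_chamber hz))
    rw [bil_apply, bil_apply] at this
    exact this.trans hX.2

lemma groupQ_fix (hz : 7 ≤ z) {g : V4 ≃ₗ[ℝ] V4} (hg : g ∈ groupQ z) : g (pointQ z) = pointQ z := by
  have fix : ∀ U, form z U U ≠ 0 → form z (pointQ z) U = 0 → reflect z U (pointQ z) = pointQ z :=
    fun U hU h => by rw [reflect_apply z hU, h]; simp
  have : groupQ z ≤ MulAction.stabilizer (V4 ≃ₗ[ℝ] V4) (pointQ z) := by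
    rw [groupQ, Subgroup.closure_le]
    rintro g (rfl | rfl | rfl)
    · exact fix _ (facePole_ne hz 0) (by rw [form_facePole hz, pointQ_eq hz]; rfl)
    · exact fix _ (facePole_ne hz 1) (by rw [form_facePole hz, pointQ_eq hz]; rfl)
    · exact fix _ (form_A3_ne hz) ((form_root_zero_eq_iff hz _).1 (form_pointQ_root_zero hz))
  exact this hg

lemma halfTurn_pointQ_ne (hz : 7 ≤ z) : halfTurn (pointQ z) ≠ pointQ z := by
  intro h
  have := congrFun h 1
  rw [halfTurn_apply, pointQ_eq hz] at this
  simp at this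

/-- The group `G_Q` is the stabilizer of `Q`. -/
lemma mem_groupQ_iff (hz : 7 ≤ z) {g : V4 ≃ₗ[ℝ] V4} (hg : g ∈ orthoGroup z) :
    g ∈ groupQ z ↔ g (pointQ z) = pointQ z := by
  refine ⟨groupQ_fix hz, fun h => ?_⟩
  obtain ⟨w, rfl | rfl⟩ := exists_orthoHom hz hg
  · have h2 := (stabilizer_orthoHom hz (pointQ_mem_chamber hz) (pointQ_mem_chamber hz) h.symm).2
    have : (Subgroup.closure ((orthoSystem z).simple '' {i | form z (pointQ z) (root z i) = 0})) ≤
        (groupQ z).comap (orthoHom hz) := by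
      rw [Subgroup.closure_le]
      rintro _ ⟨i, hi, rfl⟩
      rw [SetLike.mem_coe, Subgroup.mem_comap, orthoHom, OrthoschemeRelations.hom_simple]
      rcases form_pointQ_root_eq_zero hz hi with rfl | rfl | rfl <;>
        exact Subgroup.subset_closure (by simp [OrthoschemeRelations.mirrors])
    exact this h2
  · exact absurd (stabilizer_orthoHom hz (pointQ_mem_chamber hz)
      (halfTurn_mem_chamber hz (pointQ_mem_chamber hz)) h.symm).1.symm (halfTurn_pointQ_ne hz)

/-! #### Compactness -/

lemma form_self_eq (hz : 7 ≤ z) (X : V4) : form z X X = X 0 * form z X (vertexA 0) +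
    X 1 * form z (halfTurn X) (vertexA 2) + X 2 * form z X (vertexA 2) +
      X 3 * form z X (vertexA 3) := by
  rw [(form_vertexA hz X).1, (form_vertexA hz X).2.1, (form_vertexA hz _).2.1,
    (form_vertexA hz X).2.2, form_eq hz]
  have := (ez_pos hz).ne'
  simp only [halfTurn_apply, Fin.rev]
  field_simp
  simp
  ring

lemma form_self_neg (hz : 7 ≤ z) {X : V4} (hX : X ∈ chamber (bil z) (root z)) (h0 : X ≠ 0) :
    form z X X < 0 := by
  have hr := mem_chamber.1 hX
  have hp : ∀ i, 0 ≤ X i := fun i => by rw [← form_root_pole hz X i]; exact hr _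
  have h3 := (form_root_zero_nonneg_iff hz X).1 (hr 0)
  have hA := (form_root_five_nonneg_iff hz X).1 (hr 5)
  have hE := ez_pos hz
  have ha := two_cz_sq_pos hz
  have hc := cz_gt hz
  have hc1 := cz_lt_one hz
  have hq := cz_sq_lt hz
  have k1 : 0 ≤ 1 - cz z ^ 2 := by linarith
  have k2 : 0 ≤ cz z * (1 - cz z ^ 2) := mul_nonneg (by linarith) k1
  have h2 : ∀ Y : V4, (∀ i, 0 ≤ Y i) → form z Y (vertexA 2) ≤ -((1 - cz z ^ 2) * Y 2) / ez z := by
    intro Y hY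
    rw [(form_vertexA hz _).2.1]
    refine div_le_div_of_nonneg_right (neg_le_neg ?_) hE.le
    have := mul_nonneg (sq_nonneg (cz z)) (hY 0)
    have := mul_nonneg (show 0 ≤ cz z by linarith) (hY 1)
    have := mul_nonneg k2 (hY 3)
    linarith
  have t2 := mul_le_mul_of_nonneg_left (h2 X hp) (hp 2)
  have t1 := mul_le_mul_of_nonneg_left (h2 (halfTurn X) fun i => hp _) (hp 1)
  rw [show halfTurn X 2 = X 1 from rfl] at t1
  have t0 := mul_nonpos_of_nonneg_of_nonpos (hp 0) hA
  have t3 := mul_nonpos_of_nonneg_of_nonpos (hp 3) h3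
  have sq : ∀ x : ℝ, x ≠ 0 → x * (-((1 - cz z ^ 2) * x) / ez z) < 0 := fun x hx => by
    have h1 : 0 < 1 - cz z ^ 2 := by linarith
    have h2 : 0 < x * x := mul_self_pos.2 hx
    have := div_pos (mul_pos h1 h2) hE
    have e : x * (-((1 - cz z ^ 2) * x) / ez z) = -((1 - cz z ^ 2) * (x * x) / ez z) := by ring
    rw [e]; linarith
  have nn : ∀ x : ℝ, x * (-((1 - cz z ^ 2) * x) / ez z) ≤ 0 := fun x => by
    rcases eq_or_ne x 0 with rfl | hx
    · simp
    · exact (sq x hx).le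
  rw [form_self_eq hz]
  by_cases e1 : X 1 = 0
  · by_cases e2 : X 2 = 0
    · have b0 := hA
      have b3 := h3
      rw [(form_vertexA hz X).1, div_le_iff₀ hE, e1, e2] at b0
      rw [(form_vertexA hz X).2.2, div_le_iff₀ hE, e1, e2] at b3
      have lt : 2 * cz z ^ 2 - 1 < cz z ^ 3 := by
        nlinarith [mul_pos (sub_pos.2 hc1) (show 0 < 1 + cz z - cz z ^ 2 by linarith)]
      have p0 : X 0 ≠ 0 := fun e => h0 (by
        have : X 3 = 0 := by rw [e] at b3; nlinarith [hp 3]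
        ext i; fin_cases i <;> assumption)
      have p3 : X 3 ≠ 0 := fun e => p0 (by rw [e] at b0; nlinarith [hp 0])
      have q0 : 0 < X 0 := lt_of_le_of_ne (hp 0) p0.symm
      have q3 : 0 < X 3 := lt_of_le_of_ne (hp 3) p3.symm
      rw [e1, e2, (form_vertexA hz X).1, (form_vertexA hz X).2.2, e1, e2]
      have key : (2 * cz z ^ 2 - 1) * (X 0 * X 0 + X 3 * X 3) < 2 * cz z ^ 3 * (X 0 * X 3) := by
        rcases le_total (X 0) (X 3) with h | h
        · have : (2 * cz z ^ 2 - 1) * X 0 < cz z ^ 3 * X 3 := by nlinarith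
          nlinarith
        · have : (2 * cz z ^ 2 - 1) * X 3 < cz z ^ 3 * X 0 := by nlinarith
          nlinarith
      have : X 0 * (-((1 - 2 * cz z ^ 2) * X 0 + cz z * (1 - cz z ^ 2) * 0 + cz z ^ 2 * 0 +
          cz z ^ 3 * X 3) / ez z) + X 3 * (-((1 - 2 * cz z ^ 2) * X 3 + cz z * (1 - cz z ^ 2) * 0 +
          cz z ^ 2 * 0 + cz z ^ 3 * X 0) / ez z) =
          ((2 * cz z ^ 2 - 1) * (X 0 * X 0 + X 3 * X 3) - 2 * cz z ^ 3 * (X 0 * X 3)) / ez z := by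
        ring
      rw [zero_mul, zero_mul, add_zero, add_zero, this]
      exact div_neg_of_neg_of_pos (by linarith) hE
    · linarith [sq _ e2, nn (X 1)]
  · linarith [sq _ e1, nn (X 2)]

lemma isClosed_chamber (z : ℕ) : IsClosed (chamber (bil z) (root z)) := by
  have : chamber (bil z) (root z) = ⋂ i, {X | 0 ≤ form z X (root z i)} := by
    ext X; rw [mem_chamber]; simp
  rw [this]
  exact isClosed_iInter fun i => isClosed_le continuous_const
    ((continuous_form z).comp (continuous_id.prodMk continuous_const))

lemma isCompact_completeOrthoscheme (hz : 7 ≤ z) : IsCompact (completeOrthoscheme z) := by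
  have hcl : IsClosed (completeOrthoscheme z) := by
    have : completeOrthoscheme z = Subtype.val ⁻¹' chamber (bil z) (root z) := by
      ext X; exact mem_completeOrthoscheme_iff hz X
    rw [this]
    exact (isClosed_chamber z).preimage continuous_subtype_val
  -- the scalar square is bounded away from zero on a compact section of the cone
  set K : Set V4 := chamber (bil z) (root z) ∩ {X | ∑ i, X i = 1} with hK
  have hp : ∀ {X}, X ∈ chamber (bil z) (root z) → ∀ i, 0 ≤ X i := fun {X} hX i => by
    rw [← form_root_pole hz X i]; exact mem_chamber.1 hX _
  have hKc : IsCompact K := by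
    refine (isCompact_univ_pi fun _ : Fin 4 => isCompact_Icc (a := (0 : ℝ)) (b := 1)).of_isClosed_subset
      ((isClosed_chamber z).inter (isClosed_eq (by fun_prop) continuous_const)) ?_
    rintro X ⟨hX, h1⟩ i -
    refine ⟨hp hX i, ?_⟩
    rw [← show ∑ i, X i = 1 from h1]
    exact Finset.single_le_sum (f := X) (fun i _ => hp hX i) (Finset.mem_univ i)
  obtain ⟨m, hm, hmb⟩ : ∃ m > 0, ∀ X ∈ K, m ≤ -form z X X := by
    rcases K.eq_empty_or_nonempty with he | hne
    · exact ⟨1, one_pos, fun X hX => by rw [he] at hX; exact hX.elim⟩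
    · obtain ⟨P, hP, hmin⟩ := hKc.exists_isMinOn hne (f := fun X => -form z X X)
        ((continuous_form z).comp (continuous_id.prodMk continuous_id)).neg.continuousOn
      refine ⟨_, neg_pos.2 (form_self_neg hz hP.1 fun h => ?_), hmin⟩
      have : ∑ i, P i = 1 := hP.2
      rw [h] at this; simp at this
  refine isCompact_of_form_le hz hcl (centre z hz)
    ((∑ i, -form z (vertexA i) (centre z hz).1 ⊔ 0) * (Real.sqrt m)⁻¹) fun X hX => ?_
  have hX' := (mem_completeOrthoscheme_iff hz X).1 hX
  have hs : 0 < ∑ i, X.1 i := by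
    refine lt_of_le_of_ne (Finset.sum_nonneg fun i _ => hp hX' i) fun h => ?_
    have h0 := (Finset.sum_eq_zero_iff_of_nonneg fun i _ => hp hX' i).1 h.symm
    have : X.1 = 0 := funext fun i => h0 i (Finset.mem_univ i)
    have h1 := X.2.1
    rw [this, form_zero_left] at h1; norm_num at h1
  set S := ∑ i, X.1 i with hS
  have hb : S ≤ (Real.sqrt m)⁻¹ := by
    have hk : S⁻¹ • X.1 ∈ K := by
      refine ⟨mem_chamber.2 fun i => ?_, ?_⟩
      · rw [form_smul_left]
        exact mul_nonneg (inv_pos.2 hs).le (mem_chamber.1 hX' i)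
      · change ∑ i, S⁻¹ * X.1 i = 1
        rw [← Finset.mul_sum, inv_mul_cancel₀ hs.ne']
    have := hmb _ hk
    rw [form_smul_left, form_smul_right, X.2.1] at this
    have h2 : m ≤ (S⁻¹) ^ 2 := by nlinarith
    have h3 := (Real.sqrt_le_left (inv_pos.2 hs).le).2 h2
    rwa [le_inv_comm₀ hs (Real.sqrt_pos.2 hm)]
  have hdec : X.1 = ∑ i, X.1 i • vertexA i := by
    ext j; simp [vertexA, Pi.single_apply]
  have hform : -form z X.1 (centre z hz).1 =
      ∑ i, X.1 i * -form z (vertexA i) (centre z hz).1 := by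
    conv_lhs => rw [hdec]
    simp only [← bil_apply, map_sum, LinearMap.sum_apply, map_smul, LinearMap.smul_apply,
      smul_eq_mul, mul_neg, Finset.sum_neg_distrib]
  rw [hform, Finset.sum_mul]
  refine Finset.sum_le_sum fun i _ => ?_
  calc X.1 i * -form z (vertexA i) (centre z hz).1
      ≤ X.1 i * (-form z (vertexA i) (centre z hz).1 ⊔ 0) :=
        mul_le_mul_of_nonneg_left le_sup_left (hp hX' i)
    _ ≤ (Real.sqrt m)⁻¹ * (-form z (vertexA i) (centre z hz).1 ⊔ 0) :=
        mul_le_mul_of_nonneg_right ((Finset.single_le_sum (f := X.1) (fun i _ => hp hX' i)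
          (Finset.mem_univ i)).trans hb) le_sup_right
    _ = _ := mul_comm _ _

lemma isCompact_halfOrthoscheme (hz : 7 ≤ z) : IsCompact (halfOrthoscheme z) := by
  refine (isCompact_completeOrthoscheme hz).of_isClosed_subset ?_ fun X hX => hX.1
  have : halfOrthoscheme z = completeOrthoscheme z ∩
      {X : H3 z | form z X.1 (halfTurn (pointQ z)) ≤ form z X.1 (pointQ z)} := by
    ext X
    rw [mem_half_iff' hz, ← mem_completeOrthoscheme_iff hz]; rfl
  rw [this]
  exact (isCompact_completeOrthoscheme hz).isClosed.inter
    (isClosed_le (continuous_form_left _) (continuous_form_left _))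

end

section

namespace OrthoschemeRelations

/-! ### The images of the centre under the pairings

In this part the group acts on a set that contains a point `q` fixed by `r₀`, `r₁` and `r_a`. -/

variable {H X : Type*} [Group H] [MulAction H X] {z p : ℕ} {r0 r1 ra h : H} {q : X}

/-- The point `q` is fixed by `r₀`, `r₁` and `r_a`. -/
structure IsCentre (r0 r1 ra : H) (q : X) : Prop where
  r0 : r0 • q = q
  r1 : r1 • q = q
  ra : ra • q = q

lemma IsCentre.zpow (hq : IsCentre r0 r1 ra q) (n : ℤ) : (r0 * r1) ^ n • q = q := by
  have h1 : r0 * r1 ∈ MulAction.stabilizer H q := by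
    rw [MulAction.mem_stabilizer_iff, mul_smul, hq.r1, hq.r0]
  exact zpow_mem h1 n

lemma sideAt_smul (j : ℤ) (x : X) : sideAt r0 r1 ra h p j • x =
    (r0 * r1) ^ (-(2 * j)) • side r0 r1 ra h p • (r0 * r1) ^ (2 * j) • x := by
  rw [sideAt, zpow_neg, mul_smul, mul_smul]

lemma sideAt_inv_smul (j : ℤ) (x : X) : (sideAt r0 r1 ra h p j)⁻¹ • x =
    (r0 * r1) ^ (-(2 * j)) • (side r0 r1 ra h p)⁻¹ • (r0 * r1) ^ (2 * j) • x := by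
  rw [inv_smul_eq_iff, sideAt_smul]
  simp only [← mul_smul, ← mul_assoc, ← zpow_add]
  simp

lemma side_inv_smul (hr : OrthoschemeRelations z r0 r1 ra h) (x : X) :
    (side r0 r1 ra h p)⁻¹ • x = (r0 * r1) ^ (1 - 2 * (p : ℤ)) • ra • h • r0 • x := by
  have := congrArg (· • x) (hr.side_inv_mul (p := p) 1)
  simpa only [mul_one, mul_smul] using this

lemma base_smul (hr : OrthoschemeRelations z r0 r1 ra h) (x : X) :
    base r0 r1 ra h p • x = (r0 * r1) ^ (4 * (p : ℤ) - 2) • (h * r0 * h) • ra • x := by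
  have := congrArg (· • x) (hr.base_mul (p := p) 1)
  simpa only [mul_one, mul_smul] using this

lemma base_inv_smul (hr : OrthoschemeRelations z r0 r1 ra h) (x : X) :
    (base r0 r1 ra h p)⁻¹ • x = (r0 * r1) ^ (2 - 4 * (p : ℤ)) • ra • (h * r0 * h) • x := by
  have := congrArg (· • x) (hr.base_inv_mul (p := p) 1)
  simpa only [mul_one, mul_smul] using this

lemma side_smul (x : X) : side r0 r1 ra h p • x =
    r0 • h • ra • (r0 * r1) ^ (2 * (p : ℤ) - 1) • x := by
  have := congrArg (· • x) (side_mul (r0 := r0) (r1 := r1) (ra := ra) (h := h) (p := p) 1)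
  simpa only [mul_one, mul_smul] using this

lemma r3_smul_zpow (hr : OrthoschemeRelations z r0 r1 ra h) (n : ℤ) (x : X) :
    (h * r0 * h) • (r0 * r1) ^ n • x = (r0 * r1) ^ n • (h * r0 * h) • x := by
  rw [← mul_smul, (hr.commute_r3.zpow_right n).eq, mul_smul]

lemma ra_smul_zpow (hr : OrthoschemeRelations z r0 r1 ra h) (n : ℤ) (x : X) :
    ra • (r0 * r1) ^ n • x = (r0 * r1) ^ n • ra • x := by
  rw [← mul_smul, (hr.commute_ra.zpow_right n).eq, mul_smul]

lemma r3_smul_h (hr : OrthoschemeRelations z r0 r1 ra h) (x : X) :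
    (h * r0 * h) • h • x = h • r0 • x := by
  rw [← mul_smul, ← mul_smul, mul_assoc, hr.h_sq, mul_one]

lemma h_smul_r3 (hr : OrthoschemeRelations z r0 r1 ra h) (x : X) :
    h • (h * r0 * h) • x = r0 • h • x := by
  rw [← mul_smul, ← mul_smul, ← mul_assoc, ← mul_assoc, hr.h_sq, one_mul]

lemma zpow_smul_zpow (m n : ℤ) (x : X) :
    (r0 * r1) ^ m • (r0 * r1) ^ n • x = (r0 * r1) ^ (m + n) • x := by
  rw [zpow_add, mul_smul]

lemma sq_smul {a : H} (ha : a * a = 1) (x : X) : a • a • x = x := by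
  rw [← mul_smul, ha, one_smul]

lemma r3_smul_r0 (hr : OrthoschemeRelations z r0 r1 ra h) (x : X) :
    (h * r0 * h) • r0 • x = r0 • (h * r0 * h) • x := by
  rw [← mul_smul, hr.r3_r0, mul_smul]

lemma ra_smul_r0 (hr : OrthoschemeRelations z r0 r1 ra h) (x : X) :
    ra • r0 • x = r0 • ra • x := by
  rw [← mul_smul, hr.ra_r0, mul_smul]

lemma base_centre (hr : OrthoschemeRelations z r0 r1 ra h) (hq : IsCentre r0 r1 ra q) :
    base r0 r1 ra h p • q = (h * r0 * h) • q := by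
  rw [hr.base_smul, hq.ra, ← hr.r3_smul_zpow, hq.zpow]

lemma base_inv_centre (hr : OrthoschemeRelations z r0 r1 ra h) (hq : IsCentre r0 r1 ra q) :
    (base r0 r1 ra h p)⁻¹ • q = ra • (h * r0 * h) • q := by
  rw [hr.base_inv_smul, ← hr.ra_smul_zpow, ← hr.r3_smul_zpow, hq.zpow]

lemma middle_centre (hr : OrthoschemeRelations z r0 r1 ra h) (hq : IsCentre r0 r1 ra q) (j : ℤ) :
    (sideAt r0 r1 ra h p j * (base r0 r1 ra h p)⁻¹ * sideAt r0 r1 ra h p (1 - p + j)) • q =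
      (r0 * r1) ^ (-(2 * j)) • (h * r1 * h) • q := by
  rw [hr.middle_at, MulAut.conj_apply, mul_smul, ← zpow_neg, hq.zpow, mul_smul, mul_smul, mul_smul,
    ← zpow_one (r0 * r1), hq.zpow, hq.ra]

lemma middle_inv_centre (hr : OrthoschemeRelations z r0 r1 ra h) (hq : IsCentre r0 r1 ra q)
    (j : ℤ) : (sideAt r0 r1 ra h p j * (base r0 r1 ra h p)⁻¹ * sideAt r0 r1 ra h p (1 - p + j))⁻¹ • q =
      (r0 * r1) ^ (-(2 * j) - 1) • (h * r1 * h) • q := by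
  have e : (h * r1 * h * ra * (r0 * r1))⁻¹ = (r0 * r1) ^ (-1 : ℤ) * (ra * (h * r1 * h)) := by
    rw [mul_inv_rev, mul_inv_rev (_ * r1 * h), hr.inv_ra, zpow_neg_one, mul_inv_rev (h * r1),
      mul_inv_rev h, hr.h_inv, hr.inv_r1, ← mul_assoc h]
  rw [hr.middle_at, ← map_inv, MulAut.conj_apply, mul_smul, ← zpow_neg, hq.zpow, e, hr.ra_r2, mul_smul,
    mul_smul, zpow_smul_zpow, mul_smul, hq.ra, sub_eq_add_neg]

lemma side_centre (hq : IsCentre r0 r1 ra q) (j : ℤ) :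
    sideAt r0 r1 ra h p j • q = (r0 * r1) ^ (-(2 * j)) • r0 • h • q := by
  rw [sideAt_smul, hq.zpow, side_smul, hq.zpow, hq.ra]

lemma side_inv_centre (hr : OrthoschemeRelations z r0 r1 ra h) (hq : IsCentre r0 r1 ra q) (j : ℤ) :
    (sideAt r0 r1 ra h p j)⁻¹ • q = (r0 * r1) ^ (-(2 * j) + (1 - 2 * p)) • ra • h • q := by
  rw [sideAt_inv_smul, hq.zpow, hr.side_inv_smul, hq.r0, zpow_smul_zpow]

lemma base_inv_side_centre (hr : OrthoschemeRelations z r0 r1 ra h) (hq : IsCentre r0 r1 ra q)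
    (j : ℤ) : ((base r0 r1 ra h p)⁻¹ * sideAt r0 r1 ra h p j) • q =
      (r0 * r1) ^ (-(2 * j) + (2 - 4 * p)) • r0 • ra • h • q := by
  rw [mul_smul, side_centre hq, hr.base_inv_smul, hr.r3_smul_zpow, hr.ra_smul_zpow, zpow_smul_zpow,
    hr.r3_smul_r0, hr.r3_smul_h, hq.r0, hr.ra_smul_r0, add_comm]

lemma side_inv_base_centre (hr : OrthoschemeRelations z r0 r1 ra h) (hq : IsCentre r0 r1 ra q)
    (j : ℤ) : ((base r0 r1 ra h p)⁻¹ * sideAt r0 r1 ra h p j)⁻¹ • q =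
      (r0 * r1) ^ (-(2 * j) + (1 - 2 * p)) • r0 • ra • h • q := by
  rw [mul_inv_rev, inv_inv, mul_smul, hr.base_centre hq, sideAt_inv_smul, ← hr.r3_smul_zpow,
    hq.zpow, hr.side_inv_smul, ← hr.r3_smul_r0, hq.r0, hr.h_smul_r3, hr.ra_smul_r0, zpow_smul_zpow]

lemma side_base_inv_centre (hr : OrthoschemeRelations z r0 r1 ra h) (hq : IsCentre r0 r1 ra q)
    (j : ℤ) : (sideAt r0 r1 ra h p j * (base r0 r1 ra h p)⁻¹) • q =
      (r0 * r1) ^ (-(2 * j)) • h • q := by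
  rw [mul_smul, hr.base_inv_centre hq, sideAt_smul, ← hr.ra_smul_zpow, ← hr.r3_smul_zpow, hq.zpow,
    side_smul, ← hr.ra_smul_zpow, ← hr.r3_smul_zpow, hq.zpow, sq_smul hr.ra_sq, hr.h_smul_r3,
    sq_smul hr.r0_sq]

lemma base_side_inv_centre (hr : OrthoschemeRelations z r0 r1 ra h) (hq : IsCentre r0 r1 ra q)
    (j : ℤ) : (sideAt r0 r1 ra h p j * (base r0 r1 ra h p)⁻¹)⁻¹ • q =
      (r0 * r1) ^ (-(2 * j) + (2 * p - 1)) • h • q := by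
  rw [mul_inv_rev, inv_inv, mul_smul, hr.side_inv_centre hq, hr.base_smul, hr.ra_smul_zpow,
    sq_smul hr.ra_sq, hr.r3_smul_zpow, zpow_smul_zpow, hr.r3_smul_h, hq.r0]
  congr 2; ring

lemma base_inv_side_base_inv_centre (hr : OrthoschemeRelations z r0 r1 ra h)
    (hq : IsCentre r0 r1 ra q) (j : ℤ) :
    ((base r0 r1 ra h p)⁻¹ * sideAt r0 r1 ra h p j * (base r0 r1 ra h p)⁻¹) • q =
      (r0 * r1) ^ (-(2 * j) + (2 - 4 * p)) • ra • h • q := by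
  rw [mul_assoc, mul_smul, hr.side_base_inv_centre hq, hr.base_inv_smul, hr.r3_smul_zpow,
    hr.ra_smul_zpow, zpow_smul_zpow, hr.r3_smul_h, hq.r0, add_comm]

lemma base_side_inv_base_centre (hr : OrthoschemeRelations z r0 r1 ra h)
    (hq : IsCentre r0 r1 ra q) (j : ℤ) :
    ((base r0 r1 ra h p)⁻¹ * sideAt r0 r1 ra h p j * (base r0 r1 ra h p)⁻¹)⁻¹ • q =
      (r0 * r1) ^ (-(2 * j) + (2 * p - 1)) • r0 • h • q := by
  rw [mul_inv_rev, inv_inv, mul_smul, hr.side_inv_base_centre hq, hr.base_smul, hr.ra_smul_zpow,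
    ← hr.ra_smul_r0, sq_smul hr.ra_sq, hr.r3_smul_zpow, zpow_smul_zpow, hr.r3_smul_r0, hr.r3_smul_h,
    hq.r0]
  congr 2; ring

lemma ra_mul_zpow_cond (hr : OrthoschemeRelations z r0 r1 ra h) (n : ℤ) (e d : Bool) :
    (bif d then ra else 1) * ((r0 * r1) ^ n * (bif e then r0 else 1)) =
      (r0 * r1) ^ n * ((bif e then r0 else 1) * (bif d then ra else 1)) := by
  cases d
  · simp
  · rw [cond_true, hr.ra_mul_zpow]
    cases e
    · simp
    · rw [cond_true, hr.ra_r0]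

end OrthoschemeRelations

/-! ### The neighbours of the centre -/

open OrthoschemeRelations

variable {z p : ℕ}

lemma isCentre (hz : 7 ≤ z) : IsCentre (planeRefl z 0) (planeRefl z 1) (reflA3 z) (pointQ z) where
  r0 := groupQ_fix hz (Subgroup.subset_closure (by simp))
  r1 := groupQ_fix hz (Subgroup.subset_closure (by simp))
  ra := groupQ_fix hz (Subgroup.subset_closure (by simp))

/-- The images of `r₃ Q`, `r₂ Q` and `h Q` under the group `G_Q`. -/
def neighbours (z : ℕ) : Set V4 := {v | ∃ g ∈ groupQ z, v = g (planeRefl z 3 (pointQ z)) ∨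
  v = g (planeRefl z 2 (pointQ z)) ∨ v = g (halfTurn (pointQ z))}

lemma rot_zpow_mem (n : ℤ) : rot z ^ n ∈ groupQ z :=
  zpow_mem (mul_mem (Subgroup.subset_closure (by simp)) (Subgroup.subset_closure (by simp))) n

lemma r0_mem_groupQ : planeRefl z 0 ∈ groupQ z := Subgroup.subset_closure (by simp)
lemma ra_mem_groupQ : reflA3 z ∈ groupQ z := Subgroup.subset_closure (by simp)

lemma sideScrew_intCast (hz : 7 ≤ z) (hzp : (z : ℤ) = 4 * p - 1) (j : ℤ) :
    sideScrew z p (j : ZMod z) =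
      sideAt (planeRefl z 0) (planeRefl z 1) (reflA3 z) halfTurn p j := by
  have : NeZero z := ⟨by omega⟩
  rw [sideScrew_eq hz hzp]
  exact (orthoRelations hz).sideAt_congr (by simp)

lemma middleScrew_intCast (hz : 7 ≤ z) (hzp : (z : ℤ) = 4 * p - 1) (j : ℤ) :
    middleScrew z p (j : ZMod z) =
      sideAt (planeRefl z 0) (planeRefl z 1) (reflA3 z) halfTurn p j *
        (base (planeRefl z 0) (planeRefl z 1) (reflA3 z) halfTurn p)⁻¹ *
        sideAt (planeRefl z 0) (planeRefl z 1) (reflA3 z) halfTurn p (1 - p + j) := by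
  rw [middleScrew, sideScrew_intCast hz hzp, baseScrew_eq hz hzp,
    show (j : ZMod z) + 1 - p = ((1 - p + j : ℤ) : ZMod z) by push_cast; ring,
    sideScrew_intCast hz hzp]

lemma r3_eq (hz : 7 ≤ z) : halfTurn * planeRefl z 0 * halfTurn = planeRefl z 3 :=
  halfTurn_conj_planeRefl hz 0

lemma r2_eq (hz : 7 ≤ z) : halfTurn * planeRefl z 1 * halfTurn = planeRefl z 2 :=
  halfTurn_conj_planeRefl hz 1

lemma baseScrew_pointQ (hz : 7 ≤ z) (hzp : (z : ℤ) = 4 * p - 1) :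
    baseScrew z (pointQ z) = planeRefl z 3 (pointQ z) := by
  rw [baseScrew_eq hz hzp, ← r3_eq hz]
  exact (orthoRelations hz).base_centre (isCentre hz)

lemma baseScrew_inv_pointQ (hz : 7 ≤ z) (hzp : (z : ℤ) = 4 * p - 1) :
    (baseScrew z)⁻¹ (pointQ z) = reflA3 z (planeRefl z 3 (pointQ z)) := by
  rw [baseScrew_eq hz hzp, ← r3_eq hz]
  exact (orthoRelations hz).base_inv_centre (isCentre hz)

/-- The neighbours of `Q` in the tiling are its images under the face pairings. -/
theorem image_facePairings (hz : 7 ≤ z) (hzp : (z : ℤ) = 4 * p - 1) :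
    (fun γ : V4 ≃ₗ[ℝ] V4 => γ (pointQ z)) '' facePairings z p = neighbours z := by
  have hr := orthoRelations hz
  have hq := isCentre hz
  have cast : ∀ i : ZMod z, ∃ j : ℤ, (j : ZMod z) = i := ZMod.intCast_surjective
  have R : ∀ n : ℤ, (planeRefl z 0 * planeRefl z 1) ^ n ∈ groupQ z := rot_zpow_mem
  have hR : ∀ {n : ℤ} {g : V4 ≃ₗ[ℝ] V4}, g ∈ groupQ z →
      (planeRefl z 0 * planeRefl z 1) ^ n • g • halfTurn • pointQ z ∈ neighbours z :=
    fun {n g} hg => ⟨_, mul_mem (R n) hg, Or.inr (Or.inr rfl)⟩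
  have m0 := r0_mem_groupQ (z := z)
  have ma := ra_mem_groupQ (z := z)
  have hR2 : ∀ n : ℤ, (planeRefl z 0 * planeRefl z 1) ^ n •
      (halfTurn * planeRefl z 1 * halfTurn) • pointQ z ∈ neighbours z := fun n =>
    ⟨_, R n, Or.inr (Or.inl (by rw [r2_eq hz]; rfl))⟩
  ext v
  constructor
  · rintro ⟨γ, hγ, rfl⟩
    change γ • pointQ z ∈ neighbours z
    rw [← inv_inv γ] 
    rcases hγ with (((((h | ⟨i, h⟩) | ⟨i, h⟩) | ⟨i, h⟩) | ⟨i, h⟩) | ⟨i, h⟩) |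
      (((((h | ⟨i, h⟩) | ⟨i, h⟩) | ⟨i, h⟩) | ⟨i, h⟩) | ⟨i, h⟩)
    · rw [inv_inv, h, baseScrew_eq hz hzp, hr.base_centre hq, r3_eq hz]
      exact ⟨1, one_mem _, Or.inl rfl⟩
    · obtain ⟨j, rfl⟩ := cast i
      rw [inv_inv, ← h, middleScrew_intCast hz hzp, hr.middle_centre hq]
      exact hR2 _
    · obtain ⟨j, rfl⟩ := cast i
      rw [inv_inv, ← h, sideScrew_intCast hz hzp, side_centre hq]
      exact hR m0
    · obtain ⟨j, rfl⟩ := cast i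
      beta_reduce at h
      rw [inv_inv, ← h, baseScrew_eq hz hzp, sideScrew_intCast hz hzp, hr.base_inv_side_centre hq]
      exact hR (mul_mem m0 ma)
    · obtain ⟨j, rfl⟩ := cast i
      beta_reduce at h
      rw [inv_inv, ← h, baseScrew_eq hz hzp, sideScrew_intCast hz hzp, hr.side_base_inv_centre hq]
      exact hR (one_mem _)
    · obtain ⟨j, rfl⟩ := cast i
      beta_reduce at h
      rw [inv_inv, ← h, baseScrew_eq hz hzp, sideScrew_intCast hz hzp,
        hr.base_inv_side_base_inv_centre hq]
      exact hR ma
    · rw [show γ⁻¹ = _ from h, baseScrew_eq hz hzp, hr.base_inv_centre hq, r3_eq hz]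
      exact ⟨_, ma, Or.inl rfl⟩
    · obtain ⟨j, rfl⟩ := cast i
      rw [← h, middleScrew_intCast hz hzp, hr.middle_inv_centre hq]
      exact hR2 _
    · obtain ⟨j, rfl⟩ := cast i
      rw [← h, sideScrew_intCast hz hzp, hr.side_inv_centre hq]
      exact hR ma
    · obtain ⟨j, rfl⟩ := cast i
      beta_reduce at h
      rw [← h, baseScrew_eq hz hzp, sideScrew_intCast hz hzp, hr.side_inv_base_centre hq]
      exact hR (mul_mem m0 ma)
    · obtain ⟨j, rfl⟩ := cast i
      beta_reduce at h
      rw [← h, baseScrew_eq hz hzp, sideScrew_intCast hz hzp, hr.base_side_inv_centre hq]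
      exact hR (one_mem _)
    · obtain ⟨j, rfl⟩ := cast i
      beta_reduce at h
      rw [← h, baseScrew_eq hz hzp, sideScrew_intCast hz hzp, hr.base_side_inv_base_centre hq]
      exact hR m0
  · rintro ⟨g, hg, hv⟩
    obtain ⟨n, e, d, rfl⟩ := exists_normal_form hr.r0_sq hr.r1_sq hr.ra_sq hr.ra_r0 hr.ra_r1 hg
    rcases hv with rfl | rfl | rfl
    · change (_ : V4 ≃ₗ[ℝ] V4) • planeRefl z 3 • pointQ z ∈ _
      have e0 : (bif e then planeRefl z 0 else 1 : V4 ≃ₗ[ℝ] V4) • planeRefl z 3 • pointQ z =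
          planeRefl z 3 • pointQ z := by
        cases e
        · exact one_smul _ _
        · rw [cond_true, ← r3_eq hz, ← hr.r3_smul_r0, hq.r0]
      rw [mul_assoc, ← (hr.ra_mul_zpow_cond n e d), mul_smul, mul_smul, e0, ← r3_eq hz,
        ← hr.r3_smul_zpow, hq.zpow]
      cases d
      · refine ⟨baseScrew z, Or.inl (by simp [pairingHalf]), ?_⟩
        change baseScrew z • pointQ z = _
        rw [baseScrew_eq hz hzp, hr.base_centre hq, cond_false, one_smul]
      · refine ⟨(baseScrew z)⁻¹, Or.inr (by simp [pairingHalf]), ?_⟩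
        change (baseScrew z)⁻¹ • pointQ z = _
        rw [baseScrew_eq hz hzp, hr.base_inv_centre hq, cond_true]
    · change (_ : V4 ≃ₗ[ℝ] V4) • planeRefl z 2 • pointQ z ∈ _
      have ea : (bif d then reflA3 z else 1 : V4 ≃ₗ[ℝ] V4) • planeRefl z 2 • pointQ z =
          planeRefl z 2 • pointQ z := by
        cases d
        · exact one_smul _ _
        · rw [cond_true, ← r2_eq hz, ← mul_smul, hr.ra_r2, mul_smul, hq.ra]
      have e0 : (bif e then planeRefl z 0 else 1 : V4 ≃ₗ[ℝ] V4) • planeRefl z 2 • pointQ z =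
          planeRefl z 2 • pointQ z := by
        cases e
        · exact one_smul _ _
        · rw [cond_true, ← r2_eq hz, ← mul_smul, ← hr.r0_r2, mul_smul, hq.r0]
      rw [mul_smul, ea, mul_smul, e0, ← r2_eq hz]
      rcases Int.even_or_odd' n with ⟨k, rfl | rfl⟩
      · refine ⟨middleScrew z p ((-k : ℤ) : ZMod z), Or.inl (by simp [pairingHalf]), ?_⟩
        change middleScrew z p _ • pointQ z = _
        rw [middleScrew_intCast hz hzp, hr.middle_centre hq]; congr 2; ring
      · refine ⟨(middleScrew z p ((-k - 1 : ℤ) : ZMod z))⁻¹, Or.inr (by simp [pairingHalf]), ?_⟩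
        change (middleScrew z p _)⁻¹ • pointQ z = _
        rw [middleScrew_intCast hz hzp, hr.middle_inv_centre hq]; congr 2; ring
    · change (_ : V4 ≃ₗ[ℝ] V4) • halfTurn • pointQ z ∈ _
      rw [mul_smul, mul_smul]
      rcases Int.even_or_odd' n with ⟨k, rfl | rfl⟩
      · cases e
        · cases d
          · refine ⟨sideScrew z p ((-k : ℤ) : ZMod z) * (baseScrew z)⁻¹,
              Or.inl (by simp [pairingHalf]), ?_⟩
            change (_ : V4 ≃ₗ[ℝ] V4) • pointQ z = _
            rw [sideScrew_intCast hz hzp, baseScrew_eq hz hzp, hr.side_base_inv_centre hq,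
              cond_false, cond_false, one_smul, one_smul]
            congr 2; ring
          · refine ⟨(baseScrew z)⁻¹ * sideScrew z p ((1 - 2 * p - k : ℤ) : ZMod z) * (baseScrew z)⁻¹,
              Or.inl (by simp [pairingHalf]), ?_⟩
            change (_ : V4 ≃ₗ[ℝ] V4) • pointQ z = _
            rw [sideScrew_intCast hz hzp, baseScrew_eq hz hzp, hr.base_inv_side_base_inv_centre hq,
              cond_false, cond_true, one_smul]
            congr 2; ring
        · cases d
          · refine ⟨sideScrew z p ((-k : ℤ) : ZMod z), Or.inl (by simp [pairingHalf]), ?_⟩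
            change (_ : V4 ≃ₗ[ℝ] V4) • pointQ z = _
            rw [sideScrew_intCast hz hzp, side_centre hq, cond_false, cond_true, one_smul]
            congr 2; ring
          · refine ⟨(baseScrew z)⁻¹ * sideScrew z p ((1 - 2 * p - k : ℤ) : ZMod z),
              Or.inl (by simp [pairingHalf]), ?_⟩
            change (_ : V4 ≃ₗ[ℝ] V4) • pointQ z = _
            rw [sideScrew_intCast hz hzp, baseScrew_eq hz hzp, hr.base_inv_side_centre hq,
              cond_true, cond_true]
            congr 2; ring
      · cases e
        · cases d
          · refine ⟨(sideScrew z p ((p - 1 - k : ℤ) : ZMod z) * (baseScrew z)⁻¹)⁻¹,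
              Or.inr (by rw [inv_inv]; simp [pairingHalf]), ?_⟩
            change (_ : V4 ≃ₗ[ℝ] V4) • pointQ z = _
            rw [sideScrew_intCast hz hzp, baseScrew_eq hz hzp, hr.base_side_inv_centre hq,
              cond_false, cond_false, one_smul, one_smul]
            congr 2; ring
          · refine ⟨(sideScrew z p ((-p - k : ℤ) : ZMod z))⁻¹,
              Or.inr (by rw [inv_inv]; simp [pairingHalf]), ?_⟩
            change (_ : V4 ≃ₗ[ℝ] V4) • pointQ z = _
            rw [sideScrew_intCast hz hzp, hr.side_inv_centre hq, cond_false, cond_true, one_smul]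
            congr 2; ring
        · cases d
          · refine ⟨((baseScrew z)⁻¹ * sideScrew z p ((p - 1 - k : ℤ) : ZMod z) * (baseScrew z)⁻¹)⁻¹,
              Or.inr (by rw [inv_inv]; simp [pairingHalf]), ?_⟩
            change (_ : V4 ≃ₗ[ℝ] V4) • pointQ z = _
            rw [sideScrew_intCast hz hzp, baseScrew_eq hz hzp, hr.base_side_inv_base_centre hq,
              cond_false, cond_true, one_smul]
            congr 2; ring
          · refine ⟨((baseScrew z)⁻¹ * sideScrew z p ((-p - k : ℤ) : ZMod z))⁻¹,
              Or.inr (by rw [inv_inv]; simp [pairingHalf]), ?_⟩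
            change (_ : V4 ≃ₗ[ℝ] V4) • pointQ z = _
            rw [sideScrew_intCast hz hzp, baseScrew_eq hz hzp, hr.side_inv_base_centre hq,
              cond_true, cond_true]
            congr 2; ring

end

section

/-! ### The cobweb polyhedron as a Voronoi cell -/

variable {z p : ℕ}

lemma form_inv_left {g : V4 ≃ₗ[ℝ] V4} (hg : g ∈ isomH z) (X Y : V4) :
    form z (g⁻¹ X) Y = form z X (g Y) := by
  rw [← hg.1, apply_inv_self]

lemma mem_cobweb_iff_exists (X : H3 z) :
    X ∈ cobweb z ↔ ∃ g ∈ groupQ z, ∃ Y ∈ halfOrthoscheme z, X.1 = g Y.1 := by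
  rw [cobweb, Set.mem_iUnion₂]
  exact ⟨fun ⟨g, hg, Y, hY, e⟩ => ⟨g, hg, Y, hY, e⟩, fun ⟨g, hg, Y, hY, e⟩ => ⟨g, hg, Y, hY, e⟩⟩

lemma form_orbit_le_of_mem_cobweb (hz : 7 ≤ z) {X : H3 z} (hX : X ∈ cobweb z)
    {g : V4 ≃ₗ[ℝ] V4} (hg : g ∈ orthoGroup z) :
    form z X.1 (g (pointQ z)) ≤ form z X.1 (pointQ z) := by
  obtain ⟨k, hk, Y, hY, e⟩ := (mem_cobweb_iff_exists X).1 hX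
  have hk' := orthoGroup_le hz (groupQ_le hk)
  have h := form_orbit_le_of_mem_half hz hY (mul_mem (inv_mem (groupQ_le hk)) hg)
  rw [LinearEquiv.mul_apply, ← hk'.1, apply_inv_self, ← hk'.1 _ (pointQ z), groupQ_fix hz hk,
    ← e] at h
  exact h

lemma form_planeRefl (hz : 7 ≤ z) (i : Fin 4) (X Y : V4) :
    form z X (planeRefl z i Y) = form z X Y - 2 * Y i * X i := by
  rw [planeRefl, reflect_apply z (facePole_ne hz i), form_sub_right, form_smul_right,
    form_facePole_self hz, form_facePole hz, form_facePole hz, div_one]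

/-- The neighbours of `Q` determine the cobweb polyhedron: a point that is at least as close to `Q`
as to the neighbours can be moved by `G_Q` into the half orthoscheme. -/
theorem mem_cobweb_of_neighbours (hz : 7 ≤ z) {X : H3 z}
    (h : ∀ v ∈ neighbours z, form z X.1 v ≤ form z X.1 (pointQ z)) : X ∈ cobweb z := by
  set P := innerPoint z hz
  obtain ⟨g, ⟨hg, hr⟩, hmin⟩ := Set.exists_min_image _ (fun g : V4 ≃ₗ[ℝ] V4 => -form z (g X.1) P.1)
    ((finite_form_le hz X P (-form z X.1 P.1)).subset (fun g (hg : g ∈ groupQ z ∧ _) =>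
      ⟨groupQ_le hg.1, hg.2⟩)) ⟨1, one_mem _, le_rfl⟩
  have hg' := orthoGroup_le hz (groupQ_le hg)
  have hroot : ∀ i, reflect z (root z i) ∈ groupQ z → 0 ≤ form z (g X.1) (root z i) := fun i hi => by
    refine form_nonneg_of_min hz (root_self hz i) (innerPoint_pos hz i) ?_
    by_contra hlt
    push Not at hlt
    have := hmin (reflect z (root z i) * g) ⟨mul_mem hi hg, by
      rw [LinearEquiv.mul_apply]; linarith⟩
    rw [LinearEquiv.mul_apply] at this
    linarith
  have hQ : ∀ v, v ∈ neighbours z → form z (g X.1) v ≤ form z (g X.1) (pointQ z) := by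
    rintro v ⟨k, hk, hv⟩
    have := h (g⁻¹ v) ⟨g⁻¹ * k, mul_mem (inv_mem hg) hk, by
      rcases hv with rfl | rfl | rfl
      · exact Or.inl rfl
      · exact Or.inr (Or.inl rfl)
      · exact Or.inr (Or.inr rfl)⟩
    rwa [← hg'.1, apply_inv_self, ← hg'.1 _ (pointQ z), groupQ_fix hz hg] at this
  refine (mem_cobweb_iff_exists X).2 ⟨g⁻¹, inv_mem hg, (⟨g, hg'⟩ : isomH z) • X, ?_,
    (inv_apply_self g X.1).symm⟩
  rw [mem_half_iff hz, smul_val]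
  have m0 : reflect z (root z 0) ∈ groupQ z := by
    rw [← reflect_root hz]; exact Subgroup.subset_closure (by simp [OrthoschemeRelations.mirrors])
  have m1 : reflect z (root z 1) ∈ groupQ z := Subgroup.subset_closure (Or.inl rfl)
  have m2 : reflect z (root z 2) ∈ groupQ z := Subgroup.subset_closure (Or.inr (Or.inl rfl))
  have n2 := hQ _ ⟨1, one_mem _, Or.inr (Or.inl rfl)⟩
  have n3 := hQ _ ⟨1, one_mem _, Or.inl rfl⟩
  have nh := hQ _ ⟨1, one_mem _, Or.inr (Or.inr rfl)⟩
  have hq := heightQ_pos hz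
  change form z (g X.1) (planeRefl z 2 (pointQ z)) ≤ _ at n2
  change form z (g X.1) (planeRefl z 3 (pointQ z)) ≤ _ at n3
  rw [form_planeRefl hz, show pointQ z 2 = 1 by rw [pointQ_eq hz]; rfl] at n2
  rw [form_planeRefl hz, show pointQ z 3 = heightQ z by rw [pointQ_eq hz]; rfl] at n3
  refine ⟨fun i => ?_, (form_root_zero_nonneg_iff hz _).1 (hroot 0 m0), nh⟩
  fin_cases i
  · exact (form_root_pole hz (g X.1) 0) ▸ hroot 1 m1
  · exact (form_root_pole hz (g X.1) 1) ▸ hroot 2 m2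
  · change 0 ≤ g X.1 2; linarith
  · change 0 ≤ g X.1 3; nlinarith

lemma neighbours_orbit {v : V4} (hz : 7 ≤ z) (hv : v ∈ neighbours z) :
    ∃ g ∈ orthoGroup z, v = g (pointQ z) := by
  obtain ⟨k, hk, rfl | rfl | rfl⟩ := hv
  · exact ⟨k * planeRefl z 3, mul_mem (groupQ_le hk) (planeRefl_mem hz 3), rfl⟩
  · exact ⟨k * planeRefl z 2, mul_mem (groupQ_le hk) (planeRefl_mem hz 2), rfl⟩
  · exact ⟨k * halfTurn, mul_mem (groupQ_le hk) halfTurn_mem_orthoGroup, rfl⟩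

/-- The cobweb polyhedron is the Voronoi cell of `Q` with respect to its neighbours. -/
lemma mem_cobweb_iff (hz : 7 ≤ z) (X : H3 z) :
    X ∈ cobweb z ↔ ∀ v ∈ neighbours z, form z X.1 v ≤ form z X.1 (pointQ z) := by
  refine ⟨fun h v hv => ?_, mem_cobweb_of_neighbours hz⟩
  obtain ⟨g, hg, rfl⟩ := neighbours_orbit hz hv
  exact form_orbit_le_of_mem_cobweb hz h hg

lemma mem_cobweb_iff_orbit (hz : 7 ≤ z) (X : H3 z) :
    X ∈ cobweb z ↔ ∀ g ∈ orthoGroup z, form z X.1 (g (pointQ z)) ≤ form z X.1 (pointQ z) := by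
  refine ⟨fun h g hg => form_orbit_le_of_mem_cobweb hz h hg, fun h => (mem_cobweb_iff hz X).2 ?_⟩
  intro v hv
  obtain ⟨g, hg, rfl⟩ := neighbours_orbit hz hv
  exact h g hg

lemma facePairings_le (γ : V4 ≃ₗ[ℝ] V4) (h : γ ∈ facePairings z p) : γ ∈ cobwebGroup z p := by
  have hs : baseScrew z ∈ cobwebGroup z p := Subgroup.subset_closure (Or.inl rfl)
  have ha : ∀ i, sideScrew z p i ∈ cobwebGroup z p := fun i =>
    Subgroup.subset_closure (Or.inr ⟨i, rfl⟩)
  have half : ∀ γ ∈ pairingHalf z p, γ ∈ cobwebGroup z p := by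
    rintro γ (((((rfl | ⟨i, rfl⟩) | ⟨i, rfl⟩) | ⟨i, rfl⟩) | ⟨i, rfl⟩) | ⟨i, rfl⟩)
    · exact hs
    · exact mul_mem (mul_mem (ha _) (inv_mem hs)) (ha _)
    · exact ha i
    · exact mul_mem (inv_mem hs) (ha i)
    · exact mul_mem (ha i) (inv_mem hs)
    · exact mul_mem (mul_mem (inv_mem hs) (ha i)) (inv_mem hs)
  rcases h with h | h
  · exact half _ h
  · exact inv_mem_iff.1 (half _ h)

lemma facePairings_le_isomH (hz : 7 ≤ z) {γ : V4 ≃ₗ[ℝ] V4} (h : γ ∈ facePairings z p) : γ ∈ isomH z :=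
  orthoGroup_le hz (cobwebGroup_le_orthoGroup hz (facePairings_le γ h))

lemma inv_mem_facePairings {γ : V4 ≃ₗ[ℝ] V4} (h : γ ∈ facePairings z p) : γ⁻¹ ∈ facePairings z p := by
  rcases h with h | h
  · exact Or.inr (by rwa [inv_inv])
  · exact Or.inl h

lemma mem_cobweb_iff_pairings (hz : 7 ≤ z) (hzp : (z : ℤ) = 4 * p - 1) (X : H3 z) :
    X ∈ cobweb z ↔ ∀ γ ∈ facePairings z p, form z X.1 (γ (pointQ z)) ≤ form z X.1 (pointQ z) := by
  rw [mem_cobweb_iff hz, ← image_facePairings hz hzp]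
  exact Set.forall_mem_image

/-- The cobweb polyhedron is the Dirichlet polyhedron of the face pairings with centre `Q`. -/
theorem cobweb_eq (hz : 7 ≤ z) (hzp : (z : ℤ) = 4 * p - 1) :
    cobweb z = {X : H3 z | ∀ γ ∈ facePairings z p,
      hdist z X (pointQ z) ≤ hdist z X (γ (pointQ z))} := by
  ext X
  rw [mem_cobweb_iff_pairings hz hzp]
  exact forall₂_congr fun γ hγ => (hdist_le_iff hz (facePairings_le_isomH hz hγ) X).symm

lemma finite_groupQ (hz : 7 ≤ z) (hzp : (z : ℤ) = 4 * p - 1) : Finite (groupQ z) :=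
  Nat.finite_of_card_ne_zero (by rw [card_groupQ hz hzp]; omega)

lemma isCompact_cobweb (hz : 7 ≤ z) (hzp : (z : ℤ) = 4 * p - 1) : IsCompact (cobweb z) := by
  have := finite_groupQ hz hzp
  have hf : (groupQ z : Set (V4 ≃ₗ[ℝ] V4)).Finite := Set.toFinite _
  refine hf.isCompact_biUnion fun g hg => ?_
  have := move_eq_smul ⟨g, orthoGroup_le hz (groupQ_le hg)⟩ (halfOrthoscheme z)
  rw [show move g (halfOrthoscheme z) = _ from this]
  exact (isCompact_halfOrthoscheme hz).image (continuous_const_smul _)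

/-! #### Separation of the images of `Q` -/

lemma form_pointQ_orbit_lt (hz : 7 ≤ z) {g : V4 ≃ₗ[ℝ] V4} (hg : g ∈ isomH z)
    (h : g (pointQ z) ≠ pointQ z) :
    form z (pointQ z) (g (pointQ z)) < form z (pointQ z) (pointQ z) := by
  obtain ⟨t, ht, e⟩ := centre_val hz
  have h1 : centre z hz ≠ (⟨g, hg⟩ : isomH z) • centre z hz := fun h' => h (by
    have := congrArg Subtype.val h'
    rw [smul_val, e, map_smul] at this
    exact (smul_right_injective _ ht.ne' this).symm)
  have h2 := form_sub_pos hz h1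
  rw [form_sub_left, form_sub_right, form_sub_right, smul_val, e, map_smul] at h2
  simp only [form_smul_left, form_smul_right, hg.1] at h2
  rw [form_comm hz (g (pointQ z))] at h2
  have ht2 : 0 < t * t := mul_pos ht ht
  nlinarith

lemma form_bisector_pos (hz : 7 ≤ z) {g : V4 ≃ₗ[ℝ] V4} (hg : g ∈ isomH z)
    (h : g (pointQ z) ≠ pointQ z) :
    0 < form z (pointQ z - g (pointQ z)) (pointQ z - g (pointQ z)) := by
  rw [form_sub_left, form_sub_right, form_sub_right, hg.1, form_comm hz (g (pointQ z))]
  linarith [form_pointQ_orbit_lt hz hg h]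

/-- A pairing that fixes `Q` is trivial. -/
lemma eq_one_of_fix_pointQ (hz : 7 ≤ z) (hzp : (z : ℤ) = 4 * p - 1) {γ : V4 ≃ₗ[ℝ] V4}
    (hγ : γ ∈ cobwebGroup z p) (h : γ (pointQ z) = pointQ z) : γ = 1 :=
  eq_one_of_mem_groupQ hz hzp hγ ((mem_groupQ_iff hz (cobwebGroup_le_orthoGroup hz hγ)).2 h)

lemma eq_of_apply_pointQ (hz : 7 ≤ z) (hzp : (z : ℤ) = 4 * p - 1) {γ δ : V4 ≃ₗ[ℝ] V4}
    (hγ : γ ∈ cobwebGroup z p) (hδ : δ ∈ cobwebGroup z p) (h : γ (pointQ z) = δ (pointQ z)) :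
    γ = δ := by
  have := eq_one_of_fix_pointQ hz hzp (mul_mem (inv_mem hδ) hγ)
    (by rw [LinearEquiv.mul_apply, h, inv_apply_self])
  exact (inv_mul_eq_one.1 this).symm

/-- The intersection of two polyhedra of the tiling lies in the bisector of their centres. -/
lemma inter_move_eq (hz : 7 ≤ z) {γ : V4 ≃ₗ[ℝ] V4} (hγ : γ ∈ orthoGroup z) :
    cobweb z ∩ move γ (cobweb z) = {X ∈ cobweb z | form z X.1 (pointQ z - γ (pointQ z)) = 0} := by
  have hg := orthoGroup_le hz hγ
  ext X
  rw [Set.mem_inter_iff, mem_move hg, Set.mem_sep_iff]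
  refine and_congr_right fun hX => ?_
  rw [form_sub_right, sub_eq_zero, mem_cobweb_iff_orbit hz]
  change (∀ δ ∈ orthoGroup z, form z (γ⁻¹ X.1) (δ (pointQ z)) ≤ form z (γ⁻¹ X.1) (pointQ z)) ↔ _
  simp only [form_inv_left hg]
  constructor
  · intro h
    refine le_antisymm ?_ (form_orbit_le_of_mem_cobweb hz hX hγ)
    have := h γ⁻¹ (inv_mem hγ)
    rwa [apply_inv_self] at this
  · intro h δ hδ
    rw [← h]
    exact form_orbit_le_of_mem_cobweb hz hX (mul_mem hγ hδ)

end

section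

/-! ### The faces of the cobweb polyhedron -/

variable {z p : ℕ}

lemma eq_zero_of_form_eq_zero (hz : 7 ≤ z) {D : V4} (h : ∀ X, form z X D = 0) : D = 0 := by
  ext i
  have := h (facePole z i)
  rwa [form_comm hz, form_facePole hz] at this

/-- A plane in hyperbolic space has only one pole, up to a factor. -/
lemma exists_smul_of_finrank (hz : 7 ≤ z) {L : Submodule ℝ V4} (hL : Module.finrank ℝ L = 3)
    {U U' : V4} (hU : ∀ X ∈ L, form z X U = 0) (hU' : ∀ X ∈ L, form z X U' = 0) (h0 : U' ≠ 0) :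
    ∃ t : ℝ, U = t • U' := by
  obtain ⟨Y, hY⟩ : ∃ Y, form z Y U' ≠ 0 := by
    by_contra! h; exact h0 (eq_zero_of_form_eq_zero hz h)
  refine ⟨form z Y U / form z Y U', sub_eq_zero.1 (eq_zero_of_form_eq_zero hz ?_)⟩
  have hYL : Y ∉ L := fun h => hY (hU' Y h)
  have hlt : L < L ⊔ Submodule.span ℝ {Y} := by
    refine lt_of_le_of_ne le_sup_left fun h => hYL ?_
    rw [h]
    exact Submodule.mem_sup_right (Submodule.mem_span_singleton_self Y)
  have htop : L ⊔ Submodule.span ℝ {Y} = ⊤ := by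
    apply Submodule.eq_top_of_finrank_eq
    have h1 := Submodule.finrank_lt_finrank_of_lt hlt
    have h2 := Submodule.finrank_le (L ⊔ Submodule.span ℝ {Y})
    rw [Module.finrank_fin_fun] at h2 ⊢
    omega
  intro X
  obtain ⟨A, hA, B, hB, rfl⟩ := Submodule.mem_sup.1 (htop ▸ Submodule.mem_top : X ∈ L ⊔ _)
  obtain ⟨t, rfl⟩ := Submodule.mem_span_singleton.1 hB
  rw [form_add_left, form_smul_left, form_sub_right, form_sub_right, form_smul_right,
    form_smul_right, hU A hA, hU' A hA]
  field_simp
  ring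

lemma isFacet_of_points {F : Set (H3 z)} {U : V4} (hU : 0 < form z U U)
    (hF : ∀ X ∈ F, 0 ≤ form z X.1 U) (P : Fin 3 → H3 z) (hP : ∀ k, P k ∈ F ∧ form z (P k).1 U = 0)
    (hli : LinearIndependent ℝ fun k => (P k).1) : IsFacet F {X ∈ F | form z X.1 U = 0} := by
  refine ⟨U, hU, hF, rfl, le_antisymm ?_ ?_⟩
  · have hne : Submodule.span ℝ (Subtype.val '' {X ∈ F | form z X.1 U = 0}) ≠ ⊤ := by
      intro h
      have hle : Submodule.span ℝ (Subtype.val '' {X ∈ F | form z X.1 U = 0}) ≤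
          LinearMap.ker ((bil z).flip U) := by
        rw [Submodule.span_le]
        rintro _ ⟨X, hX, rfl⟩
        exact (bil_apply z _ _).trans hX.2
      rw [h] at hle
      have := hle (Submodule.mem_top : U ∈ ⊤)
      exact hU.ne' ((bil_apply z _ _).symm.trans this)
    have := Submodule.finrank_lt hne
    rw [Module.finrank_fin_fun] at this
    exact Nat.lt_succ_iff.1 this
  · rw [← Fintype.card_fin 3, ← finrank_span_eq_card hli]
    refine Submodule.finrank_mono (Submodule.span_mono ?_)
    rintro _ ⟨k, rfl⟩
    exact ⟨P k, hP k, rfl⟩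

/-! #### Points that span the faces -/

/-- A vector in the cone over the half orthoscheme is proportional to a point of it. -/
lemma exists_half_point (hz : 7 ≤ z) {X : V4} (h0 : X ≠ 0) (h1 : ∀ i, 0 ≤ X i)
    (h2 : form z X (vertexA 3) ≤ 0) (h3 : form z X (halfTurn (pointQ z)) ≤ form z X (pointQ z)) :
    ∃ Y ∈ halfOrthoscheme z, ∃ t : ℝ, 0 < t ∧ Y.1 = t • X := by
  have hc : X ∈ chamber (bil z) (root z) := mem_chamber.2 (forall_fin_six
    ((form_root_zero_nonneg_iff hz X).2 h2)
    ((form_root_five_nonneg_iff hz X).2 (form_A0_nonpos hz h1 h3))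
    fun j => by rw [form_root_pole hz]; exact h1 j)
  have hn := form_self_neg hz hc h0
  have hs : form z X (vertexA 2) < 0 := by
    have c1 := cz_gt hz
    have c2 := cz_sq_lt hz
    rw [(form_vertexA hz _).2.1]
    refine div_neg_of_neg_of_pos (neg_neg_of_pos ?_) (ez_pos hz)
    have k0 := mul_nonneg (sq_nonneg (cz z)) (h1 0)
    have k1 := mul_nonneg (show 0 ≤ cz z by linarith) (h1 1)
    have k2 := mul_nonneg (show 0 ≤ 1 - cz z ^ 2 by linarith) (h1 2)
    have k4 : 0 < cz z * (1 - cz z ^ 2) := mul_pos (by linarith) (by linarith)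
    have k3 := mul_nonneg k4.le (h1 3)
    refine lt_of_le_of_ne (by linarith) fun e => h0 ?_
    have e0 : cz z ^ 2 * X 0 = 0 := by linarith
    have e1 : cz z * X 1 = 0 := by linarith
    have e2 : (1 - cz z ^ 2) * X 2 = 0 := by linarith
    have e3 : cz z * (1 - cz z ^ 2) * X 3 = 0 := by linarith
    have := (mul_eq_zero.1 e0).resolve_left (by positivity)
    have := (mul_eq_zero.1 e1).resolve_left (by positivity)
    have := (mul_eq_zero.1 e2).resolve_left (by linarith)
    have := (mul_eq_zero.1 e3).resolve_left k4.ne'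
    ext i; fin_cases i <;> assumption
  refine ⟨normalize z X hn hs, ?_, _, sqrt_inv_pos hn, rfl⟩
  have ht := (sqrt_inv_pos hn).le
  rw [mem_half_iff hz, normalize_val, form_smul_left, form_smul_left, form_smul_left]
  exact ⟨fun i => mul_nonneg ht (h1 i), mul_nonpos_of_nonneg_of_nonpos ht h2,
    mul_le_mul_of_nonneg_left h3 ht⟩

/-- The position of a vector relative to the halving plane. -/
lemma form_halfTurn_le_iff (hz : 7 ≤ z) (X : V4) :
    form z X (halfTurn (pointQ z)) ≤ form z X (pointQ z) ↔
      0 ≤ cz z ^ 2 * (X 3 - X 0) + (cz z ^ 2 + cz z - 1) * (X 2 - X 1) := by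
  rw [form_pointQ hz, form_halfTurn_pointQ hz, div_le_div_iff_of_pos_right (two_cz_sq_pos hz)]
  constructor <;> intro h <;> linarith

lemma form_halfTurn_eq_iff (hz : 7 ≤ z) (X : V4) :
    form z X (halfTurn (pointQ z)) = form z X (pointQ z) ↔
      cz z ^ 2 * (X 3 - X 0) + (cz z ^ 2 + cz z - 1) * (X 2 - X 1) = 0 := by
  rw [form_pointQ hz, form_halfTurn_pointQ hz, div_left_inj' (two_cz_sq_pos hz).ne']
  constructor <;> intro h <;> linarith

lemma form_A3_nonpos_iff (hz : 7 ≤ z) (X : V4) : form z X (vertexA 3) ≤ 0 ↔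
    (2 * cz z ^ 2 - 1) * X 3 ≤ cz z * (1 - cz z ^ 2) * X 2 + cz z ^ 2 * X 1 + cz z ^ 3 * X 0 := by
  rw [(form_vertexA hz X).2.2, div_le_iff₀ (ez_pos hz)]
  constructor <;> intro h <;> linarith

lemma linearIndependent_fin_three {v : Fin 3 → V4} (h : ∀ a b c : ℝ,
    (∀ i, a * v 0 i + b * v 1 i + c * v 2 i = 0) → a = 0 ∧ b = 0 ∧ c = 0) :
    LinearIndependent ℝ v := by
  rw [Fintype.linearIndependent_iff]
  intro g hg
  rw [Fin.sum_univ_three] at hg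
  obtain ⟨h0, h1, h2⟩ := h (g 0) (g 1) (g 2) fun i => congrFun hg i
  intro i; fin_cases i <;> assumption

/-- Each of the faces `b³`, `b²` and the halving face of the half orthoscheme contains three linearly
independent points. -/
lemma exists_half_points (hz : 7 ≤ z) {v : V4} (hv : v = planeRefl z 3 (pointQ z) ∨
    v = planeRefl z 2 (pointQ z) ∨ v = halfTurn (pointQ z)) :
    ∃ X : Fin 3 → V4, LinearIndependent ℝ X ∧ ∀ k, (∀ i, 0 ≤ X k i) ∧
      form z (X k) (vertexA 3) ≤ 0 ∧ form z (X k) (halfTurn (pointQ z)) ≤ form z (X k) (pointQ z) ∧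
      form z (X k) v = form z (X k) (pointQ z) := by
  have hc := cz_gt hz
  have hc1 := cz_lt_one hz
  have hq := cz_sq_lt hz
  have hq1 := cz_sq_gt hz
  have ha := two_cz_sq_pos hz
  have hk : 0 < cz z ^ 2 + cz z - 1 := by linarith
  have e1 : 2 * cz z ^ 2 - 1 ≤ cz z ^ 3 := by
    nlinarith [mul_nonneg (sub_nonneg.2 hc1.le) (show 0 ≤ cz z by linarith)]
  have e2 : (2 * cz z ^ 2 - 1) * (cz z ^ 2 + cz z - 1) < cz z ^ 4 := by
    have : (2 * cz z ^ 2 - 1) * (cz z ^ 2 + cz z - 1) < (2 * cz z ^ 2 - 1) * cz z :=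
      mul_lt_mul_of_pos_left (by linarith) ha
    nlinarith
  have e4 : 0 ≤ cz z * (1 - cz z ^ 2) := mul_nonneg (by linarith) (by linarith)
  simp only [form_A3_nonpos_iff hz, form_halfTurn_le_iff hz]
  rcases hv with rfl | rfl | rfl
  · refine ⟨![![0, 0, 1, 0], ![0, 1, 1, 0], ![cz z ^ 2 + cz z - 1, 0, cz z ^ 2, 0]],
      linearIndependent_fin_three fun a b c h => ?_, fun k => ⟨fun i => ?_, ?_, ?_, ?_⟩⟩
    · have h0 := h 0; have h1 := h 1; have h2 := h 2
      simp [hk.ne'] at h0 h1 h2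
      simp_all
    · fin_cases k <;> fin_cases i <;> simp [hk.le] <;> positivity
    · fin_cases k <;> simp <;> nlinarith
    · fin_cases k <;> simp <;> nlinarith
    · rw [form_planeRefl hz]; fin_cases k <;> simp
  · refine ⟨![![0, cz z ^ 2, 0, cz z ^ 2 + cz z - 1], ![0, 2 * cz z ^ 2 - 1, 0, cz z ^ 2],
      ![1, 0, 0, 1]],
      linearIndependent_fin_three fun a b c h => ?_, fun k => ⟨fun i => ?_, ?_, ?_, ?_⟩⟩
    · have h0 := h 0; have h1 := h 1; have h3 := h 3
      simp only [Matrix.cons_val_zero, Matrix.cons_val_one, Matrix.cons_val, mul_zero, mul_one,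
        zero_add, add_zero] at h0 h1 h3
      have hc0 : c = 0 := h0
      have hd : a * (cz z ^ 4 - (2 * cz z ^ 2 - 1) * (cz z ^ 2 + cz z - 1)) = 0 := by
        linear_combination cz z ^ 2 * h1 - (2 * cz z ^ 2 - 1) * (h3 - hc0)
      have ha0 := (mul_eq_zero.1 hd).resolve_right (by linarith)
      rw [ha0, zero_mul, zero_add] at h1
      exact ⟨ha0, (mul_eq_zero.1 h1).resolve_right ha.ne', hc0⟩
    · fin_cases k <;> fin_cases i <;> simp [hk.le, ha.le] <;> nlinarith
    · fin_cases k <;> simp <;> nlinarith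
    · fin_cases k <;> simp <;> nlinarith
    · rw [form_planeRefl hz]; fin_cases k <;> simp
  · refine ⟨![![1, 0, 0, 1], ![0, 1, 1, 0], ![0, cz z ^ 2, 0, cz z ^ 2 + cz z - 1]],
      linearIndependent_fin_three fun a b c h => ?_, fun k => ⟨fun i => ?_, ?_, ?_, ?_⟩⟩
    · have h0 := h 0; have h1 := h 1; have h2 := h 2; have h3 := h 3
      simp at h0 h1 h2 h3
      have hc0 : c = 0 := by
        rw [h0, zero_add] at h3
        exact (mul_eq_zero.1 h3).resolve_right (by linarith)
      exact ⟨h0, h2, hc0⟩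
    · fin_cases k <;> fin_cases i <;> simp [hk.le] <;> positivity
    · fin_cases k <;> simp <;> nlinarith
    · fin_cases k <;> simp <;> nlinarith
    · rw [form_halfTurn_eq_iff hz]; fin_cases k <;> simp <;> ring

/-- Each bisector of `Q` and a neighbour contains three linearly independent points of the cobweb
polyhedron. -/
lemma exists_cobweb_points (hz : 7 ≤ z) {v : V4} (hv : v ∈ neighbours z) :
    ∃ P : Fin 3 → H3 z, (∀ k, P k ∈ cobweb z ∧ form z (P k).1 (pointQ z - v) = 0) ∧
      LinearIndependent ℝ fun k => (P k).1 := by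
  obtain ⟨g, hg, hv⟩ := hv
  have hg' := orthoGroup_le hz (groupQ_le hg)
  obtain ⟨v0, hv0, rfl⟩ : ∃ v0, (v0 = planeRefl z 3 (pointQ z) ∨ v0 = planeRefl z 2 (pointQ z) ∨
      v0 = halfTurn (pointQ z)) ∧ v = g v0 := by
    rcases hv with rfl | rfl | rfl
    exacts [⟨_, Or.inl rfl, rfl⟩, ⟨_, Or.inr (Or.inl rfl), rfl⟩, ⟨_, Or.inr (Or.inr rfl), rfl⟩]
  obtain ⟨X, hX, h⟩ := exists_half_points hz hv0
  have hpt := fun k => exists_half_point hz (hX.ne_zero k) (h k).1 (h k).2.1 (h k).2.2.1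
  choose Y hY t ht e using hpt
  refine ⟨fun k => (⟨g, hg'⟩ : isomH z) • Y k, fun k => ⟨?_, ?_⟩, ?_⟩
  · exact (mem_cobweb_iff_exists _).2 ⟨g, hg, Y k, hY k, rfl⟩
  · rw [smul_val, form_sub_right, hg'.1]
    nth_rw 1 [← groupQ_fix hz hg]
    rw [hg'.1, e, form_smul_left, form_smul_left, (h k).2.2.2, sub_self]
  · have h1 : LinearIndependent ℝ fun k => t k • X k := by
      exact hX.units_smul fun k => Units.mk0 (t k) (ht k).ne'
    have h2 := h1.map' (g : V4 →ₗ[ℝ] V4) (LinearEquiv.ker g)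
    have : (fun k => ((⟨g, hg'⟩ : isomH z) • Y k).1) =
        (g : V4 →ₗ[ℝ] V4) ∘ fun k => t k • X k := funext fun k => by rw [smul_val, e]; rfl
    rw [this]; exact h2

/-! #### The bijection between face pairings and faces -/

lemma neighbours_ne (hz : 7 ≤ z) {v : V4} (hv : v ∈ neighbours z) : v ≠ pointQ z := by
  obtain ⟨g, hg, hv⟩ := hv
  have hfix : ∀ w, w ≠ pointQ z → g w ≠ pointQ z := fun w hw h =>
    hw (g.injective (h.trans (groupQ_fix hz hg).symm))
  have hpl : ∀ i, pointQ z i ≠ 0 → planeRefl z i (pointQ z) ≠ pointQ z := fun i hi h => by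
    have := form_planeRefl hz i (fun _ => 1) (pointQ z)
    rw [h] at this
    exact hi (by linarith)
  rcases hv with rfl | rfl | rfl
  · exact hfix _ (hpl 3 (by rw [pointQ_eq hz]; exact (heightQ_pos hz).ne'))
  · exact hfix _ (hpl 2 (by rw [pointQ_eq hz]; exact one_ne_zero))
  · exact hfix _ (halfTurn_pointQ_ne hz)

lemma mem_neighbours (hz : 7 ≤ z) (hzp : (z : ℤ) = 4 * p - 1) {γ : V4 ≃ₗ[ℝ] V4}
    (hγ : γ ∈ facePairings z p) : γ (pointQ z) ∈ neighbours z :=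
  image_facePairings hz hzp ▸ ⟨γ, hγ, rfl⟩

lemma bisector_pos (hz : 7 ≤ z) (hzp : (z : ℤ) = 4 * p - 1) {γ : V4 ≃ₗ[ℝ] V4}
    (hγ : γ ∈ facePairings z p) :
    0 < form z (pointQ z - γ (pointQ z)) (pointQ z - γ (pointQ z)) :=
  form_bisector_pos hz (facePairings_le_isomH hz hγ)
    (neighbours_ne hz (mem_neighbours hz hzp hγ))

lemma form_bisector_nonneg (hz : 7 ≤ z) (hzp : (z : ℤ) = 4 * p - 1) {γ : V4 ≃ₗ[ℝ] V4}
    (hγ : γ ∈ facePairings z p) {X : H3 z} (hX : X ∈ cobweb z) :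
    0 ≤ form z X.1 (pointQ z - γ (pointQ z)) := by
  rw [form_sub_right, sub_nonneg]
  exact (mem_cobweb_iff hz X).1 hX _ (mem_neighbours hz hzp hγ)

lemma inter_pairing (hz : 7 ≤ z) {γ : V4 ≃ₗ[ℝ] V4} (hγ : γ ∈ facePairings z p) :
    cobweb z ∩ move γ (cobweb z) = {X ∈ cobweb z | form z X.1 (pointQ z - γ (pointQ z)) = 0} :=
  inter_move_eq hz (cobwebGroup_le_orthoGroup hz (facePairings_le γ hγ))

lemma isFacet_pairing (hz : 7 ≤ z) (hzp : (z : ℤ) = 4 * p - 1) {γ : V4 ≃ₗ[ℝ] V4}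
    (hγ : γ ∈ facePairings z p) : IsFacet (cobweb z) (cobweb z ∩ move γ (cobweb z)) := by
  obtain ⟨P, hP, hli⟩ := exists_cobweb_points hz (mem_neighbours hz hzp hγ)
  rw [inter_pairing hz hγ]
  exact isFacet_of_points (bisector_pos hz hzp hγ)
    (fun X hX => form_bisector_nonneg hz hzp hγ hX) P hP hli

lemma form_eq_zero_of_mem_span {S : Set (H3 z)} {U : V4} (h : ∀ X ∈ S, form z X.1 U = 0) :
    ∀ X ∈ Submodule.span ℝ (Subtype.val '' S), form z X U = 0 := by
  have : Submodule.span ℝ (Subtype.val '' S) ≤ LinearMap.ker ((bil z).flip U) := by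
    rw [Submodule.span_le]
    rintro _ ⟨X, hX, rfl⟩
    exact (bil_apply z _ _).trans (h X hX)
  exact fun X hX => (bil_apply z _ _).symm.trans (this hX)

lemma injOn_apply_pointQ (hz : 7 ≤ z) (hzp : (z : ℤ) = 4 * p - 1) :
    Set.InjOn (fun γ : V4 ≃ₗ[ℝ] V4 => γ (pointQ z)) (facePairings z p) := fun _ hγ _ hδ h =>
  eq_of_apply_pointQ hz hzp (facePairings_le _ hγ) (facePairings_le _ hδ) h

/-- Each face contains three linearly independent points, so its plane, the bisector of `Q` and `γ
Q`, determines `γ Q`. -/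
lemma injOn_face (hz : 7 ≤ z) (hzp : (z : ℤ) = 4 * p - 1) :
    Set.InjOn (fun γ => cobweb z ∩ move γ (cobweb z)) (facePairings z p) := by
  intro γ hγ δ hδ h
  apply injOn_apply_pointQ hz hzp hγ hδ
  obtain ⟨-, -, -, -, hfin⟩ := isFacet_pairing hz hzp hγ
  have hU : ∀ X ∈ cobweb z ∩ move γ (cobweb z), form z X.1 (pointQ z - γ (pointQ z)) = 0 :=
    fun X hX => by rw [inter_pairing hz hγ] at hX; exact hX.2
  have hV : ∀ X ∈ cobweb z ∩ move γ (cobweb z), form z X.1 (pointQ z - δ (pointQ z)) = 0 :=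
    fun X hX => by
      have hX' : X ∈ cobweb z ∩ move δ (cobweb z) :=
        (show cobweb z ∩ move γ (cobweb z) = cobweb z ∩ move δ (cobweb z) from h) ▸ hX
      rw [inter_pairing hz hδ] at hX'; exact hX'.2
  have pU := bisector_pos hz hzp hγ
  have pV := bisector_pos hz hzp hδ
  obtain ⟨t, ht⟩ := exists_smul_of_finrank hz hfin (form_eq_zero_of_mem_span hU)
    (form_eq_zero_of_mem_span hV) (fun e => by rw [e, form_zero_left] at pV; exact pV.ne rfl)
  -- both bisectors contain the midpoint with `Q`, so that the factor is one
  have nU : form z (pointQ z - γ (pointQ z)) (pointQ z - γ (pointQ z)) =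
      2 * form z (pointQ z) (pointQ z - γ (pointQ z)) := by
    simp only [form_sub_left, form_sub_right, (facePairings_le_isomH hz hγ).1,
      form_comm hz (γ (pointQ z)) (pointQ z)]
    ring
  have nV : form z (pointQ z - δ (pointQ z)) (pointQ z - δ (pointQ z)) =
      2 * form z (pointQ z) (pointQ z - δ (pointQ z)) := by
    simp only [form_sub_left, form_sub_right, (facePairings_le_isomH hz hδ).1,
      form_comm hz (δ (pointQ z)) (pointQ z)]
    ring
  rw [ht, form_smul_left, form_smul_right, form_smul_right] at nU
  rw [ht, form_smul_left, form_smul_right] at pU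
  have ht0 : t ≠ 0 := fun e => by rw [e] at pU; simp at pU
  have ht1 : t = 1 := by
    have : t * ((t - 1) * form z (pointQ z - δ (pointQ z)) (pointQ z - δ (pointQ z))) = 0 := by
      linear_combination nU - t * nV
    have := (mul_eq_zero.1 ((mul_eq_zero.1 this).resolve_left ht0)).resolve_right pV.ne'
    linarith
  rw [ht1, one_smul] at ht
  exact sub_right_injective ht

lemma finite_neighbours (hz : 7 ≤ z) (hzp : (z : ℤ) = 4 * p - 1) : (neighbours z).Finite := by
  have := finite_groupQ hz hzp
  have hf : (groupQ z : Set (V4 ≃ₗ[ℝ] V4)).Finite := Set.toFinite _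
  refine ((((hf.image fun g => g (planeRefl z 3 (pointQ z))).union
    (hf.image fun g => g (planeRefl z 2 (pointQ z)))).union
    (hf.image fun g => g (halfTurn (pointQ z))))).subset ?_
  rintro v ⟨g, hg, rfl | rfl | rfl⟩
  · exact Or.inl (Or.inl ⟨g, hg, rfl⟩)
  · exact Or.inl (Or.inr ⟨g, hg, rfl⟩)
  · exact Or.inr ⟨g, hg, rfl⟩

lemma finite_facePairings (hz : 7 ≤ z) (hzp : (z : ℤ) = 4 * p - 1) : (facePairings z p).Finite :=
  Set.Finite.of_finite_image (image_facePairings hz hzp ▸ finite_neighbours hz hzp)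
    (injOn_apply_pointQ hz hzp)

/-- The cone over hyperbolic space is convex. -/
lemma exists_sum_point (hz : 7 ≤ z) {ι : Type*} {s : Finset ι} (hs : s.Nonempty) (X : ι → H3 z) :
    ∃ Y : H3 z, ∃ t : ℝ, 0 < t ∧ Y.1 = t • ∑ i ∈ s, (X i).1 := by
  have hl : ∀ V : V4, form z (∑ i ∈ s, (X i).1) V = ∑ i ∈ s, form z (X i).1 V := fun V => by
    simp only [← bil_apply, map_sum, LinearMap.sum_apply]
  have h1 : form z (∑ i ∈ s, (X i).1) (∑ i ∈ s, (X i).1) < 0 := by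
    rw [hl]
    refine Finset.sum_neg (fun i _ => ?_) hs
    rw [form_comm hz, hl]
    exact Finset.sum_neg (fun j _ => form_neg hz _ _) hs
  have h2 : form z (∑ i ∈ s, (X i).1) (vertexA 2) < 0 := by
    rw [hl]
    exact Finset.sum_neg (fun i _ => (X i).2.2) hs
  exact ⟨normalize z _ h1 h2, _, sqrt_inv_pos h1, rfl⟩

/-- A point that is closer to `Q` than to the neighbours is an inner point. -/
lemma mem_interior_cobweb (hz : 7 ≤ z) (hzp : (z : ℤ) = 4 * p - 1) {X : H3 z}
    (h : ∀ γ ∈ facePairings z p, 0 < form z X.1 (pointQ z - γ (pointQ z))) :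
    X ∈ interior (cobweb z) := by
  have ho : IsOpen (⋂ γ ∈ facePairings z p, {X : H3 z | 0 < form z X.1 (pointQ z - γ (pointQ z))}) :=
    (finite_facePairings hz hzp).isOpen_biInter fun γ _ =>
      isOpen_lt continuous_const (continuous_form_left _)
  refine interior_maximal ?_ ho (Set.mem_iInter₂.2 h)
  intro Y hY
  rw [mem_cobweb_iff_pairings hz hzp]
  intro γ hγ
  have : 0 < form z Y.1 (pointQ z - γ (pointQ z)) := Set.mem_iInter₂.1 hY γ hγ
  rw [form_sub_right] at this
  linarith

/-- Every face lies in the bisector of `Q` and one of its neighbours. -/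
lemma surjOn_face (hz : 7 ≤ z) (hzp : (z : ℤ) = 4 * p - 1) :
    Set.SurjOn (fun γ => cobweb z ∩ move γ (cobweb z)) (facePairings z p)
      {f | IsFacet (cobweb z) f} := by
  rintro f ⟨U, hU, hF, hf, hfin⟩
  obtain ⟨γ, hγ, hf0⟩ : ∃ γ ∈ facePairings z p,
      ∀ X ∈ f, form z X.1 (pointQ z - γ (pointQ z)) = 0 := by
    -- otherwise the sum of suitable points of the face is an inner point of the polyhedron
    by_contra! hcon
    have : Nonempty (H3 z) := ⟨centre z hz⟩
    choose! Y hY hne using hcon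
    have hs : (finite_facePairings hz hzp).toFinset.Nonempty :=
      ⟨baseScrew z, (finite_facePairings hz hzp).mem_toFinset.2 (Or.inl (by simp [pairingHalf]))⟩
    obtain ⟨P, t, ht, hP⟩ := exists_sum_point hz hs Y
    have hform : ∀ V, form z P.1 V = t * ∑ γ ∈ (finite_facePairings hz hzp).toFinset,
        form z (Y γ).1 V := fun V => by
      rw [hP, form_smul_left]; simp only [← bil_apply, map_sum, LinearMap.sum_apply]
    have hT : ∀ γ ∈ facePairings z p, Y γ ∈ cobweb z := fun γ hγ => by
      have := hY γ hγ; rw [hf] at this; exact this.1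
    have hint : P ∈ interior (cobweb z) := by
      refine mem_interior_cobweb hz hzp fun γ hγ => ?_
      rw [hform]
      refine mul_pos ht (Finset.sum_pos' (fun δ hδ => ?_) ⟨γ, ?_, ?_⟩)
      · exact form_bisector_nonneg hz hzp hγ (hT δ ((Set.Finite.mem_toFinset _).1 hδ))
      · exact (Set.Finite.mem_toFinset _).2 hγ
      · exact lt_of_le_of_ne (form_bisector_nonneg hz hzp hγ (hT γ hγ)) (hne γ hγ).symm
    have := form_pos_of_mem_interior hz hU hF hint
    rw [hform, Finset.sum_eq_zero, mul_zero] at this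
    · exact this.ne rfl
    · intro γ hγ
      have := hY γ ((Set.Finite.mem_toFinset _).1 hγ)
      rw [hf] at this; exact this.2
  refine ⟨γ, hγ, ?_⟩
  have hp := bisector_pos hz hzp hγ
  obtain ⟨t, ht⟩ := exists_smul_of_finrank hz hfin (form_eq_zero_of_mem_span hf0)
    (form_eq_zero_of_mem_span (fun X hX => by rw [hf] at hX; exact hX.2))
    (fun e => by rw [e, form_zero_left] at hU; exact hU.ne rfl)
  have ht0 : t ≠ 0 := fun e => by rw [ht, e, zero_smul, form_zero_left] at hp; exact hp.ne rfl
  change cobweb z ∩ move γ (cobweb z) = f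
  rw [inter_pairing hz hγ, hf, ht]
  ext X
  simp only [Set.mem_sep_iff, form_smul_right, mul_eq_zero, ht0, false_or]

/-- The faces of the cobweb polyhedron are its intersections with the adjacent polyhedra. -/
theorem bijOn_face (hz : 7 ≤ z) (hzp : (z : ℤ) = 4 * p - 1) :
    Set.BijOn (fun γ => cobweb z ∩ move γ (cobweb z)) (facePairings z p)
      {f | IsFacet (cobweb z) f} :=
  ⟨fun _ hγ => isFacet_pairing hz hzp hγ, injOn_face hz hzp, surjOn_face hz hzp⟩

end

section

/-! ### The number of the faces -/

variable {z p : ℕ}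

open OrthoschemeRelations

lemma exists_orthoHom_of_mem_groupQ (hz : 7 ≤ z) {g : V4 ≃ₗ[ℝ] V4} (hg : g ∈ groupQ z) :
    ∃ w, g = orthoHom hz w := by
  have : groupQ z ≤ (orthoHom hz).range := by
    rw [groupQ, Subgroup.closure_le]
    rintro g (rfl | rfl | rfl)
    · exact ⟨(orthoSystem z).simple 1, (orthoRelations hz).hom_simple (by omega) 1⟩
    · exact ⟨(orthoSystem z).simple 2, (orthoRelations hz).hom_simple (by omega) 2⟩
    · exact ⟨(orthoSystem z).simple 0, (orthoRelations hz).hom_simple (by omega) 0⟩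
  obtain ⟨w, h⟩ := this hg
  exact ⟨w, h.symm⟩

/-- The points `Q` and `h Q` have no common mirror, hence trivial common stabilizer in `G_Q`. -/
lemma eq_one_of_fix_halfTurn (hz : 7 ≤ z) {g : V4 ≃ₗ[ℝ] V4} (hg : g ∈ groupQ z)
    (h : g (halfTurn (pointQ z)) = halfTurn (pointQ z)) : g = 1 := by
  obtain ⟨w, rfl⟩ := exists_orthoHom_of_mem_groupQ hz hg
  have hQ := mem_chamber.1 (pointQ_mem_chamber hz)
  have pos : ∀ i, 0 < form z (pointQ z + halfTurn (pointQ z)) (root z i) := fun i => by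
    rw [form_add_left, form_halfTurn_root hz]
    have h1 := hQ i
    have h2 := hQ (Fin.rev i)
    refine lt_of_le_of_ne (by linarith) fun e => ?_
    have e1 := form_pointQ_root_eq_zero hz (i := i) (by linarith)
    have e2 := form_pointQ_root_eq_zero hz (i := Fin.rev i) (by linarith)
    rcases e1 with rfl | rfl | rfl <;> revert e2 <;> decide
  have hw := (isReflectionRep hz).eq_one_of_interior (w := w)
    (x := pointQ z + halfTurn (pointQ z)) (y := pointQ z + halfTurn (pointQ z))
    (mem_chamber.2 fun i => (pos i).le) (fun i => by rw [bil_apply]; exact pos i)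
    (by rw [map_add, h, groupQ_fix hz hg])
  rw [hw, map_one]

lemma planeRefl_two_pointQ (hz : 7 ≤ z) :
    planeRefl z 2 (pointQ z) = pointQ z - (2 : ℝ) • facePole z 2 := by
  rw [planeRefl, reflect_apply z (facePole_ne hz 2), form_facePole_self hz, form_facePole hz,
    show pointQ z 2 = 1 by rw [pointQ_eq hz]; rfl]
  norm_num

/-- A rotation about the axis `A₂A₃` that fixes the point `r₂ Q` is trivial. -/
lemma rot_zpow_eq_one (hz : 7 ≤ z) {n : ℤ}
    (h : (rot z ^ n) (planeRefl z 2 (pointQ z)) = planeRefl z 2 (pointQ z)) : rot z ^ n = 1 := by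
  obtain ⟨w, hw⟩ := exists_orthoHom_of_mem_groupQ hz (rot_zpow_mem (z := z) n)
  have fixV : ∀ V : V4, form z V (facePole z 0) = 0 → form z V (facePole z 1) = 0 →
      (rot z ^ n) V = V := fun V h0 h1 => by
    have hm : rot z ∈ MulAction.stabilizer (V4 ≃ₗ[ℝ] V4) V := by
      change planeRefl z 0 (planeRefl z 1 V) = V
      rw [planeRefl, planeRefl, reflect_apply z (facePole_ne hz 1), h1]
      simp only [mul_zero, zero_div, zero_smul, sub_zero]
      rw [reflect_apply z (facePole_ne hz 0), h0]
      simp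
    exact zpow_mem hm n
  have f2 : (rot z ^ n) (vertexA 2) = vertexA 2 :=
    fixV _ (by rw [form_facePole hz]; simp [vertexA]) (by rw [form_facePole hz]; simp [vertexA])
  have f3 : (rot z ^ n) (vertexA 3) = vertexA 3 :=
    fixV _ (by rw [form_facePole hz]; simp [vertexA]) (by rw [form_facePole hz]; simp [vertexA])
  have fb : (rot z ^ n) (facePole z 2) = facePole z 2 := by
    rw [planeRefl_two_pointQ hz, map_sub, map_smul, groupQ_fix hz (rot_zpow_mem n)] at h
    exact smul_right_injective _ (two_ne_zero (α := ℝ)) (sub_right_injective h)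
  have c0 : cz z ≠ 0 := by linarith [cz_gt hz]
  have f1 : (rot z ^ n) (vertexA 1) = vertexA 1 := by
    have e : vertexA 1 = (cz z)⁻¹ • (vertexA 2 - facePole z 2 - cz z • vertexA 3) := by
      ext i; fin_cases i <;> simp [vertexA, facePole, coxeterSchlafli_eq, c0]
    rw [e, map_smul, map_sub, map_sub, map_smul, f2, f3, fb]
  set Y : V4 := vertexA 1 + vertexA 2 + vertexA 3 with hY
  have fY : (rot z ^ n) Y = Y := by rw [hY, map_add, map_add, f1, f2, f3]
  have eY : Y = ![0, 1, 1, 1] := by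
    rw [hY]; ext i; fin_cases i <;> simp [vertexA]
  have hc := cz_gt hz
  have hc1 := cz_lt_one hz
  have hq := cz_sq_lt hz
  have k3 : form z Y (vertexA 3) < 0 := by
    rw [(form_vertexA hz _).2.2, eY]
    refine div_neg_of_neg_of_pos ?_ (ez_pos hz)
    simp
    nlinarith
  have k0 : form z Y (vertexA 0) < 0 := by
    rw [(form_vertexA hz _).1, eY]
    refine div_neg_of_neg_of_pos ?_ (ez_pos hz)
    simp
    nlinarith
  have hroot : ∀ i, (i = 1 ∧ form z Y (root z i) = 0) ∨ 0 < form z Y (root z i) :=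
    forall_fin_six (Or.inr <| lt_of_le_of_ne ((form_root_zero_nonneg_iff hz Y).2 k3.le) fun e =>
        k3.ne ((form_root_zero_eq_iff hz Y).1 e.symm))
      (Or.inr <| lt_of_le_of_ne ((form_root_five_nonneg_iff hz Y).2 k0.le) fun e =>
        k0.ne ((form_root_five_eq_iff hz Y).1 e.symm)) fun j => by
      rw [form_root_pole hz, eY]
      fin_cases j <;> simp
  have hmem : Y ∈ chamber (bil z) (root z) := mem_chamber.2 fun i => by
    rcases hroot i with h | h
    · exact h.2.ge
    · exact h.le
  have hst := (stabilizer_orthoHom hz hmem hmem (w := w) (by rw [← hw, fY])).2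
  have hcl : Subgroup.closure ((orthoSystem z).simple '' {i | form z Y (root z i) = 0}) ≤
      (Subgroup.zpowers (planeRefl z 0)).comap (orthoHom hz) := by
    rw [Subgroup.closure_le]
    rintro _ ⟨i, hi, rfl⟩
    rcases hroot i with h | h
    · rw [h.1]
      exact ⟨1, (zpow_one _).trans ((orthoRelations hz).hom_simple (by omega) 1).symm⟩
    · exact absurd hi h.ne'
  obtain ⟨m, hm⟩ := hcl hst
  change planeRefl z 0 ^ m = orthoHom hz w at hm
  rw [← hw] at hm
  -- the determinant excludes the reflection
  have hdet := congrArg detHom hm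
  rw [map_zpow, map_zpow, detHom_rot hz, detHom_planeRefl hz, one_zpow] at hdet
  rcases Int.even_or_odd m with hm2 | hm2
  · obtain ⟨k, rfl⟩ := hm2
    rw [← hm, ← two_mul, zpow_mul, zpow_two, (orthoRelations hz).r0_sq, one_zpow]
  · rw [hm2.neg_one_zpow] at hdet; norm_num at hdet

lemma rot_zpow_z_ne (hz : 7 ≤ z) (hzp : (z : ℤ) = 4 * p - 1) : rot z ^ (z : ℤ) ≠ 1 := by
  intro h
  have := stabElt_injective (isFaithful hz) hzp
    (a₁ := ((0 : ZMod z), false, true, false)) (a₂ := (0, false, false, false)) (by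
      simp only [stabElt, cond_true, cond_false, one_mul, mul_one, ← hzp]
      exact congrArg _ h)
  simp at this

lemma rot_zpow_eq_one_iff (hz : 7 ≤ z) (hzp : (z : ℤ) = 4 * p - 1) {n : ℤ}
    (h : rot z ^ n = 1) : 2 * (z : ℤ) ∣ n := by
  have hrot : rot z ^ (2 * z) = 1 := (orthoRelations hz).rot
  have h1 : orderOf (rot z ^ 2) = z := orderOf_rot_sq hz hzp
  have h2 : (z : ℤ) ∣ n := by
    rw [← h1, orderOf_dvd_iff_zpow_eq_one, ← zpow_natCast, ← zpow_mul, mul_comm, zpow_mul, h, one_zpow]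
  obtain ⟨k, rfl⟩ := h2
  rcases Int.even_or_odd' k with ⟨m, rfl | rfl⟩
  · exact ⟨m, by ring⟩
  · refine absurd ?_ (rot_zpow_z_ne hz hzp)
    rw [show (z : ℤ) * (2 * m + 1) = ((2 * z : ℕ) : ℤ) * m + z by push_cast; ring, zpow_add, zpow_mul,
      zpow_natCast (rot z) (2 * z), hrot, one_zpow, one_mul] at h
    exact h

lemma neighbours_eq (hz : 7 ≤ z) : neighbours z =
    {planeRefl z 3 (pointQ z), reflA3 z (planeRefl z 3 (pointQ z))} ∪
      ((fun n : ℕ => (rot z ^ n) (planeRefl z 2 (pointQ z))) '' Set.Iio (2 * z) ∪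
        Set.range fun g : groupQ z => g.1 (halfTurn (pointQ z))) := by
  have hr := orthoRelations hz
  have hq := isCentre hz
  ext v
  constructor
  · rintro ⟨g, hg, hv⟩
    obtain ⟨n, e, d, hn⟩ := exists_normal_form hr.r0_sq hr.r1_sq hr.ra_sq hr.ra_r0 hr.ra_r1 hg
    rcases hv with rfl | rfl | rfl
    · left
      subst hn
      have e0 : (bif e then planeRefl z 0 else 1 : V4 ≃ₗ[ℝ] V4) • planeRefl z 3 • pointQ z =
          planeRefl z 3 • pointQ z := by
        cases e
        · exact one_smul _ _
        · rw [cond_true, ← r3_eq hz, ← hr.r3_smul_r0, hq.r0]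
      have : ((planeRefl z 0 * planeRefl z 1) ^ n * (bif e then planeRefl z 0 else 1) *
          (bif d then reflA3 z else 1)) • planeRefl z 3 • pointQ z =
          (bif d then reflA3 z else 1 : V4 ≃ₗ[ℝ] V4) • planeRefl z 3 • pointQ z := by
        rw [mul_assoc, ← (hr.ra_mul_zpow_cond n e d), mul_smul, mul_smul, e0, ← r3_eq hz,
          ← hr.r3_smul_zpow, hq.zpow]
      change (_ : V4 ≃ₗ[ℝ] V4) • planeRefl z 3 • pointQ z ∈ _
      rw [this]
      cases d
      · left; exact one_smul _ _
      · right; rfl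
    · right; left
      subst hn
      have ea : (bif d then reflA3 z else 1 : V4 ≃ₗ[ℝ] V4) • planeRefl z 2 • pointQ z =
          planeRefl z 2 • pointQ z := by
        cases d
        · exact one_smul _ _
        · rw [cond_true, ← r2_eq hz, ← mul_smul, hr.ra_r2, mul_smul, hq.ra]
      have e0 : (bif e then planeRefl z 0 else 1 : V4 ≃ₗ[ℝ] V4) • planeRefl z 2 • pointQ z =
          planeRefl z 2 • pointQ z := by
        cases e
        · exact one_smul _ _
        · rw [cond_true, ← r2_eq hz, ← mul_smul, ← hr.r0_r2, mul_smul, hq.r0]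
      change (_ : V4 ≃ₗ[ℝ] V4) • planeRefl z 2 • pointQ z ∈ _
      rw [mul_smul, ea, mul_smul, e0]
      have hpos : 0 < (2 * z : ℤ) := by omega
      refine ⟨(n % (2 * z)).toNat, ?_, ?_⟩
      · rw [Set.mem_Iio, ← Int.ofNat_lt, Int.toNat_of_nonneg (Int.emod_nonneg _ hpos.ne')]
        exact Int.emod_lt_of_pos _ hpos
      · change rot z ^ _ • planeRefl z 2 • pointQ z = _
        rw [← zpow_natCast, Int.toNat_of_nonneg (Int.emod_nonneg _ hpos.ne'), rot,
          hr.zpow_congr_add (m := n) (n / (2 * z)) (Int.emod_add_mul_ediv n (2 * z)).symm]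
    · right; right
      exact ⟨⟨g, hg⟩, rfl⟩
  · rintro ((rfl | rfl) | ⟨n, -, rfl⟩ | ⟨g, rfl⟩)
    · exact ⟨1, one_mem _, Or.inl rfl⟩
    · exact ⟨_, ra_mem_groupQ, Or.inl rfl⟩
    · exact ⟨rot z ^ n, by rw [← zpow_natCast]; exact rot_zpow_mem _, Or.inr (Or.inl rfl)⟩
    · exact ⟨g.1, g.2, Or.inr (Or.inr rfl)⟩

/-- The polyhedron has `10 z + 2` neighbours: the bases, the `2z` middle faces and the `8z` halving
faces have three different distances from `Q`. -/
theorem ncard_neighbours (hz : 7 ≤ z) (hzp : (z : ℤ) = 4 * p - 1) :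
    (neighbours z).ncard = 10 * z + 2 := by
  have hfin := finite_neighbours hz hzp
  rw [neighbours_eq hz] at hfin ⊢
  have hc := cz_gt hz
  have hc1 := cz_lt_one hz
  have hq := cz_sq_lt hz
  have hq1 := cz_sq_gt hz
  have ha := two_cz_sq_pos hz
  have ha0 := ha.ne'
  have hb := heightQ_pos hz
  have hb1 := heightQ_lt_one hz
  have inv : ∀ g ∈ groupQ z, ∀ v, form z (pointQ z) (g v) = form z (pointQ z) v := fun g hg v => by
    conv_lhs => rw [← groupQ_fix hz hg]
    exact (orthoGroup_le hz (groupQ_le hg)).1 _ _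
  have v3 : form z (pointQ z) (planeRefl z 3 (pointQ z)) =
      form z (pointQ z) (pointQ z) - 2 * heightQ z ^ 2 := by
    rw [form_planeRefl hz, show pointQ z 3 = heightQ z by rw [pointQ_eq hz]; rfl]; ring
  have v2 : form z (pointQ z) (planeRefl z 2 (pointQ z)) = form z (pointQ z) (pointQ z) - 2 := by
    rw [form_planeRefl hz, show pointQ z 2 = 1 by rw [pointQ_eq hz]; rfl]; ring
  have vh : form z (pointQ z) (halfTurn (pointQ z)) =
      -(cz z ^ 2 * heightQ z + cz z) / (2 * cz z ^ 2 - 1) := by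
    rw [form_halfTurn_pointQ hz, pointQ_eq hz]; simp
  have vQ : form z (pointQ z) (pointQ z) = -(1 - cz z ^ 2) / (2 * cz z ^ 2 - 1) := by
    rw [form_pointQ hz, pointQ_eq hz]; simp
  have hb2 : heightQ z < 1 / 10 := by
    rw [heightQ, div_lt_iff₀ ha]; nlinarith
  have d32 : form z (pointQ z) (planeRefl z 3 (pointQ z)) ≠
      form z (pointQ z) (planeRefl z 2 (pointQ z)) := by
    rw [v3, v2]; nlinarith
  have d3h : form z (pointQ z) (planeRefl z 3 (pointQ z)) ≠
      form z (pointQ z) (halfTurn (pointQ z)) := by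
    rw [v3, vh, vQ]
    refine ne_of_gt ?_
    rw [← sub_pos]
    have : -(1 - cz z ^ 2) / (2 * cz z ^ 2 - 1) - 2 * heightQ z ^ 2 -
        -(cz z ^ 2 * heightQ z + cz z) / (2 * cz z ^ 2 - 1) = (cz z ^ 2 * heightQ z + cz z -
          (1 - cz z ^ 2) - 2 * heightQ z ^ 2 * (2 * cz z ^ 2 - 1)) / (2 * cz z ^ 2 - 1) := by
      rw [eq_div_iff ha0, sub_mul, sub_mul, div_mul_cancel₀ _ ha0, div_mul_cancel₀ _ ha0]; ring
    rw [this]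
    refine div_pos ?_ ha
    nlinarith
  have d2h : form z (pointQ z) (planeRefl z 2 (pointQ z)) ≠
      form z (pointQ z) (halfTurn (pointQ z)) := by
    rw [v2, vh, vQ]
    refine ne_of_lt ?_
    rw [← sub_pos]
    have : -(cz z ^ 2 * heightQ z + cz z) / (2 * cz z ^ 2 - 1) -
        (-(1 - cz z ^ 2) / (2 * cz z ^ 2 - 1) - 2) = (3 * cz z ^ 2 - 1 - cz z ^ 2 * heightQ z -
          cz z) / (2 * cz z ^ 2 - 1) := by
      rw [eq_div_iff ha0, sub_mul, sub_mul, div_mul_cancel₀ _ ha0, div_mul_cancel₀ _ ha0]; ring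
    rw [this]
    refine div_pos ?_ ha
    nlinarith
  have valA : ∀ v ∈ ({planeRefl z 3 (pointQ z), reflA3 z (planeRefl z 3 (pointQ z))} : Set V4),
      form z (pointQ z) v = form z (pointQ z) (planeRefl z 3 (pointQ z)) := by
    rintro v (rfl | rfl)
    · rfl
    · exact inv _ ra_mem_groupQ _
  have valB : ∀ n : ℕ, form z (pointQ z) ((rot z ^ n) (planeRefl z 2 (pointQ z))) =
      form z (pointQ z) (planeRefl z 2 (pointQ z)) := fun n =>
    inv _ (by rw [← zpow_natCast]; exact rot_zpow_mem _) _
  have disj1 : Disjoint ({planeRefl z 3 (pointQ z), reflA3 z (planeRefl z 3 (pointQ z))} : Set V4)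
      ((fun n : ℕ => (rot z ^ n) (planeRefl z 2 (pointQ z))) '' Set.Iio (2 * z) ∪
        Set.range fun g : groupQ z => g.1 (halfTurn (pointQ z))) := by
    rw [Set.disjoint_left]
    rintro v hv (⟨n, -, rfl⟩ | ⟨g, rfl⟩)
    · exact d32 ((valA _ hv).symm.trans (valB n))
    · exact d3h ((valA _ hv).symm.trans (inv _ g.2 _))
  have disj2 : Disjoint ((fun n : ℕ => (rot z ^ n) (planeRefl z 2 (pointQ z))) '' Set.Iio (2 * z))
      (Set.range fun g : groupQ z => g.1 (halfTurn (pointQ z))) := by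
    rw [Set.disjoint_left]
    rintro v ⟨n, -, rfl⟩ ⟨g, hg⟩
    exact d2h ((valB n).symm.trans ((congrArg (form z (pointQ z)) hg).symm.trans (inv _ g.2 _)))
  rw [Set.ncard_union_eq disj1 (hfin.subset Set.subset_union_left)
    (hfin.subset Set.subset_union_right), Set.ncard_union_eq disj2
    (hfin.subset (Set.subset_union_left.trans Set.subset_union_right))
    (hfin.subset (Set.subset_union_right.trans Set.subset_union_right))]
  have cA : ({planeRefl z 3 (pointQ z), reflA3 z (planeRefl z 3 (pointQ z))} : Set V4).ncard = 2 := by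
    refine Set.ncard_pair fun h => ?_
    have h1 : form z (planeRefl z 3 (pointQ z)) (vertexA 3) = -(2 * heightQ z) := by
      rw [form_comm hz, form_planeRefl hz, form_comm hz,
        (form_root_zero_eq_iff hz _).1 (form_pointQ_root_zero hz),
        show pointQ z 3 = heightQ z by rw [pointQ_eq hz]; rfl]
      simp [vertexA]
    have h2 : form z (reflA3 z (planeRefl z 3 (pointQ z))) (vertexA 3) = 2 * heightQ z := by
      have hA := form_A3_ne hz
      rw [reflA3, reflect_apply z hA, form_sub_left, form_smul_left, h1]
      field_simp
      ring
    rw [← h, h1] at h2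
    linarith
  have cB : ((fun n : ℕ => (rot z ^ n) (planeRefl z 2 (pointQ z))) '' Set.Iio (2 * z)).ncard =
      2 * z := by
    rw [Set.InjOn.ncard_image, ← Finset.coe_Iio, Set.ncard_coe_finset, Nat.card_Iio]
    intro m hm n hn h
    have hk : (rot z ^ ((m : ℤ) - n)) (planeRefl z 2 (pointQ z)) = planeRefl z 2 (pointQ z) := by
      rw [sub_eq_neg_add, zpow_add, LinearEquiv.mul_apply, zpow_natCast,
        show (rot z ^ m) (planeRefl z 2 (pointQ z)) = (rot z ^ n) (planeRefl z 2 (pointQ z)) from h,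
        zpow_neg, zpow_natCast, inv_apply_self]
    have := rot_zpow_eq_one_iff hz hzp (rot_zpow_eq_one hz hk)
    rw [Set.mem_Iio] at hm hn
    obtain ⟨k, hk⟩ := this
    have hz0 : 0 < (z : ℤ) := by omega
    have k0 : k = 0 := by
      by_contra hk0
      rcases lt_or_gt_of_ne hk0 with h1 | h1
      · have : 2 * (z : ℤ) * k ≤ 2 * z * (-1) := by nlinarith
        omega
      · have : 2 * (z : ℤ) * 1 ≤ 2 * z * k := by nlinarith
        omega
    rw [k0] at hk
    omega
  have cC : (Set.range fun g : groupQ z => g.1 (halfTurn (pointQ z))).ncard = 8 * z := by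
    rw [← Set.image_univ, Set.ncard_image_of_injective, Set.ncard_univ, card_groupQ hz hzp]
    intro g g' h
    have := eq_one_of_fix_halfTurn hz (mul_mem (inv_mem g'.2) g.2) (by
      rw [LinearEquiv.mul_apply]
      exact (congrArg (g'.1⁻¹ : V4 ≃ₗ[ℝ] V4) h).trans (inv_apply_self _ _))
    exact Subtype.ext (inv_mul_eq_one.1 this).symm
  rw [cA, cB, cC]
  ring

theorem ncard_facePairings (hz : 7 ≤ z) (hzp : (z : ℤ) = 4 * p - 1) :
    (facePairings z p).ncard = 10 * z + 2 := by
  rw [← ncard_neighbours hz hzp, ← image_facePairings hz hzp,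
    (injOn_apply_pointQ hz hzp).ncard_image]

end

section

/-! ### The tiling -/

variable {z p : ℕ}

lemma centre_mem_half (hz : 7 ≤ z) : centre z hz ∈ halfOrthoscheme z := by
  obtain ⟨t, ht, e⟩ := centre_val hz
  have hc := mem_chamber.1 (pointQ_mem_chamber hz)
  rw [mem_half_iff hz, e]
  refine ⟨fun i => mul_nonneg ht.le ?_, ?_, ?_⟩
  · rw [← form_root_pole hz (pointQ z) i]; exact hc _
  · rw [form_smul_left, (form_root_zero_eq_iff hz _).1 (form_pointQ_root_zero hz), mul_zero]
  · rw [form_smul_left, form_smul_left]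
    exact mul_le_mul_of_nonneg_left
      (form_pointQ_orbit_lt hz (halfTurn_mem_isomH hz) (halfTurn_pointQ_ne hz)).le ht.le

/-- The copies of the half orthoscheme around `Q` do not overlap: the bisector of the images of an
inner point of the orthoscheme separates them. -/
theorem disjoint_half (hz : 7 ≤ z) {g g' : V4 ≃ₗ[ℝ] V4} (hg : g ∈ groupQ z) (hg' : g' ∈ groupQ z)
    (h : g ≠ g') : Disjoint (interior (move g (halfOrthoscheme z)))
      (interior (move g' (halfOrthoscheme z))) := by
  have ig := orthoGroup_le hz (groupQ_le hg)
  have ig' := orthoGroup_le hz (groupQ_le hg')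
  obtain ⟨w, hw⟩ := exists_orthoHom_of_mem_groupQ hz (mul_mem (inv_mem hg) hg')
  set P := innerPoint z hz
  -- the bisector of `g P` and `g' P`
  have le : ∀ (a b : V4 ≃ₗ[ℝ] V4), a ∈ groupQ z → b ∈ groupQ z →
      ∀ X ∈ move a (halfOrthoscheme z), 0 ≤ form z X.1 (a P.1 - b P.1) := by
    rintro a b ha hb X ⟨Y, hY, e⟩
    have ia := orthoGroup_le hz (groupQ_le ha)
    obtain ⟨w, hw⟩ := exists_orthoHom_of_mem_groupQ hz (mul_mem (inv_mem ha) hb)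
    have := (isReflectionRep hz).form_orbit_le _ w rfl Y.1 P.1 ((mem_half_iff' hz Y).1 hY).1
      (innerPoint_mem hz)
    rw [bil_apply, bil_apply, show orthoHom hz w = a⁻¹ * b from hw.symm, LinearEquiv.mul_apply,
      ← ia.1, apply_inv_self, ← ia.1 Y.1 P.1, ← e] at this
    rw [form_sub_right]; linarith
  have hne : (⟨g, ig⟩ : isomH z) • P ≠ (⟨g', ig'⟩ : isomH z) • P := by
    intro e
    have e' : P.1 = orthoHom hz w P.1 := by
      rw [← hw, LinearEquiv.mul_apply, ← show g P.1 = g' P.1 from congrArg Subtype.val e,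
        inv_apply_self]
    have := (isReflectionRep hz).eq_one_of_interior (innerPoint_mem hz)
      (fun i => by rw [bil_apply]; exact innerPoint_pos hz i) e'
    rw [this, map_one, inv_mul_eq_one] at hw
    exact h hw
  have pos := form_sub_pos hz hne
  have pos' := form_sub_pos hz hne.symm
  rw [Set.disjoint_left]
  intro X hX hX'
  have h1 := form_pos_of_mem_interior hz pos (le g g' hg hg') hX
  have h2 := form_pos_of_mem_interior hz pos' (le g' g hg' hg) hX'
  rw [smul_val, smul_val, form_sub_right] at h1 h2
  linarith

/-- Different polyhedra of the tiling are separated by the bisector of their centres. -/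
lemma disjoint_interior_move (hz : 7 ≤ z) (hzp : (z : ℤ) = 4 * p - 1) {γ : V4 ≃ₗ[ℝ] V4}
    (hγ : γ ∈ cobwebGroup z p) (h1 : γ ≠ 1) :
    Disjoint (interior (cobweb z)) (interior (move γ (cobweb z))) := by
  have hγ' := cobwebGroup_le_orthoGroup hz hγ
  have ig := orthoGroup_le hz hγ'
  have hne : γ (pointQ z) ≠ pointQ z := fun h => h1 (eq_one_of_fix_pointQ hz hzp hγ h)
  have pos := form_bisector_pos hz ig hne
  have pos' : 0 < form z (γ (pointQ z) - pointQ z) (γ (pointQ z) - pointQ z) := by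
    rw [← neg_sub, form_neg_left, form_neg_right, neg_neg]; exact pos
  rw [Set.disjoint_left]
  intro X hX hX'
  have k1 := form_pos_of_mem_interior hz pos (fun Y hY => by
    rw [form_sub_right, sub_nonneg]; exact form_orbit_le_of_mem_cobweb hz hY hγ') hX
  have k2 := form_pos_of_mem_interior hz pos' (fun Y hY => by
    rw [form_sub_right, sub_nonneg]
    obtain ⟨Z, hZ, e⟩ := hY
    have := form_orbit_le_of_mem_cobweb hz hZ (inv_mem hγ')
    rwa [← ig.1, apply_inv_self, ← ig.1 Z.1 (pointQ z), ← e] at this) hX'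
  rw [form_sub_right] at k1 k2
  linarith

/-- The images of the cobweb polyhedron cover space. -/
lemma exists_mem_cobweb (hz : 7 ≤ z) (hzp : (z : ℤ) = 4 * p - 1) (X : H3 z) :
    ∃ γ ∈ cobwebGroup z p, ∃ Y ∈ cobweb z, X.1 = γ Y.1 := by
  obtain ⟨g, hg, hgX⟩ := exists_mem_orthoscheme hz X
  obtain ⟨k, hk, hkX⟩ : ∃ (k : V4 ≃ₗ[ℝ] V4) (hk : k ∈ orthoGroup z),
      (⟨k, orthoGroup_le hz hk⟩ : isomH z) • X ∈ halfOrthoscheme z := by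
    by_cases h : form z (g X.1) (halfTurn (pointQ z)) ≤ form z (g X.1) (pointQ z)
    · exact ⟨g, hg, (mem_half_iff' hz _).2 ⟨hgX, h⟩⟩
    · refine ⟨halfTurn * g, mul_mem halfTurn_mem_orthoGroup hg, (mem_half_iff' hz _).2
        ⟨halfTurn_mem_chamber hz hgX, ?_⟩⟩
      change form z (halfTurn (g X.1)) (halfTurn (pointQ z)) ≤ form z (halfTurn (g X.1)) (pointQ z)
      rw [form_halfTurn hz, ← form_halfTurn_right hz]
      exact (not_le.1 h).le
  obtain ⟨γ, hγ, κ, hκ, e⟩ := exists_mul_groupQ hz hzp (inv_mem hk)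
  refine ⟨γ, hγ, (⟨κ, orthoGroup_le hz (groupQ_le hκ)⟩ : isomH z) • _,
    (mem_cobweb_iff_exists _).2 ⟨κ, hκ, _, hkX, rfl⟩, ?_⟩
  change X.1 = γ (κ (k X.1))
  rw [← LinearEquiv.mul_apply, ← e, inv_apply_self]

/-- No nontrivial pairing has a fixed point. -/
theorem apply_ne_of_ne_one (hz : 7 ≤ z) (hzp : (z : ℤ) = 4 * p - 1) {γ : V4 ≃ₗ[ℝ] V4}
    (hγ : γ ∈ cobwebGroup z p) (h1 : γ ≠ 1) (X : H3 z) : γ X.1 ≠ X.1 := by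
  intro h
  obtain ⟨g, hg, hgX⟩ := exists_mem_orthoscheme hz X
  refine h1 (eq_one_of_fixes hz hzp hγ (inv_mem hg)
    (Y := (⟨g, orthoGroup_le hz hg⟩ : isomH z) • X) ((mem_completeOrthoscheme_iff hz _).2 hgX) ?_)
  rw [smul_val]
  change γ (g⁻¹ (g X.1)) = g⁻¹ (g X.1)
  rw [inv_apply_self, h]

/-- Only finitely many polyhedra of the tiling meet a bounded set. -/
lemma finite_move_inter (hz : 7 ≤ z) (hzp : (z : ℤ) = 4 * p - 1) (X : H3 z) (r : ℝ) :
    {γ | γ ∈ cobwebGroup z p ∧ (move γ (cobweb z) ∩ {Y | -form z Y.1 X.1 ≤ r}).Nonempty}.Finite := by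
  obtain ⟨K, hK⟩ : ∃ K, ∀ Y ∈ cobweb z, -form z Y.1 (centre z hz).1 ≤ K := by
    obtain ⟨K, hK⟩ := (isCompact_cobweb hz hzp).bddAbove_image
      (f := fun Y : H3 z => -form z Y.1 (centre z hz).1) (continuous_form_left _).neg.continuousOn
    exact ⟨K, fun Y hY => hK ⟨Y, hY, rfl⟩⟩
  refine (finite_form_le hz (centre z hz) X (2 * K * r)).subset ?_
  rintro γ ⟨hγ, Y, ⟨Z, hZ, e⟩, hY⟩
  have hγ' := cobwebGroup_le_orthoGroup hz hγ
  have ig := orthoGroup_le hz hγ'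
  refine ⟨hγ', ?_⟩
  have h1 := neg_form_le hz ((⟨γ, ig⟩ : isomH z) • centre z hz) Y X
  have h2 : form z (γ (centre z hz).1) Y.1 = form z Z.1 (centre z hz).1 := by
    rw [e, ig.1, form_comm hz]
  rw [smul_val] at h1
  change -form z (γ (centre z hz).1) X.1 ≤ 2 * -form z (γ (centre z hz).1) Y.1 * _ at h1
  rw [h2] at h1
  have h3 := one_le_neg_form hz Z (centre z hz)
  have h4 : 1 ≤ -form z Y.1 X.1 := one_le_neg_form hz Y X
  have h5 : -form z Y.1 X.1 ≤ r := hY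
  have h6 := hK Z hZ
  calc _ ≤ 2 * -form z Z.1 (centre z hz).1 * -form z Y.1 X.1 := h1
    _ ≤ 2 * K * r := mul_le_mul (by linarith) h5 (by linarith) (by linarith)

/-- The images of the cobweb polyhedron form a locally finite tiling. -/
theorem isFundamentalDomain (hz : 7 ≤ z) (hzp : (z : ℤ) = 4 * p - 1) :
    IsFundamentalDomain (cobwebGroup z p) (cobweb z) := by
  refine ⟨Set.eq_univ_of_forall fun X => ?_, fun γ hγ h1 => disjoint_interior_move hz hzp hγ h1,
    fun X => ⟨{Y | -form z Y.1 X.1 ≤ 2}, ?_, finite_move_inter hz hzp X 2⟩⟩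
  · obtain ⟨γ, hγ, Y, hY, e⟩ := exists_mem_cobweb hz hzp X
    exact Set.mem_iUnion₂.2 ⟨γ, hγ, Y, hY, e⟩
  · refine Filter.mem_of_superset ((isOpen_lt (continuous_form_left X.1).neg
      continuous_const).mem_nhds (?_ : -form z X.1 X.1 < 2)) fun Y (hY : -form z Y.1 X.1 < 2) => hY.le
    rw [X.2.1]; norm_num

/-! ### The bases and the rotation about the axis -/

lemma upperBase_eq (hz : 7 ≤ z) (hzp : (z : ℤ) = 4 * p - 1) :
    upperBase z = cobweb z ∩ move (baseScrew z) (cobweb z) := by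
  rw [inter_move_eq hz (baseScrew_mem_orthoGroup hz), baseScrew_pointQ hz hzp]
  ext X
  refine and_congr_right fun _ => ?_
  rw [form_sub_right, form_planeRefl hz, show pointQ z 3 = heightQ z by rw [pointQ_eq hz]; rfl,
    sub_sub_cancel]
  have := (heightQ_pos hz).ne'
  simp [this]

lemma move_cobweb_of_mem_groupQ (hz : 7 ≤ z) {g : V4 ≃ₗ[ℝ] V4} (hg : g ∈ groupQ z) :
    move g (cobweb z) = cobweb z := by
  have key : ∀ g ∈ groupQ z, move g (cobweb z) ⊆ cobweb z := by
    rintro g hg X ⟨Y, hY, e⟩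
    obtain ⟨k, hk, Z, hZ, e'⟩ := (mem_cobweb_iff_exists Y).1 hY
    exact (mem_cobweb_iff_exists X).2 ⟨g * k, mul_mem hg hk, Z, hZ, by rw [e, e']; rfl⟩
  refine (key g hg).antisymm ?_
  have := move_mono g (key _ (inv_mem hg))
  rwa [← move_mul _ _ (inv_mem (orthoGroup_le hz (groupQ_le hg))), mul_inv_cancel, move_one] at this

lemma move_inter {g : V4 ≃ₗ[ℝ] V4} (hg : g ∈ isomH z) (F F' : Set (H3 z)) :
    move g (F ∩ F') = move g F ∩ move g F' := by
  ext X
  simp only [Set.mem_inter_iff, mem_move hg]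

/-- The lower base is the intersection with the preceding polyhedron. -/
lemma lowerBase_eq (hz : 7 ≤ z) (hzp : (z : ℤ) = 4 * p - 1) :
    lowerBase z = cobweb z ∩ move (baseScrew z)⁻¹ (cobweb z) := by
  have ia : reflA3 z ∈ isomH z := orthoGroup_le hz reflA3_mem_orthoGroup
  have is := orthoGroup_le hz (baseScrew_mem_orthoGroup hz)
  rw [lowerBase, upperBase_eq hz hzp, move_inter ia, move_cobweb_of_mem_groupQ hz ra_mem_groupQ]
  congr 1
  -- both polyhedra have the same centre
  rw [← move_mul _ _ is]
  have hk : (baseScrew z) * (reflA3 z * baseScrew z) ∈ groupQ z := by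
    rw [mem_groupQ_iff hz (mul_mem (baseScrew_mem_orthoGroup hz) (mul_mem reflA3_mem_orthoGroup
      (baseScrew_mem_orthoGroup hz))), LinearEquiv.mul_apply, LinearEquiv.mul_apply,
      baseScrew_pointQ hz hzp, ← baseScrew_inv_pointQ hz hzp, apply_inv_self]
  have e : reflA3 z * baseScrew z = (baseScrew z)⁻¹ * (baseScrew z * (reflA3 z * baseScrew z)) := by
    rw [inv_mul_cancel_left]
  rw [e, move_mul _ _ (orthoGroup_le hz (groupQ_le hk)), move_cobweb_of_mem_groupQ hz hk]

lemma move_lowerBase (hz : 7 ≤ z) (hzp : (z : ℤ) = 4 * p - 1) :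
    move (baseScrew z) (lowerBase z) = upperBase z := by
  have is := orthoGroup_le hz (baseScrew_mem_orthoGroup hz)
  rw [lowerBase_eq hz hzp, move_inter is, ← move_mul _ _ (inv_mem is), mul_inv_cancel, move_one,
    Set.inter_comm, ← upperBase_eq hz hzp]

lemma baseScrew_mem_facePairings : baseScrew z ∈ facePairings z p := Or.inl (by simp [pairingHalf])

lemma isFacet_upperBase (hz : 7 ≤ z) (hzp : (z : ℤ) = 4 * p - 1) :
    IsFacet (cobweb z) (upperBase z) :=
  upperBase_eq hz hzp ▸ isFacet_pairing hz hzp baseScrew_mem_facePairings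

lemma isFacet_lowerBase (hz : 7 ≤ z) (hzp : (z : ℤ) = 4 * p - 1) :
    IsFacet (cobweb z) (lowerBase z) :=
  lowerBase_eq hz hzp ▸ isFacet_pairing hz hzp (inv_mem_facePairings baseScrew_mem_facePairings)

lemma rot_sq_conj_baseScrew (hz : 7 ≤ z) (hzp : (z : ℤ) = 4 * p - 1) :
    rot z ^ 2 * baseScrew z * (rot z ^ 2)⁻¹ = baseScrew z := by
  have := (orthoRelations hz).conj_base (p := p) 2
  rw [baseScrew_eq hz hzp]
  exact this

lemma rot_sq_conj_sideScrew (hz : 7 ≤ z) (hzp : (z : ℤ) = 4 * p - 1) (i : ZMod z) :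
    rot z ^ 2 * sideScrew z p (i + 1) * (rot z ^ 2)⁻¹ = sideScrew z p i := by
  obtain ⟨j, rfl⟩ := ZMod.intCast_surjective i
  have e := sideScrew_intCast hz hzp (j + 1)
  push_cast at e
  rw [e, sideScrew_intCast hz hzp, OrthoschemeRelations.sideAt_add, MulAut.conj_apply]
  change _ * (rot z ^ _ * _ * (rot z ^ _)⁻¹) * _ = _
  simp only [mul_one, zpow_neg, inv_inv]
  rw [← zpow_natCast]
  group

end

section

/-! ### The gluing of the cobweb polyhedron -/

variable {z p : ℕ}

/-- If a point of the cobweb polyhedron also lies in its image under `δ⁻¹ ≠ 1`, then some face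
through this point leads to a polyhedron whose centre is nearer to `δ⁻¹ Q`: otherwise one could move
from the point towards `δ⁻¹ Q` without leaving the cobweb polyhedron. -/
lemma exists_pairing_closer (hz : 7 ≤ z) (hzp : (z : ℤ) = 4 * p - 1) {y : H3 z}
    (hy : y ∈ cobweb z) {δ : V4 ≃ₗ[ℝ] V4} (hδ : δ ∈ cobwebGroup z p) (h1 : δ ≠ 1)
    (hyδ : form z y.1 (δ (pointQ z)) = form z y.1 (pointQ z)) :
    ∃ γ ∈ facePairings z p, form z y.1 (γ (pointQ z)) = form z y.1 (pointQ z) ∧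
      form z (δ (pointQ z)) (pointQ z) < form z (δ (pointQ z)) (γ (pointQ z)) := by
  by_contra! hcon
  have hδo := cobwebGroup_le_orthoGroup hz hδ
  have ig := orthoGroup_le hz hδo
  have hne : δ (pointQ z) ≠ pointQ z := fun h => h1 (eq_one_of_fix_pointQ hz hzp hδ h)
  obtain ⟨t, ht, et⟩ := centre_val hz
  set C : H3 z := (⟨δ, ig⟩ : isomH z) • centre z hz
  have eC : C.1 = t • δ (pointQ z) := by
    rw [smul_val, et, map_smul]
  have hev : ∀ γ ∈ facePairings z p, ∀ᶠ ε : ℝ in 𝓝[>] 0,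
      form z (y.1 + ε • C.1) (γ (pointQ z)) ≤ form z (y.1 + ε • C.1) (pointQ z) := by
    intro γ hγ
    rcases ((mem_cobweb_iff_pairings hz hzp y).1 hy γ hγ).eq_or_lt with h | h
    · filter_upwards [self_mem_nhdsWithin] with ε (hε : 0 < ε)
      have := mul_le_mul_of_nonneg_left (hcon γ hγ h) (mul_pos hε ht).le
      rw [form_add_left, form_add_left, eC, smul_smul, form_smul_left, form_smul_left, h]
      linarith
    · refine (Filter.Tendsto.eventually_lt (f := fun ε : ℝ =>
        form z (y.1 + ε • C.1) (γ (pointQ z))) (g := fun ε : ℝ => form z (y.1 + ε • C.1) (pointQ z))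
        (tendsto_nhdsWithin_of_tendsto_nhds ?_) (tendsto_nhdsWithin_of_tendsto_nhds ?_) h).mono
        fun ε hε => hε.le
      all_goals
        simp only [form_add_left, form_smul_left]
        refine Continuous.tendsto' (by fun_prop) _ _ (by simp)
  obtain ⟨ε, hε, hε0⟩ := ((((finite_facePairings hz hzp).eventually_all).2 hev).and
    self_mem_nhdsWithin).exists
  replace hε0 : 0 < ε := hε0
  have hn : form z (y.1 + ε • C.1) (y.1 + ε • C.1) < 0 := by
    rw [form_add_left, form_add_right, form_add_right, form_smul_left, form_smul_left,
      form_smul_right, form_smul_right, y.2.1, C.2.1, form_comm hz C.1]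
    nlinarith [mul_pos hε0 (neg_pos.2 (form_neg hz y C)), mul_pos hε0 hε0]
  have hn' : form z (y.1 + ε • C.1) (vertexA 2) < 0 := by
    rw [form_add_left, form_smul_left]
    exact add_neg y.2.2 (mul_neg_of_pos_of_neg hε0 C.2.2)
  have hX := (mem_cobweb_iff_pairings hz hzp (normalize z _ hn hn')).2 fun γ hγ => by
    rw [normalize_val, form_smul_left, form_smul_left]
    exact mul_le_mul_of_nonneg_left (hε γ hγ) (sqrt_inv_pos hn).le
  have h2 := form_orbit_le_of_mem_cobweb hz hX hδo
  rw [normalize_val, form_smul_left, form_smul_left] at h2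
  have h3 := le_of_mul_le_mul_left h2 (sqrt_inv_pos hn)
  have h4 := form_pointQ_orbit_lt hz ig hne
  rw [form_add_left, form_add_left, hyδ, eC, smul_smul, form_smul_left, form_smul_left, ig.1,
    form_comm hz (δ (pointQ z))] at h3
  have := mul_lt_mul_of_pos_left h4 (mul_pos hε0 ht)
  linarith

/-- The face pairings generate the equivalence relation of lying in the same orbit. -/
theorem mk_eq_mk_of_apply_eq (hz : 7 ≤ z) (hzp : (z : ℤ) = 4 * p - 1) (x y : cobweb z)
    {δ : V4 ≃ₗ[ℝ] V4} (hδ : δ ∈ cobwebGroup z p) (h : δ y.1.1 = x.1.1) :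
    (Quot.mk _ x : CobwebManifold z p) = Quot.mk _ y := by
  by_contra hne
  set bad : Set (V4 ≃ₗ[ℝ] V4) := {δ | δ ∈ cobwebGroup z p ∧ ∃ y : cobweb z, δ y.1.1 = x.1.1 ∧
    (Quot.mk _ x : CobwebManifold z p) ≠ Quot.mk _ y}
  have hfin : bad.Finite := (finite_move_inter hz hzp x.1 1).subset fun δ ⟨hδ, y, e, _⟩ =>
    ⟨hδ, x.1, ⟨y.1, y.2, e.symm⟩, show -form z x.1.1 x.1.1 ≤ 1 by rw [x.1.2.1, neg_neg]⟩
  obtain ⟨δ, ⟨hδ, y, e, hxy⟩, hmax⟩ := Set.exists_max_image _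
    (fun δ : V4 ≃ₗ[ℝ] V4 => form z (δ (pointQ z)) (pointQ z)) hfin ⟨δ, hδ, y, h, hne⟩
  have ig := orthoGroup_le hz (cobwebGroup_le_orthoGroup hz hδ)
  have h1 : δ⁻¹ ≠ 1 := by
    rintro h1
    rw [inv_eq_one.1 h1] at e
    exact hxy (congrArg _ (Subtype.ext (Subtype.ext e.symm)))
  have hyδ : form z y.1.1 (δ⁻¹ (pointQ z)) = form z y.1.1 (pointQ z) := by
    refine le_antisymm (form_orbit_le_of_mem_cobweb hz y.2
      (cobwebGroup_le_orthoGroup hz (inv_mem hδ))) ?_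
    have := form_orbit_le_of_mem_cobweb hz x.2 (cobwebGroup_le_orthoGroup hz hδ)
    rwa [← e, ig.1, ← inv_inv δ, form_inv_left (inv_mem ig)] at this
  obtain ⟨γ, hγ, hyγ, hlt⟩ := exists_pairing_closer hz hzp y.2 (inv_mem hδ) h1 hyδ
  have hγ' := facePairings_le γ hγ
  have hmem : y.1 ∈ cobweb z ∩ move γ (cobweb z) := by
    rw [inter_move_eq hz (cobwebGroup_le_orthoGroup hz hγ')]
    exact ⟨y.2, by rw [form_sub_right, hyγ, sub_self]⟩
  obtain ⟨w, hw, ew⟩ := hmem.2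
  have hyw : (Quot.mk _ (⟨w, hw⟩ : cobweb z) : CobwebManifold z p) = Quot.mk _ y :=
    Quot.sound ⟨γ, hγ, ew⟩
  have := hmax (δ * γ) ⟨mul_mem hδ hγ', ⟨w, hw⟩, by rw [LinearEquiv.mul_apply, ← ew, e],
    fun h' => hxy (h'.trans hyw)⟩
  rw [LinearEquiv.mul_apply, form_comm hz (δ (pointQ z)), form_comm hz (δ (γ _)),
    ← form_inv_left ig, ← form_inv_left ig] at this
  exact this.not_gt hlt

/-! ### The covering of the glued space -/

/-- The group generated by the face pairings, as a group of isometries of hyperbolic space. -/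
abbrev deckGroup (z p : ℕ) : Subgroup (isomH z) := (cobwebGroup z p).subgroupOf (isomH z)

instance : ContinuousConstSMul (deckGroup z p) (H3 z) where
  continuous_const_smul γ := continuous_const_smul γ.1

/-- Finitely many images of `Q` lie in a bounded region, since the group is discrete. -/
lemma properlyDiscontinuous (hz : 7 ≤ z) :
    ProperlyDiscontinuousSMul (deckGroup z p) (H3 z) where
  finite_disjoint_inter_image {K L} hK hL := by
    set P := centre z hz
    have bdd : ∀ {K : Set (H3 z)}, IsCompact K → ∃ r, ∀ X ∈ K, -form z X.1 P.1 ≤ r := by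
      intro K hK
      obtain ⟨r, hr⟩ := hK.bddAbove_image (f := fun Y : H3 z => -form z Y.1 P.1)
        (continuous_form_left _).neg.continuousOn
      exact ⟨r, fun Y hY => hr ⟨Y, hY, rfl⟩⟩
    obtain ⟨r, hr⟩ := bdd hK
    obtain ⟨s, hs⟩ := bdd hL
    refine Set.Finite.of_finite_image (f := fun γ : deckGroup z p => γ.1.1)
      ((finite_form_le hz P P (2 * r * s)).subset ?_)
      (fun a _ b _ e => Subtype.ext (Subtype.ext e))
    rintro _ ⟨γ, ⟨_, ⟨X, hX, rfl⟩, hY⟩, rfl⟩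
    refine ⟨cobwebGroup_le_orthoGroup hz γ.2, ?_⟩
    have h1 := neg_form_le hz (γ.1 • P) (γ.1 • X) P
    have h2 : form z (γ.1 • P).1 (γ.1 • X).1 = form z X.1 P.1 := by
      rw [smul_val, smul_val, γ.1.2.1, form_comm hz]
    rw [h2] at h1
    have h3 := one_le_neg_form hz X P
    have h4 := one_le_neg_form hz (γ.1 • X) P
    have h5 := hr X hX
    have h6 : -form z (γ.1 • X).1 P.1 ≤ s := hs _ hY
    calc _ ≤ 2 * -form z X.1 P.1 * -form z (γ.1 • X).1 P.1 := h1
      _ ≤ 2 * r * s := mul_le_mul (by linarith) h6 (by linarith) (by linarith)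

lemma isCancelSMul_deckGroup (hz : 7 ≤ z) (hzp : (z : ℤ) = 4 * p - 1) :
    IsCancelSMul (deckGroup z p) (H3 z) := by
  rw [isCancelSMul_iff_eq_one_of_smul_eq]
  intro γ X h
  by_contra h1
  refine apply_ne_of_ne_one hz hzp γ.2 (fun e => h1 (Subtype.ext (Subtype.ext e))) X ?_
  exact congrArg Subtype.val h

lemma deckGroup_mem_orbit (hz : 7 ≤ z) {X Y : H3 z} :
    X ∈ MulAction.orbit (deckGroup z p) Y ↔ ∃ γ ∈ cobwebGroup z p, γ Y.1 = X.1 := by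
  constructor
  · rintro ⟨γ, rfl⟩
    exact ⟨γ.1.1, γ.2, rfl⟩
  · rintro ⟨γ, hγ, e⟩
    exact ⟨⟨⟨γ, orthoGroup_le hz (cobwebGroup_le_orthoGroup hz hγ)⟩, hγ⟩, Subtype.ext e⟩

/-- The space glued from the cobweb polyhedron is the orbit space. -/
theorem exists_homeomorph_orbits (hz : 7 ≤ z) (hzp : (z : ℤ) = 4 * p - 1) :
    ∃ e : CobwebManifold z p ≃ₜ Quotient (MulAction.orbitRel (deckGroup z p) (H3 z)),
      ∀ x : cobweb z, e (Quot.mk _ x) = Quotient.mk _ x.1 := by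
  have := locallyCompactSpace_H3 hz
  have := properlyDiscontinuous (p := p) hz
  have : CompactSpace (cobweb z) := isCompact_iff_compactSpace.1 (isCompact_cobweb hz hzp)
  set f : CobwebManifold z p → Quotient (MulAction.orbitRel (deckGroup z p) (H3 z)) :=
    Quot.lift (fun x : cobweb z => Quotient.mk _ x.1) (by
      rintro x y ⟨γ, hγ, e⟩
      exact Quotient.sound <| (MulAction.orbitRel (deckGroup z p) (H3 z)).symm
        ((deckGroup_mem_orbit hz).2 ⟨γ, facePairings_le γ hγ, e.symm⟩))
  have hf : Continuous f := continuous_quot_lift _ (continuous_quot_mk.comp continuous_subtype_val)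
  have hbij : Function.Bijective f := by
    constructor
    · rintro ⟨x⟩ ⟨y⟩ h
      obtain ⟨γ, hγ, e⟩ := (deckGroup_mem_orbit hz).1 (Quotient.exact h)
      exact mk_eq_mk_of_apply_eq hz hzp x y hγ e
    · rintro ⟨X⟩
      obtain ⟨γ, hγ, Y, hY, e⟩ := exists_mem_cobweb hz hzp X
      exact ⟨Quot.mk _ ⟨Y, hY⟩, Quotient.sound <| (MulAction.orbitRel (deckGroup z p) (H3 z)).symm
        ((deckGroup_mem_orbit hz).2 ⟨γ, hγ, e.symm⟩)⟩
  exact ⟨Continuous.homeoOfEquivCompactToT2 (f := Equiv.ofBijective f hbij) hf, fun x => rfl⟩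

/-- The covering of the glued space by hyperbolic space that extends the gluing map. -/
theorem exists_covering (hz : 7 ≤ z) (hzp : (z : ℤ) = 4 * p - 1) :
    T2Space (CobwebManifold z p) ∧ ∃ π : H3 z → CobwebManifold z p,
      IsQuotientCoveringMap π (deckGroup z p) ∧ ∀ x : cobweb z, π x = Quot.mk _ x := by
  have := locallyCompactSpace_H3 hz
  have := properlyDiscontinuous (p := p) hz
  have := isCancelSMul_deckGroup hz hzp
  obtain ⟨e, he⟩ := exists_homeomorph_orbits hz hzp
  refine ⟨e.symm.t2Space, e.symm ∘ Quotient.mk _, IsQuotientCoveringMap.homeomorph_comp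
    (isQuotientCoveringMap_quotientMk_of_properlyDiscontinuousSMul) e.symm, fun x => ?_⟩
  rw [Function.comp_apply, ← he, Homeomorph.symm_apply_apply]

lemma covering_eq_iff (hz : 7 ≤ z) {M : Type} [TopologicalSpace M] {π : H3 z → M}
    (hπ : IsQuotientCoveringMap π (deckGroup z p)) (X Y : H3 z) :
    π X = π Y ↔ ∃ γ ∈ cobwebGroup z p, γ X.1 = Y.1 := by
  rw [eq_comm, hπ.apply_eq_iff_mem_orbit, deckGroup_mem_orbit hz]

/-- The fundamental group of the quotient is the group of deck transformations. -/
theorem nonempty_fundamentalGroup_mulEquiv (hz : 7 ≤ z) {M : Type} [TopologicalSpace M]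
    {π : H3 z → M} (hπ : IsQuotientCoveringMap π (deckGroup z p)) (x : M) :
    Nonempty (FundamentalGroup M x ≃* cobwebGroup z p) := by
  have := contractibleSpace_H3 hz
  obtain ⟨X, hX⟩ := hπ.surjective x
  exact ⟨((hπ.fundamentalGroupEquiv ⟨X, hX⟩).trans (MulEquiv.inv' _).symm).trans
    (Subgroup.subgroupOfEquivOfLe
      ((cobwebGroup_le_orthoGroup hz).trans (orthoGroup_le hz)))⟩

/-! ### The hyperbolic structure -/

/-- Where a local inverse of the covering is defined, it agrees locally with a deck
transformation after the covering. -/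
lemma exists_eventually_chart_eq (hz : 7 ≤ z) {M : Type} [TopologicalSpace M] {π : H3 z → M}
    (hπ : IsQuotientCoveringMap π (deckGroup z p)) {e : OpenPartialHomeomorph (H3 z) M}
    (he : ⇑e = π) {x : H3 z} (hx : π x ∈ e.target) :
    ∃ g ∈ isomPlus z, ∀ᶠ y in 𝓝 x, (e.symm (π y)).1 = g y.1 := by
  obtain ⟨γ, hγ⟩ := hπ.apply_eq_iff_mem_orbit.1
    (show π (e.symm (π x)) = π x by rw [← he, e.right_inv (he ▸ hx)])
  refine ⟨γ.1.1, cobwebGroup_le_isomPlus hz γ.2, ?_⟩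
  have hcont : Continuous fun y : H3 z => γ • y := continuous_const_smul γ
  have hmem : γ • x ∈ e.source := by
    change γ • x = _ at hγ
    rw [hγ]
    exact e.map_target hx
  filter_upwards [(e.open_source.preimage hcont).mem_nhds hmem] with y hy
  rw [← hπ.map_smul γ, ← he, e.left_inv hy]
  rfl

/-- The local inverses of the covering are charts whose transition maps are locally given by
elements of the group, which preserve the metric and the orientation. -/
theorem isHyperbolicCovering (hz : 7 ≤ z) {M : Type} [TopologicalSpace M] {π : H3 z → M}
    (hπ : IsQuotientCoveringMap π (deckGroup z p)) : IsHyperbolicCovering π := by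
  refine ⟨hπ.isCoveringMap, hπ.surjective, ?_⟩
  choose s hs using hπ.surjective
  choose f hf hf' using hπ.isCoveringMap.isLocalHomeomorph
  let charted : ChartedSpace (H3 z) M :=
    { atlas := {c | ∃ e : OpenPartialHomeomorph (H3 z) M, ⇑e = π ∧ c = e.symm}
      chartAt := fun x => (f (s x)).symm
      mem_chart_source := fun x => by
        have h := (f (s x)).map_source (hf (s x))
        rwa [← hf', hs] at h
      chart_mem_atlas := fun x => ⟨_, (hf' (s x)).symm, rfl⟩ }
  refine ⟨charted, ?_, ?_⟩
  · apply hasGroupoid_of_pregroupoid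
    rintro _ _ ⟨e, he, rfl⟩ ⟨e', he', rfl⟩ x hx
    have hx' : π x ∈ e'.target := by
      have := hx.2
      simpa [he] using this
    obtain ⟨g, hg, hev⟩ := exists_eventually_chart_eq hz hπ he' hx'
    obtain ⟨u, hu, huo, hxu⟩ := eventually_nhds_iff.1 hev
    refine ⟨g, hg, u, huo, hxu, fun y hy => ?_⟩
    rw [← hu y hy.2, ← he]
    rfl
  · rintro _ ⟨e, he, rfl⟩ x hx
    exact exists_eventually_chart_eq hz hπ he hx

end

section

/-! ### Screw motions -/

variable {z p : ℕ}

/-- A vector orthogonal to a timelike one is spacelike. -/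
lemma form_pos_of_orthogonal (hz : 7 ≤ z) {P X : V4} (hP : form z P P < 0) (h : form z P X = 0)
    (hX : X ≠ 0) : 0 < form z X X := by
  rw [form_lorentz hz] at hP h ⊢
  have hX' : lorentz z hz X ≠ 0 := fun e => hX ((lorentz z hz).map_eq_zero_iff.1 e)
  set a := lorentz z hz P
  set x := lorentz z hz X
  have h1 : a 0 * x 0 + a 1 * x 1 + a 2 * x 2 = a 3 * x 3 := by linarith
  -- the Cauchy–Schwarz inequality for the space parts
  have h2 : (a 3 * x 3) ^ 2 ≤ (a 0 ^ 2 + a 1 ^ 2 + a 2 ^ 2) * (x 0 ^ 2 + x 1 ^ 2 + x 2 ^ 2) := by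
    rw [← h1]
    nlinarith [sq_nonneg (a 0 * x 1 - a 1 * x 0), sq_nonneg (a 0 * x 2 - a 2 * x 0),
      sq_nonneg (a 1 * x 2 - a 2 * x 1)]
  have h3 : 0 ≤ a 0 ^ 2 + a 1 ^ 2 + a 2 ^ 2 := by positivity
  have h4 : a 0 ^ 2 + a 1 ^ 2 + a 2 ^ 2 < a 3 ^ 2 := by nlinarith
  by_contra! hle
  have h5 : x 0 ^ 2 + x 1 ^ 2 + x 2 ^ 2 ≤ x 3 ^ 2 := by nlinarith
  have h6 : (a 0 ^ 2 + a 1 ^ 2 + a 2 ^ 2) * (x 0 ^ 2 + x 1 ^ 2 + x 2 ^ 2) ≤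
      (a 0 ^ 2 + a 1 ^ 2 + a 2 ^ 2) * x 3 ^ 2 := mul_le_mul_of_nonneg_left h5 h3
  have h7 : x 3 ^ 2 ≤ 0 := by
    by_contra! h7
    nlinarith [mul_lt_mul_of_pos_right h4 h7]
  have h8 : ∀ i, x i = 0 := by
    have : x 0 ^ 2 + x 1 ^ 2 + x 2 ^ 2 ≤ 0 := h5.trans h7
    intro i
    refine pow_eq_zero_iff two_ne_zero |>.1 (le_antisymm ?_ (sq_nonneg _))
    fin_cases i <;>
      simp only [Fin.zero_eta, Fin.mk_one, Fin.reduceFinMk] <;>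
      nlinarith [sq_nonneg (x 0), sq_nonneg (x 1), sq_nonneg (x 2)]
  exact hX' (funext h8)

section Eigenvectors

variable {g : V4 ≃ₗ[ℝ] V4} {u v : ℝ} {A B : V4}

lemma form_self_adjoint (hg : g ∈ isomH z) (A B : V4) :
    form z (g A + g⁻¹ A) B = form z A (g B + g⁻¹ B) := by
  have h := form_inv_left (inv_mem hg) A B
  rw [inv_inv] at h
  rw [form_add_left, form_add_right, form_inv_left hg, h, add_comm]

lemma apply_apply_of_eigen (hA : g A + g⁻¹ A = u • A) : g (g A) = u • g A - A := by
  have := congrArg g hA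
  rw [map_add, apply_inv_self, map_smul] at this
  rw [← this, add_sub_cancel_right]

lemma eigen_apply (hA : g A + g⁻¹ A = u • A) : g (g A) + g⁻¹ (g A) = u • g A := by
  rw [apply_apply_of_eigen hA, inv_apply_self, sub_add_cancel]

lemma form_eigen_eq_zero (hg : g ∈ isomH z) (hA : g A + g⁻¹ A = u • A)
    (hB : g B + g⁻¹ B = v • B) (huv : u ≠ v) : form z A B = 0 := by
  have := form_self_adjoint hg A B
  rw [hA, hB, form_smul_left, form_smul_right] at this
  by_contra h
  exact huv (mul_right_cancel₀ h this)

lemma form_apply_of_eigen (hz : 7 ≤ z) (hg : g ∈ isomH z) (hA : g A + g⁻¹ A = u • A) :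
    form z (g A) A = u / 2 * form z A A := by
  have h1 := congrArg (form z · A) hA
  simp only [form_add_left, form_smul_left] at h1
  rw [form_inv_left hg, form_comm hz A] at h1
  linarith

/-- An isometry `g` is a screw motion if `g + g⁻¹` has a timelike eigenvector to an eigenvalue
`2 cosh d` and a spacelike one to an eigenvalue `2 cos θ`. -/
lemma isScrewMotion_of_eigenvectors (hz : 7 ≤ z) (hg : g ∈ isomPlus z) {θ d : ℝ} (hθ : 0 < θ)
    (hθ' : θ < Real.pi) (hd : 0 < d) (hA : g A + g⁻¹ A = (2 * Real.cosh d) • A)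
    (hB : g B + g⁻¹ B = (2 * Real.cos θ) • B) (hAA : form z A A = -1) (hBB : form z B B = 1) :
    IsScrewMotion z g θ := by
  have hs := Real.sinh_pos_iff.2 hd
  have hs2 := Real.cosh_sq d
  have hc := Real.one_lt_cosh.2 hd.ne'
  have ht := Real.sin_pos_of_pos_of_lt_pi hθ hθ'
  have ht2 := Real.sin_sq_add_cos_sq θ
  have hct := Real.cos_le_one θ
  have hg' := isomPlus_le hg
  have gA := form_apply_of_eigen hz hg' hA
  have gB := form_apply_of_eigen hz hg' hB
  have ggA := apply_apply_of_eigen hA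
  have ggB := apply_apply_of_eigen hB
  have huv : 2 * Real.cosh d ≠ 2 * Real.cos θ := by linarith
  have o1 := form_eigen_eq_zero hg' hA hB huv
  have o2 := form_eigen_eq_zero hg' (eigen_apply hA) hB huv
  have o3 := form_eigen_eq_zero hg' hA (eigen_apply hB) huv
  have o4 := form_eigen_eq_zero hg' (eigen_apply hA) (eigen_apply hB) huv
  have kA := hg'.1 A A
  have kB := hg'.1 B B
  rw [hAA] at kA gA
  rw [hBB] at kB gB
  set S := Real.sinh d
  set C := Real.cosh d
  set s := Real.sin θ
  set c := Real.cos θ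
  set E1 := s⁻¹ • (g B - c • B) with hE1
  set E2 := S⁻¹ • (g A - C • A) with hE2
  have gB' : g B = c • B + s • E1 := by rw [hE1, smul_smul, mul_inv_cancel₀ ht.ne']; module
  have gA' : g A = S • E2 + C • A := by rw [hE2, smul_smul, mul_inv_cancel₀ hs.ne']; module
  have f11 : form z E1 E1 = 1 := by
    simp only [hE1, form_smul_left, form_smul_right, form_sub_left, form_sub_right,
      form_comm hz B (g B), gB, kB, hBB]
    field_simp; linear_combination -ht2
  have f22 : form z E2 E2 = 1 := by
    simp only [hE2, form_smul_left, form_smul_right, form_sub_left, form_sub_right,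
      form_comm hz A (g A), gA, kA, hAA]
    field_simp; linear_combination hs2
  have f10 : form z E1 B = 0 := by
    rw [hE1, form_smul_left, form_sub_left, form_smul_left, gB, hBB]; ring
  have f23 : form z E2 A = 0 := by
    rw [hE2, form_smul_left, form_sub_left, form_smul_left, gA, hAA]; ring
  have f21 : form z E2 E1 = 0 := by
    simp [hE1, hE2, form_smul_left, form_smul_right, form_sub_left, form_sub_right, o1, o2, o3, o4]
  have f20 : form z E2 B = 0 := by simp [hE2, form_smul_left, form_sub_left, o1, o2]
  have f31 : form z A E1 = 0 := by simp [hE1, form_smul_right, form_sub_right, o1, o3]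
  refine ⟨hg, ![B, E1, E2, A], d, hd, ?_, ?_, ?_, ?_, ?_⟩
  · intro i j
    fin_cases i <;> fin_cases j <;>
      simp [f11, f22, f10, f23, f21, f20, f31, o1, hAA, hBB, form_comm hz B, form_comm hz E1 E2,
        form_comm hz E1 A, form_comm hz A E2]
  · exact gB'
  · change g E1 = -s • B + c • E1
    have h1 : s⁻¹ * (c * s) = c := by field_simp
    have h2 : s⁻¹ * (c ^ 2 - 1) = -s := by field_simp; linarith
    calc g E1 = s⁻¹ • ((2 * c) • g B - B - c • g B) := by rw [hE1, map_smul, map_sub, map_smul, ggB]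
      _ = (s⁻¹ * (c ^ 2 - 1)) • B + (s⁻¹ * (c * s)) • E1 := by rw [gB']; module
      _ = -s • B + c • E1 := by rw [h1, h2]
  · change g E2 = C • E2 + S • A
    have h1 : S⁻¹ * (C * S) = C := by field_simp
    have h2 : S⁻¹ * (C ^ 2 - 1) = S := by field_simp; linarith
    calc g E2 = S⁻¹ • ((2 * C) • g A - A - C • g A) := by rw [hE2, map_smul, map_sub, map_smul, ggA]
      _ = (S⁻¹ * (C * S)) • E2 + (S⁻¹ * (C ^ 2 - 1)) • A := by rw [gA']; module
      _ = C • E2 + S • A := by rw [h1, h2]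
  · exact gA'

/-- An isometry `g` is a screw motion if `g + g⁻¹` satisfies, on the plane of a point `F` and its
image, a quadratic equation with one root larger than `2` and the other one between `-2` and `2`. -/
theorem exists_isScrewMotion (hz : 7 ≤ z) (hg : g ∈ isomPlus z) (F : H3 z) {G : V4} {t q : ℝ}
    (hG : g F.1 + g⁻¹ F.1 = G) (hq : g G + g⁻¹ G = t • G - q • F.1) (hne : ∀ r : ℝ, G ≠ r • F.1)
    (h1 : 4 - 2 * t + q < 0) (h2 : 0 < 4 + 2 * t + q) :
    ∃ θ, 0 < θ ∧ θ ≤ Real.pi ∧ IsScrewMotion z g θ := by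
  obtain ⟨u, v, rfl, rfl, hu, hv, hv'⟩ :
      ∃ u v, u + v = t ∧ u * v = q ∧ 2 < u ∧ v < 2 ∧ -2 < v := by
    have hD : 0 < t ^ 2 - 4 * q := by nlinarith [sq_nonneg (t - 4)]
    have hr := Real.sq_sqrt hD.le
    have hr0 := Real.sqrt_pos.2 hD
    set r := Real.sqrt (t ^ 2 - 4 * q)
    have e2 : ((t + r) / 2 - 2) * ((t - r) / 2 - 2) < 0 := by nlinarith
    have e3 : 0 < ((t + r) / 2 + 2) * ((t - r) / 2 + 2) := by nlinarith
    refine ⟨(t + r) / 2, (t - r) / 2, by ring, by linear_combination -hr / 4, ?_, ?_, ?_⟩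
    · by_contra! h
      nlinarith
    · by_contra! h
      nlinarith
    · by_contra! h
      have : 2 < (t + r) / 2 := by
        by_contra! h'
        nlinarith
      nlinarith
  have hg' := isomPlus_le hg
  have hadd : ∀ (a : ℝ), g (G - a • F.1) + g⁻¹ (G - a • F.1) =
      (u + v - a) • G - (u * v) • F.1 := fun a => by
    have : g (G - a • F.1) + g⁻¹ (G - a • F.1) = (g G + g⁻¹ G) - a • (g F.1 + g⁻¹ F.1) := by
      simp only [map_sub, map_smul]; module
    rw [this, hG, hq]; module
  have hA : g (G - v • F.1) + g⁻¹ (G - v • F.1) = u • (G - v • F.1) := by rw [hadd]; module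
  have hB : g (G - u • F.1) + g⁻¹ (G - u • F.1) = v • (G - u • F.1) := by rw [hadd]; module
  have hAB := form_eigen_eq_zero hg' hA hB (by linarith)
  have hGF : form z G F.1 ≤ -2 := by
    have h3 := one_le_neg_form hz ((⟨g, hg'⟩ : isomH z) • F) F
    rw [smul_val] at h3
    change 1 ≤ -form z (g F.1) F.1 at h3
    rw [← hG, form_add_left, form_inv_left hg', form_comm hz F.1]
    linarith
  -- `F` is the difference of the two eigenvectors, up to a factor
  have hAF : form z (G - v • F.1) (G - v • F.1) = (u - v) * form z (G - v • F.1) F.1 := by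
    have e : (G - v • F.1) = (G - u • F.1) + (u - v) • F.1 := by module
    nth_rewrite 2 [e]
    rw [form_add_right, hAB, form_smul_right, zero_add]
  have hAn : form z (G - v • F.1) (G - v • F.1) < 0 := by
    rw [hAF, form_sub_left, form_smul_left, F.2.1]
    exact mul_neg_of_pos_of_neg (by linarith) (by linarith)
  have hBp := form_pos_of_orthogonal hz hAn hAB (sub_ne_zero.2 (hne u))
  have hcos : 2 * Real.cos (Real.arccos (v / 2)) = v := by
    rw [Real.cos_arccos (by linarith) (by linarith)]; ring
  have hcosh : 2 * Real.cosh (Real.arcosh (u / 2)) = u := by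
    rw [Real.cosh_arcosh (by linarith)]; ring
  have hπ : Real.arccos (v / 2) < Real.pi := by
    refine lt_of_le_of_ne (Real.arccos_le_pi _) fun h => ?_
    rw [h, Real.cos_pi] at hcos; linarith
  refine ⟨Real.arccos (v / 2), Real.arccos_pos.2 (by linarith), hπ.le,
    isScrewMotion_of_eigenvectors hz hg (A := (Real.sqrt (-form z (G - v • F.1) (G - v • F.1)))⁻¹ •
      (G - v • F.1)) (B := (Real.sqrt (form z (G - u • F.1) (G - u • F.1)))⁻¹ • (G - u • F.1))
      (Real.arccos_pos.2 (by linarith)) hπ (d := Real.arcosh (u / 2)) ?_ ?_ ?_ ?_ ?_⟩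
  · exact Real.arcosh_pos (by linarith)
  · rw [hcosh, map_smul, map_smul, ← smul_add, hA, smul_comm]
  · rw [hcos, map_smul, map_smul, ← smul_add, hB, smul_comm]
  · have hs := Real.sqrt_pos.2 (neg_pos.2 hAn)
    have hq := Real.mul_self_sqrt (neg_pos.2 hAn).le
    rw [form_smul_left, form_smul_right]
    field_simp; linarith
  · have hs := Real.sqrt_pos.2 hBp
    have hq := Real.mul_self_sqrt hBp.le
    rw [form_smul_left, form_smul_right]
    field_simp; linarith

end Eigenvectors

/-- A conjugate of a screw motion is a screw motion with the same angle. -/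
lemma IsScrewMotion.conj {g k : V4 ≃ₗ[ℝ] V4} {θ : ℝ} (h : IsScrewMotion z g θ) (hk : k ∈ isomH z) :
    IsScrewMotion z (k * g * k⁻¹) θ := by
  obtain ⟨hg, e, d, hd, ho, h0, h1, h2, h3⟩ := h
  have hc : ∀ X, (k * g * k⁻¹) (k X) = k (g X) := fun X => by
    rw [LinearEquiv.mul_apply, LinearEquiv.mul_apply, inv_apply_self]
  refine ⟨?_, fun i => k (e i), d, hd, fun i j => by rw [hk.1, ho], ?_, ?_, ?_, ?_⟩
  · rw [mem_isomPlus_iff] at hg ⊢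
    refine ⟨mul_mem (mul_mem hk hg.1) (inv_mem hk), ?_⟩
    rw [map_mul, map_mul, hg.2, mul_one, ← map_mul, mul_inv_cancel, map_one]
  all_goals simp only [hc, h0, h1, h2, h3, map_add, map_smul]

end

section

/-! ### The screw motion between the bases -/

variable {z p : ℕ}

/-- The unit vector orthogonal to `b⁰` in the plane of `b⁰` and `b¹`. -/
def axisNormal (z : ℕ) : V4 := (sz z)⁻¹ • (facePole z 1 + cz z • facePole z 0)

lemma axisNormal_eq (hz : 7 ≤ z) : axisNormal z = ![0, sz z, -cz z / sz z, 0] := by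
  have h1 := (sz_pos hz).ne'
  have h2 := sz_sq z
  ext i
  fin_cases i <;> simp [axisNormal, facePole, coxeterSchlafli_eq] <;> field_simp
  linarith

lemma facePole_zero_eq : facePole z 0 = ![1, -cz z, 0, 0] := by
  ext i; fin_cases i <;> simp [facePole, coxeterSchlafli_eq]

lemma facePole_three_eq : facePole z 3 = ![0, 0, -cz z, 1] := by
  ext i; fin_cases i <;> simp [facePole, coxeterSchlafli_eq]

lemma form_axisNormal (hz : 7 ≤ z) (X : V4) :
    form z X (axisNormal z) = (sz z)⁻¹ * (X 1 + cz z * X 0) := by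
  rw [axisNormal, form_smul_right, form_add_right, form_smul_right, form_facePole hz,
    form_facePole hz]

/-- The powers of `R` rotate the plane spanned by the pole of the face `0` and `axisNormal`, and fix
the orthogonal complement of this plane. -/
lemma rot_pow_apply (hz : 7 ≤ z) (n : ℕ) :
    (rot z ^ n) (facePole z 0) = Real.cos (2 * n * (Real.pi / (2 * z))) • facePole z 0 +
      Real.sin (2 * n * (Real.pi / (2 * z))) • axisNormal z ∧
    (rot z ^ n) (axisNormal z) = -Real.sin (2 * n * (Real.pi / (2 * z))) • facePole z 0 +
      Real.cos (2 * n * (Real.pi / (2 * z))) • axisNormal z ∧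
    ∀ X : V4, X 0 = 0 → X 1 = 0 → (rot z ^ n) X = X := by
  have h := rotation_pow hz (form_facePole_self hz 0) (form_facePole_self hz 1)
    (t := Real.pi / (2 * z)) (by
      rw [form_facePole hz]; simp [facePole, coxeterSchlafli_eq, cz]) (sz_pos hz).ne' n
  refine ⟨h.1, h.2.1, fun X h0 h1 => h.2.2 X ?_ ?_⟩ <;> rwa [form_facePole hz]

lemma planeRefl_apply (hz : 7 ≤ z) (i : Fin 4) (X : V4) :
    planeRefl z i X = X - (2 * X i) • facePole z i := by
  rw [planeRefl, reflect_apply z (facePole_ne hz i), form_facePole hz, form_facePole_self hz,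
    div_one]

lemma reflA3_apply (hz : 7 ≤ z) (X : V4) :
    reflA3 z X = X - (2 * form z X (vertexA 3) / outerSq z) • vertexA 3 := by
  rw [reflA3, reflect_apply z (form_A3_ne hz), form_A3_A3 hz]

theorem isScrewMotion_baseScrew (hz : 7 ≤ z) :
    IsScrewMotion z (baseScrew z) (2 * Real.pi * ((z : ℝ) - 1) / (2 * z)) := by
  have ho := outerSq_pos hz
  have hs := (sz_pos hz).ne'
  have hs2 := sz_sq z
  obtain ⟨t, ht, et⟩ := centre_val hz
  set C := (centre z hz).1
  have hCC : form z C C = -1 := (centre z hz).2.1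
  have hQ : pointQ z 0 = 0 ∧ pointQ z 1 = 0 ∧ pointQ z 3 = heightQ z := by
    rw [pointQ_eq hz]; exact ⟨rfl, rfl, rfl⟩
  have hCA : form z C (vertexA 3) = 0 := by
    rw [et, form_smul_left, (form_root_zero_eq_iff hz _).1 (form_pointQ_root_zero hz), mul_zero]
  have hC0 : C 0 = 0 := by rw [et, Pi.smul_apply, hQ.1, smul_zero]
  have hC1 : C 1 = 0 := by rw [et, Pi.smul_apply, hQ.2.1, smul_zero]
  have hC3 : 0 < C 3 := by
    rw [et, Pi.smul_apply, hQ.2.2]; exact mul_pos ht (heightQ_pos hz)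
  set κ := C 3
  -- the decomposition of the pole of the upper base along the axis
  have hb : facePole z 3 = -κ • C + (outerSq z)⁻¹ • vertexA 3 := by
    have e : facePole z 3 = -(cz z / t) • C + (1 + cz z * heightQ z) • vertexA 3 := by
      rw [et, pointQ_eq hz, facePole_three_eq]
      ext i
      fin_cases i <;> simp [vertexA] <;> field_simp
      ring
    have e1 := congrArg (form z C ·) e
    have e2 := congrArg (form z (vertexA 3) ·) e
    simp only [form_add_right, form_smul_right, hCA, hCC, form_facePole hz, form_A3_A3 hz,
      form_comm hz (vertexA 3) C] at e1 e2
    have e3 : (1 + cz z * heightQ z) = (outerSq z)⁻¹ := by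
      refine eq_inv_of_mul_eq_one_left ?_
      simpa [vertexA] using e2.symm
    have e4 : cz z / t = κ := by
      change κ = _ at e1
      linarith
    rw [e, e3, e4]
  have hκ : (outerSq z)⁻¹ = 1 + κ ^ 2 := by
    have e := form_facePole_self hz 3
    nth_rewrite 1 [hb] at e
    rw [form_add_left, form_smul_left, form_smul_left, form_facePole hz, form_facePole hz] at e
    have : vertexA 3 3 = 1 := by simp [vertexA]
    rw [this] at e
    change -κ * κ + _ = 1 at e
    linarith
  have hρ2 : Real.sqrt (1 + κ ^ 2) ^ 2 = 1 + κ ^ 2 := Real.sq_sqrt (by positivity)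
  have hρ : 0 < Real.sqrt (1 + κ ^ 2) := Real.sqrt_pos.2 (by positivity)
  have hcd : Real.cosh (2 * Real.arsinh κ) = 1 + 2 * κ ^ 2 := by
    rw [Real.cosh_two_mul, Real.cosh_arsinh, Real.sinh_arsinh, hρ2]; ring
  have hsd : Real.sinh (2 * Real.arsinh κ) = 2 * Real.sqrt (1 + κ ^ 2) * κ := by
    rw [Real.sinh_two_mul, Real.cosh_arsinh, Real.sinh_arsinh]; ring
  set ρ := Real.sqrt (1 + κ ^ 2)
  set E2 : V4 := -ρ • vertexA 3 with hE2
  have hb' : facePole z 3 = -κ • C - ρ • E2 := by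
    rw [hb, hE2, hκ, ← hρ2]; module
  have hE20 : E2 0 = 0 := by simp [hE2, vertexA]
  have hE21 : E2 1 = 0 := by simp [hE2, vertexA]
  have hE23 : E2 3 = -ρ := by simp [hE2, vertexA]
  have hE2A : form z E2 (vertexA 3) = -ρ * outerSq z := by
    rw [hE2, form_smul_left, form_A3_A3 hz]
  have hE2E : form z E2 E2 = 1 := by
    nth_rewrite 2 [hE2]
    rw [form_smul_right, hE2A]
    have : ρ ^ 2 * outerSq z = 1 := by rw [hρ2, ← hκ, inv_mul_cancel₀ ho.ne']
    linarith
  have hCE : form z C E2 = 0 := by rw [hE2, form_smul_right, hCA, mul_zero]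
  have happ : ∀ X, baseScrew z X = planeRefl z 3 (reflA3 z ((rot z ^ (z - 1)) X)) := fun _ => rfl
  have hfix : ∀ X : V4, X 0 = 0 → X 1 = 0 → (rot z ^ (z - 1)) X = X := (rot_pow_apply hz _).2.2
  have hang : 2 * ((z - 1 : ℕ) : ℝ) * (Real.pi / (2 * z)) =
      2 * Real.pi * ((z : ℝ) - 1) / (2 * z) := by
    rw [Nat.cast_sub (by omega)]; push_cast; ring
  have hup : ∀ X, form z X (vertexA 3) = 0 → X 3 = 0 → planeRefl z 3 (reflA3 z X) = X := by
    intro X h1 h3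
    rw [reflA3_apply hz, h1, mul_zero, zero_div, zero_smul, sub_zero, planeRefl_apply hz, h3]
    simp
  have hn3 : axisNormal z 3 = 0 := by rw [axisNormal_eq hz]; rfl
  have hnA : form z (axisNormal z) (vertexA 3) = 0 := by
    rw [form_comm hz, form_axisNormal hz]; simp [vertexA]
  have hb3 : facePole z 0 3 = 0 := by rw [facePole_zero_eq]; rfl
  have hbA : form z (facePole z 0) (vertexA 3) = 0 := by
    rw [form_comm hz, form_facePole hz]; simp [vertexA]
  have hcomb : ∀ a b : ℝ, planeRefl z 3 (reflA3 z (a • facePole z 0 + b • axisNormal z)) =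
      a • facePole z 0 + b • axisNormal z := fun a b => hup _ (by
        rw [form_add_left, form_smul_left, form_smul_left, hnA, hbA]; ring) (by
        rw [Pi.add_apply, Pi.smul_apply, Pi.smul_apply, hn3, hb3]; simp)
  have n1 : form z (axisNormal z) (axisNormal z) = 1 := by
    rw [form_axisNormal hz, axisNormal_eq hz]
    simp [hs]
  have n0 : form z (axisNormal z) (facePole z 0) = 0 := by
    rw [form_facePole hz, axisNormal_eq hz]; rfl
  have nC : form z C (axisNormal z) = 0 := by rw [form_axisNormal hz, hC0, hC1]; ring
  have nE : form z E2 (axisNormal z) = 0 := by rw [form_axisNormal hz, hE20, hE21]; ring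
  have bC : form z C (facePole z 0) = 0 := by rw [form_facePole hz, hC0]
  have bE : form z E2 (facePole z 0) = 0 := by rw [form_facePole hz, hE20]
  refine ⟨baseScrew_mem_isomPlus hz, ![facePole z 0, axisNormal z, E2, C], 2 * Real.arsinh κ,
    mul_pos two_pos (Real.arsinh_pos_iff.2 hC3), ?_, ?_, ?_, ?_, ?_⟩
  · intro i j
    fin_cases i <;> fin_cases j <;>
      simp [form_facePole_self hz, n0, n1, nC, nE, bC, bE, hCC, hE2E, hCE,
        form_comm hz (facePole z 0) (axisNormal z), form_comm hz (facePole z 0) E2,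
        form_comm hz (facePole z 0) C, form_comm hz (axisNormal z) E2,
        form_comm hz (axisNormal z) C, form_comm hz E2 C]
  · change baseScrew z (facePole z 0) = _
    rw [happ, (rot_pow_apply hz _).1, hcomb, hang]; rfl
  · change baseScrew z (axisNormal z) = _
    rw [happ, (rot_pow_apply hz _).2.1, hcomb, hang]; rfl
  · change baseScrew z E2 = Real.cosh _ • E2 + Real.sinh _ • C
    have hra : reflA3 z E2 = -E2 := by
      rw [reflA3_apply hz, hE2A, show 2 * (-ρ * outerSq z) / outerSq z = -(2 * ρ) by field_simp, hE2]
      module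
    rw [happ, hfix _ hE20 hE21, hra, planeRefl_apply hz, Pi.neg_apply, hE23, hb', hcd, hsd,
      show 1 + 2 * κ ^ 2 = 2 * ρ ^ 2 - 1 by rw [hρ2]; ring]
    module
  · change baseScrew z C = Real.sinh _ • E2 + Real.cosh _ • C
    have hra : reflA3 z C = C := by
      rw [reflA3_apply hz, hCA, mul_zero, zero_div, zero_smul, sub_zero]
    rw [happ, hfix _ hC0 hC1, hra, planeRefl_apply hz, hb', hcd, hsd]
    change C - (2 * κ) • _ = _
    module

end

section

/-! ### The side pairings as products of two half-turns -/

variable {z p : ℕ}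

/-- The half-turn about the intersection of the polar plane of `A₃` with a plane through the axis;
after conjugation by `r₀`, the pairing `a₀` is its product with the half-turn `h`. -/
def axisHalfTurn (z p : ℕ) : V4 ≃ₗ[ℝ] V4 := reflA3 z * rot z ^ (2 * p - 1) * planeRefl z 0

lemma axisHalfTurn_inv (hz : 7 ≤ z) : (axisHalfTurn z p)⁻¹ = axisHalfTurn z p := by
  have hr := orthoRelations hz
  have i0 := inv_eq_of_mul_eq_one_left hr.r0_sq
  have i1 := inv_eq_of_mul_eq_one_left hr.r1_sq
  have ia := inv_eq_of_mul_eq_one_left hr.ra_sq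
  have e1 : planeRefl z 0 * (rot z ^ (2 * p - 1))⁻¹ * planeRefl z 0 = rot z ^ (2 * p - 1) := by
    have : rot z = planeRefl z 0 * (rot z)⁻¹ * (planeRefl z 0)⁻¹ := by
      rw [rot, mul_inv_rev, i0, i1]; simp only [mul_assoc, hr.r0_sq, mul_one]
    nth_rewrite 2 [this]
    rw [conj_pow, i0, inv_pow]
  have c0 : Commute (reflA3 z) (planeRefl z 0) := hr.ra_r0
  have c1 : Commute (reflA3 z) (rot z ^ (2 * p - 1)) := (c0.mul_right hr.ra_r1).pow_right _
  have e2 : rot z ^ (2 * p - 1) * planeRefl z 0 = planeRefl z 0 * (rot z ^ (2 * p - 1))⁻¹ := by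
    nth_rewrite 1 [← e1]
    rw [mul_assoc, hr.r0_sq, mul_one]
  rw [axisHalfTurn, mul_inv_rev, mul_inv_rev, i0, ia, ← mul_assoc, mul_assoc (reflA3 z),
    (c1.mul_right c0).eq, e2]

lemma halfTurn_mul_axisHalfTurn_mem (hz : 7 ≤ z) :
    halfTurn * axisHalfTurn z p ∈ isomPlus z := by
  have h0 := orthoGroup_le hz (planeRefl_mem hz 0)
  rw [mem_isomPlus_iff]
  refine ⟨mul_mem (halfTurn_mem_isomH hz) (mul_mem (mul_mem
    (orthoGroup_le hz reflA3_mem_orthoGroup) (pow_mem (orthoGroup_le hz rot_mem) _)) h0), ?_⟩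
  rw [axisHalfTurn, map_mul, map_mul, map_mul, map_pow, detHom_rot hz, detHom_planeRefl hz,
    detHom_reflA3 hz, show detHom halfTurn = 1 from det_halfTurn]
  norm_num

/-- The rotation through `π/2 - π/(2z)`, composed with `r₀`, is the reflection in a plane through
the axis. -/
lemma rot_pow_planeRefl_apply (hz : 7 ≤ z) (hzp : (z : ℤ) = 4 * p - 1) (X : V4) :
    (rot z ^ (2 * p - 1)) (planeRefl z 0 X) =
      X - ((1 + sz z) * X 0 + cz z * ((sz z)⁻¹ * (X 1 + cz z * X 0))) • facePole z 0 -
        (cz z * X 0 + (1 - sz z) * ((sz z)⁻¹ * (X 1 + cz z * X 0))) • axisNormal z := by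
  have hs := (sz_pos hz).ne'
  have hs2 := sz_sq z
  have hang : 2 * ((2 * p - 1 : ℕ) : ℝ) * (Real.pi / (2 * z)) =
      Real.pi / 2 - Real.pi / (2 * z) := by
    have h1 : (z : ℝ) = 4 * p - 1 := by exact_mod_cast hzp
    have h2 : (z : ℝ) ≠ 0 := by positivity
    rw [Nat.cast_sub (by omega)]
    push_cast
    field_simp
    linarith
  obtain ⟨h1, h2, h3⟩ := rot_pow_apply hz (2 * p - 1)
  rw [hang, Real.cos_pi_div_two_sub, Real.sin_pi_div_two_sub] at h1 h2
  set y := (sz z)⁻¹ * (X 1 + cz z * X 0) with hy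
  have hb : facePole z 0 0 = 1 ∧ facePole z 0 1 = -cz z := by rw [facePole_zero_eq]; exact ⟨rfl, rfl⟩
  have hn : axisNormal z 0 = 0 ∧ axisNormal z 1 = sz z := by
    rw [axisNormal_eq hz]; exact ⟨rfl, rfl⟩
  have hZ := h3 (X - X 0 • facePole z 0 - y • axisNormal z)
    (by simp [hb, hn]) (by simp [hb, hn, hy]; field_simp; ring)
  have e : planeRefl z 0 X = (X - X 0 • facePole z 0 - y • axisNormal z) - X 0 • facePole z 0 +
      y • axisNormal z := by rw [planeRefl_apply hz]; module
  rw [e, map_add, map_sub, map_smul, map_smul, hZ, h1, h2]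
  change X - _ - _ - X 0 • (sz z • facePole z 0 + cz z • axisNormal z) +
    y • (-cz z • facePole z 0 + sz z • axisNormal z) = _
  module

/-- The ratio that occurs in the reflection in the polar plane of `A₃`. -/
def outerRatio (z : ℕ) : ℝ := (1 + cz z - cz z ^ 2) / (2 * cz z ^ 2 - 1)

/-- The images of a basis of the space of the vectors fixed by `h`, that is, of the plane spanned by
the axis of `h`. -/
lemma axisHalfTurn_apply (hz : 7 ≤ z) (hzp : (z : ℤ) = 4 * p - 1) :
    axisHalfTurn z p ![0, 1, 1, 0] = ![-cz z / sz z, 1 / sz z,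
      1 + cz z * (1 - sz z) / sz z ^ 2, 2 * cz z * outerRatio z] ∧
    axisHalfTurn z p ![1, 0, 0, 1] = ![-1 / sz z, cz z / sz z, cz z ^ 2 / sz z ^ 2,
      1 + 2 * (1 - cz z) * outerRatio z] := by
  have hs := (sz_pos hz).ne'
  have hs2 := sz_sq z
  have hD : 2 * cz z ^ 2 - 1 ≠ 0 := by linarith [cz_sq_gt hz]
  have hE := (ez_pos hz).ne'
  have hn3 : axisNormal z 3 = 0 := by rw [axisNormal_eq hz]; rfl
  have happ : ∀ X, axisHalfTurn z p X = reflA3 z ((rot z ^ (2 * p - 1)) (planeRefl z 0 X)) :=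
    fun _ => rfl
  have hA : ∀ (X : V4) (a b : ℝ), form z (X - a • facePole z 0 - b • axisNormal z) (vertexA 3) =
      form z X (vertexA 3) := fun X a b => by
    rw [form_sub_left, form_sub_left, form_smul_left, form_smul_left,
      form_comm hz (facePole z 0), form_comm hz (axisNormal z), form_facePole hz,
      form_axisNormal hz]
    simp [vertexA]
  rw [happ, happ, rot_pow_planeRefl_apply hz hzp, rot_pow_planeRefl_apply hz hzp,
    reflA3_apply hz, reflA3_apply hz, hA, hA, (form_vertexA hz _).2.2, (form_vertexA hz _).2.2,
    outerSq, outerRatio, facePole_zero_eq, axisNormal_eq hz]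
  constructor <;> ext i <;> fin_cases i <;> simp [vertexA] <;> field_simp
  · linear_combination hs2
  · ring
  · ring
  · linear_combination -hs2
  · linear_combination cz z * hs2
  · ring
  · ring

/-- The estimates behind the rotational and the translational part of `a₀`: the eigenvalues
`2 cosh d` and `2 cos θ` of `a₀ + a₀⁻¹` lie on different sides of `2`, and the second one is larger
than `-2`. Here `t` and `q` are their sum and product, in terms of `c`, `s` and `outerRatio`. -/
lemma side_estimates {c s J t q : ℝ} (hc : 97 / 100 < c) (hc1 : c < 1) (hs : 0 < s)
    (hs2 : s ^ 2 = 1 - c ^ 2) (hJ : 0 < J) (hJ' : J < 118 / 100)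
    (ht : t = (1 / s + 1 + c * (1 - s) / s ^ 2) + (-1 / s + 1 + 2 * (1 - c) * J))
    (hq : q = (1 / s + 1 + c * (1 - s) / s ^ 2) * (-1 / s + 1 + 2 * (1 - c) * J) -
      (-c / s + 2 * c * J) * (c / s + c ^ 2 / s ^ 2)) : 4 - 2 * t + q < 0 ∧ 0 < 4 + 2 * t + q := by
  have hs1 : s < 1 / 4 := by nlinarith
  have e1 : 4 - 2 * t + q =
      2 * J * ((1 - c) * (s - s ^ 2 + c - c * s) - c ^ 2 * (s + c)) / s ^ 2 := by
    rw [ht, hq]; field_simp; linear_combination (s + c) * hs2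
  have e2 : 4 + 2 * t + q = (8 * s ^ 2 + 4 * c * (1 - s) + 2 * J * (2 * (1 - c) * s ^ 2 +
      (1 - c) * (s + s ^ 2 + c - c * s) - c ^ 2 * (s + c))) / s ^ 2 := by
    rw [ht, hq]; field_simp; linear_combination (s + c) * hs2
  rw [e1, e2]
  have hcs : 0 < (1 - c) * (c * s) := by positivity
  constructor
  · refine div_neg_of_neg_of_pos (mul_neg_of_pos_of_neg (by positivity) ?_) (by positivity)
    nlinarith
  · refine div_pos ?_ (by positivity)
    have k1 : 0 ≤ J * ((1 - c) * s ^ 2) := by positivity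
    have k2 : 0 ≤ J * ((1 - c) * (s + s ^ 2 + c * (1 - s))) :=
      mul_nonneg hJ.le (mul_nonneg (by linarith)
        (by nlinarith [mul_pos (show 0 < c by linarith) (show 0 < 1 - s by linarith)]))
    have k3 : c * (s + c) ≤ 1 + s := by nlinarith
    have k4 : J * (c * (s + c)) ≤ 118 / 100 * (1 + s) :=
      mul_le_mul hJ'.le k3 (by positivity) (by norm_num)
    have k5 : 0 < c * (4 * (1 - s) - 2 * (J * (c * (s + c)))) :=
      mul_pos (by linarith) (by linarith)
    nlinarith [sq_nonneg s]

/-- The pairing `a_i` is conjugate to the product `k` of the half-turns `h` and `axisHalfTurn`. For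
`X` on the axis of `h`, the vector `k X + k⁻¹ X` is fixed by `h`, so `k + k⁻¹` preserves the plane
of this axis, where its eigenvalues come from a quadratic equation. -/
theorem exists_isScrewMotion_sideScrew (hz : 7 ≤ z) (hzp : (z : ℤ) = 4 * p - 1) (i : ZMod z) :
    ∃ θ : ℝ, 0 < θ ∧ θ ≤ Real.pi ∧ IsScrewMotion z (sideScrew z p i) θ := by
  have hc := cz_gt hz
  have hc1 := cz_lt_one hz
  have hs := sz_pos hz
  have hE := ez_pos hz
  have hD : 0 < 2 * cz z ^ 2 - 1 := by nlinarith [cz_sq_gt hz]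
  have hJ : 0 < outerRatio z := div_pos (by nlinarith) hD
  have hJ' : outerRatio z < 118 / 100 := by
    rw [outerRatio, div_lt_iff₀ hD]; nlinarith [cz_sq_gt hz]
  obtain ⟨a1, a2⟩ := axisHalfTurn_apply hz hzp
  set k := halfTurn * axisHalfTurn z p with hk
  have hk' := halfTurn_mul_axisHalfTurn_mem (p := p) hz
  have hinv : k⁻¹ = axisHalfTurn z p * halfTurn := by
    rw [hk, mul_inv_rev, axisHalfTurn_inv hz, inv_eq_of_mul_eq_one_left halfTurn_mul_self]
  have b1 : k ![0, 1, 1, 0] + k⁻¹ ![0, 1, 1, 0] =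
      (1 / sz z + 1 + cz z * (1 - sz z) / sz z ^ 2) • ![0, 1, 1, 0] +
        (-cz z / sz z + 2 * cz z * outerRatio z) • ![1, 0, 0, 1] := by
    have : halfTurn ![0, 1, 1, 0] = ![0, 1, 1, 0] := by
      ext i; fin_cases i <;> simp [halfTurn_apply, Fin.rev]
    rw [hinv, hk, LinearEquiv.mul_apply, LinearEquiv.mul_apply, this, a1]
    ext i
    fin_cases i <;> simp [halfTurn_apply, Fin.rev] <;> ring
  have b2 : k ![1, 0, 0, 1] + k⁻¹ ![1, 0, 0, 1] =
      (cz z / sz z + cz z ^ 2 / sz z ^ 2) • ![0, 1, 1, 0] +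
        (-1 / sz z + 1 + 2 * (1 - cz z) * outerRatio z) • ![1, 0, 0, 1] := by
    have : halfTurn ![1, 0, 0, 1] = ![1, 0, 0, 1] := by
      ext i; fin_cases i <;> simp [halfTurn_apply, Fin.rev]
    rw [hinv, hk, LinearEquiv.mul_apply, LinearEquiv.mul_apply, this, a2]
    ext i
    fin_cases i <;> simp [halfTurn_apply, Fin.rev] <;> ring
  obtain ⟨h1, h2⟩ := side_estimates hc hc1 hs (sz_sq z) hJ hJ' rfl rfl
  have hy : -cz z / sz z + 2 * cz z * outerRatio z ≠ 0 := by
    refine ne_of_lt ?_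
    have : 4 < 1 / sz z := by
      rw [lt_div_iff₀ hs]; nlinarith [sz_sq z]
    have e : -cz z / sz z + 2 * cz z * outerRatio z = cz z * (2 * outerRatio z - 1 / sz z) := by ring
    rw [e]
    exact mul_neg_of_pos_of_neg (by linarith) (by linarith)
  set x := 1 / sz z + 1 + cz z * (1 - sz z) / sz z ^ 2
  set y := -cz z / sz z + 2 * cz z * outerRatio z
  set x' := cz z / sz z + cz z ^ 2 / sz z ^ 2
  set y' := -1 / sz z + 1 + 2 * (1 - cz z) * outerRatio z
  have n1 : form z ![0, 1, 1, 0] ![0, 1, 1, 0] < 0 := by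
    rw [form_eq hz]
    refine div_neg_of_neg_of_pos ?_ hE
    simp
    nlinarith
  have n2 : form z ![0, 1, 1, 0] (vertexA 2) < 0 := by
    rw [(form_vertexA hz _).2.1]
    refine div_neg_of_neg_of_pos ?_ hE
    simp
    nlinarith
  have hr := sqrt_inv_pos n1
  obtain ⟨θ, hθ, hθ', h⟩ := exists_isScrewMotion hz hk' (normalize z _ n1 n2)
    (t := x + y') (q := x * y' - y * x')
    (G := (Real.sqrt (-form z ![0, 1, 1, 0] ![0, 1, 1, 0]))⁻¹ • (x • ![0, 1, 1, 0] +
      y • ![1, 0, 0, 1]))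
    (by rw [normalize_val, map_smul, map_smul, ← smul_add, b1])
    (by
      rw [normalize_val]
      simp only [map_smul, map_add]
      rw [← smul_add]
      have : x • k ![0, 1, 1, 0] + y • k ![1, 0, 0, 1] + (x • k⁻¹ ![0, 1, 1, 0] +
          y • k⁻¹ ![1, 0, 0, 1]) = x • (k ![0, 1, 1, 0] + k⁻¹ ![0, 1, 1, 0]) +
          y • (k ![1, 0, 0, 1] + k⁻¹ ![1, 0, 0, 1]) := by module
      rw [this, b1, b2]
      module)
    (fun r hr' => by
      have := congrFun hr' 0
      rw [normalize_val] at this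
      simp at this
      exact this.elim (Real.sqrt_ne_zero'.2 (neg_pos.2 n1)) hy)
    h1 h2
  have h0 : planeRefl z 0 * planeRefl z 0 = 1 := (orthoRelations hz).r0_sq
  have hconj : sideScrew z p i = ((rot z ^ (2 * i.val))⁻¹ * planeRefl z 0) * k *
      ((rot z ^ (2 * i.val))⁻¹ * planeRefl z 0)⁻¹ := by
    rw [sideScrew, hk, axisHalfTurn, mul_inv_rev, inv_inv, inv_eq_of_mul_eq_one_left h0]
    simp only [mul_assoc]
    rw [← mul_assoc (planeRefl z 0) (planeRefl z 0), h0, one_mul]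
  refine ⟨θ, hθ, hθ', ?_⟩
  rw [hconj]
  exact h.conj (orthoGroup_le hz (mul_mem (inv_mem (pow_mem rot_mem _)) (planeRefl_mem hz 0)))

end

end Cobweb

end

open Cobweb

theorem theorem2p2 (p z : ℕ) (hp : 2 ≤ p) (hz : z = 4 * p - 1) :
    -- the model is hyperbolic space
    HasLorentzSignature z ∧
    -- the cobweb polyhedron consists of `8z` copies of `W(2z)` around `Q`
    (Nat.card (groupQ z) = 8 * z ∧
      (∀ g ∈ groupQ z, g (pointQ z) = pointQ z) ∧
      (∃ q ∈ halfOrthoscheme z, ∃ t : ℝ, 0 < t ∧ (q : V4) = t • pointQ z) ∧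
      (∀ g ∈ groupQ z, ∀ g' ∈ groupQ z, g ≠ g' →
        Disjoint (interior (move g (halfOrthoscheme z)))
          (interior (move g' (halfOrthoscheme z))))) ∧
    -- it is a compact convex polyhedron, and the `10z + 2` face pairings correspond to its faces
    (IsCompact (cobweb z) ∧
      cobweb z = {X : H3 z | ∀ γ ∈ facePairings z p,
        hdist z X (pointQ z) ≤ hdist z X (γ (pointQ z))} ∧
      (facePairings z p).ncard = 10 * z + 2 ∧
      Set.BijOn (fun γ => cobweb z ∩ move γ (cobweb z)) (facePairings z p)
        {f | IsFacet (cobweb z) f}) ∧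
    -- the bases are paired by the screw motion `s`, and the `a_i` are screw motions, too
    (IsFacet (cobweb z) (lowerBase z) ∧ IsFacet (cobweb z) (upperBase z) ∧
      move (baseScrew z) (lowerBase z) = upperBase z ∧
      cobweb z ∩ move (baseScrew z) (cobweb z) = upperBase z ∧
      IsScrewMotion z (baseScrew z) (2 * Real.pi * ((z : ℝ) - 1) / (2 * z)) ∧
      ∀ i, ∃ θ : ℝ, 0 < θ ∧ θ ≤ Real.pi ∧ IsScrewMotion z (sideScrew z p i) θ) ∧
    -- the construction is `z`-cyclic
    (orderOf (rot z ^ 2) = z ∧ move (rot z ^ 2) (cobweb z) = cobweb z ∧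
      rot z ^ 2 * baseScrew z * (rot z ^ 2)⁻¹ = baseScrew z ∧
      ∀ i, rot z ^ 2 * sideScrew z p (i + 1) * (rot z ^ 2)⁻¹ = sideScrew z p i) ∧
    -- the generated group acts freely by orientation-preserving isometries, with the cobweb
    -- polyhedron as a fundamental domain
    (cobwebGroup z p ≤ isomPlus z ∧
      IsFundamentalDomain (cobwebGroup z p) (cobweb z) ∧
      ∀ γ ∈ cobwebGroup z p, γ ≠ 1 → ∀ X : H3 z, γ (X : V4) ≠ X) ∧
    -- gluing the paired faces gives a compact oriented hyperbolic manifold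
    (CompactSpace (CobwebManifold z p) ∧ ConnectedSpace (CobwebManifold z p) ∧
      T2Space (CobwebManifold z p) ∧
      ∃ π : H3 z → CobwebManifold z p, IsHyperbolicCovering π ∧
        (∀ x : cobweb z, π x = Quot.mk _ x) ∧
        ∀ X Y : H3 z, π X = π Y ↔ ∃ γ ∈ cobwebGroup z p, γ (X : V4) = Y) ∧
    -- the fundamental group and the first homology group
    (∃ φ : PresentedCobwebGroup z p ≃* cobwebGroup z p,
      (φ (PresentedGroup.of Gen.s) : V4 ≃ₗ[ℝ] V4) = baseScrew z ∧
      ∀ i, (φ (PresentedGroup.of (Gen.a i)) : V4 ≃ₗ[ℝ] V4) = sideScrew z p i) ∧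
    (∀ x : CobwebManifold z p,
      Nonempty (FundamentalGroup (CobwebManifold z p) x ≃* PresentedCobwebGroup z p) ∧
      Nonempty (Abelianization (FundamentalGroup (CobwebManifold z p) x) ≃*
        Abelianization (PresentedCobwebGroup z p))) := by
  have hz7 := seven_le hp hz
  have hzp := cast_eq hp hz
  obtain ⟨t2, π, hπ, hπ'⟩ := exists_covering hz7 hzp
  have := contractibleSpace_H3 hz7
  have : CompactSpace (cobweb z) := isCompact_iff_compactSpace.1 (isCompact_cobweb hz7 hzp)
  refine ⟨lorentzSignature hz7, ⟨card_groupQ hz7 hzp, fun g hg => groupQ_fix hz7 hg,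
      ⟨centre z hz7, centre_mem_half hz7, centre_val hz7⟩,
      fun g hg g' hg' h => disjoint_half hz7 hg hg' h⟩,
    ⟨isCompact_cobweb hz7 hzp, cobweb_eq hz7 hzp, ncard_facePairings hz7 hzp,
      bijOn_face hz7 hzp⟩,
    ⟨isFacet_lowerBase hz7 hzp, isFacet_upperBase hz7 hzp, move_lowerBase hz7 hzp,
      upperBase_eq hz7 hzp |>.symm, isScrewMotion_baseScrew hz7,
      exists_isScrewMotion_sideScrew hz7 hzp⟩,
    ⟨orderOf_rot_sq hz7 hzp, move_cobweb_of_mem_groupQ hz7 (rot_zpow_mem 2),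
      rot_sq_conj_baseScrew hz7 hzp, rot_sq_conj_sideScrew hz7 hzp⟩,
    ⟨cobwebGroup_le_isomPlus hz7, isFundamentalDomain hz7 hzp,
      fun γ hγ h X => apply_ne_of_ne_one hz7 hzp hγ h X⟩,
    ⟨inferInstance, hπ.surjective.connectedSpace hπ.continuous, t2, π,
      isHyperbolicCovering hz7 hπ, hπ', covering_eq_iff hz7 hπ⟩,
    ⟨presentation hz7 hzp, (presentation_val hz7 hzp _).trans (pairing_s hz7 hzp),
      fun i => (presentation_val hz7 hzp _).trans (pairing_a hz7 hzp i)⟩, fun x => ?_⟩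
  obtain ⟨e⟩ := nonempty_fundamentalGroup_mulEquiv hz7 hπ x
  have e' := e.trans (presentation hz7 hzp).symm
  exact ⟨⟨e'⟩, ⟨e'.abelianizationCongr⟩⟩
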